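/- Let $H$ be a fixed finite simple graph. There is a constant $c_2(H)>1$ such that the following two statements hold. (A graph is $H$-minor free if no graph isomorphic to $H$ can be obtained from one of its subgraphs by contracting edges.) (1) For every $\gamma\in(0,1]$ and every integer $d\ge 1$, every finite simple $H$-minor free graph $G=(V,E)$ in which all degrees are at most $d$ is $(\gamma,\,c_2(H)d^2/\gamma^2)$-hyperfinite: one can remove at most $\gamma|V|$ edges from $G$ so that every connected component of the remaining graph has at most $c_2(H)d^2/\gamma^2$ vertices. (2) There is a single deterministic algorithm (depending only on $H$) that, for every $\gamma\in(0,1]$, every integer $d\ge1$ and every such graph $G$ with $|V|\ge 1$, finds a $(\gamma,\,c_2(H)d^2/\gamma^2)$-partition of $V$ in time at most $C|V|^{3/2}$, where the constant $C$ depends only on $H$. Here an $(\epsilon,k)$-partition of $V$ is a partition into parts of size at most $k$, each inducing a connected subgraph of $G$, such that at most $\epsilon|V|$ edges of $G$ have their endpoints in different parts. The algorithm runs on a word RAM with unit-cost operations; it has query access to the incidence lists of $G$ (with $V=\{0,\dots,|V|-1\}$, and the neighbours of each vertex listed in an arbitrary order), and its input is $|V|$, $d$ and a fraction $p/q$ with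 $\gamma/2\le p/q\le\gamma$ (any such fraction; for instance $\gamma$ itself if $\gamma$ is rational). Its words have $O(\log(|V|+d+q))$ bits, where the implied constant depends only on $H$. -/

import Mathlib

/-! ### Minors -/

/-- `H` is (isomorphic to) a graph obtained from `K` by contracting edges: the map `f` sends every
vertex of `K` to the vertex of `H` into which it is contracted. The fibres of `f` form a partition
of the vertices of `K` into sets that induce connected (in particular nonempty) subgraphs, and two
distinct vertices of `H` are adjacent exactly when `K` has an edge between the two fibres. -/
def IsContraction {W U : Type*} (H : SimpleGraph W) (K : SimpleGraph U) : Prop :=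
  ∃ f : U → W,
    (∀ x : W, (K.induce (f ⁻¹' {x})).Connected) ∧
    ∀ x y : W, H.Adj x y ↔ x ≠ y ∧ ∃ u v : U, f u = x ∧ f v = y ∧ K.Adj u v

/-- `H` is a minor of `G`: it is obtained by edge contractions from a subgraph of `G`. -/
def IsMinor {W V : Type*} (H : SimpleGraph W) (G : SimpleGraph V) : Prop :=
  ∃ K : G.Subgraph, IsContraction H K.coe

/-- `G` is `H`-minor free. -/
def IsMinorFree {W V : Type*} (H : SimpleGraph W) (G : SimpleGraph V) : Prop :=
  ¬ IsMinor H G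

/-- Every vertex of the (finite) graph `G` has at most `d` neighbours. -/
def DegreeBoundedBy {V : Type*} (G : SimpleGraph V) (d : ℕ) : Prop :=
  ∀ v : V, (G.neighborSet v).ncard ≤ d

/-! ### Hyperfiniteness and partitions (for finite graphs) -/

/-- One can remove at most `ε |V|` edges such that all connected components of the remaining graph
have at most `k` vertices. -/
def IsHyperfinite {V : Type*} (G : SimpleGraph V) (ε k : ℝ) : Prop :=
  ∃ F : Set (Sym2 V), F ⊆ G.edgeSet ∧ (F.ncard : ℝ) ≤ ε * (Nat.card V : ℝ) ∧
    ∀ c : (G.deleteEdges F).ConnectedComponent, (c.supp.ncard : ℝ) ≤ k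

/-- The partition of the vertices of `G` into the classes of `P` is an `(ε, k)`-partition: every
part has at most `k` vertices and induces a connected subgraph, and at most `ε |V|` edges of `G`
have their endpoints in different parts. -/
def IsEpsPartition {V : Type*} (G : SimpleGraph V) (ε k : ℝ) (P : Setoid V) : Prop :=
  (∀ A ∈ P.classes, (A.ncard : ℝ) ≤ k) ∧
  (∀ A ∈ P.classes, (G.induce A).Connected) ∧
  (({e ∈ G.edgeSet | ∃ u v : V, e = s(u, v) ∧ ¬ P u v}.ncard : ℕ) : ℝ) ≤ ε * (Nat.card V : ℝ)

/-! ### Incidence lists -/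

/-- An incidence-lists representation of a graph on the vertices `0, …, n - 1`: every vertex has a
list of its neighbours, each once, in an arbitrary order. -/
structure IncidenceLists {n : ℕ} (G : SimpleGraph (Fin n)) where
  /-- the list of the neighbours of a vertex -/
  nbrs : Fin n → List (Fin n)
  nodup : ∀ v, (nbrs v).Nodup
  mem_iff : ∀ v u, u ∈ nbrs v ↔ G.Adj v u

/-- The answer to the query for the `i`-th neighbour of `v` (counting from `0`): the neighbour `u` is
returned as the number `u + 1`, and `0` is the special symbol for "no such neighbour". -/
def IncidenceLists.query {n : ℕ} {G : SimpleGraph (Fin n)} (L : IncidenceLists G) (v i : ℕ) : ℕ :=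
  if hv : v < n then
    match (L.nbrs ⟨v, hv⟩)[i]? with
    | some u => (u : ℕ) + 1
    | none => 0
  else 0

/-! ### A word RAM

A program is a finite piece of code over scalar registers and random-access arrays, both named by
numerals. All memory holds words, i.e. natural numbers less than a bound `B`; an operation whose
result is not a word does not execute. Besides the usual operations on words, a program can query
the incidence lists of the input graph. Every operation takes one unit of time. -/

namespace WordRAM

/-- Expressions. -/
inductive Expr where
  /-- a constant -/
  | const (c : ℕ)
  /-- the content of a register -/
  | reg (x : ℕ)
  /-- the content of the `i`-th cell of the array `a` -/
  | read (a : ℕ) (i : Expr)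
  /-- a query to the incidence lists of the input graph -/
  | query (v i : Expr)
  | add (e f : Expr)
  /-- truncated subtraction -/
  | sub (e f : Expr)
  | mul (e f : Expr)
  /-- integer division, with result `0` for the divisor `0` -/
  | div (e f : Expr)
  /-- `1` if the first value is less than the second, else `0` -/
  | lt (e f : Expr)
  /-- `1` if the two values are equal, else `0` -/
  | eq (e f : Expr)

/-- Programs. A condition counts as true if its value is not `0`. -/
inductive Program where
  | skip
  /-- put the value of `e` into the register `x` -/
  | assign (x : ℕ) (e : Expr)
  /-- put the value of `e` into the `i`-th cell of the array `a` -/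
  | write (a : ℕ) (i e : Expr)
  | seq (P Q : Program)
  /-- if `e` then `P` else `Q` -/
  | cond (e : Expr) (P Q : Program)
  /-- while `e` do `P` -/
  | loop (e : Expr) (P : Program)

/-- The memory: the contents of the registers and of the arrays. -/
structure Memory where
  reg : ℕ → ℕ
  arr : ℕ → ℕ → ℕ

/-- `m` as a word, if it is one. -/
def word (B m : ℕ) : Option ℕ :=
  if m < B then some m else none

/-- The value of an expression; `none` if a number that is not a word occurs. -/
def Expr.value (query : ℕ → ℕ → ℕ) (B : ℕ) (σ : Memory) : Expr → Option ℕ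
  | .const c => word B c
  | .reg x => word B (σ.reg x)
  | .read a i => (i.value query B σ).bind fun j => word B (σ.arr a j)
  | .query v i => (v.value query B σ).bind fun w => (i.value query B σ).bind fun j =>
      word B (query w j)
  | .add e f => (e.value query B σ).bind fun k => (f.value query B σ).bind fun l => word B (k + l)
  | .sub e f => (e.value query B σ).bind fun k => (f.value query B σ).bind fun l => word B (k - l)
  | .mul e f => (e.value query B σ).bind fun k => (f.value query B σ).bind fun l => word B (k * l)
  | .div e f => (e.value query B σ).bind fun k => (f.value query B σ).bind fun l => word B (k / l)
  | .lt e f => (e.value query B σ).bind fun k => (f.value query B σ).bind fun l =>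
      word B (if k < l then 1 else 0)
  | .eq e f => (e.value query B σ).bind fun k => (f.value query B σ).bind fun l =>
      word B (if k = l then 1 else 0)

/-- The time to evaluate an expression: one unit per operation. -/
def Expr.time : Expr → ℕ
  | .const _ => 1
  | .reg _ => 1
  | .read _ i => i.time + 1
  | .query v i => v.time + i.time + 1
  | .add e f => e.time + f.time + 1
  | .sub e f => e.time + f.time + 1
  | .mul e f => e.time + f.time + 1
  | .div e f => e.time + f.time + 1
  | .lt e f => e.time + f.time + 1
  | .eq e f => e.time + f.time + 1

/-- `Runs query B P σ t τ`: with the given answers to the queries and with words less than `B`, the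
program `P` started on the memory `σ` halts after exactly `t` units of time with the memory `τ`. -/
inductive Runs (query : ℕ → ℕ → ℕ) (B : ℕ) : Program → Memory → ℕ → Memory → Prop where
  | skip (σ : Memory) : Runs query B .skip σ 1 σ
  | assign (σ : Memory) (x : ℕ) (e : Expr) (m : ℕ) (he : e.value query B σ = some m) :
      Runs query B (.assign x e) σ (e.time + 1)
        { σ with reg := Function.update σ.reg x m }
  | write (σ : Memory) (a : ℕ) (i e : Expr) (j m : ℕ) (hi : i.value query B σ = some j)
      (he : e.value query B σ = some m) :
      Runs query B (.write a i e) σ (i.time + e.time + 1)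
        { σ with arr := Function.update σ.arr a (Function.update (σ.arr a) j m) }
  | seq (P Q : Program) (σ σ₁ σ₂ : Memory) (t₁ t₂ : ℕ) (h₁ : Runs query B P σ t₁ σ₁)
      (h₂ : Runs query B Q σ₁ t₂ σ₂) :
      Runs query B (.seq P Q) σ (t₁ + t₂) σ₂
  | cond_true (e : Expr) (P Q : Program) (σ τ : Memory) (m t : ℕ)
      (he : e.value query B σ = some m) (hm : m ≠ 0) (h : Runs query B P σ t τ) :
      Runs query B (.cond e P Q) σ (e.time + 1 + t) τ
  | cond_false (e : Expr) (P Q : Program) (σ τ : Memory) (t : ℕ)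
      (he : e.value query B σ = some 0) (h : Runs query B Q σ t τ) :
      Runs query B (.cond e P Q) σ (e.time + 1 + t) τ
  | loop_true (e : Expr) (P : Program) (σ σ₁ σ₂ : Memory) (m t₁ t₂ : ℕ)
      (he : e.value query B σ = some m) (hm : m ≠ 0) (h₁ : Runs query B P σ t₁ σ₁)
      (h₂ : Runs query B (.loop e P) σ₁ t₂ σ₂) :
      Runs query B (.loop e P) σ (e.time + 1 + t₁ + t₂) σ₂
  | loop_false (e : Expr) (P : Program) (σ : Memory) (he : e.value query B σ = some 0) :
      Runs query B (.loop e P) σ (e.time + 1) σ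

/-- The initial memory: the registers `0, 1, 2, 3` hold the numbers `n, d, p, q`, everything else
is `0`. -/
def input (n d p q : ℕ) : Memory where
  reg x := if x = 0 then n else if x = 1 then d else if x = 2 then p else if x = 3 then q else 0
  arr _ _ := 0

/-- The partition of the vertices that a final memory describes: two vertices are in the same part
if the array `0` holds the same label for both. -/
def outputPartition (n : ℕ) (τ : Memory) : Setoid (Fin n) :=
  Setoid.ker fun v : Fin n => τ.arr 0 v

end WordRAM

/-- The program `P` finds, for every graph `G` on the vertices `0, …, n - 1` with `n ≥ 1` that is
`H`-minor free and has degrees at most `d`, where `d ≥ 1`, and for every real `γ ∈ (0, 1]`, a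
`(γ, c * d ^ 2 / γ ^ 2)`-partition of `G` in time at most `C * n ^ (3 / 2)`. It has query access to
incidence lists of `G`, gets `n`, `d` and `γ` as input, and its words are the numbers less than
`(n + d + q) ^ a`, i.e. they have `O(log (n + d + q))` bits. A real number `γ` is handed over as a
fraction `p / q` with `γ / 2 ≤ p / q ≤ γ`; this can be any such fraction, and `γ` itself if `γ` is
rational. -/
def FindsPartition {W : Type*} (H : SimpleGraph W) (P : WordRAM.Program) (c C : ℝ) (a : ℕ) :
    Prop :=
  ∀ (n d p q : ℕ) (γ : ℝ) (G : SimpleGraph (Fin n)) (L : IncidenceLists G),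
    1 ≤ n → 1 ≤ d → 0 < γ → γ ≤ 1 → 1 ≤ q → γ / 2 ≤ (p : ℝ) / (q : ℝ) → (p : ℝ) / (q : ℝ) ≤ γ →
    IsMinorFree H G → DegreeBoundedBy G d →
    ∃ (t : ℕ) (τ : WordRAM.Memory),
      WordRAM.Runs L.query ((n + d + q) ^ a) P (WordRAM.input n d p q) t τ ∧
      (t : ℝ) ≤ C * (n : ℝ) ^ (3 / 2 : ℝ) ∧
      IsEpsPartition G γ (c * (d : ℝ) ^ 2 / γ ^ 2) (WordRAM.outputPartition n τ)

/-! Both statements come from repeated balanced separation. Hyperfiniteness is read off the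
partition that the algorithm outputs, by deleting the edges between its parts. With `h` one more
than the number of vertices of `H`, an `H`-minor free graph has no clique minor of order `h`. This,
and the linear edge bound that follows from it (Mader's theorem, `ncard_arcs_lt`), is all that is
used about the graph.

Separators follow the method of Alon, Seymour and Thomas. Take a connected piece with `N` vertices
and let `g` be the integer part of `√N`. Maintain a connected set `B` with more than `N / 2`
vertices, and pairwise adjacent, disjoint connected sets ("trees") next to `B`, each with at most `5
* h * g` vertices next to `B`. There are fewer than `h` trees, since they form a clique minor.
Breadth-first search runs in a layered graph made of copies of `B`, where one passes from copy `i`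
to copy `i + 1` at the vertices with a neighbour in tree `i`. There are two outcomes. Either the
last copy is reached, with at most `3 * g + 1` steps per copy; then a shortest walk projects to a
connected set `Q` of `O(h * g)` vertices that touches every tree. Or a new copy fails to appear for
`3 * g + 1` steps; since only `h * N` nodes can have been reached, one of the `g` middle layers of
this window has `O(h * g)` nodes, and its vertices form `Q`.

If every component of `B - Q` has at most `N / 2` vertices, then `Q` together with the tree vertices
next to `B` is a balanced separator with at most `5 * h ^ 2 * g` vertices. Otherwise let `B'` be the
big component. In the first case `B \ B'` becomes a new tree, which touches `B'` only in `Q`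
(`Trees.path`). In the second case `B'` avoids the layer, so there is a `k` such that `B'` lies
before the layer in copy `k` and behind it in copy `k + 1`; hence tree `k` does not touch `B'`. It
is extended by the set `D` of all vertices of `B \ B'` that it can reach (`Trees.layer`), and the
`g` layers on one side of `Q` force `D` to have at least `g` vertices (`le_ncard_of_layer`). Either
way `B` loses at least `g` vertices, so `O(g)` rounds of linear time suffice (`wp_search`).

Pieces with more than `κ = 400 * h ^ 4 * d ^ 2 * q ^ 2 / p ^ 2` vertices are split in this way. A
potential `A * m / √κ - B * √m` shows that at most `20 * h ^ 2 * n / √κ` separator vertices are used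
in total. Each of them spoils at most `d` edges, and the choice of `κ` turns this into at most `(p /
q) * n ≤ γ * n` edges. Halving makes the costs of the pieces decrease geometrically with the depth,
so the total time is a constant times `√n` times the sum of the degrees plus one, which is `O(n ^ (3
/ 2))` (`wp_partitionProgram`).

Programs are verified by weakest preconditions over unbounded numbers. The transfer to words
(`Exec.runs`) works because the numbers in memory grow by at most one per unit of time and every
expression is polynomial of bounded degree. -/

namespace WordRAM

/-! ### Unbounded execution -/

/-- The value of an expression over unbounded natural numbers. -/
def Expr.ev (qy : ℕ → ℕ → ℕ) (σ : Memory) : Expr → ℕ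
  | .const c => c
  | .reg x => σ.reg x
  | .read a i => σ.arr a (i.ev qy σ)
  | .query v i => qy (v.ev qy σ) (i.ev qy σ)
  | .add e f => e.ev qy σ + f.ev qy σ
  | .sub e f => e.ev qy σ - f.ev qy σ
  | .mul e f => e.ev qy σ * f.ev qy σ
  | .div e f => e.ev qy σ / f.ev qy σ
  | .lt e f => if e.ev qy σ < f.ev qy σ then 1 else 0
  | .eq e f => if e.ev qy σ = f.ev qy σ then 1 else 0

/-- The memory after putting `m` into the register `x`. -/
def Memory.setReg (σ : Memory) (x m : ℕ) : Memory :=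
  { σ with reg := Function.update σ.reg x m }

/-- The memory after putting `m` into the `j`-th cell of the array `a`. -/
def Memory.setArr (σ : Memory) (a j m : ℕ) : Memory :=
  { σ with arr := Function.update σ.arr a (Function.update (σ.arr a) j m) }

@[simp] theorem Memory.setReg_reg (σ : Memory) (x m y : ℕ) :
    (σ.setReg x m).reg y = if y = x then m else σ.reg y := by
  simp [Memory.setReg, Function.update_apply]

@[simp] theorem Memory.setReg_arr (σ : Memory) (x m : ℕ) : (σ.setReg x m).arr = σ.arr := rfl

@[simp] theorem Memory.setArr_reg (σ : Memory) (a j m : ℕ) : (σ.setArr a j m).reg = σ.reg := rfl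

@[simp] theorem Memory.setArr_arr (σ : Memory) (a j m b : ℕ) :
    (σ.setArr a j m).arr b = if b = a then Function.update (σ.arr a) j m else σ.arr b := by
  simp [Memory.setArr, Function.update_apply]

/-- Execution over unbounded natural numbers. -/
inductive Exec (qy : ℕ → ℕ → ℕ) : Program → Memory → ℕ → Memory → Prop where
  | skip (σ : Memory) : Exec qy .skip σ 1 σ
  | assign (σ : Memory) (x : ℕ) (e : Expr) :
      Exec qy (.assign x e) σ (e.time + 1) (σ.setReg x (e.ev qy σ))
  | write (σ : Memory) (a : ℕ) (i e : Expr) :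
      Exec qy (.write a i e) σ (i.time + e.time + 1) (σ.setArr a (i.ev qy σ) (e.ev qy σ))
  | seq (P Q : Program) (σ σ₁ σ₂ : Memory) (t₁ t₂ : ℕ) (h₁ : Exec qy P σ t₁ σ₁)
      (h₂ : Exec qy Q σ₁ t₂ σ₂) : Exec qy (.seq P Q) σ (t₁ + t₂) σ₂
  | cond_true (e : Expr) (P Q : Program) (σ τ : Memory) (t : ℕ)
      (he : e.ev qy σ ≠ 0) (h : Exec qy P σ t τ) : Exec qy (.cond e P Q) σ (e.time + 1 + t) τ
  | cond_false (e : Expr) (P Q : Program) (σ τ : Memory) (t : ℕ)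
      (he : e.ev qy σ = 0) (h : Exec qy Q σ t τ) : Exec qy (.cond e P Q) σ (e.time + 1 + t) τ
  | loop_true (e : Expr) (P : Program) (σ σ₁ σ₂ : Memory) (t₁ t₂ : ℕ)
      (he : e.ev qy σ ≠ 0) (h₁ : Exec qy P σ t₁ σ₁) (h₂ : Exec qy (.loop e P) σ₁ t₂ σ₂) :
      Exec qy (.loop e P) σ (e.time + 1 + t₁ + t₂) σ₂
  | loop_false (e : Expr) (P : Program) (σ : Memory) (he : e.ev qy σ = 0) :
      Exec qy (.loop e P) σ (e.time + 1) σ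

/-! ### From unbounded execution to execution on words -/

/-- An exponent that bounds the growth of all values occurring in the evaluation of an
expression. -/
def Expr.deg : Expr → ℕ
  | .const _ => 1
  | .reg _ => 1
  | .read _ i => i.deg
  | .query v i => max v.deg i.deg
  | .add e f => max e.deg f.deg + 1
  | .sub e f => max e.deg f.deg
  | .mul e f => e.deg + f.deg
  | .div e f => max e.deg f.deg
  | .lt e f => max e.deg f.deg
  | .eq e f => max e.deg f.deg

/-- All constants of the expression are at most `K`. -/
def Expr.constLe (K : ℕ) : Expr → Prop
  | .const c => c ≤ K
  | .reg _ => True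
  | .read _ i => i.constLe K
  | .query v i => v.constLe K ∧ i.constLe K
  | .add e f => e.constLe K ∧ f.constLe K
  | .sub e f => e.constLe K ∧ f.constLe K
  | .mul e f => e.constLe K ∧ f.constLe K
  | .div e f => e.constLe K ∧ f.constLe K
  | .lt e f => e.constLe K ∧ f.constLe K
  | .eq e f => e.constLe K ∧ f.constLe K

/-- The value of the expression is at most the largest number in the memory. -/
def Expr.Flat : Expr → Prop
  | .const _ => True
  | .reg _ => True
  | .read _ _ => True
  | .query _ _ => True
  | .add _ _ => False
  | .sub e _ => e.Flat
  | .mul _ _ => False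
  | .div e _ => e.Flat
  | .lt _ _ => True
  | .eq _ _ => True

/-- The value of the expression exceeds the largest number in the memory by at most `1`. -/
def Expr.Slow : Expr → Prop
  | .add e (.const 1) => e.Flat
  | e => e.Flat

/-- The numbers in the memory grow by at most `1` per step, and expressions have bounded degree. -/
def Program.Tame (D K : ℕ) : Program → Prop
  | .skip => True
  | .assign _ e => e.Slow ∧ e.deg ≤ D ∧ e.constLe K
  | .write _ i e => (i.deg ≤ D ∧ i.constLe K) ∧ e.Slow ∧ e.deg ≤ D ∧ e.constLe K
  | .seq P Q => P.Tame D K ∧ Q.Tame D K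
  | .cond e P Q => (e.deg ≤ D ∧ e.constLe K) ∧ P.Tame D K ∧ Q.Tame D K
  | .loop e P => (e.deg ≤ D ∧ e.constLe K) ∧ P.Tame D K

/-- All numbers in the memory are at most `M`. -/
def Memory.Le (σ : Memory) (M : ℕ) : Prop :=
  (∀ x, σ.reg x ≤ M) ∧ ∀ a i, σ.arr a i ≤ M

theorem Memory.Le.mono {σ : Memory} {M N : ℕ} (h : σ.Le M) (hMN : M ≤ N) : σ.Le N :=
  ⟨fun x => (h.1 x).trans hMN, fun a i => (h.2 a i).trans hMN⟩

theorem Memory.Le.setReg {σ : Memory} {M x m : ℕ} (h : σ.Le M) (hm : m ≤ M) :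
    (σ.setReg x m).Le M := by
  refine ⟨fun y => ?_, fun a i => h.2 a i⟩
  rw [Memory.setReg_reg]
  split_ifs
  exacts [hm, h.1 y]

theorem Memory.Le.setArr {σ : Memory} {M a j m : ℕ} (h : σ.Le M) (hm : m ≤ M) :
    (σ.setArr a j m).Le M := by
  refine ⟨fun y => h.1 y, fun b i => ?_⟩
  rw [Memory.setArr_arr]
  split_ifs
  · rw [Function.update_apply]
    split_ifs
    exacts [hm, h.2 a i]
  · exact h.2 b i

theorem Expr.deg_pos (e : Expr) : 1 ≤ e.deg := by
  induction e <;> simp only [Expr.deg] <;> omega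

section Bounded

variable {qy : ℕ → ℕ → ℕ} {M K : ℕ}

theorem Expr.ev_le_of_flat {σ : Memory} (hσ : σ.Le M) (hq : ∀ v i, qy v i ≤ M) (hK : K ≤ M)
    (hM : 1 ≤ M) {e : Expr} (he : e.Flat) (hc : e.constLe K) : e.ev qy σ ≤ M := by
  induction e with
  | const c => exact le_trans hc hK
  | reg x => exact hσ.1 x
  | read a i => exact hσ.2 a _
  | query v i => exact hq _ _
  | add => exact he.elim
  | sub e f ihe => exact (Nat.sub_le _ _).trans (ihe he hc.1)
  | mul => exact he.elim
  | div e f ihe => exact (Nat.div_le_self _ _).trans (ihe he hc.1)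
  | lt e f => simp only [Expr.ev]; split_ifs <;> omega
  | eq e f => simp only [Expr.ev]; split_ifs <;> omega

theorem Expr.ev_le_of_slow {σ : Memory} (hσ : σ.Le M) (hq : ∀ v i, qy v i ≤ M) (hK : K ≤ M)
    (hM : 1 ≤ M) {e : Expr} (he : e.Slow) (hc : e.constLe K) : e.ev qy σ ≤ M + 1 := by
  unfold Expr.Slow at he
  split at he
  · simpa [Expr.ev] using Expr.ev_le_of_flat hσ hq hK hM he hc.1
  · exact (Expr.ev_le_of_flat hσ hq hK hM he hc).trans (Nat.le_succ _)

theorem Expr.ev_le_pow {σ : Memory} (hσ : σ.Le M) (hq : ∀ v i, qy v i ≤ M) (hK : K ≤ M)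
    (hM : 2 ≤ M) (e : Expr) (hc : e.constLe K) : e.ev qy σ ≤ M ^ e.deg := by
  have hmono : ∀ {a b : ℕ}, a ≤ b → M ^ a ≤ M ^ b := fun h => Nat.pow_le_pow_right (by omega) h
  have h1 : ∀ {m : ℕ} (e : Expr), m ≤ M → m ≤ M ^ e.deg := fun e h =>
    h.trans (by simpa using hmono e.deg_pos)
  induction e with
  | const c => exact h1 (.const c) (le_trans hc hK)
  | reg x => exact h1 (.reg x) (hσ.1 x)
  | read a i => exact h1 i (hσ.2 a _)
  | query v i => exact h1 (.query v i) (hq _ _)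
  | add e f ihe ihf =>
    have h2 := (ihe hc.1).trans (hmono (le_max_left e.deg f.deg))
    have h3 := (ihf hc.2).trans (hmono (le_max_right e.deg f.deg))
    simp only [Expr.ev, Expr.deg, pow_succ]
    -- Two summands of at most `M ^ k` give `2 * M ^ k ≤ M ^ (k + 1)`; this is where `M ≥ 2` is
    -- needed and why a sum raises the exponent by one.
    nlinarith [Nat.zero_le (M ^ max e.deg f.deg)]
  | sub e f ihe ihf =>
    exact (Nat.sub_le _ _).trans ((ihe hc.1).trans (hmono (le_max_left e.deg f.deg)))
  | mul e f ihe ihf =>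
    simp only [Expr.ev, Expr.deg, pow_add]
    exact Nat.mul_le_mul (ihe hc.1) (ihf hc.2)
  | div e f ihe ihf =>
    exact (Nat.div_le_self _ _).trans ((ihe hc.1).trans (hmono (le_max_left e.deg f.deg)))
  | lt e f => exact h1 (.lt e f) (by simp only [Expr.ev]; split_ifs <;> omega)
  | eq e f => exact h1 (.eq e f) (by simp only [Expr.ev]; split_ifs <;> omega)

/-- The exponent of a subexpression never exceeds that of the whole expression, so one inequality `M
^ D < B` rules out an overflow at every intermediate value. -/
theorem Expr.value_eq {σ : Memory} (hσ : σ.Le M) (hq : ∀ v i, qy v i ≤ M) (hK : K ≤ M)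
    (hM : 2 ≤ M) {B D : ℕ} (hB : M ^ D < B) (e : Expr) (hD : e.deg ≤ D) (hc : e.constLe K) :
    e.value qy B σ = some (e.ev qy σ) := by
  have hword : ∀ e' : Expr, e'.deg ≤ D → e'.constLe K →
      word B (e'.ev qy σ) = some (e'.ev qy σ) := fun e' h h' => by
    have := Expr.ev_le_pow hσ hq hK hM e' h'
    have h2 : M ^ e'.deg ≤ M ^ D := Nat.pow_le_pow_right (by omega) h
    rw [word, if_pos (by omega)]
  have hw := hword e hD hc
  induction e with
  | const c => exact hw
  | reg x => exact hw
  | read a i ih =>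
    have hi := ih hD hc (hword i hD hc)
    simp only [Expr.value, hi, Option.bind_some]
    exact hw
  | query v i ihv ihi =>
    simp only [Expr.deg, max_le_iff] at hD
    have h1 := ihv hD.1 hc.1 (hword v hD.1 hc.1)
    have h2 := ihi hD.2 hc.2 (hword i hD.2 hc.2)
    simp only [Expr.value, h1, h2, Option.bind_some]
    exact hw
  | add e f ihe ihf | mul e f ihe ihf | sub e f ihe ihf | div e f ihe ihf | lt e f ihe ihf
  | eq e f ihe ihf =>
    have hpe := e.deg_pos
    have hpf := f.deg_pos
    have hde : e.deg ≤ D := by simp only [Expr.deg] at hD; omega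
    have hdf : f.deg ≤ D := by simp only [Expr.deg] at hD; omega
    have h1 := ihe hde hc.1 (hword e hde hc.1)
    have h2 := ihf hdf hc.2 (hword f hdf hc.2)
    simp only [Expr.value, h1, h2, Option.bind_some]
    exact hw

/-- A tame program runs on words in the same way as on unbounded numbers. -/
theorem Exec.runs {P : Program} {σ τ : Memory} {t D B : ℕ} (h : Exec qy P σ t τ)
    (hP : P.Tame D K) (hσ : σ.Le M) (hq : ∀ v i, qy v i ≤ M) (hK : K ≤ M)
    (hM : 2 ≤ M) (hB : (M + t) ^ D < B) : Runs qy B P σ t τ ∧ τ.Le (M + t) := by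
  have key : ∀ {M t t' : ℕ}, t' ≤ t → (M + t) ^ D < B → (M + t') ^ D < B := fun h h' =>
    lt_of_le_of_lt (Nat.pow_le_pow_left (by omega) _) h'
  have hB0 : ∀ {M t : ℕ}, (M + t) ^ D < B → M ^ D < B := fun {M t} h =>
    key (Nat.zero_le t) h
  -- The bound has to vary in the induction: the second half of a sequence, or the rest of a loop,
  -- starts with numbers up to `M` plus the time already spent.
  induction h generalizing M with
  | skip σ => exact ⟨.skip σ, hσ.mono (by omega)⟩
  | assign σ x e =>
    refine ⟨.assign σ x e _ (e.value_eq hσ hq hK hM (hB0 hB) hP.2.1 hP.2.2), ?_⟩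
    exact (hσ.mono (by omega)).setReg
      ((Expr.ev_le_of_slow hσ hq hK (by omega) hP.1 hP.2.2).trans (by omega))
  | write σ a i e =>
    refine ⟨.write σ a i e _ _ (i.value_eq hσ hq hK hM (hB0 hB) hP.1.1 hP.1.2)
      (e.value_eq hσ hq hK hM (hB0 hB) hP.2.2.1 hP.2.2.2), ?_⟩
    exact (hσ.mono (by omega)).setArr
      ((Expr.ev_le_of_slow hσ hq hK (by omega) hP.2.1 hP.2.2.2).trans (by omega))
  | seq P Q σ σ₁ σ₂ t₁ t₂ h₁ h₂ ih₁ ih₂ =>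
    obtain ⟨r₁, l₁⟩ := ih₁ hP.1 hσ hq hK hM (key (by omega) hB)
    obtain ⟨r₂, l₂⟩ := ih₂ hP.2 l₁ (fun v i => (hq v i).trans (by omega)) (by omega) (by omega)
      (by rwa [add_assoc])
    exact ⟨.seq _ _ _ _ _ _ _ r₁ r₂, by rwa [← add_assoc]⟩
  | cond_true e P Q σ τ t he h ih =>
    obtain ⟨r, l⟩ := ih hP.2.1 hσ hq hK hM (key (by omega) hB)
    exact ⟨.cond_true _ _ _ _ _ _ _ (e.value_eq hσ hq hK hM (hB0 hB) hP.1.1 hP.1.2) he r,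
      l.mono (by omega)⟩
  | cond_false e P Q σ τ t he h ih =>
    obtain ⟨r, l⟩ := ih hP.2.2 hσ hq hK hM (key (by omega) hB)
    exact ⟨.cond_false _ _ _ _ _ _
      (by rw [e.value_eq hσ hq hK hM (hB0 hB) hP.1.1 hP.1.2, he]) r, l.mono (by omega)⟩
  | loop_true e P σ σ₁ σ₂ t₁ t₂ he h₁ h₂ ih₁ ih₂ =>
    obtain ⟨r₁, l₁⟩ := ih₁ hP.2 hσ hq hK hM (key (by omega) hB)
    obtain ⟨r₂, l₂⟩ := ih₂ hP l₁ (fun v i => (hq v i).trans (by omega)) (by omega) (by omega)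
      (by rw [add_assoc]; exact key (by omega) hB)
    exact ⟨.loop_true _ _ _ _ _ _ _ _
      (e.value_eq hσ hq hK hM (hB0 hB) hP.1.1 hP.1.2) he r₁ r₂, l₂.mono (by omega)⟩
  | loop_false e P σ he =>
    exact ⟨.loop_false _ _ _ (by rw [e.value_eq hσ hq hK hM (hB0 hB) hP.1.1 hP.1.2, he]),
      hσ.mono (by omega)⟩

end Bounded

/-! ### Weakest preconditions -/

/-- Does the program assign to the register `x`? -/
def Program.setsReg (x : ℕ) : Program → Bool
  | .skip => false
  | .assign y _ => x == y
  | .write _ _ _ => false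
  | .seq P Q => P.setsReg x || Q.setsReg x
  | .cond _ P Q => P.setsReg x || Q.setsReg x
  | .loop _ P => P.setsReg x

/-- Does the program write into the array `a`? -/
def Program.setsArr (a : ℕ) : Program → Bool
  | .skip => false
  | .assign _ _ => false
  | .write b _ _ => a == b
  | .seq P Q => P.setsArr a || Q.setsArr a
  | .cond _ P Q => P.setsArr a || Q.setsArr a
  | .loop _ P => P.setsArr a

/-- The program does not touch what it does not write to. -/
structure Frame (P : Program) (σ τ : Memory) : Prop where
  reg : ∀ x, P.setsReg x = false → τ.reg x = σ.reg x
  arr : ∀ a, P.setsArr a = false → τ.arr a = σ.arr a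

/-- Most registers and arrays are untouched by most programs. Since the written ones are computed by
a Boolean function, their preservation is later discharged by `rfl` instead of being carried through
every invariant. -/
theorem Exec.frame {qy : ℕ → ℕ → ℕ} {P : Program} {σ τ : Memory} {t : ℕ}
    (h : Exec qy P σ t τ) : Frame P σ τ := by
  induction h with
  | skip σ => exact ⟨fun _ _ => rfl, fun _ _ => rfl⟩
  | assign σ x e =>
    refine ⟨fun y hy => ?_, fun _ _ => rfl⟩
    simp only [Program.setsReg, beq_eq_false_iff_ne] at hy
    simp [hy]
  | write σ a i e =>
    refine ⟨fun _ _ => rfl, fun b hb => ?_⟩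
    simp only [Program.setsArr, beq_eq_false_iff_ne] at hb
    simp [hb]
  | seq P Q σ σ₁ σ₂ t₁ t₂ h₁ h₂ ih₁ ih₂ =>
    refine ⟨fun x hx => ?_, fun a ha => ?_⟩
    · simp only [Program.setsReg, Bool.or_eq_false_iff] at hx
      rw [ih₂.reg x hx.2, ih₁.reg x hx.1]
    · simp only [Program.setsArr, Bool.or_eq_false_iff] at ha
      rw [ih₂.arr a ha.2, ih₁.arr a ha.1]
  | cond_true e P Q σ τ t he h ih =>
    refine ⟨fun x hx => ?_, fun a ha => ?_⟩
    · simp only [Program.setsReg, Bool.or_eq_false_iff] at hx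
      exact ih.reg x hx.1
    · simp only [Program.setsArr, Bool.or_eq_false_iff] at ha
      exact ih.arr a ha.1
  | cond_false e P Q σ τ t he h ih =>
    refine ⟨fun x hx => ?_, fun a ha => ?_⟩
    · simp only [Program.setsReg, Bool.or_eq_false_iff] at hx
      exact ih.reg x hx.2
    · simp only [Program.setsArr, Bool.or_eq_false_iff] at ha
      exact ih.arr a ha.2
  | loop_true e P σ σ₁ σ₂ t₁ t₂ he h₁ h₂ ih₁ ih₂ =>
    refine ⟨fun x hx => ?_, fun a ha => ?_⟩
    · rw [ih₂.reg x hx, ih₁.reg x hx]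
    · rw [ih₂.arr a ha, ih₁.arr a ha]
  | loop_false e P σ he => exact ⟨fun _ _ => rfl, fun _ _ => rfl⟩

/-- Started at time `t` on the memory `σ`, the program halts at a time and with a memory that
satisfy `Φ`. -/
def wp (qy : ℕ → ℕ → ℕ) (P : Program) (Φ : ℕ → Memory → Prop) (t : ℕ) (σ : Memory) : Prop :=
  ∃ t' τ, Exec qy P σ t' τ ∧ Φ (t + t') τ

section WP

variable {qy : ℕ → ℕ → ℕ} {P Q : Program} {Φ Ψ : ℕ → Memory → Prop} {t : ℕ} {σ : Memory}

/-- The consequence rule hands out the frame of the execution as well, so a specification only has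
to mention what the program changes. -/
theorem wp.mono (h : wp qy P Φ t σ) (hΦ : ∀ t' τ, t ≤ t' → Frame P σ τ → Φ t' τ → Ψ t' τ) :
    wp qy P Ψ t σ := by
  obtain ⟨t', τ, h1, h2⟩ := h
  exact ⟨t', τ, h1, hΦ _ _ (by omega) h1.frame h2⟩

theorem wp_skip (h : Φ (t + 1) σ) : wp qy .skip Φ t σ := ⟨1, σ, .skip σ, h⟩

theorem wp_assign {x : ℕ} {e : Expr} (h : Φ (t + (e.time + 1)) (σ.setReg x (e.ev qy σ))) :
    wp qy (.assign x e) Φ t σ := ⟨_, _, .assign σ x e, h⟩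

theorem wp_write {a : ℕ} {i e : Expr}
    (h : Φ (t + (i.time + e.time + 1)) (σ.setArr a (i.ev qy σ) (e.ev qy σ))) :
    wp qy (.write a i e) Φ t σ := ⟨_, _, .write σ a i e, h⟩

theorem wp_seq (h : wp qy P (wp qy Q Φ) t σ) : wp qy (.seq P Q) Φ t σ := by
  obtain ⟨t₁, σ₁, h1, t₂, σ₂, h2, h3⟩ := h
  exact ⟨_, _, .seq _ _ _ _ _ _ _ h1 h2, by rwa [← add_assoc]⟩

theorem wp_cond {e : Expr} (h1 : e.ev qy σ ≠ 0 → wp qy P Φ (t + (e.time + 1)) σ)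
    (h2 : e.ev qy σ = 0 → wp qy Q Φ (t + (e.time + 1)) σ) : wp qy (.cond e P Q) Φ t σ := by
  by_cases he : e.ev qy σ = 0
  · obtain ⟨t', τ, h3, h4⟩ := h2 he
    exact ⟨_, _, .cond_false _ _ _ _ _ _ he h3, by rwa [← add_assoc]⟩
  · obtain ⟨t', τ, h3, h4⟩ := h1 he
    exact ⟨_, _, .cond_true _ _ _ _ _ _ he h3, by rwa [← add_assoc]⟩

/-- The invariant of a loop bounds the running time, which makes the loop terminate. -/
theorem wp_loop {e : Expr} (I : ℕ → Memory → Prop) (T : ℕ) (h0 : I t σ)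
    (hT : ∀ t σ, I t σ → t ≤ T)
    (hstep : ∀ t σ, I t σ → e.ev qy σ ≠ 0 → wp qy P I (t + (e.time + 1)) σ)
    (hexit : ∀ t σ, I t σ → e.ev qy σ = 0 → Φ (t + (e.time + 1)) σ) :
    wp qy (.loop e P) Φ t σ := by
  -- The test of the guard already costs time, so `T - t` drops in every iteration: the time bound
  -- itself is the termination measure.
  induction hk : T - t using Nat.strong_induction_on generalizing t σ with
  | _ k ih =>
    by_cases he : e.ev qy σ = 0
    · exact ⟨_, _, .loop_false _ _ _ he, hexit t σ h0 he⟩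
    · obtain ⟨t₁, σ₁, h1, h2⟩ := hstep t σ h0 he
      have h3 := hT _ _ h2
      obtain ⟨t₂, σ₂, h4, h5⟩ := ih (T - (t + (e.time + 1) + t₁)) (by omega) h2 rfl
      exact ⟨_, _, .loop_true _ _ _ _ _ _ _ he h1 h4, by
        rwa [show t + (e.time + 1 + t₁ + t₂) = t + (e.time + 1) + t₁ + t₂ by ring]⟩

end WP

/-- The programs of the list in sequence. -/
def Program.block : List Program → Program
  | [] => .skip
  | [P] => P
  | P :: Q :: Ps => .seq P (block (Q :: Ps))

end WordRAM


/-! ### Connected vertex sets -/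

section Conn

variable {V : Type*} {G : SimpleGraph V}

/-- Adjacency within a set of vertices. -/
def AdjIn (G : SimpleGraph V) (S : Set V) (u v : V) : Prop := G.Adj u v ∧ u ∈ S ∧ v ∈ S

/-- The set `S` induces a connected subgraph. -/
def Conn (G : SimpleGraph V) (S : Set V) : Prop :=
  S.Nonempty ∧ ∀ u ∈ S, ∀ v ∈ S, Relation.ReflTransGen (AdjIn G S) u v

theorem AdjIn.symm {S : Set V} {u v : V} (h : AdjIn G S u v) : AdjIn G S v u :=
  ⟨h.1.symm, h.2.2, h.2.1⟩

theorem AdjIn.mono {S T : Set V} (hST : S ⊆ T) {u v : V} (h : AdjIn G S u v) : AdjIn G T u v :=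
  ⟨h.1, hST h.2.1, hST h.2.2⟩

theorem reach_symm {S : Set V} {u v : V} (h : Relation.ReflTransGen (AdjIn G S) u v) :
    Relation.ReflTransGen (AdjIn G S) v u :=
  haveI : Std.Symm (AdjIn G S) := ⟨fun _ _ => AdjIn.symm⟩
  Relation.ReflTransGen.stdSymm.symm _ _ h

theorem reach_mono {S T : Set V} (hST : S ⊆ T) {u v : V}
    (h : Relation.ReflTransGen (AdjIn G S) u v) : Relation.ReflTransGen (AdjIn G T) u v :=
  Relation.ReflTransGen.mono (fun _ _ => AdjIn.mono hST) _ _ h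

/-- A set is connected if all its vertices are reachable from one of them. -/
theorem Conn.of_root {S : Set V} {r : V} (hr : r ∈ S)
    (h : ∀ v ∈ S, Relation.ReflTransGen (AdjIn G S) r v) : Conn G S :=
  ⟨⟨r, hr⟩, fun u hu v hv => (reach_symm (h u hu)).trans (h v hv)⟩

theorem Conn.singleton (v : V) : Conn G {v} :=
  Conn.of_root (r := v) rfl fun u hu => by rw [Set.mem_singleton_iff.1 hu]

/-- A part of a connected set that is closed under adjacency is everything. -/
theorem Conn.subset_of_closed {S U : Set V} (hS : Conn G S) {r : V} (hr : r ∈ S) (hrU : r ∈ U)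
    (hU : ∀ u v, u ∈ S → v ∈ S → u ∈ U → G.Adj u v → v ∈ U) : S ⊆ U := by
  intro v hv
  have := hS.2 r hr v hv
  induction this with
  | refl => exact hrU
  | tail h1 h2 ih => exact hU _ _ h2.2.1 h2.2.2 (ih h2.2.1) h2.1

/-- A connected set that meets `U` and is not contained in it has an edge leaving `U`. -/
theorem Conn.exists_adj {S U : Set V} (hS : Conn G S) {r x : V} (hr : r ∈ S) (hrU : r ∈ U)
    (hx : x ∈ S) (hxU : x ∉ U) : ∃ u v, u ∈ S ∧ v ∈ S ∧ u ∈ U ∧ v ∉ U ∧ G.Adj u v := by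
  by_contra hcon
  push Not at hcon
  exact hxU (hS.subset_of_closed hr hrU (fun u v hu hv huU huv => by
    by_contra hvU
    exact hcon u v hu hv huU hvU huv) hx)

/-- Adding vertices that are reachable from a connected set keeps it connected. -/
theorem Conn.of_subset {S T : Set V} (hS : Conn G S) (hST : S ⊆ T)
    (h : ∀ v ∈ T, ∃ u ∈ S, Relation.ReflTransGen (AdjIn G T) u v) : Conn G T := by
  obtain ⟨r, hr⟩ := hS.1
  refine Conn.of_root (hST hr) fun v hv => ?_
  obtain ⟨u, hu, huv⟩ := h v hv
  exact (reach_mono hST (hS.2 r hr u hu)).trans huv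

theorem Conn.insert {S : Set V} (hS : Conn G S) {u v : V} (hu : u ∈ S) (huv : G.Adj u v) :
    Conn G (insert v S) := by
  refine hS.of_subset (Set.subset_insert v S) fun w hw => ?_
  rcases hw with rfl | hw
  · exact ⟨u, hu, .single ⟨huv, Or.inr hu, Or.inl rfl⟩⟩
  · exact ⟨w, hw, .refl⟩

theorem Conn.induce_connected {S : Set V} (hS : Conn G S) : (G.induce S).Connected := by
  obtain ⟨r, hr⟩ := hS.1
  have : Nonempty S := ⟨⟨r, hr⟩⟩
  have key : ∀ v (hv : v ∈ S), (G.induce S).Reachable ⟨r, hr⟩ ⟨v, hv⟩ := by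
    intro v hv
    have := hS.2 r hr v hv
    induction this with
    | refl => exact .refl _
    | tail h1 h2 ih =>
      exact (ih h2.2.1).trans (SimpleGraph.Adj.reachable (by simpa using h2.1))
  exact ⟨fun u v => (key u u.2).symm.trans (key v v.2)⟩

end Conn

/-! ### Clique minors -/

/-- The complete graph on `t` vertices is a minor of `G`. -/
def CliqueMinor {V : Type*} (t : ℕ) (G : SimpleGraph V) : Prop :=
  ∃ B : Fin t → Set V, (∀ i, Conn G (B i)) ∧ ∀ i j, i ≠ j →
    Disjoint (B i) (B j) ∧ ∃ u ∈ B i, ∃ v ∈ B j, G.Adj u v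

theorem CliqueMinor.mono {V : Type*} {G : SimpleGraph V} {s t : ℕ} (hst : s ≤ t)
    (h : CliqueMinor t G) : CliqueMinor s G := by
  obtain ⟨B, h1, h2⟩ := h
  exact ⟨fun i => B (Fin.castLE hst i), fun i => h1 _, fun i j hij => h2 _ _ fun h =>
    hij (Fin.castLE_injective hst h)⟩

/-- A graph on `t` vertices is a minor of every graph with a clique minor of order `t`. -/
theorem CliqueMinor.isMinor {V W : Type*} [Finite W] {G : SimpleGraph V} (H : SimpleGraph W)
    (h : CliqueMinor (Nat.card W) G) : IsMinor H G := by
  classical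
  obtain ⟨B, hB, hBB⟩ := h
  let φ := Finite.equivFin W
  let C : W → Set V := fun w => B (φ w)
  have hC : ∀ w, Conn G (C w) := fun w => hB _
  have hCC : ∀ w w', w ≠ w' → Disjoint (C w) (C w') ∧ ∃ u ∈ C w, ∃ v ∈ C w', G.Adj u v :=
    fun w w' h => hBB _ _ fun h' => h (φ.injective h')
  have huniq : ∀ {v w w'}, v ∈ C w → v ∈ C w' → w = w' := by
    intro v w w' h1 h2
    by_contra h3
    exact Set.disjoint_left.1 (hCC w w' h3).1 h1 h2
  -- Only edges inside a branch set, or between the branch sets of two adjacent vertices of `H`, are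
  -- kept. Surplus edges of the clique minor would otherwise survive the contraction.
  let K : G.Subgraph :=
    { verts := ⋃ w, C w
      Adj := fun u v => G.Adj u v ∧ ∃ w w', u ∈ C w ∧ v ∈ C w' ∧ (w = w' ∨ H.Adj w w')
      adj_sub := fun h => h.1
      edge_vert := fun {u v} h => by
        obtain ⟨_, w, w', h1, _⟩ := h
        exact Set.mem_iUnion.2 ⟨w, h1⟩
      symm := ⟨fun u v h => by
        obtain ⟨h0, w, w', h1, h2, h3⟩ := h
        exact ⟨h0.symm, w', w, h2, h1, h3.imp Eq.symm fun h => h.symm⟩⟩ }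
  have hf : ∀ u : K.verts, ∃ w, (u : V) ∈ C w := fun u => Set.mem_iUnion.1 u.2
  choose f hf using hf
  have hmem : ∀ {v : V} {w}, v ∈ C w → v ∈ K.verts := fun {v w} h => Set.mem_iUnion.2 ⟨w, h⟩
  have hfeq : ∀ {v : V} {w} (h : v ∈ C w), f ⟨v, hmem h⟩ = w := fun {v w} h => huniq (hf _) h
  refine ⟨K, f, fun w => ?_, fun x y => ⟨fun hxy => ⟨hxy.ne, ?_⟩, ?_⟩⟩
  · apply Conn.induce_connected
    obtain ⟨r, hr⟩ := (hC w).1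
    refine Conn.of_root (r := ⟨r, hmem hr⟩) (hfeq hr) ?_
    rintro ⟨v, hvK⟩ hv
    have hvw : v ∈ C w := by
      have := hf ⟨v, hvK⟩
      rwa [show f ⟨v, hvK⟩ = w from hv] at this
    have := (hC w).2 r hr v hvw
    induction this with
    | refl => exact .refl
    | @tail b c h1 h2 ih =>
      refine (ih (hmem h2.2.1) (hfeq h2.2.1) h2.2.1).tail ⟨?_, hfeq h2.2.1, hfeq h2.2.2⟩
      exact ⟨h2.1, w, w, h2.2.1, h2.2.2, Or.inl rfl⟩
  · obtain ⟨-, u, hu, v, hv, huv⟩ := hCC x y hxy.ne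
    exact ⟨⟨u, hmem hu⟩, ⟨v, hmem hv⟩, hfeq hu, hfeq hv, huv, x, y, hu, hv, Or.inr hxy⟩
  · rintro ⟨hne, u, v, rfl, rfl, huv⟩
    obtain ⟨-, w, w', h1, h2, h3⟩ := huv
    have e1 : f u = w := huniq (hf u) h1
    have e2 : f v = w' := huniq (hf v) h2
    rw [e1, e2] at hne ⊢
    exact h3.resolve_left hne

/-! ### The number of edges -/

section Edges

/-- A clique minor of the neighbourhood of a vertex extends by that vertex. -/
theorem CliqueMinor.of_neighbors {V : Type*} {G : SimpleGraph V} {t : ℕ} (v : V)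
    (h : CliqueMinor t (G.induce (G.neighborSet v))) : CliqueMinor (t + 1) G := by
  obtain ⟨B, hB, hBB⟩ := h
  have hlift : ∀ S : Set (G.neighborSet v), Conn (G.induce (G.neighborSet v)) S →
      Conn G (Subtype.val '' S) := by
    rintro S ⟨⟨r, hr⟩, h⟩
    refine Conn.of_root (r := r) ⟨r, hr, rfl⟩ ?_
    rintro _ ⟨w, hw, rfl⟩
    have := h r hr w hw
    refine Relation.ReflTransGen.lift Subtype.val (fun a b hab => ?_) _ _ this
    exact ⟨by simpa using hab.1, ⟨a, hab.2.1, rfl⟩, ⟨b, hab.2.2, rfl⟩⟩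
  have hv : ∀ i, v ∉ (Subtype.val '' B i : Set V) := by
    rintro i ⟨w, -, hw⟩
    exact G.loopless.irrefl v (by have := w.2; rw [hw] at this; exact this)
  have hadj : ∀ i, ∃ w ∈ (Subtype.val '' B i : Set V), G.Adj v w := by
    intro i
    obtain ⟨w, hw⟩ := (hB i).1
    exact ⟨w, ⟨w, hw, rfl⟩, w.2⟩
  refine ⟨Fin.cons {v} fun i => Subtype.val '' B i, fun i => ?_, fun i j => ?_⟩
  · refine Fin.cases ?_ (fun i => ?_) i
    · simpa using Conn.singleton v
    · simpa using hlift _ (hB i)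
  · refine Fin.cases ?_ (fun i => ?_) i <;> refine Fin.cases ?_ (fun j => ?_) j
    · exact fun h => (h rfl).elim
    · intro _
      obtain ⟨w, hw, hvw⟩ := hadj j
      exact ⟨by simpa only [Fin.cons_zero, Fin.cons_succ, Set.disjoint_singleton_left] using hv j,
        v, by simp, w, by simpa using hw, hvw⟩
    · intro _
      obtain ⟨w, hw, hvw⟩ := hadj i
      exact ⟨by simpa only [Fin.cons_zero, Fin.cons_succ, Set.disjoint_singleton_right] using hv i,
        w, by simpa using hw, v, by simp, hvw.symm⟩
    · intro hij
      obtain ⟨h1, u, hu, w, hw, huw⟩ := hBB i j fun h => hij (by rw [h])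
      simp only [Fin.cons_succ]
      exact ⟨(Set.disjoint_image_iff Subtype.val_injective).2 h1, u, ⟨u, hu, rfl⟩, w,
        ⟨w, hw, rfl⟩, by simpa using huw⟩

/-- The graph obtained by contracting `v` into its neighbour `u`. -/
def contractInto {V : Type*} (G : SimpleGraph V) (u v : V) : SimpleGraph {x : V // x ≠ v} where
  Adj x y := x ≠ y ∧ (G.Adj x y ∨ ((x : V) = u ∧ G.Adj v y) ∨ ((y : V) = u ∧ G.Adj v x))
  symm := ⟨fun x y h => ⟨h.1.symm, by
    rcases h.2 with h | h | h
    exacts [Or.inl h.symm, Or.inr (Or.inr h), Or.inr (Or.inl h)]⟩⟩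
  loopless := ⟨fun x h => h.1 rfl⟩

/-- Undo the contraction by adding `v` to the branch set that contains `u`, if there is one. The
edge `uv` keeps this set connected, and every edge of the contracted graph that comes from an edge
at `v` is recovered through `v`. -/
theorem CliqueMinor.of_contractInto {V : Type*} {G : SimpleGraph V} {t : ℕ} {u v : V}
    (huv : G.Adj u v) (h : CliqueMinor t (contractInto G u v)) : CliqueMinor t G := by
  obtain ⟨B, hB, hBB⟩ := h
  let up : Set {x : V // x ≠ v} → Set V := fun S => {x | (∃ y ∈ S, (y : V) = x) ∨
    (x = v ∧ ∃ y ∈ S, (y : V) = u)}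
  have hadj : ∀ (S T : Set {x : V // x ≠ v}) (x y : {x : V // x ≠ v}), x ∈ S → y ∈ T →
      (contractInto G u v).Adj x y → G.Adj x y ∨ ((x : V) = u ∧ v ∈ up S ∧ G.Adj v y) ∨
        ((y : V) = u ∧ v ∈ up T ∧ G.Adj v x) := by
    rintro S T x y hx hy ⟨-, h | ⟨h1, h2⟩ | ⟨h1, h2⟩⟩
    exacts [Or.inl h, Or.inr (Or.inl ⟨h1, Or.inr ⟨rfl, x, hx, h1⟩, h2⟩),
      Or.inr (Or.inr ⟨h1, Or.inr ⟨rfl, y, hy, h1⟩, h2⟩)]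
  refine ⟨fun i => up (B i), fun i => ?_, fun i j hij => ⟨?_, ?_⟩⟩
  · obtain ⟨⟨r, hr⟩, h⟩ := hB i
    have key : ∀ x ∈ B i, Relation.ReflTransGen (AdjIn G (up (B i))) r x := by
      intro x hx
      have := h r hr x hx
      clear hx
      induction this with
      | refl => exact .refl
      | @tail b c _ h2 ih =>
        have hb : (b : V) ∈ up (B i) := Or.inl ⟨b, h2.2.1, rfl⟩
        have hc : (c : V) ∈ up (B i) := Or.inl ⟨c, h2.2.2, rfl⟩
        rcases hadj _ _ b c h2.2.1 h2.2.2 h2.1 with h | ⟨h3, h4, h5⟩ | ⟨h3, h4, h5⟩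
        · exact ih.tail ⟨h, hb, hc⟩
        · exact (ih.tail ⟨by rw [h3]; exact huv, hb, h4⟩).tail ⟨h5, h4, hc⟩
        · exact (ih.tail ⟨h5.symm, hb, h4⟩).tail ⟨by rw [h3]; exact huv.symm, h4, hc⟩
    refine Conn.of_root (r := r) (Or.inl ⟨r, hr, rfl⟩) ?_
    rintro x (⟨y, hy, rfl⟩ | ⟨rfl, y, hy, rfl⟩)
    · exact key y hy
    · exact (key y hy).tail ⟨huv, Or.inl ⟨y, hy, rfl⟩, Or.inr ⟨rfl, y, hy, rfl⟩⟩
  · rw [Set.disjoint_left]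
    have hd := Set.disjoint_left.1 (hBB i j hij).1
    rintro x (⟨y, hy, rfl⟩ | ⟨rfl, y, hy, hyu⟩) (⟨z, hz, hzx⟩ | ⟨hzv, z, hz, hzu⟩)
    · exact hd hy (Subtype.ext hzx ▸ hz)
    · exact y.2 hzv
    · exact z.2 hzx
    · exact hd hy (Subtype.ext (hyu.trans hzu.symm) ▸ hz)
  · obtain ⟨-, x, hx, y, hy, hxy⟩ := hBB i j hij
    have hx' : (x : V) ∈ up (B i) := Or.inl ⟨x, hx, rfl⟩
    have hy' : (y : V) ∈ up (B j) := Or.inl ⟨y, hy, rfl⟩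
    rcases hadj _ _ x y hx hy hxy with h | ⟨h3, h4, h5⟩ | ⟨h3, h4, h5⟩
    · exact ⟨x, hx', y, hy', h⟩
    · exact ⟨v, h4, y, hy', h5⟩
    · exact ⟨x, hx', v, h4, h5.symm⟩

/-- The pairs of adjacent vertices. -/
def arcs {V : Type*} (G : SimpleGraph V) : Set (V × V) := {p | G.Adj p.1 p.2}

/-- A contraction of `uv` destroys only the two arcs between `u` and `v` and, for each common
neighbour, one of two parallel edges, which counts as two arcs. -/
theorem ncard_arcs_le_contractInto {V : Type*} [Finite V] {G : SimpleGraph V} {u v : V}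
    (huv : G.Adj u v) : (arcs G).ncard ≤ (arcs (contractInto G u v)).ncard + 2 +
      2 * (G.neighborSet u ∩ G.neighborSet v).ncard := by
  classical
  set C := G.neighborSet u ∩ G.neighborSet v with hC
  set E₁ : Set (V × V) := {(u, v), (v, u)}
  set E₂ : Set (V × V) := (fun w => (v, w)) '' C
  set E₃ : Set (V × V) := (fun w => (w, v)) '' C
  have h1 : E₁.ncard ≤ 2 := (Set.ncard_insert_le _ _).trans (by simp)
  have h2 : E₂.ncard ≤ C.ncard := Set.ncard_image_le
  have h3 : E₃.ncard ≤ C.ncard := Set.ncard_image_le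
  have hu : u ≠ v := huv.ne
  let φ : V → {x : V // x ≠ v} := fun x => if h : x = v then ⟨u, hu⟩ else ⟨x, h⟩
  have hφ : ∀ x, ((φ x : {x : V // x ≠ v}) : V) = if x = v then u else x := by
    intro x; simp only [φ]; split_ifs <;> rfl
  -- On the remaining arcs, replacing the endpoint `v` by `u` produces neither a loop nor a
  -- coincidence, so it is injective into the arcs of the contracted graph.
  set E₀ := arcs G \ (E₁ ∪ (E₂ ∪ E₃))
  have h0 : E₀.ncard ≤ (arcs (contractInto G u v)).ncard := by
    have hE : ∀ p ∈ E₀, G.Adj p.1 p.2 ∧ (p.1 = v → p.2 ≠ u ∧ ¬ G.Adj u p.2) ∧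
        (p.2 = v → p.1 ≠ u ∧ ¬ G.Adj u p.1) := by
      rintro ⟨x, y⟩ ⟨hxy, hn⟩
      simp only [E₁, E₂, E₃, hC, Set.mem_union, Set.mem_insert_iff, Set.mem_singleton_iff,
        Set.mem_image, Set.mem_inter_iff, SimpleGraph.mem_neighborSet, Prod.mk.injEq,
        not_or, not_exists, not_and] at hn
      have hxy : G.Adj x y := hxy
      refine ⟨hxy, ?_, ?_⟩
      · rintro rfl
        exact ⟨fun h => hn.1.2 rfl h, fun h => hn.2.1 y ⟨h, hxy⟩ rfl rfl⟩
      · rintro rfl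
        exact ⟨fun h => hn.1.1 h rfl, fun h => hn.2.2 x ⟨h, hxy.symm⟩ rfl rfl⟩
    refine Set.ncard_le_ncard_of_injOn (fun p => (φ p.1, φ p.2)) ?_ ?_ (Set.toFinite _)
    · intro p hp
      obtain ⟨ha, hb, hc⟩ := hE p hp
      have hne := ha.ne
      refine ⟨fun h => ?_, ?_⟩
      · have h := congrArg Subtype.val h
        simp only [hφ] at h
        split_ifs at h <;> grind
      · simp only [hφ]
        split_ifs with h4 h5 h5
        · exact (hne (h4.trans h5.symm)).elim
        · exact Or.inr (Or.inl ⟨rfl, h4 ▸ ha⟩)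
        · exact Or.inr (Or.inr ⟨rfl, h5 ▸ ha.symm⟩)
        · exact Or.inl ha
    · intro p hp q hq hpq
      obtain ⟨ha, hb, hc⟩ := hE p hp
      obtain ⟨ha', hb', hc'⟩ := hE q hq
      have e1 := congrArg (fun x => ((x.1 : {x : V // x ≠ v}) : V)) hpq
      have e2 := congrArg (fun x => ((x.2 : {x : V // x ≠ v}) : V)) hpq
      simp only [hφ] at e1 e2
      ext
      · split_ifs at e1 e2 <;> grind [SimpleGraph.Adj.symm, SimpleGraph.Adj.ne]
      · split_ifs at e1 e2 <;> grind [SimpleGraph.Adj.symm, SimpleGraph.Adj.ne]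
  have h4 : (arcs G).ncard ≤ (E₀ ∪ (E₁ ∪ (E₂ ∪ E₃))).ncard :=
    Set.ncard_le_ncard (by simp [E₀]) (Set.toFinite _)
  have h5 := Set.ncard_union_le E₀ (E₁ ∪ (E₂ ∪ E₃))
  have h6 := Set.ncard_union_le E₁ (E₂ ∪ E₃)
  have h7 := Set.ncard_union_le E₂ E₃
  omega

theorem ncard_arcs_eq_sum {V : Type*} [Fintype V] (G : SimpleGraph V) :
    (arcs G).ncard = ∑ v, (G.neighborSet v).ncard := by
  classical
  have h : (arcs G).ncard = (Finset.univ.sigma fun v : V => (G.neighborSet v).toFinset).card := by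
    rw [Set.ncard_eq_toFinset_card']
    refine Finset.card_bij (fun p _ => ⟨p.1, p.2⟩) ?_ ?_ ?_
    · intro p hp
      rw [Set.mem_toFinset] at hp
      have hp : G.Adj p.1 p.2 := hp
      simpa using hp
    · rintro ⟨a, b⟩ _ ⟨c, d⟩ _ h; simpa using h
    · rintro ⟨a, b⟩ h; have h : G.Adj a b := by simpa using h
      exact ⟨(a, b), by rw [Set.mem_toFinset]; exact h, rfl⟩
  rw [h, Finset.card_sigma]
  exact Finset.sum_congr rfl fun v _ => (Set.ncard_eq_toFinset_card' _).symm

/-- **Mader's theorem** (with a weak constant): a graph without a clique minor of order `t` has a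
linear number of edges. -/
theorem ncard_arcs_lt (t : ℕ) : ∀ (m : ℕ) {V : Type*} [Finite V] [Nonempty V]
    (G : SimpleGraph V), Nat.card V = m → ¬ CliqueMinor t G →
    (arcs G).ncard < 2 ^ (t + 1) * Nat.card V := by
  induction t with
  | zero => exact fun m V _ _ G _ h => (h ⟨Fin.elim0, fun i => i.elim0, fun i => i.elim0⟩).elim
  | succ t iht =>
    intro m
    induction m with
    | zero => intro V _ _ G hm; exact absurd hm Nat.card_pos.ne'
    | succ m ihm =>
      intro V _ _ G hm hG
      have hpos : 0 < 2 ^ (t + 1) := by positivity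
      -- If some edge lies in fewer than `2 ^ (t + 1)` triangles, contract it: at most `2 + 2 * (2 ^
      -- (t + 1) - 1) = 2 ^ (t + 2)` arcs are lost, exactly the allowance of one vertex.
      by_cases hE : ∃ u v, G.Adj u v ∧ (G.neighborSet u ∩ G.neighborSet v).ncard < 2 ^ (t + 1)
      · obtain ⟨u, v, huv, hc⟩ := hE
        have h1 := ncard_arcs_le_contractInto huv
        have : Nonempty {x : V // x ≠ v} := ⟨⟨u, huv.ne⟩⟩
        have hcard : Nat.card {x : V // x ≠ v} = m := by
          classical
          have := Fintype.ofFinite V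
          rw [Nat.card_eq_fintype_card] at hm ⊢
          rw [Fintype.card_subtype_compl, Fintype.card_subtype_eq, hm]
          rfl
        have h2 := ihm _ hcard fun h => hG (h.of_contractInto huv)
        rw [hcard] at h2
        rw [hm, pow_succ 2 (t + 1)]
        rw [pow_succ 2 (t + 1)] at h2
        nlinarith
      · push Not at hE
        rcases (arcs G).eq_empty_or_nonempty with h0 | ⟨⟨v, w⟩, hvw⟩
        · rw [h0, Set.ncard_empty]
          exact Nat.mul_pos (by positivity) Nat.card_pos
        · exfalso
          have hvw : G.Adj v w := hvw
          have : Nonempty (G.neighborSet v) := ⟨⟨w, hvw⟩⟩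
          -- Otherwise the neighbourhood of any non-isolated vertex has minimum degree at least `2 ^
          -- (t + 1)`, too many arcs for a graph without a clique minor of order `t`; adding the
          -- vertex itself gives order `t + 1`.
          have h1 := iht _ (G.induce (G.neighborSet v)) rfl fun h => hG h.of_neighbors
          have := Fintype.ofFinite (G.neighborSet v)
          rw [ncard_arcs_eq_sum] at h1
          have h2 : ∑ _x : G.neighborSet v, 2 ^ (t + 1) ≤
              ∑ x, ((G.induce (G.neighborSet v)).neighborSet x).ncard := by
            refine Finset.sum_le_sum fun x _ => (hE v x x.2).trans ?_
            rw [← Set.ncard_image_of_injective _ (Subtype.val_injective (p := (· ∈ G.neighborSet v)))]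
            refine Set.ncard_le_ncard (fun y hy => ?_) (Set.toFinite _)
            exact ⟨⟨y, hy.1⟩, by simpa using hy.2, rfl⟩
          rw [Finset.sum_const, Finset.card_univ, smul_eq_mul, ← Nat.card_eq_fintype_card] at h2
          rw [mul_comm] at h1
          omega

end Edges


namespace WordRAM

/-! ### Rules for straight-line code -/

section Rules

variable {qy : ℕ → ℕ → ℕ} {P Q : Program} {Φ : ℕ → Memory → Prop} {t : ℕ} {σ : Memory}

theorem wp_skip_iff : wp qy .skip Φ t σ ↔ Φ (t + 1) σ :=
  ⟨fun ⟨_, _, h, h'⟩ => by cases h; exact h', wp_skip⟩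

theorem wp_assign_iff {x : ℕ} {e : Expr} :
    wp qy (.assign x e) Φ t σ ↔ Φ (t + (e.time + 1)) (σ.setReg x (e.ev qy σ)) :=
  ⟨fun ⟨_, _, h, h'⟩ => by cases h; exact h', wp_assign⟩

theorem wp_write_iff {a : ℕ} {i e : Expr} : wp qy (.write a i e) Φ t σ ↔
    Φ (t + (i.time + e.time + 1)) (σ.setArr a (i.ev qy σ) (e.ev qy σ)) :=
  ⟨fun ⟨_, _, h, h'⟩ => by cases h; exact h', wp_write⟩

theorem wp_seq_iff : wp qy (.seq P Q) Φ t σ ↔ wp qy P (wp qy Q Φ) t σ := by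
  refine ⟨fun ⟨_, _, h, h'⟩ => ?_, wp_seq⟩
  cases h with
  | seq _ _ _ σ₁ _ t₁ t₂ h₁ h₂ => exact ⟨t₁, σ₁, h₁, t₂, _, h₂, by rwa [add_assoc]⟩

theorem Frame.refl (P : Program) (σ : Memory) : Frame P σ σ := ⟨fun _ _ => rfl, fun _ _ => rfl⟩

theorem Frame.trans {P : Program} {σ₁ σ₂ σ₃ : Memory} (h : Frame P σ₁ σ₂) (h' : Frame P σ₂ σ₃) :
    Frame P σ₁ σ₃ :=
  ⟨fun x hx => (h'.reg x hx).trans (h.reg x hx), fun a ha => (h'.arr a ha).trans (h.arr a ha)⟩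

theorem Frame.setReg {P : Program} {σ₁ σ₂ : Memory} (h : Frame P σ₁ σ₂) {x : ℕ} (m : ℕ)
    (hx : P.setsReg x = true) : Frame P σ₁ (σ₂.setReg x m) := by
  refine ⟨fun y hy => ?_, h.arr⟩
  rw [Memory.setReg_reg, if_neg (by rintro rfl; simp [hx] at hy)]
  exact h.reg y hy

theorem Frame.of_sub {P : Program} {σ₁ σ₂ : Memory} (h : Frame P σ₁ σ₂)
    (hr : ∀ x, Q.setsReg x = false → P.setsReg x = false)
    (ha : ∀ a, Q.setsArr a = false → P.setsArr a = false) : Frame Q σ₁ σ₂ :=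
  ⟨fun x hx => h.reg x (hr x hx), fun a h' => h.arr a (ha a h')⟩

/-- `wp_loop` with the frame of the body. -/
theorem wp_loop_frame {e : Expr} (I : ℕ → Memory → Prop) (T : ℕ) (h0 : I t σ)
    (hT : ∀ t σ, I t σ → t ≤ T)
    (hstep : ∀ t τ, Frame P σ τ → I t τ → e.ev qy τ ≠ 0 → wp qy P I (t + (e.time + 1)) τ)
    (hexit : ∀ t τ, Frame P σ τ → I t τ → e.ev qy τ = 0 → Φ (t + (e.time + 1)) τ) :
    wp qy (.loop e P) Φ t σ := by
  refine wp_loop (fun t τ => Frame P σ τ ∧ I t τ) T ⟨Frame.refl P σ, h0⟩ (fun t σ h => hT t σ h.2)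
    (fun t τ h he => ?_) (fun t τ h he => hexit t τ h.1 h.2 he)
  exact (hstep t τ h.1 h.2 he).mono fun t' τ' _ hF h' => ⟨h.1.trans hF, h'⟩

end Rules

/-! ### Segments of arrays -/

section Seg

variable {n : ℕ}

/-- The cells `s, …, e - 1` of `A` hold the vertices of the list `l`. -/
structure Seg (A : ℕ → ℕ) (s e : ℕ) (l : List (Fin n)) : Prop where
  len : e = s + l.length
  get : ∀ i (h : i < l.length), A (s + i) = (l[i] : ℕ)

variable {A A' : ℕ → ℕ} {s e : ℕ} {l : List (Fin n)}

theorem Seg.nil (A : ℕ → ℕ) (s : ℕ) : Seg A s s ([] : List (Fin n)) :=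
  ⟨rfl, fun i h => absurd h (by simp)⟩

theorem Seg.congr (h : Seg A s e l) (hA : ∀ i, i < e → A' i = A i) : Seg A' s e l := by
  refine ⟨h.len, fun i hi => ?_⟩
  rw [hA _ (by have := h.len; omega), h.get i hi]

theorem Seg.snoc (h : Seg A s e l) {v : Fin n} (hv : A e = v) : Seg A s (e + 1) (l ++ [v]) := by
  refine ⟨by simp [h.len, add_assoc], fun i hi => ?_⟩
  rw [List.getElem_append]
  split_ifs with h'
  · exact h.get i h'
  · simp only [List.length_append, List.length_singleton] at hi
    obtain rfl : i = l.length := by omega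
    simpa [← h.len] using hv

theorem Seg.push (h : Seg A s e l) (v : Fin n) :
    Seg (Function.update A e v) s (e + 1) (l ++ [v]) :=
  Seg.snoc (h.congr fun i hi => Function.update_of_ne (by omega) _ _) (by simp)

theorem Seg.at_append {l' : List (Fin n)} {v : Fin n} (h : Seg A s e (l ++ v :: l')) :
    A (s + l.length) = v ∧ s + l.length < e := by
  have h1 := h.get l.length (by simp)
  have h2 := h.len
  simp only [List.length_append, List.length_cons] at h2
  exact ⟨by simpa using h1, by omega⟩

end Seg

/-! ### Loops over neighbours and over segments -/

/-- For all neighbours `w` (in the register `14`) of the vertex in the register `v`, do `P`. -/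
def forNbrs (v : ℕ) (P : Program) : Program :=
  .block [.assign 12 (.const 0), .assign 13 (.query (.reg v) (.reg 12)),
    .loop (.reg 13) (.block [.assign 14 (.sub (.reg 13) (.const 1)), P,
      .assign 12 (.add (.reg 12) (.const 1)), .assign 13 (.query (.reg v) (.reg 12))])]

/-- For all entries (in the register `18`) of the array `1` from the position in the register `4`
to the position in the register `5`, do `P`. -/
def forSeg (P : Program) : Program :=
  .block [.assign 17 (.reg 4), .loop (.lt (.reg 17) (.reg 5)) (.block [
    .assign 18 (.read 1 (.reg 17)), P, .assign 17 (.add (.reg 17) (.const 1))])]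

section Loops

variable {n : ℕ} {G : SimpleGraph (Fin n)}

/-- One more than the degree of a vertex. -/
def _root_.IncidenceLists.wt (L : IncidenceLists G) (v : Fin n) : ℕ := (L.nbrs v).length + 1

theorem _root_.IncidenceLists.query_eq (L : IncidenceLists G) (v : Fin n) (i : ℕ) :
    L.query v i = match (L.nbrs v)[i]? with
      | some u => (u : ℕ) + 1
      | none => 0 :=
  dif_pos v.2

/-- The invariant `J` depends on the list of neighbours treated so far. The answer `0` ends the
loop, so a vertex costs one query more than its degree; this is why `wt` is the degree plus one. `J`
must not depend on the loop registers `12`, `13`, `14`. -/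
theorem wp_forNbrs (L : IncidenceLists G) {v : ℕ} {P : Program} {Φ : ℕ → Memory → Prop} {t : ℕ}
    {σ : Memory} (x : Fin n) (c : ℕ) (J : List (Fin n) → Memory → Prop)
    (hx : σ.reg v = x) (hPv : (forNbrs v P).setsReg v = false) (hP : P.setsReg 12 = false)
    (hJ : ∀ l τ m i, i ∈ [12, 13, 14] → J l τ → J l (τ.setReg i m))
    (h0 : J [] σ)
    (hstep : ∀ (l : List (Fin n)) (y : Fin n) r t τ, L.nbrs x = l ++ y :: r →
    Frame (forNbrs v P) σ τ → J l τ →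
      τ.reg 14 = y → G.Adj x y → wp L.query P (fun t' τ' => t' ≤ t + c ∧ J (l ++ [y]) τ') t τ)
    (hΦ : ∀ t' τ, t' ≤ t + (c + 20) * L.wt x → Frame (forNbrs v P) σ τ → J (L.nbrs x) τ → Φ t' τ) :
    wp L.query (forNbrs v P) Φ t σ := by
  have hv : ∀ τ, Frame (forNbrs v P) σ τ → τ.reg v = x := fun τ hF => (hF.reg v hPv).trans hx
  suffices h : wp L.query (forNbrs v P)
      (fun t' τ => t' ≤ t + (c + 20) * L.wt x ∧ J (L.nbrs x) τ) t σ from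
    h.mono fun t' τ _ hF h => hΦ t' τ h.1 hF h.2
  have hFr : ∀ {τ τ'}, Frame P τ τ' → Frame (forNbrs v P) τ τ' := fun h => h.of_sub
    (fun y hy => by
      simp only [forNbrs, Program.block, Program.setsReg, Bool.or_eq_false_iff] at hy
      exact hy.2.2.2.1)
    (fun y hy => by
      simp only [forNbrs, Program.block, Program.setsArr, Bool.or_eq_false_iff] at hy
      exact hy.2.2.2.1)
  have h12 : (forNbrs v P).setsReg 12 = true := by simp [forNbrs, Program.block, Program.setsReg]
  have h13 : (forNbrs v P).setsReg 13 = true := by simp [forNbrs, Program.block, Program.setsReg]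
  have h14 : (forNbrs v P).setsReg 14 = true := by simp [forNbrs, Program.block, Program.setsReg]
  have hv12 : v ≠ 12 := by rintro rfl; simp [h12] at hPv
  have hv13 : v ≠ 13 := by rintro rfl; simp [h13] at hPv
  have hv14 : v ≠ 14 := by rintro rfl; simp [h14] at hPv
  conv => arg 2; rw [forNbrs]
  simp only [Program.block, wp_seq_iff, wp_assign_iff, Expr.ev, Expr.time, Memory.setReg_reg,
    hv12, if_false, if_true, hx]
  refine wp_loop (fun t' τ => ∃ l r, L.nbrs x = l ++ r ∧ t' ≤ t + 8 + (c + 16) * l.length ∧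
    J l τ ∧ Frame (forNbrs v P) σ τ ∧ τ.reg 12 = l.length ∧ τ.reg 13 = L.query x l.length)
    (t + 8 + (c + 16) * (L.nbrs x).length) ?_ ?_ ?_ ?_
  · exact ⟨[], L.nbrs x, rfl, by omega, hJ _ _ _ _ (by simp) (hJ _ _ _ _ (by simp) h0),
      ((Frame.refl _ _).setReg _ h12).setReg _ h13, by simp, by simp⟩
  · rintro t' τ ⟨l, r, hlr, ht, -⟩
    have : l.length ≤ (L.nbrs x).length := by simp [hlr]
    have := Nat.mul_le_mul_left (c + 16) this
    omega
  · rintro t' τ ⟨l, r, hlr, ht, hJl, hF, hi, hu⟩ hne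
    simp only [Expr.ev, hu, L.query_eq] at hne
    rcases r with _ | ⟨y, r⟩
    · simp [hlr] at hne
    · have hq : L.query x l.length = y + 1 := by simp [L.query_eq, hlr]
      simp only [wp_seq_iff, wp_assign_iff, Expr.ev, Expr.time, Memory.setReg_reg,
        if_true, hu, hq, Nat.add_sub_cancel]
      refine (hstep l y r _ _ hlr (hF.setReg _ h14) (hJ _ _ _ _ (by simp) hJl) (by simp)
        ((L.mem_iff x y).1 (by simp [hlr]))).mono ?_
      rintro t'' τ' - hF' ⟨ht', hJ'⟩
      have hF2 := (hF.setReg y h14).trans (hFr hF')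
      have hi' : τ'.reg 12 = l.length := by
        rw [hF'.reg 12 hP]; simpa using hi
      simp only [wp_seq_iff, wp_assign_iff, Expr.ev, Expr.time]
      refine ⟨l ++ [y], r, by simp [hlr], ?_, hJ _ _ _ _ (by simp) (hJ _ _ _ _ (by simp) hJ'),
        (hF2.setReg _ h12).setReg _ h13, by simp [hi'], ?_⟩
      · simp only [List.length_append, List.length_singleton, mul_add, mul_one]
        omega
      · simp [hv12, hi', hv _ hF2]
  · rintro t' τ ⟨l, r, hlr, ht, hJl, hF, hi, hu⟩ he
    simp only [Expr.ev, hu, L.query_eq] at he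
    rcases r with _ | ⟨y, r⟩
    · simp only [List.append_nil] at hlr
      refine ⟨?_, by rwa [hlr]⟩
      simp only [IncidenceLists.wt, hlr, Expr.time]
      nlinarith
    · simp [hlr] at he

/-- The costs of the individual entries may be very uneven, so the invariant carries the total time
`s` spent in the bodies, and only this total has to be bounded. The body may extend array `1`, but
only behind the segment. -/
theorem wp_forSeg {qy : ℕ → ℕ → ℕ} {P : Program} {Φ : ℕ → Memory → Prop} {t : ℕ}
    {σ : Memory} (l : List (Fin n)) (J : List (Fin n) → ℕ → Memory → Prop)
    (hl : Seg (σ.arr 1) (σ.reg 4) (σ.reg 5) l)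
    (hP : P.setsReg 4 = false ∧ P.setsReg 5 = false ∧ P.setsReg 17 = false) (T : ℕ)
    (hJ : ∀ l s τ m i, i ∈ [17, 18] → J l s τ → J l s (τ.setReg i m))
    (h0 : J [] 0 σ)
    (hT : ∀ l s τ, J l s τ → s ≤ T)
    (hQ : ∀ l s τ, J l s τ → ∀ i, i < σ.reg 5 → τ.arr 1 i = σ.arr 1 i)
    (hstep : ∀ (l₁ : List (Fin n)) (y : Fin n) r s t τ, l = l₁ ++ y :: r → Frame (forSeg P) σ τ →
    J l₁ s τ →
      τ.reg 18 = y → wp qy P (fun t' τ' => ∃ d, t' ≤ t + d ∧ J (l₁ ++ [y]) (s + d) τ') t τ)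
    (hΦ : ∀ t' s τ, t' ≤ t + s + 20 * (l.length + 1) → Frame (forSeg P) σ τ → J l s τ → Φ t' τ) :
    wp qy (forSeg P) Φ t σ := by
  suffices h : wp qy (forSeg P)
      (fun t' τ => ∃ s, t' ≤ t + s + 20 * (l.length + 1) ∧ J l s τ) t σ from
    h.mono fun t' τ _ hF ⟨s, h⟩ => hΦ t' s τ h.1 hF h.2
  have hFr : ∀ {τ τ'}, Frame P τ τ' → Frame (forSeg P) τ τ' := fun h => h.of_sub
    (fun y hy => by
      simp only [forSeg, Program.block, Program.setsReg, Bool.or_eq_false_iff] at hy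
      exact hy.2.2.1)
    (fun y hy => by
      simp only [forSeg, Program.block, Program.setsArr, Bool.or_eq_false_iff] at hy
      exact hy.2.2.1)
  have h4 : (forSeg P).setsReg 4 = false := by simp [forSeg, Program.block, Program.setsReg, hP]
  have h5 : (forSeg P).setsReg 5 = false := by simp [forSeg, Program.block, Program.setsReg, hP]
  have h17 : (forSeg P).setsReg 17 = true := by simp [forSeg, Program.block, Program.setsReg]
  have h18 : (forSeg P).setsReg 18 = true := by simp [forSeg, Program.block, Program.setsReg]
  conv => arg 2; rw [forSeg]
  simp only [Program.block, wp_seq_iff, wp_assign_iff, Expr.ev, Expr.time]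
  have hlen := hl.len
  refine wp_loop (fun t' τ => ∃ l₁ r s, l = l₁ ++ r ∧ t' ≤ t + s + 2 + 20 * l₁.length ∧
    J l₁ s τ ∧ Frame (forSeg P) σ τ ∧ τ.reg 17 = σ.reg 4 + l₁.length)
    (t + T + 2 + 20 * l.length) ?_ ?_ ?_ ?_
  · exact ⟨[], l, 0, rfl, by simp, hJ _ _ _ _ _ (by simp) h0,
      (Frame.refl _ _).setReg _ h17, by simp⟩
  · rintro t' τ ⟨l₁, r, s, hlr, ht, hJl, -⟩
    have : l₁.length ≤ l.length := by simp [hlr]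
    have := hT _ _ _ hJl
    omega
  · rintro t' τ ⟨l₁, r, s, hlr, ht, hJl, hF, hi⟩ hne
    simp only [Expr.ev, hi, hF.reg 5 h5, ne_eq, ite_eq_right_iff, one_ne_zero, imp_false,
      not_not] at hne
    rcases r with _ | ⟨y, r⟩
    · simp only [List.append_nil] at hlr
      subst hlr
      omega
    · obtain ⟨hy, -⟩ := (hlr ▸ hl).at_append
      simp only [wp_seq_iff, wp_assign_iff, Expr.ev, Expr.time, hi]
      rw [hQ _ _ _ hJl _ hne, hy]
      refine (hstep l₁ y r s _ _ hlr (hF.setReg _ h18) (hJ _ _ _ _ _ (by simp) hJl)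
        (by simp)).mono ?_
      rintro t'' τ' - hF' ⟨d, ht', hJ'⟩
      have hi' : τ'.reg 17 = σ.reg 4 + l₁.length := by
        rw [hF'.reg 17 hP.2.2]; simpa using hi
      simp only [wp_assign_iff, Expr.ev, Expr.time]
      refine ⟨l₁ ++ [y], r, s + d, by simp [hlr], ?_, hJ _ _ _ _ _ (by simp) hJ',
        ((hF.setReg y h18).trans (hFr hF')).setReg _ h17, by simp [hi', add_assoc]⟩
      simp only [List.length_append, List.length_singleton, mul_add, mul_one]
      omega
  · rintro t' τ ⟨l₁, r, s, hlr, ht, hJl, hF, hi⟩ he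
    simp only [Expr.ev, hi, hF.reg 5 h5, ite_eq_right_iff, one_ne_zero, imp_false] at he
    have : r = [] := by
      rw [← List.length_eq_zero_iff]
      have := congrArg List.length hlr
      simp only [List.length_append] at this
      omega
    subst this
    simp only [List.append_nil] at hlr
    subst hlr
    refine ⟨s, ?_, hJl⟩
    simp only [Expr.time]
    omega

end Loops

end WordRAM


namespace WordRAM

/-! ### Flooding

Starting from the vertices in the queue (the array `1` from the position in the register `6` to the
position in the register `7`), recolour reachable vertices of the colour in the register `8` with
the colour in the register `9`, as long as the queue holds less entries (counted from the position
in the register `19`) than the register `10` says. Colours are kept in the array `0`. -/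

/-- The step of `flood` for one neighbour. -/
def floodStep : Program :=
  .cond (.mul (.eq (.read 0 (.reg 14)) (.reg 8)) (.lt (.sub (.reg 7) (.reg 19)) (.reg 10)))
    (.block [.write 0 (.reg 14) (.reg 9), .write 1 (.reg 7) (.reg 14),
      .assign 7 (.add (.reg 7) (.const 1))]) .skip

/-- Flooding from the vertices in the queue. -/
def flood : Program :=
  .loop (.lt (.reg 6) (.reg 7)) (.block [.assign 11 (.read 1 (.reg 6)),
    .assign 6 (.add (.reg 6) (.const 1)), forNbrs 11 floodStep])

section Flood

variable {n : ℕ} {G : SimpleGraph (Fin n)}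

/-- The vertices of `l` have been added to the seeds `l₀`; the numbers `s`, `y`, `f`, `lim` are the
start of the queue, the old and the new colour, and the limit, `c` is the original colouring. -/
structure FloodSt (G : SimpleGraph (Fin n)) (σ τ : Memory) (s y f lim : ℕ) (c : Fin n → ℕ)
    (l₀ l : List (Fin n)) : Prop where
  seg : Seg (τ.arr 1) s (τ.reg 7) (l₀ ++ l)
  nodup : (l₀ ++ l).Nodup
  old : ∀ v ∈ l, c v = y
  cols : ∀ v : Fin n, τ.arr 0 v = if v ∈ l then f else c v
  reach : ∀ v ∈ l₀ ++ l, ∃ u ∈ l₀, Relation.ReflTransGen (AdjIn G {x | x ∈ l₀ ++ l}) u v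
  keep : ∀ i < s + l₀.length, τ.arr 1 i = σ.arr 1 i
  lim : l = [] ∨ (l₀ ++ l).length ≤ lim

theorem FloodSt.setReg {σ τ : Memory} {s y f lim : ℕ} {c : Fin n → ℕ} {l₀ l : List (Fin n)}
    (h : FloodSt G σ τ s y f lim c l₀ l) {x : ℕ} (m : ℕ) (hx : x ≠ 7) :
    FloodSt G σ (τ.setReg x m) s y f lim c l₀ l := by
  obtain ⟨h1, h2, h3, h4, h5, h6, h7⟩ := h
  refine ⟨?_, h2, h3, h4, h5, h6, h7⟩
  simpa [hx.symm] using h1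

/-- The neighbour `u` of a vertex in the queue need not be added. -/
def FloodDone (τ : Memory) (s y lim : ℕ) (u : Fin n) : Prop :=
  τ.arr 0 u ≠ y ∨ lim ≤ τ.reg 7 - s

theorem floodDone_setReg {τ : Memory} {s y lim : ℕ} {u : Fin n} {x m : ℕ} (hx : x ≠ 7) :
    FloodDone (τ.setReg x m) s y lim u ↔ FloodDone τ s y lim u := by
  simp [FloodDone, hx.symm]

/-- A neighbour that is done stays done: a colour never turns back into `y` because `f ≠ y`, and the
queue only grows. Hence what is known about earlier neighbours survives each step. A new vertex is
reachable from a seed through the vertex whose neighbour it is. -/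
theorem wp_floodStep {qy : ℕ → ℕ → ℕ} {σ τ : Memory} {t s y f lim : ℕ} {c : Fin n → ℕ}
    {l₀ l : List (Fin n)} (h : FloodSt G σ τ s y f lim c l₀ l) (hy : ∀ v ∈ l₀, c v ≠ y)
    (hfy : f ≠ y) (h8 : τ.reg 8 = y) (h9 : τ.reg 9 = f) (h10 : τ.reg 10 = lim)
    (h19 : τ.reg 19 = s) {x w : Fin n} (hx : x ∈ l₀ ++ l) (hxw : G.Adj x w)
    (h14 : τ.reg 14 = w) :
    wp qy floodStep (fun t' τ' => t' ≤ t + 30 ∧ ∃ r, FloodSt G σ τ' s y f lim c l₀ (l ++ r) ∧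
      FloodDone τ' s y lim w ∧ ∀ u : Fin n, FloodDone τ s y lim u → FloodDone τ' s y lim u)
      t τ := by
  have hlen := h.seg.len
  refine wp_cond (fun he => ?_) (fun he => ?_)
  · simp only [Expr.ev, h14, h8, h10, h19, ne_eq, mul_eq_zero, ite_eq_right_iff, one_ne_zero,
      imp_false, not_or, not_not] at he
    obtain ⟨hw, hlim⟩ := he
    have hwl : w ∉ l := by
      intro hwl
      rw [h.cols, if_pos hwl] at hw
      exact hfy hw
    have hcw : c w = y := by rwa [h.cols, if_neg hwl] at hw
    have hwl₀ : w ∉ l₀ := fun h' => hy w h' hcw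
    simp only [Program.block, wp_seq_iff, wp_assign_iff, wp_write_iff, Expr.ev, Expr.time, h14, h9,
      Memory.setArr_reg]
    refine ⟨by omega, [w], ⟨?_, ?_, ?_, ?_, ?_, ?_, ?_⟩, ?_, ?_⟩
    · rw [← List.append_assoc]
      simpa using h.seg.push w
    · rw [← List.append_assoc]
      rw [List.nodup_append_comm]
      simpa [hwl, hwl₀] using h.nodup
    · intro v hv
      rcases List.mem_append.1 hv with hv | hv
      · exact h.old v hv
      · rwa [List.mem_singleton.1 hv]
    · intro v
      simp only [Memory.setReg_arr, Memory.setArr_arr, zero_ne_one, if_false, if_true,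
        Function.update_apply, List.mem_append, List.mem_singleton, Fin.val_inj, h.cols v]
      by_cases hv : v = w <;> simp [hv]
    · have hsub : {x | x ∈ l₀ ++ l} ⊆ {x | x ∈ l₀ ++ (l ++ [w])} := by
        intro v hv
        rw [← List.append_assoc]
        exact List.mem_append_left _ hv
      have hww : w ∈ {x | x ∈ l₀ ++ (l ++ [w])} := by simp
      intro v hv
      rw [← List.append_assoc] at hv
      rcases List.mem_append.1 hv with hv | hv
      · obtain ⟨u, hu, huv⟩ := h.reach v hv
        exact ⟨u, hu, reach_mono hsub huv⟩
      · obtain rfl := List.mem_singleton.1 hv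
        obtain ⟨u, hu, huv⟩ := h.reach x hx
        exact ⟨u, hu, (reach_mono hsub huv).tail ⟨hxw, hsub hx, hww⟩⟩
    · intro i hi
      rw [List.length_append] at hlen
      simp only [Memory.setReg_arr, Memory.setArr_arr, if_true, one_ne_zero, if_false]
      rw [Function.update_of_ne (by omega)]
      exact h.keep i hi
    · right
      simp only [List.length_append, List.length_singleton] at hlen ⊢
      omega
    · left
      simp [hfy]
    · rintro u (hu | hu)
      · left
        simp only [Memory.setReg_arr, Memory.setArr_arr, zero_ne_one, if_false, if_true,
          Function.update_apply]
        split_ifs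
        exacts [hfy, hu]
      · right
        simp only [Memory.setReg_reg, if_true]
        omega
  · simp only [Expr.ev, h14, h8, h10, h19, mul_eq_zero, ite_eq_right_iff, one_ne_zero,
      imp_false] at he
    refine wp_skip_iff.2 ⟨?_, [], ?_, ?_, fun u hu => hu⟩
    · simp only [Expr.time]; omega
    · simpa using h
    · rw [not_lt] at he
      exact he

theorem one_le_wt (L : IncidenceLists G) (v : Fin n) : 1 ≤ L.wt v := Nat.le_add_left _ _

/-- The sum of the weights of the vertices in a list. -/
def wsum (L : IncidenceLists G) (l : List (Fin n)) : ℕ := (l.map L.wt).sum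

theorem wsum_append (L : IncidenceLists G) (l l' : List (Fin n)) :
    wsum L (l ++ l') = wsum L l + wsum L l' := by simp [wsum]

theorem wsum_cons (L : IncidenceLists G) (v : Fin n) (l : List (Fin n)) :
    wsum L (v :: l) = L.wt v + wsum L l := by simp [wsum]

theorem wsum_le_of_subset (L : IncidenceLists G) {l l' : List (Fin n)} (hl : l.Nodup)
    (h : ∀ v ∈ l, v ∈ l') : wsum L l ≤ wsum L l' := by
  obtain ⟨l₂, hp, hs⟩ := hl.subperm h
  rw [wsum, ← (hp.map L.wt).sum_eq]
  exact (hs.map L.wt).sum_le_sum fun _ _ => Nat.zero_le _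

theorem length_le_wsum (L : IncidenceLists G) (l : List (Fin n)) : l.length ≤ wsum L l := by
  induction l with
  | nil => simp
  | cons v l ih => rw [wsum_cons, List.length_cons]; have := one_le_wt L v; omega

/-- Every vertex enters the queue at most once, because entering it removes the old colour. So the
time is proportional to the weight of the final queue. When the queue is exhausted, each neighbour
of a queued vertex has lost the colour `y`, unless the limit stopped the growth. -/
theorem wp_flood (L : IncidenceLists G) {σ : Memory} {t : ℕ} {Φ : ℕ → Memory → Prop}
    (c : Fin n → ℕ) (l₀ : List (Fin n)) (hc : ∀ v : Fin n, σ.arr 0 v = c v)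
    (hseg : Seg (σ.arr 1) (σ.reg 6) (σ.reg 7) l₀) (h19 : σ.reg 19 = σ.reg 6) (hnd : l₀.Nodup)
    (hy : ∀ v ∈ l₀, c v ≠ σ.reg 8) (hfy : σ.reg 9 ≠ σ.reg 8)
    (hΦ : ∀ t' τ l, FloodSt G σ τ (σ.reg 6) (σ.reg 8) (σ.reg 9) (σ.reg 10) c l₀ l →
      (∀ x ∈ l₀ ++ l, ∀ u, G.Adj x u → FloodDone τ (σ.reg 6) (σ.reg 8) (σ.reg 10) u) →
      t' ≤ t + 70 * wsum L (l₀ ++ l) + 4 → Frame flood σ τ → Φ t' τ) :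
    wp L.query flood Φ t σ := by
  set s := σ.reg 6 with hs
  set y := σ.reg 8 with h8
  set f := σ.reg 9 with h9
  set lim := σ.reg 10 with h10
  suffices h : wp L.query flood (fun t' τ => ∃ l, FloodSt G σ τ s y f lim c l₀ l ∧
      (∀ x ∈ l₀ ++ l, ∀ u, G.Adj x u → FloodDone τ s y lim u) ∧
      t' ≤ t + 70 * wsum L (l₀ ++ l) + 4) t σ from
    h.mono fun t' τ _ hF ⟨l, h1, h2, h3⟩ => hΦ t' τ l h1 h2 h3 hF
  -- The queue consists of a processed part `p` and a waiting part `r`. The queue has no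
  -- repetitions, so the weight of `p` is at most that of all vertices, which gives the time bound.
  refine wp_loop_frame (fun t' τ => ∃ p r l, l₀ ++ l = p ++ r ∧ FloodSt G σ τ s y f lim c l₀ l ∧
    τ.reg 6 = s + p.length ∧ (∀ x ∈ p, ∀ u, G.Adj x u → FloodDone τ s y lim u) ∧
    t' ≤ t + 70 * wsum L p) (t + 70 * wsum L (List.finRange n)) ?_ ?_ ?_ ?_
  · refine ⟨[], l₀, [], by simp, ⟨by simpa using hseg, by simpa using hnd, by simp,
      by simpa using hc,
      fun v hv => ⟨v, by simpa using hv, .refl⟩, fun i hi => rfl, Or.inl rfl⟩, by simp [hs],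
      by simp, by simp⟩
  · rintro t' τ ⟨p, r, l, hp, hst, -, -, ht⟩
    have h1 : p.Nodup := (List.nodup_append.1 (hp ▸ hst.nodup)).1
    have := wsum_le_of_subset L h1 (l' := List.finRange n) (fun v _ => List.mem_finRange v)
    omega
  · rintro t' τ hF ⟨p, r, l, hp, hst, hi, hcl, ht⟩ hne
    simp only [Expr.ev, hi, ne_eq, ite_eq_right_iff, one_ne_zero, imp_false, not_not] at hne
    have hlen := hst.seg.len
    rcases r with _ | ⟨x, r⟩
    · rw [hp] at hlen
      simp only [List.append_nil] at hlen
      omega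
    obtain ⟨hx, -⟩ := (hp ▸ hst.seg).at_append
    have hxm : x ∈ l₀ ++ l := by simp [hp]
    simp only [Program.block, wp_seq_iff, wp_assign_iff, Expr.ev, Expr.time, hi, hx]
    refine wp_forNbrs L x 30 (fun ls τ' => ∃ r', FloodSt G σ τ' s y f lim c l₀ (l ++ r') ∧
      (∀ x ∈ p, ∀ u, G.Adj x u → FloodDone τ' s y lim u) ∧
      ∀ u ∈ ls, FloodDone τ' s y lim u) (by simp) rfl rfl ?_ ?_ ?_ ?_
    · rintro l' τ' m i him ⟨r', h1, h2, h3⟩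
      have hi7 : i ≠ 7 := by rintro rfl; simp at him
      exact ⟨r', h1.setReg _ hi7, by simpa only [floodDone_setReg hi7] using h2,
        by simpa only [floodDone_setReg hi7] using h3⟩
    · refine ⟨[], ?_, ?_, by simp⟩
      · simpa using (hst.setReg _ (by simp)).setReg _ (by simp)
      · simpa only [floodDone_setReg (show (6 : ℕ) ≠ 7 by simp),
          floodDone_setReg (show (11 : ℕ) ≠ 7 by simp)] using hcl
    · rintro ls w ls' t'' τ' - hF' ⟨r', h1, h2, h3⟩ h14 hadj
      have e8 : τ'.reg 8 = y := by rw [hF'.reg 8 rfl, h8, ← hF.reg 8 rfl]; simp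
      have e9 : τ'.reg 9 = f := by rw [hF'.reg 9 rfl, h9, ← hF.reg 9 rfl]; simp
      have e10 : τ'.reg 10 = lim := by rw [hF'.reg 10 rfl, h10, ← hF.reg 10 rfl]; simp
      have e19 : τ'.reg 19 = s := by rw [hF'.reg 19 rfl, ← h19, ← hF.reg 19 rfl]; simp
      refine (wp_floodStep h1 hy hfy e8 e9 e10 e19 (x := x)
        (by rw [← List.append_assoc]; exact List.mem_append_left _ hxm) hadj h14).mono ?_
      rintro t3 τ3 - - ⟨ht3, r3, g1, g2, g3⟩
      refine ⟨ht3, r' ++ r3, by simpa using g1, fun z hz u hu => g3 u (h2 z hz u hu), ?_⟩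
      intro u hu
      rcases List.mem_append.1 hu with hu | hu
      · exact g3 u (h3 u hu)
      · rw [List.mem_singleton.1 hu]; exact g2
    · rintro t'' τ' ht'' hF' ⟨r', h1, h2, h3⟩
      refine ⟨p ++ [x], r ++ r', l ++ r', ?_, h1, ?_, ?_, ?_⟩
      · rw [← List.append_assoc, hp]; simp
      · rw [hF'.reg 6 rfl]; simp [hi, add_assoc]
      · intro z hz u hu
        rcases List.mem_append.1 hz with hz | hz
        · exact h2 z hz u hu
        · rw [List.mem_singleton.1 hz] at hu
          exact h3 u ((L.mem_iff x u).2 hu)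
      · have := one_le_wt L x
        rw [wsum_append, wsum_cons]
        simp only [wsum, List.map_nil, List.sum_nil] at ht ⊢
        omega
  · rintro t' τ hF ⟨p, r, l, hp, hst, hi, hcl, ht⟩ he
    simp only [Expr.ev, hi, ite_eq_right_iff, one_ne_zero, imp_false] at he
    have hlen := hst.seg.len
    rw [hp, List.length_append] at hlen
    have hr : r = [] := by
      rw [← List.length_eq_zero_iff]
      omega
    subst hr
    rw [List.append_nil] at hp
    subst hp
    exact ⟨l, hst, hcl, by simp only [Expr.time]; omega⟩

end Flood

end WordRAM


theorem List.getElem?_snoc_eq_some {α : Type*} {l : List α} {a b : α} {i : ℕ} :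
    (l ++ [a])[i]? = some b ↔ l[i]? = some b ∨ i = l.length ∧ b = a := by
  rw [List.getElem?_append]
  split_ifs with h
  · exact ⟨Or.inl, fun h' => h'.resolve_right (by omega)⟩
  · rw [List.getElem?_eq_none (by omega : l.length ≤ i)]
    rcases Nat.eq_or_lt_of_le (not_lt.1 h) with h' | h'
    · subst h'
      simp [eq_comm]
    · rw [List.getElem?_eq_none (by simp; omega)]
      simp
      omega

namespace WordRAM

/-! ### Components

Recolour the vertices of the colour in the register `8` in the segment given by the registers `4`
and `5` so that every connected component gets a fresh colour (fresh colours start at the number in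
the register `15`). The segments of the components are put on a stack (the arrays `2` and `3`) whose
height is in the register `16`. If a component has more than half of the number of vertices in the
register `26`, then its colour and one of its vertices are put into the registers `40` and `41`. -/

/-- The step of `comps` for one entry of the segment. -/
def compsStep : Program :=
  .cond (.eq (.read 0 (.reg 18)) (.reg 8)) (.block [
    .assign 9 (.reg 15), .assign 15 (.add (.reg 15) (.const 1)), .write 0 (.reg 18) (.reg 9),
    .assign 19 (.reg 7), .assign 6 (.reg 7), .write 1 (.reg 7) (.reg 18),
    .assign 7 (.add (.reg 7) (.const 1)), .assign 10 (.add (.reg 0) (.const 1)), flood,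
    .write 2 (.reg 16) (.reg 19), .write 3 (.reg 16) (.reg 7),
    .assign 16 (.add (.reg 16) (.const 1)),
    .cond (.lt (.reg 26) (.mul (.const 2) (.sub (.reg 7) (.reg 19))))
      (.block [.assign 40 (.reg 9), .assign 41 (.reg 18)]) .skip]) .skip

/-- The components of a colour class. -/
def comps : Program := forSeg compsStep

section Comps

variable {n : ℕ} {G : SimpleGraph (Fin n)}

/-- The components `C` of the vertices that have the colour `σ.reg 8` in the colouring `c` have been
found; `c'` is the new colouring. -/
structure CompsSt (G : SimpleGraph (Fin n)) (σ τ : Memory) (c c' : Fin n → ℕ)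
    (C : List (List (Fin n))) : Prop where
  cols : ∀ v : Fin n, τ.arr 0 v = c' v
  other : ∀ v, c v ≠ σ.reg 8 → c' v = c v
  todo : ∀ v, c v = σ.reg 8 → c' v = σ.reg 8 ∨ ∃ (i : ℕ) (l : List (Fin n)), C[i]? = some l ∧ v ∈ l
  nodup : C.flatten.Nodup
  comp_nodup : ∀ (i : ℕ) (l : List (Fin n)), C[i]? = some l → l.Nodup
  comp_conn : ∀ (i : ℕ) (l : List (Fin n)), C[i]? = some l → Conn G {x | x ∈ l}
  comp_mem : ∀ (i : ℕ) (l : List (Fin n)), C[i]? = some l → ∀ v, v ∈ l ↔ c' v = σ.reg 15 + i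
  comp_old : ∀ (i : ℕ) (l : List (Fin n)), C[i]? = some l → ∀ v ∈ l, c v = σ.reg 8
  comp_closed : ∀ (i : ℕ) (l : List (Fin n)), C[i]? = some l → ∀ u ∈ l, ∀ v, G.Adj u v →
      c v = σ.reg 8 → v ∈ l
  comp_seg : ∀ (i : ℕ) (l : List (Fin n)), C[i]? = some l →
    Seg (τ.arr 1) (τ.arr 2 (σ.reg 16 + i)) (τ.arr 3 (σ.reg 16 + i)) l
  comp_le : ∀ (i : ℕ) (l : List (Fin n)), C[i]? = some l → τ.arr 3 (σ.reg 16 + i) ≤ τ.reg 7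
  queue_le : σ.reg 7 ≤ τ.reg 7
  keep : ∀ i < σ.reg 7, τ.arr 1 i = σ.arr 1 i
  keep2 : ∀ i < σ.reg 16, τ.arr 2 i = σ.arr 2 i
  keep3 : ∀ i < σ.reg 16, τ.arr 3 i = σ.arr 3 i
  fresh : τ.reg 15 = σ.reg 15 + C.length
  top : τ.reg 16 = σ.reg 16 + C.length
  big : (τ.reg 40 = 0 ∧ ∀ (i : ℕ) (l : List (Fin n)), C[i]? = some l → 2 * l.length ≤ σ.reg 26) ∨
    ∃ (i : ℕ) (l : List (Fin n)), C[i]? = some l ∧ τ.reg 40 = σ.reg 15 + i ∧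
        σ.reg 26 < 2 * l.length ∧
      ∃ v ∈ l, τ.reg 41 = (v : ℕ)

theorem CompsSt.setReg {σ τ : Memory} {c c' : Fin n → ℕ} {C : List (List (Fin n))}
    (h : CompsSt G σ τ c c' C) {x : ℕ} (m : ℕ) (hx : x ∉ [7, 15, 16, 40, 41]) :
    CompsSt G σ (τ.setReg x m) c c' C := by
  simp only [List.mem_cons, List.not_mem_nil, or_false, not_or] at hx
  obtain ⟨h1, h2, h3, h4, h5, h6, h7, h8, h9, h10, h11, h12, h13, h14, h15, h16, h17, h18⟩ := h
  constructor <;> try assumption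
  all_goals
    simp only [Memory.setReg_reg, Memory.setReg_arr, Ne.symm hx.1, Ne.symm hx.2.1,
      Ne.symm hx.2.2.1, Ne.symm hx.2.2.2.1, Ne.symm hx.2.2.2.2, if_false]
    assumption

/-- A vertex that still has the old colour is the seed of a flood with a fresh colour, which
recolours exactly its component. A vertex recoloured earlier costs constant time, so the total cost
is the weight of the components plus the length of the segment. -/
theorem wp_compsStep (L : IncidenceLists G) {σ τ : Memory} {t : ℕ} {c c' : Fin n → ℕ}
    {C : List (List (Fin n))} (h : CompsSt G σ τ c c' C) (h0 : σ.reg 0 = n) (hc : ∀ v,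
    c v < σ.reg 15)
    (hy : σ.reg 8 < σ.reg 15) (hF : Frame comps σ τ) {x : Fin n} (hx : τ.reg 18 = x) :
    wp L.query compsStep (fun t' τ' => ∃ (c'' : Fin n → ℕ) (r : List (List (Fin n))),
        CompsSt G σ τ' c c'' (C ++ r) ∧
      c'' x ≠ σ.reg 8 ∧ (∀ v, c' v ≠ σ.reg 8 → c'' v ≠ σ.reg 8) ∧
      t' ≤ t + (150 * wsum L r.flatten + 10)) t τ := by
  have h8 : τ.reg 8 = σ.reg 8 := hF.reg 8 rfl
  have h26 : τ.reg 26 = σ.reg 26 := hF.reg 26 rfl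
  have hn : τ.reg 0 = n := (hF.reg 0 rfl).trans h0
  refine wp_cond (fun he => ?_) (fun he => ?_)
  · simp only [Expr.ev, hx, h8, h.cols, ne_eq, ite_eq_right_iff, one_ne_zero, imp_false,
      not_not] at he
    have hcx : c x = σ.reg 8 := by
      by_contra hne
      rw [h.other x hne] at he
      exact hne he
    have hxC : ∀ (i : ℕ) (l : List (Fin n)), C[i]? = some l → x ∉ l := by
      intro i l hl hxl
      have := (h.comp_mem i l hl x).1 hxl
      omega
    simp only [Program.block, wp_seq_iff, wp_assign_iff, wp_write_iff, Expr.ev, Expr.time]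
    refine wp_flood L (fun v => if v = x then τ.reg 15 else c' v) [x] ?_ ?_ (by simp) (by simp)
      ?_ ?_ ?_
    · intro v
      simp only [Memory.setReg_arr, Memory.setArr_arr, Memory.setReg_reg, Memory.setArr_reg, hx]
      simp [Function.update_apply, Fin.val_inj, h.cols]
    · simp only [Memory.setReg_arr, Memory.setArr_arr, Memory.setReg_reg, Memory.setArr_reg, hx]
      simpa using (Seg.nil (τ.arr 1) (τ.reg 7)).push x
    · simp only [Memory.setReg_arr, Memory.setArr_arr, Memory.setReg_reg, Memory.setArr_reg]
      have := h.fresh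
      simp
      omega
    · have := h.fresh
      simp
      omega
    simp only [Memory.setReg_arr, Memory.setArr_arr, Memory.setReg_reg, Memory.setArr_reg]
    norm_num only [if_true, if_false]
    rw [h8, hn, hx]
    intro t' τ' l hst hcl ht' hF'
    obtain ⟨s1, s2, s3, s4, s5, s6, -⟩ := hst
    rw [List.singleton_append] at s1 s2 s5 hcl ht'
    simp only [List.mem_singleton, exists_eq_left, List.length_singleton] at s5 s6
    have hfr := h.fresh
    have htop := h.top
    have hql := h.queue_le
    have hlen := s1.len
    -- The limit of the flood was set to `n + 1`, which a list without repetitions cannot reach; so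
    -- the flood ends only when the component is exhausted.
    have hcard : (x :: l).length ≤ n := by
      simpa using s2.length_le_card
    have f15 : τ'.reg 15 = τ.reg 15 + 1 := by rw [hF'.reg 15 rfl]; simp
    have f16 : τ'.reg 16 = τ.reg 16 := by rw [hF'.reg 16 rfl]; simp
    have f18 : τ'.reg 18 = x := by rw [hF'.reg 18 rfl]; simp [hx]
    have f19 : τ'.reg 19 = τ.reg 7 := by rw [hF'.reg 19 rfl]; simp
    have f9 : τ'.reg 9 = τ.reg 15 := by rw [hF'.reg 9 rfl]; simp
    have f26 : τ'.reg 26 = σ.reg 26 := by rw [hF'.reg 26 rfl]; simp [h26]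
    have f40 : τ'.reg 40 = τ.reg 40 := by rw [hF'.reg 40 rfl]; simp
    have f41 : τ'.reg 41 = τ.reg 41 := by rw [hF'.reg 41 rfl]; simp
    have f2 : τ'.arr 2 = τ.arr 2 := by rw [hF'.arr 2 rfl]; simp
    have f3 : τ'.arr 3 = τ.arr 3 := by rw [hF'.arr 3 rfl]; simp
    have hxl : x ∉ l := (List.nodup_cons.1 s2).1
    -- the new colouring
    set c'' : Fin n → ℕ := fun v => if v ∈ x :: l then τ.reg 15 else c' v with hc''
    have hcols : ∀ v : Fin n, τ'.arr 0 v = c'' v := by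
      intro v
      rw [s4 v]
      simp only [hc'', List.mem_cons]
      by_cases h1 : v ∈ l <;> by_cases h2 : v = x <;> simp [h1, h2]
    have hold' : ∀ v ∈ x :: l, c' v = σ.reg 8 := by
      intro v hv
      rcases List.mem_cons.1 hv with rfl | hv
      · exact he
      · have := s3 v hv
        rw [if_neg (show ¬ v = x from fun h => hxl (h ▸ hv))] at this
        exact this
    have hold : ∀ v ∈ x :: l, c v = σ.reg 8 := by
      intro v hv
      by_contra hne
      have := hold' v hv
      rw [h.other v hne] at this
      exact hne this
    have hdisj : ∀ (i : ℕ) (l' : List (Fin n)), C[i]? = some l' → ∀ v ∈ l', v ∉ x :: l := by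
      intro i l' hl' v hv hv'
      have h1 := (h.comp_mem i l' hl' v).1 hv
      have h2 := hold' v hv'
      omega
    -- All colours in use lie below the register `15`, so the colour of the new component occurs
    -- nowhere else.
    have hc'lt : ∀ v, c' v < τ.reg 15 := by
      intro v
      by_cases hv : c v = σ.reg 8
      · rcases h.todo v hv with h1 | ⟨i, l', h1, h2⟩
        · omega
        · rw [(h.comp_mem i l' h1 v).1 h2, hfr]
          have := (List.getElem?_eq_some_iff.1 h1).1
          omega
      · rw [h.other v hv]; have := hc v; omega
    have key : ∀ τ'' : Memory, τ''.arr 0 = τ'.arr 0 → τ''.arr 1 = τ'.arr 1 →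
        τ''.arr 2 = Function.update (τ.arr 2) (τ.reg 16) (τ.reg 7) →
        τ''.arr 3 = Function.update (τ.arr 3) (τ.reg 16) (τ'.reg 7) →
        τ''.reg 7 = τ'.reg 7 → τ''.reg 15 = τ.reg 15 + 1 → τ''.reg 16 = τ.reg 16 + 1 →
        ((σ.reg 26 < 2 * (x :: l).length ∧ τ''.reg 40 = τ.reg 15 ∧ τ''.reg 41 = x) ∨
          (2 * (x :: l).length ≤ σ.reg 26 ∧ τ''.reg 40 = τ.reg 40 ∧ τ''.reg 41 = τ.reg 41)) →
        CompsSt G σ τ'' c c'' (C ++ [x :: l]) := by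
      intro τ'' a0 a1 a2 a3 r7 r15 r16 hbig
      refine ⟨?_, ?_, ?_, ?_, ?_, ?_, ?_, ?_, ?_, ?_, ?_, ?_, ?_, ?_, ?_, ?_, ?_, ?_⟩
      · rw [a0]; exact hcols
      · intro v hv
        have h1 : v ∉ x :: l := fun h' => hv (hold v h')
        simp only [hc'', if_neg h1]
        exact h.other v hv
      · intro v hv
        by_cases h1 : v ∈ x :: l
        · exact Or.inr ⟨C.length, x :: l, by simp, h1⟩
        · rcases h.todo v hv with h2 | ⟨i, l', h2, h3⟩
          · left; simp only [hc'', if_neg h1]; exact h2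
          · exact Or.inr ⟨i, l', List.getElem?_snoc_eq_some.2 (Or.inl h2), h3⟩
      · rw [List.flatten_append, List.nodup_append]
        refine ⟨h.nodup, by simpa using s2, ?_⟩
        rintro a ha b hb rfl
        obtain ⟨l', hl', hal⟩ := List.mem_flatten.1 ha
        obtain ⟨i, hi⟩ := List.mem_iff_getElem?.1 hl'
        exact hdisj i l' hi a hal (by simpa using hb)
      · intro i l' hl'
        rcases List.getElem?_snoc_eq_some.1 hl' with hl' | ⟨rfl, rfl⟩
        exacts [h.comp_nodup i l' hl', s2]
      · intro i l' hl'
        rcases List.getElem?_snoc_eq_some.1 hl' with hl' | ⟨rfl, rfl⟩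
        · exact h.comp_conn i l' hl'
        · exact Conn.of_root (r := x) (by simp) s5
      · intro i l' hl' v
        rcases List.getElem?_snoc_eq_some.1 hl' with hl' | ⟨rfl, rfl⟩
        · rw [h.comp_mem i l' hl' v]
          simp only [hc'']
          split_ifs with h1
          · have h2 := (List.getElem?_eq_some_iff.1 hl').1
            have := hold' v h1
            omega
          · rfl
        · simp only [hc'']
          rw [← hfr]
          split_ifs with h1
          · simp [h1]
          · simp only [h1, false_iff]
            exact (hc'lt v).ne
      · intro i l' hl'
        rcases List.getElem?_snoc_eq_some.1 hl' with hl' | ⟨rfl, rfl⟩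
        exacts [h.comp_old i l' hl', hold]
      · intro i l' hl'
        rcases List.getElem?_snoc_eq_some.1 hl' with hl' | ⟨rfl, rfl⟩
        · exact h.comp_closed i l' hl'
        · intro u hu v huv hv
          -- A neighbour that lost the old colour without joining this component would be in an
          -- earlier one; but that one is closed and would contain `u` as well.
          rcases hcl u hu v huv with h1 | h1
          · by_contra h2
            rw [hcols] at h1
            simp only [hc'', if_neg h2] at h1
            rcases h.todo v hv with h3 | ⟨i, l', h3, h4⟩
            · exact h1 h3
            · exact hdisj i l' h3 u (h.comp_closed i l' h3 v h4 u huv.symm (hold u hu)) hu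
          · omega
      · intro i l' hl'
        rw [a1, a2, a3]
        rcases List.getElem?_snoc_eq_some.1 hl' with hl' | ⟨rfl, rfl⟩
        · have h2 := (List.getElem?_eq_some_iff.1 hl').1
          rw [Function.update_of_ne (by omega), Function.update_of_ne (by omega)]
          refine (h.comp_seg i l' hl').congr fun j hj => ?_
          have := h.comp_le i l' hl'
          rw [s6 j (by omega)]
          simp [Function.update_apply]
          omega
        · rw [← htop, Function.update_self, Function.update_self]
          exact s1
      · intro i l' hl'
        rw [a3, r7]
        rcases List.getElem?_snoc_eq_some.1 hl' with hl' | ⟨rfl, rfl⟩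
        · have h2 := (List.getElem?_eq_some_iff.1 hl').1
          rw [Function.update_of_ne (by omega)]
          have := h.comp_le i l' hl'
          omega
        · rw [← htop, Function.update_self]
      · omega
      · intro i hi
        rw [a1, s6 i (by omega)]
        simp [Function.update_apply]
        rw [if_neg (by omega)]
        exact h.keep i hi
      · intro i hi
        rw [a2, Function.update_of_ne (by omega)]
        exact h.keep2 i hi
      · intro i hi
        rw [a3, Function.update_of_ne (by omega)]
        exact h.keep3 i hi
      · simp [r15, hfr, add_assoc]
      · simp [r16, htop, add_assoc]
      · rcases hbig with ⟨b1, b2, b3⟩ | ⟨b1, b2, b3⟩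
        · exact Or.inr ⟨C.length, x :: l, by simp, by omega, b1, x, by simp, b3⟩
        · rw [b2, b3]
          rcases h.big with ⟨d1, d2⟩ | ⟨i, l', d1, d2, d3, d4⟩
          · refine Or.inl ⟨d1, fun i l' hl' => ?_⟩
            rcases List.getElem?_snoc_eq_some.1 hl' with hl' | ⟨rfl, rfl⟩
            exacts [d2 i l' hl', b1]
          · exact Or.inr ⟨i, l', List.getElem?_snoc_eq_some.2 (Or.inl d1), d2, d3, d4⟩
    have hw1 : 1 ≤ wsum L [x :: l].flatten := by
      have := one_le_wt L x
      simp only [List.flatten_cons, List.flatten_nil, List.append_nil, wsum_cons]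
      omega
    have hw2 : wsum L [x :: l].flatten = wsum L (x :: l) := by simp
    have hsz : τ'.reg 7 - τ.reg 7 = (x :: l).length := by omega
    have hcx'' : c'' x ≠ σ.reg 8 := by simp [hc'']; omega
    have hc''ne : ∀ v, c' v ≠ σ.reg 8 → c'' v ≠ σ.reg 8 := by
      intro v hv
      simp only [hc'']
      split_ifs
      exacts [by omega, hv]
    simp only [wp_seq_iff, wp_assign_iff, wp_write_iff, Expr.ev, Expr.time,
      Memory.setArr_reg, f16, f19, f15]
    refine wp_cond (fun he2 => ?_) (fun he2 => ?_)
    · simp [Expr.ev, f26, f19, hsz] at he2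
      simp only [Program.block, wp_seq_iff, wp_assign_iff, Expr.ev, Expr.time]
      refine ⟨c'', [x :: l], key _ ?_ ?_ ?_ ?_ ?_ ?_ ?_ ?_, hcx'', hc''ne, ?_⟩
      any_goals simp [f9, f15, f18, f2, f3, hF'.reg 16]
      · left; simpa using he2
      · omega
    · simp [Expr.ev, f26, f19, hsz] at he2
      rw [wp_skip_iff]
      refine ⟨c'', [x :: l], key _ ?_ ?_ ?_ ?_ ?_ ?_ ?_ ?_, hcx'', hc''ne, ?_⟩
      any_goals simp [f9, f15, f18, f2, f3, f40, f41]
      · right; simpa using he2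
      · simp only [Expr.time]; omega
  · simp only [Expr.ev, hx, h8, h.cols, ite_eq_right_iff, one_ne_zero, imp_false] at he
    rw [wp_skip_iff]
    refine ⟨c', [], by simpa using h, he, fun v hv => hv, ?_⟩
    simp only [Expr.time]
    omega

theorem wsum_le_of_nodup (L : IncidenceLists G) {l : List (Fin n)} (hl : l.Nodup) :
    wsum L l ≤ wsum L (List.finRange n) :=
  wsum_le_of_subset L hl fun v _ => List.mem_finRange v

/-- The components of a colour class that is contained in the current segment. -/
theorem wp_comps (L : IncidenceLists G) {σ : Memory} {t : ℕ} {Φ : ℕ → Memory → Prop}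
    (c : Fin n → ℕ) (l : List (Fin n)) (hcols : ∀ v : Fin n, σ.arr 0 v = c v) (h0 : σ.reg 0 = n)
    (hseg : Seg (σ.arr 1) (σ.reg 4) (σ.reg 5) l) (hle : σ.reg 5 ≤ σ.reg 7)
    (hc : ∀ v, c v < σ.reg 15) (hy : σ.reg 8 < σ.reg 15) (h40 : σ.reg 40 = 0)
    (hyl : ∀ v, c v = σ.reg 8 → v ∈ l)
    (hΦ : ∀ t' τ c' C, CompsSt G σ τ c c' C → (∀ v, c' v ≠ σ.reg 8) →
      t' ≤ t + 200 * wsum L l + 20 → Frame comps σ τ → Φ t' τ) :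
    wp L.query comps Φ t σ := by
  refine wp_forSeg l (fun p s τ => ∃ c' C r, l = p ++ r ∧ CompsSt G σ τ c c' C ∧
      (∀ v ∈ p, c' v ≠ σ.reg 8) ∧ s ≤ 150 * wsum L C.flatten + 10 * p.length) hseg ⟨rfl, rfl, rfl⟩
    (150 * wsum L (List.finRange n) + 10 * l.length) ?_ ?_ ?_ ?_ ?_ ?_
  · rintro p s τ m i hi ⟨c', C, r, h1, h2, h3, h4⟩
    refine ⟨c', C, r, h1, h2.setReg _ ?_, h3, h4⟩
    fin_cases hi <;> simp
  · refine ⟨c, [], l, rfl, ⟨hcols, fun _ _ => rfl, fun _ h => Or.inl h, by simp, by simp, by simp,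
      by simp, by simp, by simp, by simp, by simp, le_rfl, fun _ _ => rfl, fun _ _ => rfl,
      fun _ _ => rfl, by simp, by simp, Or.inl ⟨h40, by simp⟩⟩, by simp, by simp⟩
  · rintro p s τ ⟨c', C, r, h1, h2, h3, h4⟩
    have := wsum_le_of_nodup L h2.nodup
    have h5 : p.length ≤ l.length := by simp [h1]
    omega
  · rintro p s τ ⟨c', C, r, h1, h2, h3, h4⟩ i hi
    exact h2.keep i (by omega)
  · rintro p x r s t τ hl hF ⟨c', C, r', -, h2, h3, h4⟩ hx
    refine (wp_compsStep L h2 h0 hc hy hF hx).mono ?_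
    rintro t' τ' - - ⟨c'', r'', g1, g2, g3, g4⟩
    refine ⟨_, g4, c'', C ++ r'', r, by simp [hl], g1, ?_, ?_⟩
    · intro v hv
      rcases List.mem_append.1 hv with hv | hv
      · exact g3 v (h3 v hv)
      · rw [List.mem_singleton.1 hv]; exact g2
    · rw [List.flatten_append, wsum_append, List.length_append, List.length_singleton]
      omega
  · rintro t' s τ ht' hF ⟨c', C, r', -, h2, h3, h4⟩
    refine hΦ t' τ c' C h2 (fun v hv => ?_) ?_ hF
    · by_cases hcv : c v = σ.reg 8
      · exact h3 v (hyl v hcv) hv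
      · rw [h2.other v hcv] at hv
        exact hcv hv
    · have h5 : wsum L C.flatten ≤ wsum L l := by
        refine wsum_le_of_subset L h2.nodup fun v hv => ?_
        obtain ⟨l', hl', hvl⟩ := List.mem_flatten.1 hv
        obtain ⟨i, hi⟩ := List.mem_iff_getElem?.1 hl'
        exact hyl v (h2.comp_old i l' hi v hvl)
      have h6 := length_le_wsum L l
      omega

end Comps

end WordRAM


/-! ### Layers -/

section Layers

variable {V : Type*}

/-- The vertex `v` has a neighbour of the colour `f`. -/
def Near (G : SimpleGraph V) (c : V → ℕ) (f : ℕ) (v : V) : Prop := ∃ u, G.Adj v u ∧ c u = f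

/-- The arcs of the layered graph: within a copy of the vertices of the colour `b`, and from the
`i`-th copy to the next one at the vertices that have a neighbour of the `i`-th colour in `A`. -/
def NodeAdj (G : SimpleGraph V) (c : V → ℕ) (b : ℕ) (A : List ℕ) (x y : V × ℕ) : Prop :=
  (y.2 = x.2 ∧ G.Adj x.1 y.1 ∧ c y.1 = b) ∨
    (y.1 = x.1 ∧ y.2 = x.2 + 1 ∧ ∃ f, A[x.2]? = some f ∧ Near G c f x.1)

/-- The nodes that can be reached by at most the given number of steps from the copy `0`. -/
def lay (G : SimpleGraph V) (c : V → ℕ) (b : ℕ) (A : List ℕ) : ℕ → Set (V × ℕ)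
  | 0 => {x | c x.1 = b ∧ x.2 = 0}
  | k + 1 => {y | y ∈ lay G c b A k ∨ ∃ x ∈ lay G c b A k, NodeAdj G c b A x y}

variable {G : SimpleGraph V} {c : V → ℕ} {b : ℕ} {A : List ℕ}

theorem lay_succ_of_adj {k : ℕ} {x y : V × ℕ} (hx : x ∈ lay G c b A k) (h : NodeAdj G c b A x y) :
    y ∈ lay G c b A (k + 1) := Or.inr ⟨x, hx, h⟩

theorem lay_mono {k m : ℕ} (h : k ≤ m) : lay G c b A k ⊆ lay G c b A m := by
  induction h with
  | refl => exact subset_rfl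
  | step _ ih => exact fun x hx => Or.inl (ih hx)

theorem lay_col {k : ℕ} {x : V × ℕ} (h : x ∈ lay G c b A k) : c x.1 = b := by
  induction k generalizing x with
  | zero => exact h.1
  | succ k ih =>
    rcases h with h | ⟨y, hy, ⟨-, -, h⟩ | ⟨h, -⟩⟩
    exacts [ih h, h, h ▸ ih hy]

theorem lay_le {k : ℕ} {x : V × ℕ} (h : x ∈ lay G c b A k) : x.2 ≤ A.length := by
  induction k generalizing x with
  | zero => rw [h.2]; omega
  | succ k ih =>
    rcases h with h | ⟨y, hy, ⟨h, -⟩ | ⟨-, h, f, hf, -⟩⟩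
    · exact ih h
    · rw [h]; exact ih hy
    · have := (List.getElem?_eq_some_iff.1 hf).1
      omega

/-- The nodes reached before the given number of steps. -/
def layBefore (G : SimpleGraph V) (c : V → ℕ) (b : ℕ) (A : List ℕ) : ℕ → Set (V × ℕ)
  | 0 => ∅
  | k + 1 => lay G c b A k

end Layers

/-! ### Breadth-first search in the layered graph: the list of nodes -/

namespace WordRAM

/-- The index of the node in the registers `43` (vertex) and `44` (copy). -/
def nodeIdx : Expr := .add (.mul (.reg 44) (.reg 0)) (.reg 43)

/-- Append the node in the registers `43` and `44` to the list of nodes, if it is new. -/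
def pushNode : Program :=
  .cond (.lt (.read 4 nodeIdx) (.reg 42)) (.block [
    .write 4 nodeIdx (.reg 27), .write 5 (.reg 27) (.reg 43), .write 6 (.reg 27) (.reg 44),
    .write 7 (.reg 27) (.reg 36),
    .cond (.lt (.reg 32) (.reg 44)) (.block [.assign 32 (.reg 44),
      .assign 31 (.add (.reg 30) (.const 1)), .assign 33 (.reg 27)]) .skip,
    .assign 27 (.add (.reg 27) (.const 1))]) .skip

section Bfs

variable {n : ℕ} {G : SimpleGraph (Fin n)} {c : Fin n → ℕ} {b : ℕ} {A : List ℕ}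

/-- The list of nodes `l` is stored from the position `s`. -/
structure BfsSt (G : SimpleGraph (Fin n)) (c : Fin n → ℕ) (b : ℕ) (A : List ℕ) (s g : ℕ)
    (τ : Memory) (l : List (Fin n × ℕ)) : Prop where
  size : τ.reg 27 = s + l.length
  vert : ∀ (i : ℕ) (x : Fin n × ℕ), l[i]? = some x → τ.arr 5 (s + i) = x.1
  copy : ∀ (i : ℕ) (x : Fin n × ℕ), l[i]? = some x → τ.arr 6 (s + i) = x.2
  nodup : l.Nodup
  col : ∀ x ∈ l, c x.1 = b
  le : ∀ x ∈ l, x.2 ≤ τ.reg 32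
  cm_le : τ.reg 32 ≤ A.length
  pos : ∀ (i : ℕ) (x : Fin n × ℕ), l[i]? = some x → τ.arr 4 (x.2 * n + x.1) = s + i
  mem : ∀ (v : Fin n) (k : ℕ), s ≤ τ.arr 4 (k * n + v) → (v, k) ∈ l
  lt : ∀ i, τ.arr 4 i < τ.reg 27
  par : ∀ (i : ℕ) (x : Fin n × ℕ), l[i]? = some x → (x.2 = 0 ∧ τ.arr 7 (s + i) = 0) ∨
    ∃ (j : ℕ) (y : Fin n × ℕ), l[j]? = some y ∧ τ.arr 7 (s + i) = s + j ∧
      NodeAdj G c b A y x ∧ ∀ t, x ∈ lay G c b A t → ∃ t', t = t' + 1 ∧ y ∈ lay G c b A t'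
  goal : l = [] ∨ ∃ (i : ℕ) (v : Fin n), τ.reg 33 = s + i ∧ l[i]? = some (v, τ.reg 32) ∧
    (v, τ.reg 32) ∈ lay G c b A (τ.reg 31)
  tl_le : τ.reg 31 ≤ (3 * g + 1) * τ.reg 32

theorem BfsSt.congr {s g : ℕ} {τ τ' : Memory} {l : List (Fin n × ℕ)}
    (h : BfsSt G c b A s g τ l) (hr : ∀ x ∈ [27, 31, 32, 33], τ'.reg x = τ.reg x)
    (ha : ∀ a ∈ [4, 5, 6, 7], τ'.arr a = τ.arr a) : BfsSt G c b A s g τ' l := by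
  have r1 := hr 27 (by simp)
  have r2 := hr 31 (by simp)
  have r3 := hr 32 (by simp)
  have r4 := hr 33 (by simp)
  have a1 := ha 4 (by simp)
  have a2 := ha 5 (by simp)
  have a3 := ha 6 (by simp)
  have a4 := ha 7 (by simp)
  obtain ⟨h1, h2, h3, h4, h5, h6, h7, h8, h9, h10, h11, h12, h13⟩ := h
  constructor <;> (try simp only [r1, r2, r3, r4, a1, a2, a3, a4]) <;> assumption

theorem BfsSt.setReg {s g : ℕ} {τ : Memory} {l : List (Fin n × ℕ)}
    (h : BfsSt G c b A s g τ l) {x : ℕ} (m : ℕ) (hx : x ∉ [27, 31, 32, 33]) :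
    BfsSt G c b A s g (τ.setReg x m) l := by
  refine h.congr (fun y hy => ?_) fun _ _ => rfl
  rw [Memory.setReg_reg, if_neg (by rintro rfl; exact hx hy)]

theorem index_inj {v w : Fin n} {i j : ℕ} (h : i * n + v = j * n + w) : v = w ∧ i = j := by
  have hn : 0 < n := v.pos
  have h1 : (i * n + v) % n = v := by
    rw [mul_comm, Nat.mul_add_mod, Nat.mod_eq_of_lt v.2]
  have h2 : (j * n + w) % n = w := by
    rw [mul_comm, Nat.mul_add_mod, Nat.mod_eq_of_lt w.2]
  have h3 : (v : ℕ) = w := by rw [← h1, h, h2]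
  refine ⟨Fin.ext h3, ?_⟩
  have h4 : i * n = j * n := by omega
  exact Nat.eq_of_mul_eq_mul_right hn h4

/-- The two alternatives in `hcase` are the two roles of an appended node: it becomes the target of
the walk to be traced (register `33`) with its copy as the highest copy reached, or it leaves that
record alone. -/
theorem BfsSt.push {s g : ℕ} {τ τ' : Memory} {l : List (Fin n × ℕ)}
    (h : BfsSt G c b A s g τ l) {y : Fin n} {k m : ℕ} (hnew : (y, k) ∉ l) (hyb : c y = b)
    (hkA : k ≤ A.length)
    (a4 : τ'.arr 4 = Function.update (τ.arr 4) (k * n + y) (τ.reg 27))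
    (a5 : τ'.arr 5 = Function.update (τ.arr 5) (τ.reg 27) y)
    (a6 : τ'.arr 6 = Function.update (τ.arr 6) (τ.reg 27) k)
    (a7 : τ'.arr 7 = Function.update (τ.arr 7) (τ.reg 27) m)
    (r27 : τ'.reg 27 = τ.reg 27 + 1)
    (hpar : (k = 0 ∧ m = 0) ∨ ∃ (j : ℕ) (z : Fin n × ℕ), l[j]? = some z ∧ m = s + j ∧
      NodeAdj G c b A z (y, k) ∧
      ∀ t, (y, k) ∈ lay G c b A t → ∃ t', t = t' + 1 ∧ z ∈ lay G c b A t')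
    (hcase : (τ.reg 32 ≤ k ∧ τ'.reg 32 = k ∧ τ'.reg 31 ≤ (3 * g + 1) * k ∧
        τ'.reg 33 = τ.reg 27 ∧ (y, k) ∈ lay G c b A (τ'.reg 31)) ∨
      (l ≠ [] ∧ k ≤ τ.reg 32 ∧ τ'.reg 32 = τ.reg 32 ∧ τ'.reg 31 = τ.reg 31 ∧
        τ'.reg 33 = τ.reg 33)) : BfsSt G c b A s g τ' (l ++ [(y, k)]) := by
  have hsz := h.size
  have hbound : ∀ {j : ℕ} {z : Fin n × ℕ}, l[j]? = some z → j < l.length := fun hj =>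
    (List.getElem?_eq_some_iff.1 hj).1
  refine ⟨?_, ?_, ?_, ?_, ?_, ?_, ?_, ?_, ?_, ?_, ?_, ?_, ?_⟩
  · rw [r27, hsz]; simp [add_assoc]
  · intro j z hj
    rw [a5]
    rcases List.getElem?_snoc_eq_some.1 hj with hj | ⟨rfl, rfl⟩
    · rw [Function.update_of_ne (by have := hbound hj; omega)]
      exact h.vert j z hj
    · rw [← hsz, Function.update_self]
  · intro j z hj
    rw [a6]
    rcases List.getElem?_snoc_eq_some.1 hj with hj | ⟨rfl, rfl⟩
    · rw [Function.update_of_ne (by have := hbound hj; omega)]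
      exact h.copy j z hj
    · rw [← hsz, Function.update_self]
  · rw [List.nodup_append_comm]
    simpa [hnew] using h.nodup
  · intro z hz
    rcases List.mem_append.1 hz with hz | hz
    · exact h.col z hz
    · rw [List.mem_singleton.1 hz]; exact hyb
  · intro z hz
    rcases List.mem_append.1 hz with hz | hz
    · have := h.le z hz
      omega
    · rw [List.mem_singleton.1 hz]
      simp only
      omega
  · have h2 := h.cm_le
    omega
  · intro j z hj
    rw [a4]
    rcases List.getElem?_snoc_eq_some.1 hj with hj | ⟨rfl, rfl⟩
    · rw [Function.update_of_ne]
      · exact h.pos j z hj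
      · intro heq
        obtain ⟨e1, e2⟩ := index_inj heq
        apply hnew
        rw [← e1, ← e2]
        exact List.mem_iff_getElem?.2 ⟨j, hj⟩
    · rw [Function.update_self, hsz]
  · intro v k' hv
    rw [a4, Function.update_apply] at hv
    split_ifs at hv with heq
    · obtain ⟨rfl, rfl⟩ := index_inj heq
      simp
    · exact List.mem_append_left _ (h.mem v k' hv)
  · intro j
    rw [a4, r27, Function.update_apply]
    have := h.lt j
    split_ifs <;> omega
  · intro j z hj
    rw [a7]
    rcases List.getElem?_snoc_eq_some.1 hj with hj | ⟨rfl, rfl⟩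
    · rw [Function.update_of_ne (by have := hbound hj; omega)]
      rcases h.par j z hj with h1 | ⟨j', w, h1, h2⟩
      · exact Or.inl h1
      · exact Or.inr ⟨j', w, List.getElem?_snoc_eq_some.2 (Or.inl h1), h2⟩
    · rw [← hsz, Function.update_self]
      rcases hpar with h1 | ⟨j, z, h1, h2⟩
      · exact Or.inl h1
      · exact Or.inr ⟨j, z, List.getElem?_snoc_eq_some.2 (Or.inl h1), h2⟩
  · right
    rcases hcase with ⟨d1, d2, d3, d4, d5⟩ | ⟨d0, d1, d2, d3, d4⟩
    · exact ⟨l.length, y, by rw [d4, hsz], by rw [d2]; simp, by rw [d2]; exact d5⟩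
    · obtain ⟨j, v, e1, e2, e3⟩ := h.goal.resolve_left d0
      refine ⟨j, v, by rw [d4, e1], ?_, ?_⟩
      · rw [d2]; exact List.getElem?_snoc_eq_some.2 (Or.inl e2)
      · rw [d2, d3]; exact e3
  · have h1 := h.tl_le
    rcases hcase with ⟨d1, d2, d3, d4, d5⟩ | ⟨d0, d1, d2, d3, d4⟩
    · rw [d2]; exact d3
    · rw [d2, d3]; exact h1

/-- A node counts as new if its entry in array `4` lies below the start of the current search. So
entries left over from earlier searches need not be cleared. -/
theorem wp_pushNode {qy : ℕ → ℕ → ℕ} {s g lev : ℕ} {τ : Memory} {t : ℕ}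
    {l : List (Fin n × ℕ)} (h : BfsSt G c b A s g τ l) (h0 : τ.reg 0 = n) (h42 : τ.reg 42 = s)
    (h30 : τ.reg 30 = lev) {i : ℕ} {x y : Fin n × ℕ} (hx : l[i]? = some x) (h36 : τ.reg 36 = s + i)
    (h43 : τ.reg 43 = y.1) (h44 : τ.reg 44 = y.2) (hxy : NodeAdj G c b A x y)
    (hxl : x ∈ lay G c b A lev) (hlev : ∀ z ∈ lay G c b A lev, z ∈ l)
    (hcm : τ.reg 32 < y.2 → y.2 = τ.reg 32 + 1 ∧ lev ≤ τ.reg 31 + 3 * g) :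
    wp qy pushNode (fun t' τ' => t' ≤ t + 60 ∧ ∃ r, BfsSt G c b A s g τ' (l ++ r) ∧
      (∀ z ∈ r, z = y ∧ z ∉ l) ∧ y ∈ l ++ r ∧
      ((τ'.reg 32 = τ.reg 32 ∧ τ'.reg 31 = τ.reg 31) ∨
        (τ.reg 32 < y.2 ∧ τ'.reg 32 = y.2 ∧ τ'.reg 31 = lev + 1))) t τ := by
  obtain ⟨y, k⟩ := y
  simp only at h43 h44 hcm
  have hyl : (y, k) ∈ lay G c b A (lev + 1) := lay_succ_of_adj hxl hxy
  refine wp_cond (fun he => ?_) (fun he => ?_)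
  · simp only [nodeIdx, Expr.ev, h42, h43, h44, h0, ne_eq, ite_eq_right_iff, one_ne_zero,
      imp_false, not_not] at he
    have hnew : (y, k) ∉ l := by
      intro hm
      obtain ⟨j, hj⟩ := List.mem_iff_getElem?.1 hm
      have := h.pos j _ hj
      simp only at this
      omega
    have key : ∀ τ' : Memory,
        τ'.arr 4 = Function.update (τ.arr 4) (k * n + y) (τ.reg 27) →
        τ'.arr 5 = Function.update (τ.arr 5) (τ.reg 27) y →
        τ'.arr 6 = Function.update (τ.arr 6) (τ.reg 27) k →
        τ'.arr 7 = Function.update (τ.arr 7) (τ.reg 27) (s + i) →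
        τ'.reg 27 = τ.reg 27 + 1 →
        ((τ.reg 32 < k ∧ τ'.reg 32 = k ∧ τ'.reg 31 = lev + 1 ∧ τ'.reg 33 = τ.reg 27) ∨
          (k ≤ τ.reg 32 ∧ τ'.reg 32 = τ.reg 32 ∧ τ'.reg 31 = τ.reg 31 ∧
            τ'.reg 33 = τ.reg 33)) → ∀ t', t' ≤ t + 60 →
        t' ≤ t + 60 ∧ ∃ r, BfsSt G c b A s g τ' (l ++ r) ∧
          (∀ z ∈ r, z = (y, k) ∧ z ∉ l) ∧ (y, k) ∈ l ++ r ∧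
          ((τ'.reg 32 = τ.reg 32 ∧ τ'.reg 31 = τ.reg 31) ∨
            (τ.reg 32 < k ∧ τ'.reg 32 = k ∧ τ'.reg 31 = lev + 1)) := by
      intro τ' a4 a5 a6 a7 r27 hcase t' ht'
      refine ⟨ht', [(y, k)], h.push hnew (lay_col hyl) (lay_le hyl) a4 a5 a6 a7 r27
        (Or.inr ⟨i, x, hx, rfl, hxy, fun t ht => ?_⟩) ?_, ?_, by simp, ?_⟩
      -- The layers up to `lev` are completely listed, so a new node lies in none of them. Its
      -- parent, which is in layer `lev`, therefore precedes it in every layer containing it: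
      -- following parents lowers the layer each time.
      · have hlt : lev < t := by
          by_contra hcon
          exact hnew (hlev _ (lay_mono (not_lt.1 hcon) ht))
        exact ⟨t - 1, by omega, lay_mono (by omega) hxl⟩
      · rcases hcase with ⟨d1, d2, d3, d4⟩ | ⟨d1, d2, d3, d4⟩
        · obtain ⟨e1, e2⟩ := hcm d1
          refine Or.inl ⟨d1.le, d2, ?_, d4, by rw [d3]; exact hyl⟩
          -- A new copy is opened at most `3 * g + 1` steps after the previous one, which adds one
          -- more term `3 * g + 1` to the bound.
          have h1 := h.tl_le
          rw [d3, e1, mul_add]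
          omega
        · exact Or.inr ⟨List.ne_nil_of_mem (List.mem_of_getElem? hx), d1, d2, d3, d4⟩
      · intro z hz
        rw [List.mem_singleton.1 hz]
        exact ⟨rfl, hnew⟩
      · rcases hcase with ⟨d1, d2, d3, d4⟩ | ⟨d1, d2, d3, d4⟩
        exacts [Or.inr ⟨d1, d2, d3⟩, Or.inl ⟨d2, d3⟩]
    simp only [Program.block, wp_seq_iff, wp_assign_iff, wp_write_iff, Expr.ev, Expr.time, nodeIdx,
      Memory.setArr_reg, h0, h43, h44, h36]
    refine wp_cond (fun he2 => ?_) (fun he2 => ?_)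
    · simp [Expr.ev, h44] at he2
      simp only [wp_seq_iff, wp_assign_iff, Expr.ev, Expr.time]
      apply key
      any_goals simp [h44, h30]
      exact Or.inl he2
    · simp [Expr.ev, h44] at he2
      rw [wp_skip_iff]
      simp only [wp_assign_iff, Expr.ev, Expr.time]
      apply key
      any_goals simp [h44, h30]
      exact Or.inr he2
  · simp only [nodeIdx, Expr.ev, h42, h43, h44, h0, ite_eq_right_iff, one_ne_zero,
      imp_false, not_lt] at he
    rw [wp_skip_iff]
    refine ⟨by simp only [nodeIdx, Expr.time]; omega, [], by simpa using h, by simp, ?_,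
      Or.inl ⟨rfl, rfl⟩⟩
    simpa using h.mem y k he

end Bfs

end WordRAM


/-! ### Breadth-first search: successors of a node and of a layer -/

namespace WordRAM

/-- The step of `bfsNode` for one neighbour. -/
def bfsStep : Program :=
  .cond (.eq (.read 0 (.reg 14)) (.reg 20))
    (.block [.assign 43 (.reg 14), .assign 44 (.reg 37), pushNode])
    (.cond (.eq (.read 0 (.reg 14)) (.read 8 (.reg 37)))
      (.block [.assign 43 (.reg 11), .assign 44 (.add (.reg 37) (.const 1)), pushNode]) .skip)

/-- Append the successors of the node at the position in the register `36`. -/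
def bfsNode : Program :=
  .block [.assign 11 (.read 5 (.reg 36)), .assign 37 (.read 6 (.reg 36)), forNbrs 11 bfsStep,
    .assign 36 (.add (.reg 36) (.const 1))]

/-- Append the successors of the nodes in the positions from the register `28` to the
register `29`. -/
def bfsLayer : Program :=
  .block [.assign 36 (.reg 28), .loop (.lt (.reg 36) (.reg 29)) bfsNode]

section Bfs

variable {n : ℕ} {G : SimpleGraph (Fin n)} {c : Fin n → ℕ} {b : ℕ} {A : List ℕ}

/-- The registers and arrays that are not changed by the search. -/
structure BfsEnv (c : Fin n → ℕ) (b : ℕ) (A : List ℕ) (s g N : ℕ) (τ : Memory) : Prop where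
  cols : ∀ v : Fin n, τ.arr 0 v = c v
  act : ∀ (i : ℕ) (f : ℕ), A[i]? = some f → τ.arr 8 i = f
  r0 : τ.reg 0 = n
  r20 : τ.reg 20 = b
  r21 : τ.reg 21 = g
  r25 : τ.reg 25 = A.length
  r26 : τ.reg 26 = N
  r42 : τ.reg 42 = s

theorem BfsEnv.frame {s g N : ℕ} {τ τ' : Memory} (h : BfsEnv c b A s g N τ) {P : Program}
    (hF : Frame P τ τ') (hr : ∀ x ∈ [0, 20, 21, 25, 26, 42], P.setsReg x = false)
    (ha : P.setsArr 0 = false) (ha' : P.setsArr 8 = false) : BfsEnv c b A s g N τ' := by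
  obtain ⟨h1, h2, h3, h4, h5, h6, h7, h8⟩ := h
  have e1 := hF.reg 0 (hr 0 (by simp))
  have e2 := hF.reg 20 (hr 20 (by simp))
  have e3 := hF.reg 21 (hr 21 (by simp))
  have e4 := hF.reg 25 (hr 25 (by simp))
  have e5 := hF.reg 26 (hr 26 (by simp))
  have e6 := hF.reg 42 (hr 42 (by simp))
  have e7 := hF.arr 0 ha
  have e8 := hF.arr 8 ha'
  constructor <;> simp only [e1, e2, e3, e4, e5, e6, e7, e8] <;> assumption

theorem BfsEnv.setReg {s g N : ℕ} {τ : Memory} (h : BfsEnv c b A s g N τ) {x : ℕ} (m : ℕ)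
    (hx : x ∉ [0, 20, 21, 25, 26, 42]) : BfsEnv c b A s g N (τ.setReg x m) := by
  simp only [List.mem_cons, List.not_mem_nil, or_false, not_or] at hx
  obtain ⟨x0, x1, x2, x3, x4, x5⟩ := hx
  obtain ⟨h1, h2, h3, h4, h5, h6, h7, h8⟩ := h
  refine ⟨h1, h2, ?_, ?_, ?_, ?_, ?_, ?_⟩ <;> rw [Memory.setReg_reg, if_neg (Ne.symm ‹_›)] <;>
    assumption

/-- The nodes `r` have been appended to the list `l` while processing the layer `lev`. -/
structure LevSt (G : SimpleGraph (Fin n)) (c : Fin n → ℕ) (b : ℕ) (A : List ℕ)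
    (s g lev cm tl : ℕ) (l : List (Fin n × ℕ)) (τ : Memory) (r : List (Fin n × ℕ)) : Prop where
  st : BfsSt G c b A s g τ (l ++ r)
  new : ∀ z ∈ r, z ∉ lay G c b A lev ∧ ∃ x ∈ lay G c b A lev, NodeAdj G c b A x z
  cm_tl : (τ.reg 32 = cm ∧ τ.reg 31 = tl) ∨ (τ.reg 32 = cm + 1 ∧ τ.reg 31 = lev + 1)

theorem LevSt.setReg {s g lev cm tl : ℕ} {τ : Memory} {l r : List (Fin n × ℕ)}
    (h : LevSt G c b A s g lev cm tl l τ r) {x : ℕ} (m : ℕ) (hx : x ∉ [27, 31, 32, 33]) :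
    LevSt G c b A s g lev cm tl l (τ.setReg x m) r := by
  refine ⟨h.st.setReg m hx, h.new, ?_⟩
  simp only [List.mem_cons, List.not_mem_nil, or_false, not_or] at hx
  simpa only [Memory.setReg_reg, Ne.symm hx.2.1, Ne.symm hx.2.2.1, if_false] using h.cm_tl

/-- The situation while a layer is processed. -/
structure LevCtx (G : SimpleGraph (Fin n)) (c : Fin n → ℕ) (b : ℕ) (A : List ℕ)
    (g lev cm tl : ℕ) (l : List (Fin n × ℕ)) : Prop where
  mem : ∀ z, z ∈ l ↔ z ∈ lay G c b A lev
  le : ∀ z ∈ l, z.2 ≤ cm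
  lev_le : lev ≤ tl + 3 * g

/-- A neighbour of the colour `b` gives an arc within the copy, and one in the tree of this copy
gives the arc to the next copy. The colour `b` is tested first, hence the condition `f ≠ b` in the
second conclusion; active colours satisfy it. -/
theorem wp_bfsStep {qy : ℕ → ℕ → ℕ} {s g N lev cm tl : ℕ} {τ : Memory} {t : ℕ}
    {l r : List (Fin n × ℕ)} (hctx : LevCtx G c b A g lev cm tl l)
    (henv : BfsEnv c b A s g N τ) (h30 : τ.reg 30 = lev) (h : LevSt G c b A s g lev cm tl l τ r)
    {i : ℕ} {v w : Fin n} {k : ℕ} (hx : l[i]? = some (v, k)) (hk : k < A.length)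
    (h36 : τ.reg 36 = s + i) (h11 : τ.reg 11 = v) (h37 : τ.reg 37 = k) (h14 : τ.reg 14 = w)
    (hvw : G.Adj v w) :
    wp qy bfsStep (fun t' τ' => t' ≤ t + 100 ∧ ∃ r', LevSt G c b A s g lev cm tl l τ' (r ++ r') ∧
      (c w = b → (w, k) ∈ l ++ (r ++ r')) ∧
      (∀ f, A[k]? = some f → c w = f → f ≠ b → (v, k + 1) ∈ l ++ (r ++ r'))) t τ := by
  have hxl : (v, k) ∈ l := List.mem_iff_getElem?.2 ⟨i, hx⟩
  have hxlay := (hctx.mem _).1 hxl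
  have hkcm : k ≤ cm := hctx.le _ hxl
  have hx' : (l ++ r)[i]? = some (v, k) := by
    rw [List.getElem?_append_left (List.getElem?_eq_some_iff.1 hx).1, hx]
  have key : ∀ (y : Fin n × ℕ) (t₁ : ℕ) (τ₁ : Memory), t₁ ≤ t + 40 →
      (∃ a b', τ₁ = (τ.setReg 43 a).setReg 44 b') → τ₁.reg 43 = y.1 → τ₁.reg 44 = y.2 →
      NodeAdj G c b A (v, k) y → y.2 ≤ k + 1 →
      wp qy pushNode (fun t' τ' => t' ≤ t + 100 ∧ ∃ r', LevSt G c b A s g lev cm tl l τ' (r ++ r') ∧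
        y ∈ l ++ (r ++ r')) t₁ τ₁ := by
    rintro y t₁ τ₁ ht₁ ⟨a, b', rfl⟩ h43 h44 hadj hyk
    have hL := (h.setReg (x := 43) a (by simp)).setReg (x := 44) b' (by simp)
    have hE := (henv.setReg (x := 43) a (by simp)).setReg (x := 44) b' (by simp)
    refine (wp_pushNode hL.st hE.r0 hE.r42 (lev := lev)
        (by simpa using h30) hx' (by simpa using h36)
      h43 h44 hadj hxlay (fun z hz => List.mem_append_left _ ((hctx.mem z).2 hz)) ?_).mono ?_
    · intro hlt
      have := hctx.lev_le
      rcases hL.cm_tl with ⟨e1, e2⟩ | ⟨e1, e2⟩ <;> omega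
    · rintro t' τ' - - ⟨ht', r', g1, g2, g3, g4⟩
      refine ⟨by omega, r', ⟨by simpa using g1, ?_, ?_⟩, by simpa using g3⟩
      · intro z hz
        rcases List.mem_append.1 hz with hz | hz
        · exact h.new z hz
        · obtain ⟨rfl, hz2⟩ := g2 z hz
          refine ⟨fun hz3 => hz2 (List.mem_append_left _ ((hctx.mem _).2 hz3)), (v, k), hxlay, hadj⟩
      · have e := hL.cm_tl
        omega
  refine wp_cond (fun he => ?_) (fun he => ?_)
  · simp only [Expr.ev, h14, henv.cols, henv.r20, ne_eq, ite_eq_right_iff, one_ne_zero,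
      imp_false, not_not] at he
    simp only [Program.block, wp_seq_iff, wp_assign_iff, Expr.ev, Expr.time]
    refine (key (w, k) _ _ (by omega) ⟨_, _, rfl⟩ (by simp [h14]) (by simp [h37])
      (Or.inl ⟨rfl, hvw, he⟩) (by simp)).mono ?_
    rintro t' τ' - - ⟨ht', r', g1, g2⟩
    exact ⟨ht', r', g1, fun _ => g2, fun f hf hcw hfb => (hfb (hcw.symm.trans he)).elim⟩
  · simp only [Expr.ev, h14, henv.cols, henv.r20, ite_eq_right_iff, one_ne_zero, imp_false] at he
    have hk' : A[k]? = some A[k] := List.getElem?_eq_getElem hk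
    refine wp_cond (fun he2 => ?_) (fun he2 => ?_)
    · simp only [Expr.ev, h14, henv.cols, h37, henv.act _ _ hk', ne_eq, ite_eq_right_iff,
        one_ne_zero, imp_false, not_not] at he2
      simp only [Program.block, wp_seq_iff, wp_assign_iff, Expr.ev, Expr.time]
      refine (key (v, k + 1) _ _ (by omega) ⟨_, _, rfl⟩ (by simp [h11]) (by simp [h37])
        (Or.inr ⟨rfl, rfl, _, hk', w, hvw, he2⟩) (by simp)).mono ?_
      rintro t' τ' - - ⟨ht', r', g1, g2⟩
      exact ⟨ht', r', g1, fun h' => (he h').elim, fun _ _ _ _ => g2⟩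
    · simp only [Expr.ev, h14, henv.cols, h37, henv.act _ _ hk', ite_eq_right_iff,
        one_ne_zero, imp_false] at he2
      rw [wp_skip_iff]
      refine ⟨by simp only [Expr.time]; omega, [], by simpa using h, fun h' => (he h').elim,
        fun f hf hcw hfb => ?_⟩
      rw [hk', Option.some_inj] at hf
      exact (he2 (hcw.trans hf.symm)).elim

/-- The sum of the weights of the vertices of nodes. -/
def nsum (L : IncidenceLists G) (l : List (Fin n × ℕ)) : ℕ := wsum L (l.map Prod.fst)

theorem wsum_flatMap_replicate (L : IncidenceLists G) (p : List (Fin n)) (k : ℕ) :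
    ((p ×ˢ List.range k).map fun x => L.wt x.1).sum = k * wsum L p := by
  induction p with
  | nil => simp [wsum]
  | cons v p ih =>
    rw [List.product_cons, List.map_append, List.sum_append, ih, wsum_cons]
    simp [Function.comp_def, mul_add]

/-- The nodes are pairwise different pairs of a vertex of `p` and one of `k + 1` copies, so each
vertex weight is counted at most `k + 1` times. -/
theorem nsum_le (L : IncidenceLists G) {l : List (Fin n × ℕ)} (hl : l.Nodup) (p : List (Fin n))
    (k : ℕ) (h : ∀ x ∈ l, x.1 ∈ p ∧ x.2 ≤ k) : nsum L l ≤ (k + 1) * wsum L p := by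
  rw [← wsum_flatMap_replicate, nsum, wsum, List.map_map]
  obtain ⟨l₂, hp, hs⟩ := hl.subperm (l₂ := p ×ˢ List.range (k + 1)) (by
    rintro ⟨v, j⟩ hx
    obtain ⟨h1, h2⟩ := h _ hx
    exact List.pair_mem_product.2 ⟨h1, List.mem_range.2 (Nat.lt_succ_of_le h2)⟩)
  rw [← (hp.map _).sum_eq]
  exact (hs.map _).sum_le_sum fun _ _ => Nat.zero_le _

theorem nsum_append (L : IncidenceLists G) (l l' : List (Fin n × ℕ)) :
    nsum L (l ++ l') = nsum L l + nsum L l' := by simp [nsum, wsum_append]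

theorem length_le_of_nodes {l : List (Fin n × ℕ)} (hl : l.Nodup) (p : List (Fin n))
    (k : ℕ) (h : ∀ x ∈ l, x.1 ∈ p ∧ x.2 ≤ k) : l.length ≤ (k + 1) * p.length := by
  have := (hl.subperm (l₂ := p ×ˢ List.range (k + 1)) (by
    rintro ⟨v, j⟩ hx
    obtain ⟨h1, h2⟩ := h _ hx
    exact List.pair_mem_product.2 ⟨h1, List.mem_range.2 (Nat.lt_succ_of_le h2)⟩)).length_le
  rw [List.length_product, List.length_range] at this
  linarith

/-- The successors of a node are in the list. -/
def SuccIn (G : SimpleGraph (Fin n)) (c : Fin n → ℕ) (b : ℕ) (A : List ℕ)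
    (l : List (Fin n × ℕ)) (x : Fin n × ℕ) : Prop := ∀ y, NodeAdj G c b A x y → y ∈ l

theorem SuccIn.append {l r : List (Fin n × ℕ)} {x : Fin n × ℕ} (h : SuccIn G c b A l x) :
    SuccIn G c b A (l ++ r) x := fun y hy => List.mem_append_left _ (h y hy)

theorem wp_bfsNode (L : IncidenceLists G) {s g N lev cm tl : ℕ} {τ : Memory} {t : ℕ}
    {l r : List (Fin n × ℕ)} (hctx : LevCtx G c b A g lev cm tl l)
    (henv : BfsEnv c b A s g N τ) (h30 : τ.reg 30 = lev) (h : LevSt G c b A s g lev cm tl l τ r)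
    {i : ℕ} {v : Fin n} {k : ℕ} (hx : l[i]? = some (v, k)) (hk : k < A.length)
    (hAb : ∀ f ∈ A, f ≠ b) (h36 : τ.reg 36 = s + i) :
    wp L.query bfsNode (fun t' τ' => t' ≤ t + 140 * L.wt v ∧ ∃ r',
      LevSt G c b A s g lev cm tl l τ' (r ++ r') ∧ τ'.reg 36 = s + (i + 1) ∧
      SuccIn G c b A (l ++ (r ++ r')) (v, k)) t τ := by
  have hx' : (l ++ r)[i]? = some (v, k) := by
    rw [List.getElem?_append_left (List.getElem?_eq_some_iff.1 hx).1, hx]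
  have hv : τ.arr 5 (s + i) = v := h.st.vert i _ hx'
  have hk' : τ.arr 6 (s + i) = k := h.st.copy i _ hx'
  simp only [bfsNode, Program.block, wp_seq_iff, wp_assign_iff, Expr.ev, Expr.time, h36, hv]
  simp only [Memory.setReg_reg, Memory.setReg_arr, h36]
  norm_num only [if_false]
  rw [hk']
  refine wp_forNbrs L v 100 (fun ls τ' => ∃ r', LevSt G c b A s g lev cm tl l τ' (r ++ r') ∧
    ∀ w ∈ ls, (c w = b → (w, k) ∈ l ++ (r ++ r')) ∧
      (∀ f, A[k]? = some f → c w = f → f ≠ b → (v, k + 1) ∈ l ++ (r ++ r'))) (by simp) rfl rfl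
    ?_ ?_ ?_ ?_
  · rintro ls τ' m j hj ⟨r', h1, h2⟩
    refine ⟨r', h1.setReg _ ?_, h2⟩
    fin_cases hj <;> simp
  · refine ⟨[], ?_, by simp⟩
    simpa using (h.setReg _ (by simp)).setReg _ (by simp)
  · rintro ls w ls' t' τ' - hF ⟨r', h1, h2⟩ h14 hvw
    have hE : BfsEnv c b A s g N τ' := by
      refine ((henv.setReg (x := 11) _ ?_).setReg (x := 37) _ ?_).frame hF ?_ rfl rfl
      · simp
      · simp
      · intro x hx
        fin_cases hx <;> rfl
    have e30 : τ'.reg 30 = lev := by rw [hF.reg 30 rfl]; simpa using h30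
    have e36 : τ'.reg 36 = s + i := by rw [hF.reg 36 rfl]; simpa using h36
    have e11 : τ'.reg 11 = v := by rw [hF.reg 11 rfl]; simp
    have e37 : τ'.reg 37 = k := by rw [hF.reg 37 rfl]; simp
    refine (wp_bfsStep hctx hE e30 h1 hx hk e36 e11 e37 h14 hvw).mono ?_
    rintro t'' τ'' - - ⟨ht'', r'', g1, g2, g3⟩
    refine ⟨ht'', r' ++ r'', by simpa using g1, ?_⟩
    intro u hu
    rcases List.mem_append.1 hu with hu | hu
    · obtain ⟨d1, d2⟩ := h2 u hu
      have hsub : ∀ z, z ∈ l ++ (r ++ r') → z ∈ l ++ (r ++ (r' ++ r'')) := by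
        intro z hz
        rw [← List.append_assoc r, ← List.append_assoc l]
        exact List.mem_append_left _ hz
      exact ⟨fun e => hsub _ (d1 e), fun f e1 e2 e3 => hsub _ (d2 f e1 e2 e3)⟩
    · rw [List.mem_singleton.1 hu]
      rw [List.append_assoc] at g2 g3
      exact ⟨g2, g3⟩
  · rintro t' τ' ht' hF ⟨r', h1, h2⟩
    rw [wp_assign_iff]
    have e36 : τ'.reg 36 = s + i := by rw [hF.reg 36 rfl]; simpa using h36
    refine ⟨?_, r', h1.setReg _ (by simp), by simp [Expr.ev, e36, add_assoc], ?_⟩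
    · have := one_le_wt L v
      simp only [Expr.time]
      omega
    · rintro ⟨w, k'⟩ (⟨e1, e2, e3⟩ | ⟨e1, e2, f, e3, u, e4, e5⟩)
      · simp only at e1 e2 e3
        rw [e1]
        exact (h2 w ((L.mem_iff v w).2 e2)).1 e3
      · simp only at e1 e2 e3 e4 e5
        rw [e1, e2]
        exact (h2 u ((L.mem_iff v u).2 e4)).2 f e3 e5 (hAb f (List.mem_of_getElem? e3))

/-- Only the newest nodes `q` are expanded; those in `p` had their turn before. Thus every node is
paid for once in the whole search. The record of the highest copy can rise by one at most, since no
listed node lies beyond copy `cm`. -/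
theorem wp_bfsLayer (L : IncidenceLists G) {s g N lev cm tl : ℕ} {σ : Memory} {t : ℕ}
    {Φ : ℕ → Memory → Prop} {p q : List (Fin n × ℕ)} (hctx : LevCtx G c b A g lev cm tl (p ++ q))
    (henv : BfsEnv c b A s g N σ) (h30 : σ.reg 30 = lev) (hcm : σ.reg 32 = cm)
    (htl : σ.reg 31 = tl) (h : BfsSt G c b A s g σ (p ++ q)) (hk : cm < A.length)
    (hAb : ∀ f ∈ A, f ≠ b) (h28 : σ.reg 28 = s + p.length)
    (h29 : σ.reg 29 = s + (p ++ q).length)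
    (hΦ : ∀ t' τ r, LevSt G c b A s g lev cm tl (p ++ q) τ r →
      (∀ x ∈ q, SuccIn G c b A (p ++ q ++ r) x) → t' ≤ t + 150 * nsum L q + 10 →
      Frame bfsLayer σ τ → Φ t' τ) :
    wp L.query bfsLayer Φ t σ := by
  suffices hs : wp L.query bfsLayer (fun t' τ => ∃ r, LevSt G c b A s g lev cm tl (p ++ q) τ r ∧
      (∀ x ∈ q, SuccIn G c b A (p ++ q ++ r) x) ∧ t' ≤ t + 150 * nsum L q + 10) t σ from
    hs.mono fun t' τ _ hF ⟨r, h1, h2, h3⟩ => hΦ t' τ r h1 h2 h3 hF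
  rw [bfsLayer]
  simp only [Program.block, wp_seq_iff, wp_assign_iff, Expr.ev, Expr.time, h28]
  refine wp_loop_frame (fun t' τ => ∃ q₁ q₂ r, q = q₁ ++ q₂ ∧
    LevSt G c b A s g lev cm tl (p ++ q) τ r ∧ τ.reg 36 = s + (p ++ q₁).length ∧
    (∀ x ∈ q₁, SuccIn G c b A (p ++ q ++ r) x) ∧ t' ≤ t + 2 + 150 * nsum L q₁)
    (t + 2 + 150 * nsum L q) ?_ ?_ ?_ ?_
  · exact ⟨[], q, [], rfl, ⟨by simpa using h.setReg _ (by simp), by simp, Or.inl (by simp [hcm,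
      htl])⟩,
      by simp, by simp, by simp⟩
  · rintro t' τ ⟨q₁, q₂, r, rfl, -, -, -, ht⟩
    rw [nsum_append]
    omega
  · rintro t' τ hF ⟨q₁, q₂, r, hq, h1, h2, h3, ht⟩ hne
    have e29 : τ.reg 29 = s + (p ++ q).length := by rw [hF.reg 29 rfl]; simpa using h29
    have e30 : τ.reg 30 = lev := by rw [hF.reg 30 rfl]; simpa using h30
    simp only [Expr.ev, h2, e29, ne_eq, ite_eq_right_iff, one_ne_zero, imp_false, not_not] at hne
    rcases q₂ with _ | ⟨⟨v, k⟩, q₂⟩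
    · rw [hq] at hne
      simp at hne
    have hx : (p ++ q)[(p ++ q₁).length]? = some (v, k) := by
      rw [hq, ← List.append_assoc, List.getElem?_append_right le_rfl]
      simp
    have hmem : (v, k) ∈ p ++ q := List.mem_of_getElem? hx
    have hE : BfsEnv c b A s g N τ := by
      refine (henv.setReg (x := 36) _ (by simp)).frame hF ?_ rfl rfl
      intro x hx
      fin_cases hx <;> rfl
    refine (wp_bfsNode L hctx hE e30 h1 hx (lt_of_le_of_lt (hctx.le _ hmem) hk) hAb h2).mono ?_
    rintro t'' τ' - - ⟨ht'', r', g1, g2, g3⟩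
    refine ⟨q₁ ++ [(v, k)], q₂, r ++ r', by simp [hq], g1, by rw [g2]; simp [add_assoc], ?_, ?_⟩
    · intro x hx
      rcases List.mem_append.1 hx with hx | hx
      · have := (h3 x hx).append (r := r')
        rwa [List.append_assoc] at this
      · rw [List.mem_singleton.1 hx]; exact g3
    · have := one_le_wt L v
      have e : nsum L [(v, k)] = L.wt v := by simp [nsum, wsum]
      rw [nsum_append, e]
      simp only [Expr.time] at ht''
      omega
  · rintro t' τ hF ⟨q₁, q₂, r, hq, h1, h2, h3, ht⟩ he
    have e29 : τ.reg 29 = s + (p ++ q).length := by rw [hF.reg 29 rfl]; simpa using h29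
    simp only [Expr.ev, h2, e29, ite_eq_right_iff, one_ne_zero, imp_false] at he
    have hq2 : q₂ = [] := by
      rw [← List.length_eq_zero_iff]
      simp only [hq, List.length_append] at he
      omega
    subst hq2
    rw [List.append_nil] at hq
    subst hq
    exact ⟨r, h1, h3, by simp only [Expr.time]; omega⟩

end Bfs

end WordRAM


/-! ### Breadth-first search: rounds, small layers and termination -/

namespace WordRAM

/-- Is the layer in the positions from the register `28` to the register `29` within the window and
small? -/
def smallLayer (h : ℕ) : Expr :=
  .mul (.lt (.add (.reg 31) (.reg 21)) (.reg 30))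
    (.mul (.lt (.reg 30) (.add (.add (.reg 31) (.mul (.const 2) (.reg 21))) (.const 1)))
      (.lt (.mul (.sub (.reg 29) (.reg 28)) (.reg 21))
        (.add (.mul (.const h) (.reg 26)) (.const 1))))

/-- Process a layer, and remember the next layer if it can serve as a separator. -/
def bfsRound (h : ℕ) : Program :=
  .block [bfsLayer, .assign 28 (.reg 29), .assign 29 (.reg 27),
    .assign 30 (.add (.reg 30) (.const 1)),
    .cond (smallLayer h) (.block [.assign 34 (.reg 28), .assign 35 (.reg 29)]) .skip]

/-- The search continues. -/
def bfsGuard : Expr :=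
  .mul (.lt (.reg 32) (.reg 25))
    (.lt (.reg 30) (.add (.add (.reg 31) (.mul (.const 3) (.reg 21))) (.const 1)))

/-- Put the copy `0` of the vertex in the register `18` into the list of nodes, if it has the colour
in the register `20`. -/
def bfsInitStep : Program :=
  .cond (.eq (.read 0 (.reg 18)) (.reg 20)) (.block [
    .write 4 (.reg 18) (.reg 27), .write 5 (.reg 27) (.reg 18), .write 6 (.reg 27) (.const 0),
    .write 7 (.reg 27) (.const 0), .assign 33 (.reg 27),
    .assign 27 (.add (.reg 27) (.const 1))]) .skip

/-- Breadth-first search in the layered graph. -/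
def bfs (h : ℕ) : Program :=
  .block [.assign 42 (.reg 27), .assign 31 (.const 0), .assign 32 (.const 0), forSeg bfsInitStep,
    .assign 28 (.reg 42), .assign 29 (.reg 27), .assign 30 (.const 0),
    .loop bfsGuard (bfsRound h)]

section Bfs

variable {n : ℕ} {G : SimpleGraph (Fin n)} {c : Fin n → ℕ} {b : ℕ} {A : List ℕ}

/-- A layer that can serve as a separator has been found. -/
def Saved (G : SimpleGraph (Fin n)) (c : Fin n → ℕ) (b : ℕ) (A : List ℕ) (h s g N lev : ℕ)
    (τ : Memory) (l : List (Fin n × ℕ)) : Prop :=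
  ∃ j, τ.reg 31 + g < j ∧ j ≤ τ.reg 31 + 2 * g ∧ j ≤ lev ∧
    (∀ (i : ℕ) (x : Fin n × ℕ), l[i]? = some x →
      (s + i < τ.reg 34 ↔ x ∈ lay G c b A (j - 1)) ∧ (s + i < τ.reg 35 ↔ x ∈ lay G c b A j)) ∧
    (τ.reg 35 - τ.reg 34) * g ≤ h * N ∧ s ≤ τ.reg 34 ∧ τ.reg 34 ≤ τ.reg 35 ∧
    τ.reg 35 ≤ s + l.length

/-- The invariant of the search at the beginning of a round. -/
structure BfsHead (G : SimpleGraph (Fin n)) (c : Fin n → ℕ) (b : ℕ) (A : List ℕ)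
    (h s g N lev : ℕ) (τ : Memory) (p q : List (Fin n × ℕ)) : Prop where
  st : BfsSt G c b A s g τ (p ++ q)
  mem : ∀ z, z ∈ p ++ q ↔ z ∈ lay G c b A lev
  pre : ∀ z, z ∈ p ↔ z ∈ layBefore G c b A lev
  r28 : τ.reg 28 = s + p.length
  r29 : τ.reg 29 = s + (p ++ q).length
  r30 : τ.reg 30 = lev
  lev_le : lev ≤ τ.reg 31 + 3 * g + 1
  saved : ∀ j, τ.reg 31 + g < j → j ≤ τ.reg 31 + 2 * g → j ≤ lev →
    (lay G c b A j \ lay G c b A (j - 1)).ncard * g ≤ h * N →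
    Saved G c b A h s g N lev τ (p ++ q)

/-- If a new copy appears, the window of candidate layers moves ahead of the current layer, so no
layer found so far is a candidate and nothing is claimed about the stored one. Otherwise the new
layer is stored if it is small and lies in the window, and the stored one is kept if not. -/
theorem wp_bfsRound (L : IncidenceLists G) {h s g N lev : ℕ} {τ : Memory} {t : ℕ}
    {p q : List (Fin n × ℕ)} (henv : BfsEnv c b A s g N τ)
    (hd : BfsHead G c b A h s g N lev τ p q) (hcm : τ.reg 32 < A.length)
    (hlev : lev ≤ τ.reg 31 + 3 * g) (hAb : ∀ f ∈ A, f ≠ b) :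
    wp L.query (bfsRound h) (fun t' τ' => t' ≤ t + 150 * nsum L q + 50 ∧
      ∃ r, BfsHead G c b A h s g N (lev + 1) τ' (p ++ q) r) t τ := by
  rw [bfsRound]
  simp only [Program.block, wp_seq_iff]
  have hctx : LevCtx G c b A g lev (τ.reg 32) (τ.reg 31) (p ++ q) := ⟨hd.mem, hd.st.le, hlev⟩
  refine wp_bfsLayer L hctx henv hd.r30 rfl rfl hd.st hcm hAb hd.r28 hd.r29 ?_
  intro t' τ' r hL hsucc ht' hF
  simp only [wp_seq_iff, wp_assign_iff, Expr.ev, Expr.time]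
  have henv' : BfsEnv c b A s g N τ' := by
    refine henv.frame hF ?_ rfl rfl
    intro x hx
    fin_cases hx <;> rfl
  have e29 : τ'.reg 29 = s + (p ++ q).length := by rw [hF.reg 29 rfl]; exact hd.r29
  have e30 : τ'.reg 30 = lev := by rw [hF.reg 30 rfl]; exact hd.r30
  have e34 : τ'.reg 34 = τ.reg 34 := hF.reg 34 rfl
  have e35 : τ'.reg 35 = τ.reg 35 := hF.reg 35 rfl
  have e27 := hL.st.size
  have hmem : ∀ z, z ∈ p ++ q ++ r ↔ z ∈ lay G c b A (lev + 1) := by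
    intro z
    constructor
    · intro hz
      rcases List.mem_append.1 hz with hz | hz
      · exact Or.inl ((hd.mem z).1 hz)
      · exact Or.inr (hL.new z hz).2
    · rintro (hz | ⟨x, hx, hxz⟩)
      · exact List.mem_append_left _ ((hd.mem z).2 hz)
      -- The successors of the nodes reached before layer `lev` are already in that layer, so
      -- expanding `q` yields the whole next layer.
      · rcases List.mem_append.1 ((hd.mem x).2 hx) with hx' | hx'
        · have h1 := (hd.pre x).1 hx'
          apply List.mem_append_left
          rw [hd.mem]
          cases lev with
          | zero => exact h1.elim
          | succ m => exact lay_succ_of_adj h1 hxz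
        · exact hsucc x hx' z hxz
  have hnew : lay G c b A (lev + 1) \ lay G c b A lev = {z | z ∈ r} := by
    ext z
    simp only [Set.mem_sdiff, ← hmem, ← hd.mem, Set.mem_setOf_eq]
    constructor
    · rintro ⟨h1, h2⟩
      exact (List.mem_append.1 h1).resolve_left h2
    · intro h1
      refine ⟨List.mem_append_right _ h1, fun h2 => (hL.new z h1).1 ((hd.mem z).1 h2)⟩
  have hcard : (lay G c b A (lev + 1) \ lay G c b A lev).ncard = r.length := by
    classical
    rw [hnew, ← List.coe_toFinset, Set.ncard_coe_finset, List.toFinset_card_of_nodup]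
    exact (List.nodup_append.1 hL.st.nodup).2.1
  -- New nodes stand behind both stored positions and belong to neither of the two stored layers, so
  -- appending them keeps the record correct.
  have hold : ∀ j, τ'.reg 31 + g < j → j ≤ τ'.reg 31 + 2 * g → j ≤ lev →
      (lay G c b A j \ lay G c b A (j - 1)).ncard * g ≤ h * N →
      Saved G c b A h s g N (lev + 1) τ' (p ++ q ++ r) := by
    intro j h1 h2 h3 h4
    rcases hL.cm_tl with ⟨d1, d2⟩ | ⟨d1, d2⟩
    · rw [d2] at h1 h2
      obtain ⟨j', g1, g2, g3, g4, g5, g6, g7, g8⟩ := hd.saved j h1 h2 h3 h4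
      refine ⟨j', by rw [d2]; exact g1, by rw [d2]; exact g2, by omega, ?_, ?_, ?_, ?_, ?_⟩
      · intro i x hx
        rw [e34, e35]
        by_cases hi : i < (p ++ q).length
        · rw [List.getElem?_append_left hi] at hx
          exact g4 i x hx
        · rw [List.getElem?_append_right (not_lt.1 hi)] at hx
          have hxr := (hL.new x (List.mem_of_getElem? hx)).1
          constructor
          · exact ⟨fun h => by omega, fun h => (hxr (lay_mono (by omega) h)).elim⟩
          · exact ⟨fun h => by omega, fun h => (hxr (lay_mono (by omega) h)).elim⟩
      · rw [e34, e35]; exact g5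
      · rw [e34]; exact g6
      · rw [e34, e35]; exact g7
      · rw [e35, List.length_append]; omega
    · omega
  have hle : lev + 1 ≤ τ'.reg 31 + 3 * g + 1 := by
    rcases hL.cm_tl with ⟨d1, d2⟩ | ⟨d1, d2⟩ <;> omega
  have hlen : (p ++ q ++ r).length = (p ++ q).length + r.length := List.length_append
  refine wp_cond (fun he => ?_) (fun he => ?_)
  · simp only [smallLayer, Expr.ev, Memory.setReg_reg] at he
    norm_num only [if_true, if_false] at he
    simp [e30, henv'.r21, henv'.r26, e29, e27] at he
    obtain ⟨he3, he2, he1⟩ := he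
    simp only [wp_seq_iff, wp_assign_iff, Expr.ev, Expr.time, smallLayer]
    refine ⟨by omega, r, ⟨?_, ?_, ?_, ?_, ?_, ?_, ?_, ?_⟩⟩
    · exact ((((hL.st.setReg _ (by simp)).setReg _ (by simp)).setReg _ (by simp)).setReg _
        (by simp)).setReg _ (by simp)
    · exact hmem
    · exact hd.mem
    · simp [e29]
    · simp [e27]
    · simp [e30]
    · simpa using hle
    · intro j _ _ _ _
      refine ⟨lev + 1, ?_, ?_, le_rfl, ?_, ?_, ?_, ?_, ?_⟩
      · simp
        omega
      · simp only [Memory.setReg_reg]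
        norm_num only [if_true, if_false]
        omega
      · intro i x hx
        have hxm := (hmem x).1 (List.mem_of_getElem? hx)
        have hi := (List.getElem?_eq_some_iff.1 hx).1
        simp only [Memory.setReg_reg]
        norm_num only [if_true, if_false]
        rw [e29, e27]
        refine ⟨?_, ⟨fun _ => hxm, fun _ => by omega⟩⟩
        rw [show lev + 1 - 1 = lev from rfl]
        constructor
        · intro h
          rw [List.getElem?_append_left (by omega)] at hx
          exact (hd.mem x).1 (List.mem_of_getElem? hx)
        · intro h
          by_contra hcon
          rw [List.getElem?_append_right (by omega)] at hx
          exact (hL.new x (List.mem_of_getElem? hx)).1 h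
      · simp only [Memory.setReg_reg]
        norm_num only [if_true, if_false]
        rw [e29, e27, hlen]
        simp only [List.length_append] at he3 ⊢
        calc _ ≤ _ := Nat.mul_le_mul_right _ (le_of_eq (by omega))
          _ ≤ _ := he3
      · simp [e29]
      · simp [e29, e27]
      · simp [e27]
  · simp only [smallLayer, Expr.ev, Memory.setReg_reg] at he
    norm_num only [if_true, if_false] at he
    simp [e30, henv'.r21, henv'.r26, e29, e27] at he
    rw [wp_skip_iff]
    have key : ∀ τ'' : Memory, BfsSt G c b A s g τ'' (p ++ q ++ r) → τ''.reg 31 = τ'.reg 31 →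
        τ''.reg 34 = τ'.reg 34 → τ''.reg 35 = τ'.reg 35 → τ''.reg 28 = τ'.reg 29 →
        τ''.reg 29 = τ'.reg 27 → τ''.reg 30 = lev + 1 →
        BfsHead G c b A h s g N (lev + 1) τ'' (p ++ q) r := by
      intro τ'' h1 h2 h3 h4 h5 h6 h7
      refine ⟨h1, hmem, hd.mem, by rw [h5, e29], by rw [h6, e27], h7, by rw [h2]; exact hle, ?_⟩
      intro j g1 g2 g3 g4
      rw [h2] at g1 g2
      rcases Nat.lt_or_ge j (lev + 1) with hj | hj
      · obtain ⟨j', d⟩ := hold j g1 g2 (by omega) g4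
        refine ⟨j', ?_⟩
        rw [h2, h3, h4]
        exact d
      · obtain rfl : j = lev + 1 := by omega
        rw [Nat.add_sub_cancel, hcard] at g4
        have e : s + (p.length + (q.length + r.length)) - (s + (p.length + q.length)) = r.length := by
          omega
        rw [e] at he
        have := he g4 (by omega)
        omega
    refine ⟨by simp only [Expr.time, smallLayer]; omega, r, key _ ?_ ?_ ?_ ?_ ?_ ?_ ?_⟩
    · exact ((hL.st.setReg _ (by simp)).setReg _ (by simp)).setReg _ (by simp)
    all_goals simp [e30]

theorem lay_finite (k : ℕ) : (lay G c b A k).Finite :=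
  (((Set.finite_univ (α := Fin n)).prod (Set.finite_Iic A.length))).subset fun x hx =>
    ⟨trivial, lay_le hx⟩

/-- One of `g` consecutive layers is small. -/
theorem exists_small_layer {g a M : ℕ} (hg : 0 < g) (hM : (lay G c b A (a + g)).ncard ≤ M) :
    ∃ j, a < j ∧ j ≤ a + g ∧ (lay G c b A j \ lay G c b A (j - 1)).ncard * g ≤ M := by
  by_contra hcon
  push Not at hcon
  -- If all `g` layers were large, each would contribute more than `M / g` nodes and the total would
  -- exceed `M`.
  have key : ∀ i, i ≤ g → i * (M + 1) ≤ (lay G c b A (a + i)).ncard * g := by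
    intro i
    induction i with
    | zero => simp
    | succ i ih =>
      intro hi
      have h1 := hcon (a + (i + 1)) (by omega) (by omega)
      rw [show a + (i + 1) - 1 = a + i from rfl] at h1
      have h2 := Set.ncard_sdiff_add_ncard_of_subset (lay_mono (G := G) (c := c) (b := b) (A := A)
        (show a + i ≤ a + (i + 1) by omega)) (lay_finite _)
      have h3 := ih (by omega)
      rw [← h2]
      nlinarith
  have h1 := key g le_rfl
  have h2 : g * (M + 1) ≤ g * M := by
    rw [mul_comm g M]
    exact h1.trans (Nat.mul_le_mul_right g hM)
  have := Nat.le_of_mul_le_mul_left h2 hg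
  omega

/-- The search ends because the last copy is reached or because `3 * g + 1` layers went by without a
new copy. In the second case a pigeonhole argument over the layers from `tl + g + 1` to `tl + 2 * g`
supplies the separator; the margins of `g` layers on both sides are what the progress argument
consumes later. -/
theorem wp_bfs (L : IncidenceLists G) {h g N : ℕ} {σ : Memory} {t : ℕ} {Φ : ℕ → Memory → Prop}
    (p : List (Fin n)) (henv : ∀ s, BfsEnv c b A s g N (σ.setReg 42 s)) (hp : p.Nodup)
    (hseg : Seg (σ.arr 1) (σ.reg 4) (σ.reg 5) p) (hbp : ∀ v, c v = b → v ∈ p)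
    (hb : ∃ v, c v = b) (hAb : ∀ f ∈ A, f ≠ b) (hAh : A.length ≤ h) (hN : p.length ≤ N)
    (hg : 0 < g) (h4 : ∀ i, σ.arr 4 i < σ.reg 27)
    (hΦ : ∀ t' τ l lev, BfsSt G c b A (σ.reg 27) g τ l → BfsEnv c b A (σ.reg 27) g N τ →
      (∀ z, z ∈ l ↔ z ∈ lay G c b A lev) →
      (τ.reg 32 = A.length ∨ (τ.reg 32 < A.length ∧ lev = τ.reg 31 + 3 * g + 1 ∧
        Saved G c b A h (σ.reg 27) g N lev τ l)) →
      t' ≤ t + 220 * ((h + 1) * wsum L p) + 70 * ((3 * g + 1) * (h + 1)) + 100 →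
      Frame (bfs h) σ τ → Φ t' τ) :
    wp L.query (bfs h) Φ t σ := by
  set s := σ.reg 27 with hs
  suffices hsuff : wp L.query (bfs h) (fun t' τ => ∃ l lev, BfsSt G c b A s g τ l ∧
      BfsEnv c b A s g N τ ∧ (∀ z, z ∈ l ↔ z ∈ lay G c b A lev) ∧
      (τ.reg 32 = A.length ∨ (τ.reg 32 < A.length ∧ lev = τ.reg 31 + 3 * g + 1 ∧
        Saved G c b A h s g N lev τ l)) ∧
      t' ≤ t + 220 * ((h + 1) * wsum L p) + 70 * ((3 * g + 1) * (h + 1)) + 100) t σ from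
    hsuff.mono fun t' τ _ hF ⟨l, lev, h1, h2, h3, h4, h5⟩ => hΦ t' τ l lev h1 h2 h3 h4 h5 hF
  have hlen := length_le_wsum L p
  rw [bfs]
  simp only [Program.block, wp_seq_iff, wp_assign_iff, Expr.ev, Expr.time]
  simp only [← hs]
  have henv0 : BfsEnv c b A s g N (((σ.setReg 42 s).setReg 31 0).setReg 32 0) :=
    ((henv s).setReg _ (by simp)).setReg _ (by simp)
  refine wp_forSeg p (fun p₁ d τ => ∃ l, (∃ p₂, p = p₁ ++ p₂) ∧ BfsSt G c b A s g τ l ∧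
    τ.reg 31 = 0 ∧ τ.reg 32 = 0 ∧
    (∀ x, x ∈ l ↔ x.1 ∈ p₁ ∧ c x.1 = b ∧ x.2 = 0) ∧ d ≤ 40 * p₁.length ∧ τ.arr 1 = σ.arr 1)
    (by simpa using hseg) ⟨rfl, rfl, rfl⟩ (40 * p.length) ?_ ?_ ?_ ?_ ?_ ?_
  · rintro p₁ d τ m i hi ⟨l, h1, h2, h3, h4, h5⟩
    have : i ∉ [27, 31, 32, 33] ∧ i ≠ 31 ∧ i ≠ 32 := by fin_cases hi <;> simp
    refine ⟨l, h1, h2.setReg _ this.1, ?_, ?_, h5⟩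
    · rw [Memory.setReg_reg, if_neg this.2.1.symm]; exact h3
    · rw [Memory.setReg_reg, if_neg this.2.2.symm]; exact h4
  · refine ⟨[], ⟨p, rfl⟩, ⟨by simp [hs], by simp, by simp, by simp, by simp, by simp, by simp,
      by simp, ?_, ?_, by simp, Or.inl rfl, by simp⟩, by simp, by simp, by simp, by simp, by simp⟩
    · intro v k hv
      have := h4 (k * n + v)
      simp only [Memory.setReg_arr] at hv
      omega
    · intro i
      simpa using h4 i
  · rintro p₁ d τ ⟨l, ⟨p₂, rfl⟩, -, -, -, -, hd, -⟩
    rw [List.length_append]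
    omega
  · rintro p₁ d τ ⟨l, -, -, -, -, -, -, h1⟩ i _
    simp [h1]
  · rintro p₁ x p₂ d t' τ hpx hF ⟨l, -, h2, h31, h32, hm, hd, ha1⟩ hx
    have henv1 : BfsEnv c b A s g N τ := by
      refine henv0.frame hF ?_ rfl rfl
      intro x hx
      fin_cases hx <;> rfl
    refine wp_cond (fun he => ?_) (fun he => ?_)
    · simp only [Expr.ev, hx, henv1.cols, henv1.r20, ne_eq, ite_eq_right_iff, one_ne_zero,
        imp_false, not_not] at he
      simp only [Program.block, wp_seq_iff, wp_assign_iff, wp_write_iff, Expr.ev, Expr.time,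
        Memory.setArr_reg, hx]
      have hxl : (x, 0) ∉ l := by
        rw [hm]
        rintro ⟨h1, -⟩
        rw [hpx] at hp
        exact (List.nodup_append.1 hp).2.2 x h1 x (by simp) rfl
      refine ⟨40, by omega, l ++ [(x, 0)], ⟨p₂, by simp [hpx]⟩,
        h2.push (m := 0) hxl he (Nat.zero_le _) ?_ ?_ ?_ ?_ ?_ (Or.inl ⟨rfl, rfl⟩) (Or.inl ?_),
        ?_, ?_, ?_, ?_, ?_⟩
      any_goals simp [h31, h32]
      · exact ⟨he, rfl⟩
      · intro v k
        rw [hm]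
        constructor
        · rintro (⟨h1, h2, h3⟩ | ⟨rfl, rfl⟩)
          · exact ⟨Or.inl h1, h2, h3⟩
          · exact ⟨Or.inr rfl, he, rfl⟩
        · rintro ⟨h1 | h1, h2, h3⟩
          · exact Or.inl ⟨h1, h2, h3⟩
          · exact Or.inr ⟨h1, h3⟩
      · omega
      · exact ha1
    · simp only [Expr.ev, hx, henv1.cols, henv1.r20, ite_eq_right_iff, one_ne_zero,
        imp_false] at he
      rw [wp_skip_iff]
      refine ⟨7, by simp only [Expr.time]; omega, l, ⟨p₂, by simp [hpx]⟩, h2, h31, h32, ?_, ?_, ha1⟩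
      · intro z
        rw [hm, List.mem_append, List.mem_singleton]
        constructor
        · rintro ⟨h1, h2⟩; exact ⟨Or.inl h1, h2⟩
        · rintro ⟨h1 | h1, h2, h3⟩
          · exact ⟨h1, h2, h3⟩
          · rw [h1] at h2; exact (he h2).elim
      · rw [List.length_append, List.length_singleton]; omega
  · rintro t' d τ ht' hF ⟨l, -, h2, h31, h32, hm, hd, ha1⟩
    have henv1 : BfsEnv c b A s g N τ := by
      refine henv0.frame hF ?_ rfl rfl
      intro x hx
      fin_cases hx <;> rfl
    simp only [wp_seq_iff, wp_assign_iff, Expr.ev, Expr.time]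
    have hmem0 : ∀ z, z ∈ l ↔ z ∈ lay G c b A 0 := by
      intro z
      rw [hm]
      exact ⟨fun h => h.2, fun h => ⟨hbp _ h.1, h⟩⟩
    -- Each of the at most `h + 1` copies accounts for at most `3 * g + 1` layers; this pays for the
    -- overhead of the rounds.
    have htl : ∀ {lev : ℕ} {τ₁ : Memory} {p' q' : List (Fin n × ℕ)},
        BfsHead G c b A h s g N lev τ₁ p' q' → lev ≤ (3 * g + 1) * (h + 1) := by
      intro lev τ₁ p' q' hd
      have h1 := hd.lev_le
      have h2 := hd.st.tl_le
      have h3 := hd.st.cm_le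
      have h5 := Nat.mul_le_mul_left (3 * g + 1) (h3.trans hAh)
      rw [mul_add, mul_one]
      omega
    have hsum : ∀ {lev : ℕ} {τ₁ : Memory} {p' q' : List (Fin n × ℕ)},
        BfsHead G c b A h s g N lev τ₁ p' q' → nsum L p' ≤ (h + 1) * wsum L p := by
      intro lev τ₁ p' q' hd
      refine nsum_le L (List.nodup_append.1 hd.st.nodup).1 p h fun x hx => ?_
      have hx' : x ∈ p' ++ q' := List.mem_append_left _ hx
      exact ⟨hbp _ (hd.st.col x hx'), (hd.st.le x hx').trans (hd.st.cm_le.trans hAh)⟩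
    have hw : wsum L p ≤ (h + 1) * wsum L p := Nat.le_mul_of_pos_left _ (by omega)
    refine wp_loop_frame (fun t₁ τ₁ => ∃ lev p' q', BfsHead G c b A h s g N lev τ₁ p' q' ∧
      t₁ ≤ t + 60 * wsum L p + 50 + 150 * nsum L p' + 70 * lev)
      (t + 60 * wsum L p + 50 + 150 * ((h + 1) * wsum L p) + 70 * ((3 * g + 1) * (h + 1))) ?_ ?_ ?_ ?_
    · have e42 : τ.reg 42 = s := henv1.r42
      refine ⟨0, [], l, ⟨?_, by simpa using hmem0, by simp [layBefore], ?_, ?_, ?_, ?_, ?_⟩, ?_⟩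
      · simpa using ((h2.setReg _ (by simp)).setReg _ (by simp)).setReg _ (by simp)
      · simp [e42]
      · simp [h2.size]
      · simp
      · simp
      · intro j h1 _ h3
        omega
      · simp only [nsum, wsum, List.map_nil, List.sum_nil]
        simp only [wsum] at hlen
        omega
    · rintro t₁ τ₁ ⟨lev, p', q', hd', ht₁⟩
      have h1 := htl hd'
      have h2 := hsum hd'
      omega
    · rintro t₁ τ₁ hF₁ ⟨lev, p', q', hd', ht₁⟩ he
      have henv2 : BfsEnv c b A s g N τ₁ := by
        refine (((henv1.setReg (x := 28) _ (by simp)).setReg (x := 29) _ (by simp)).setReg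
          (x := 30) _ (by simp)).frame hF₁ ?_ rfl rfl
        intro x hx
        fin_cases hx <;> rfl
      simp only [bfsGuard, Expr.ev, henv2.r25, henv2.r21, hd'.r30, ne_eq, mul_eq_zero,
        ite_eq_right_iff, one_ne_zero, imp_false, not_or, not_not] at he
      refine (wp_bfsRound L henv2 hd' he.1 (by omega) hAb).mono ?_
      rintro t₂ τ₂ - - ⟨ht₂, r, hr⟩
      refine ⟨lev + 1, p' ++ q', r, hr, ?_⟩
      rw [nsum_append]
      simp only [bfsGuard, Expr.time] at ht₂
      omega
    · rintro t₁ τ₁ hF₁ ⟨lev, p', q', hd', ht₁⟩ he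
      have henv2 : BfsEnv c b A s g N τ₁ := by
        refine (((henv1.setReg (x := 28) _ (by simp)).setReg (x := 29) _ (by simp)).setReg
          (x := 30) _ (by simp)).frame hF₁ ?_ rfl rfl
        intro x hx
        fin_cases hx <;> rfl
      simp only [bfsGuard, Expr.ev, henv2.r25, henv2.r21, hd'.r30, mul_eq_zero,
        ite_eq_right_iff, one_ne_zero, imp_false] at he
      refine ⟨p' ++ q', lev, hd'.st, henv2, hd'.mem, ?_, ?_⟩
      · have hcm := hd'.st.cm_le
        rcases Nat.lt_or_ge (τ₁.reg 32) A.length with hlt | hge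
        · right
          have hlev := hd'.lev_le
          have hlev' : lev = τ₁.reg 31 + 3 * g + 1 := by omega
          refine ⟨hlt, hlev', ?_⟩
          -- The last copy is missing, so the reached nodes lie in at most as many copies as there
          -- are active colours, that is at most `h`, with at most `N` vertices each.
          have hcard : (lay G c b A (τ₁.reg 31 + g + g)).ncard ≤ h * N := by
            classical
            have hsub : lay G c b A (τ₁.reg 31 + g + g) ⊆ ((p' ++ q').toFinset : Set (Fin n × ℕ)) := by
              intro z hz
              rw [List.coe_toFinset]
              exact (hd'.mem z).2 (lay_mono (by omega) hz)
            have h1 := Set.ncard_le_ncard hsub (Finset.finite_toSet _)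
            rw [Set.ncard_coe_finset, List.toFinset_card_of_nodup hd'.st.nodup] at h1
            have h2 := length_le_of_nodes hd'.st.nodup p (τ₁.reg 32) fun x hx =>
              ⟨hbp _ (hd'.st.col x hx), hd'.st.le x hx⟩
            exact h1.trans (h2.trans (Nat.mul_le_mul (by omega) hN))
          obtain ⟨j, g1, g2, g3⟩ := exists_small_layer hg hcard
          exact hd'.saved j g1 (by omega) (by omega) g3
        · left; omega
      · have h1 := htl hd'
        have h2 := hsum hd'
        simp only [bfsGuard, Expr.time]
        omega

end Bfs

end WordRAM


namespace WordRAM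

/-! ### Active colours -/

/-- Append the colour of the vertex in the register `14` to the list of active colours, if it is at
least the number in the register `22`, not the number in the register `20`, and not in the list. -/
def actStep : Program :=
  .block [.assign 43 (.read 0 (.reg 14)),
    .cond (.mul (.lt (.reg 22) (.add (.reg 43) (.const 1)))
        (.mul (.lt (.read 9 (.reg 43)) (.reg 24)) (.sub (.const 1) (.eq (.reg 43) (.reg 20)))))
      (.block [.write 9 (.reg 43) (.reg 24), .write 8 (.reg 25) (.reg 43),
        .assign 25 (.add (.reg 25) (.const 1))]) .skip]

/-- The step of `active` for one vertex. -/
def actVertex : Program :=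
  .cond (.eq (.read 0 (.reg 18)) (.reg 20)) (forNbrs 18 actStep) .skip

/-- List the colours of the neighbours of the vertices of the colour in the register `20`. -/
def active : Program :=
  .block [.assign 24 (.add (.reg 24) (.const 1)), .assign 25 (.const 0), forSeg actVertex]

section Active

variable {n : ℕ} {G : SimpleGraph (Fin n)}

/-- The colour `f` is at least `c₀`, and occurs next to the vertices of the colour `b`. -/
def IsActive {V : Type*} (G : SimpleGraph V) (c : V → ℕ) (b c₀ f : ℕ) : Prop :=
  c₀ ≤ f ∧ f ≠ b ∧ ∃ v u, c v = b ∧ c u = f ∧ G.Adj v u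

/-- The list of active colours `A` is stored. -/
structure ActSt (G : SimpleGraph (Fin n)) (c : Fin n → ℕ) (b c₀ it : ℕ) (τ : Memory)
    (A : List ℕ) : Prop where
  size : τ.reg 25 = A.length
  act : ∀ (i : ℕ) (f : ℕ), A[i]? = some f → τ.arr 8 i = f
  nodup : A.Nodup
  mark_le : ∀ i, τ.arr 9 i ≤ it
  mark : ∀ f, τ.arr 9 f = it ↔ f ∈ A
  sound : ∀ f ∈ A, IsActive G c b c₀ f

theorem ActSt.setReg {c : Fin n → ℕ} {b c₀ it : ℕ} {τ : Memory} {A : List ℕ}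
    (h : ActSt G c b c₀ it τ A) {x : ℕ} (m : ℕ) (hx : x ≠ 25) :
    ActSt G c b c₀ it (τ.setReg x m) A := by
  obtain ⟨h1, h2, h3, h4, h5, h6⟩ := h
  refine ⟨?_, h2, h3, h4, h5, h6⟩
  simpa [hx.symm] using h1

theorem wp_actStep {qy : ℕ → ℕ → ℕ} {c : Fin n → ℕ} {b c₀ it : ℕ} {τ : Memory} {A : List ℕ} {t : ℕ}
    (h : ActSt G c b c₀ it τ A) (hc : ∀ v : Fin n, τ.arr 0 v = c v) (h20 : τ.reg 20 = b)
    (h22 : τ.reg 22 = c₀) (h24 : τ.reg 24 = it) {v u : Fin n} (h14 : τ.reg 14 = u)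
    (hv : c v = b) (huv : G.Adj v u) :
    wp qy actStep (fun t' τ' => t' ≤ t + 40 ∧ ∃ r, ActSt G c b c₀ it τ' (A ++ r) ∧
      (c₀ ≤ c u → c u ≠ b → c u ∈ A ++ r)) t τ := by
  simp only [actStep, Program.block, wp_seq_iff, wp_assign_iff, Expr.ev, Expr.time, h14, hc]
  refine wp_cond (fun he => ?_) (fun he => ?_)
  · simp only [Expr.ev, Memory.setReg_reg, Memory.setReg_arr] at he
    norm_num only [if_true, if_false] at he
    simp [h20, h22, h24] at he
    obtain ⟨h1, h2, h3⟩ := he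
    simp only [wp_seq_iff, wp_assign_iff, wp_write_iff, Expr.ev, Expr.time]
    have h3' : c u ≠ b := by
      intro hh; rw [if_pos hh] at h3; omega
    have hnew : c u ∉ A := fun hm => by
      have := (h.mark _).2 hm
      omega
    refine ⟨by omega, [c u], ⟨?_, ?_, ?_, ?_, ?_, ?_⟩, by simp⟩
    · simp [h.size]
    · intro i f hf
      simp only [Memory.setReg_arr, Memory.setArr_arr, Memory.setReg_reg, Memory.setArr_reg]
      norm_num only [if_true, if_false]
      rcases List.getElem?_snoc_eq_some.1 hf with hf | ⟨rfl, rfl⟩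
      · have := (List.getElem?_eq_some_iff.1 hf).1
        rw [h.size, Function.update_of_ne (by omega)]
        exact h.act i f hf
      · rw [h.size, Function.update_self]
    · rw [List.nodup_append_comm]
      simpa [hnew] using h.nodup
    · intro i
      simp only [Memory.setReg_arr, Memory.setArr_arr, Memory.setReg_reg, Memory.setArr_reg]
      norm_num only [if_true, if_false]
      rw [Function.update_apply, h24]
      split_ifs
      exacts [le_rfl, h.mark_le i]
    · intro f
      simp only [Memory.setReg_arr, Memory.setArr_arr, Memory.setReg_reg, Memory.setArr_reg]
      norm_num only [if_true, if_false]
      rw [Function.update_apply, h24, List.mem_append, List.mem_singleton, ← h.mark f]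
      split_ifs with hf
      · simp [hf]
      · simp [hf]
    · intro f hf
      rcases List.mem_append.1 hf with hf | hf
      · exact h.sound f hf
      · rw [List.mem_singleton.1 hf]
        exact ⟨by omega, h3', v, u, hv, rfl, huv⟩
  · simp only [Expr.ev, Memory.setReg_reg, Memory.setReg_arr] at he
    norm_num only [if_true, if_false] at he
    simp [h20, h22, h24] at he
    rw [wp_skip_iff]
    refine ⟨by simp only [Expr.time]; omega, [], by simpa using h.setReg _ (by simp),
        fun h1 h2 => ?_⟩
    rw [if_neg h2] at he
    rw [List.append_nil, ← h.mark]
    have := h.mark_le (c u)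
    omega

/-- Array `9` holds for each colour the number of the last search that listed it, and the counter in
the register `24` is raised first. So an old mark never equals the current number, and the array
need not be cleared. -/
theorem wp_active (L : IncidenceLists G) {σ : Memory} {t : ℕ} {Φ : ℕ → Memory → Prop}
    (c : Fin n → ℕ) (b c₀ : ℕ) (p : List (Fin n)) (hc : ∀ v : Fin n, σ.arr 0 v = c v)
    (h20 : σ.reg 20 = b) (h22 : σ.reg 22 = c₀) (hseg : Seg (σ.arr 1) (σ.reg 4) (σ.reg 5) p)
    (hbp : ∀ v, c v = b → v ∈ p) (h9 : ∀ i, σ.arr 9 i ≤ σ.reg 24)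
    (hΦ : ∀ t' τ (A : List ℕ), τ.reg 25 = A.length →
      (∀ (i : ℕ) (f : ℕ), A[i]? = some f → τ.arr 8 i = f) → A.Nodup →
      (∀ f, f ∈ A ↔ IsActive G c b c₀ f) → (∀ i, τ.arr 9 i ≤ τ.reg 24) →
      t' ≤ t + 120 * wsum L p + 40 → Frame active σ τ → Φ t' τ) :
    wp L.query active Φ t σ := by
  suffices hsuff : wp L.query active (fun t' τ => ∃ A : List ℕ, τ.reg 25 = A.length ∧
      (∀ (i : ℕ) (f : ℕ), A[i]? = some f → τ.arr 8 i = f) ∧ A.Nodup ∧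
      (∀ f, f ∈ A ↔ IsActive G c b c₀ f) ∧ (∀ i, τ.arr 9 i ≤ τ.reg 24) ∧
      t' ≤ t + 120 * wsum L p + 40) t σ from
    hsuff.mono fun t' τ _ hF ⟨A, h1, h2, h3, h4, h5, h6⟩ => hΦ t' τ A h1 h2 h3 h4 h5 h6 hF
  simp only [active, Program.block, wp_seq_iff, wp_assign_iff, Expr.ev, Expr.time]
  set it := σ.reg 24 + 1 with hit
  refine wp_forSeg p (fun l s τ => ∃ A, ActSt G c b c₀ it τ A ∧ τ.arr 1 = σ.arr 1 ∧
    (∀ v ∈ l, c v = b → ∀ u, G.Adj v u → c₀ ≤ c u → c u ≠ b → c u ∈ A) ∧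
    s ≤ 100 * wsum L l ∧ ∃ r, p = l ++ r)
    (by simpa using hseg) ⟨rfl, rfl, rfl⟩ (100 * wsum L p) ?_ ?_ ?_ ?_ ?_ ?_
  · rintro l s τ m i hi ⟨A, h1, h2⟩
    refine ⟨A, h1.setReg _ ?_, h2⟩
    fin_cases hi <;> simp
  · refine ⟨[], ⟨by simp, by simp, by simp, ?_, ?_, by simp⟩, by simp, by simp, by simp, p, rfl⟩
    · intro i
      simp only [Memory.setReg_arr]
      have := h9 i
      omega
    · intro i
      simp only [Memory.setReg_arr, List.not_mem_nil, iff_false]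
      have := h9 i
      omega
  · rintro l s τ ⟨A, -, -, -, hs, r, rfl⟩
    rw [wsum_append]
    omega
  · rintro l s τ ⟨A, -, h1, -⟩ i _
    simp [h1]
  · rintro l x r s t' τ hl hF ⟨A, h1, h2, h3, h4, -⟩ hx
    have e0 : ∀ v : Fin n, τ.arr 0 v = c v := by
      intro v; rw [hF.arr 0 rfl]; simp [hc]
    have e20 : τ.reg 20 = b := by rw [hF.reg 20 rfl]; simp [h20]
    have e22 : τ.reg 22 = c₀ := by rw [hF.reg 22 rfl]; simp [h22]
    have e24 : τ.reg 24 = it := by rw [hF.reg 24 rfl]; simp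
    have hw := one_le_wt L x
    refine wp_cond (fun he => ?_) (fun he => ?_)
    · simp only [Expr.ev, hx, e0, e20, ne_eq, ite_eq_right_iff, one_ne_zero,
        imp_false, not_not] at he
      refine wp_forNbrs L x 40 (fun ls τ' => ∃ r', ActSt G c b c₀ it τ' (A ++ r') ∧
        τ'.arr 1 = σ.arr 1 ∧ ∀ u ∈ ls, c₀ ≤ c u → c u ≠ b → c u ∈ A ++ r') hx rfl rfl ?_ ?_ ?_ ?_
      · rintro ls τ' m i hi ⟨r', g1, g2⟩
        refine ⟨r', g1.setReg _ ?_, g2⟩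
        fin_cases hi <;> simp
      · exact ⟨[], by simpa using h1, h2, by simp⟩
      · rintro ls u ls' t₁ τ₁ - hF₁ ⟨r', g1, g2, g3⟩ h14 hadj
        refine (wp_actStep g1 (fun v => by rw [hF₁.arr 0 rfl, e0]) (by rw [hF₁.reg 20 rfl, e20])
          (by rw [hF₁.reg 22 rfl, e22]) (by rw [hF₁.reg 24 rfl, e24]) h14 he hadj).mono ?_
        rintro t₂ τ₂ - hF₂ ⟨ht₂, r₂, f1, f2⟩
        refine ⟨ht₂, r' ++ r₂, by simpa using f1, by rw [hF₂.arr 1 rfl, g2], ?_⟩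
        intro w hw h5 h6
        rw [← List.append_assoc]
        rcases List.mem_append.1 hw with hw | hw
        · exact List.mem_append_left _ (g3 w hw h5 h6)
        · rw [List.mem_singleton.1 hw] at h5 h6 ⊢
          exact f2 h5 h6
      · rintro t₁ τ₁ ht₁ hF₁ ⟨r', g1, g2, g3⟩
        refine ⟨100 * L.wt x, by simp only [Expr.time] at ht₁; omega, A ++ r', g1, g2, ?_, ?_, r,
            by simp [hl]⟩
        · intro v hv hvb u hvu h5 h6
          rcases List.mem_append.1 hv with hv | hv
          · exact List.mem_append_left _ (h3 v hv hvb u hvu h5 h6)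
          · rw [List.mem_singleton.1 hv] at hvu
            exact g3 u ((L.mem_iff _ _).2 hvu) h5 h6
        · rw [wsum_append, wsum_cons]
          simp only [wsum, List.map_nil, List.sum_nil] at h4 ⊢
          omega
    · simp only [Expr.ev, hx, e0, e20, ite_eq_right_iff, one_ne_zero, imp_false] at he
      rw [wp_skip_iff]
      refine ⟨10, by simp only [Expr.time]; omega, A, h1, h2, ?_, ?_, r, by simp [hl]⟩
      · intro v hv hvb u hvu h5 h6
        rcases List.mem_append.1 hv with hv | hv
        · exact h3 v hv hvb u hvu h5 h6
        · rw [List.mem_singleton.1 hv] at hvb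
          exact (he hvb).elim
      · rw [wsum_append, wsum_cons]
        simp only [wsum, List.map_nil, List.sum_nil] at h4 ⊢
        omega
  · rintro t' s τ ht' hF ⟨A, h1, -, h3, h4, -⟩
    have e24 : τ.reg 24 = it := by rw [hF.reg 24 rfl]; simp
    refine ⟨A, h1.size, h1.act, h1.nodup, fun f => ⟨h1.sound f, ?_⟩, ?_, ?_⟩
    · rintro ⟨g1, g2, v, u, g3, rfl, g5⟩
      exact h3 v (hbp v g3) g3 u g5 g1 g2
    · rw [e24]; exact h1.mark_le
    · have := length_le_wsum L p
      omega

end Active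

end WordRAM


namespace WordRAM

/-! ### Separators -/

/-- The step of `tracePath` for one node. -/
def traceStep : Program :=
  .block [.assign 11 (.read 5 (.reg 36)),
    .cond (.eq (.read 0 (.reg 11)) (.reg 20)) (.block [.write 0 (.reg 11) (.reg 38),
      .write 1 (.reg 7) (.reg 11), .assign 7 (.add (.reg 7) (.const 1))]) .skip,
    .assign 36 (.read 7 (.reg 36))]

/-- Follow the parents from the position in the register `33`; give the vertices the colour in the
register `38`, and put them into the queue. -/
def tracePath : Program :=
  .block [.assign 36 (.reg 33), .loop (.reg 36) traceStep]

/-- The separator is a path, together with more vertices if the path is short. -/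
def pathSep : Program :=
  .block [.assign 6 (.reg 7), .assign 19 (.reg 7), tracePath, .assign 8 (.reg 20),
    .assign 9 (.reg 38), .assign 10 (.reg 21), flood]

/-- The separator is the layer in the positions from the register `34` to the register `35`. -/
def layerSep : Program :=
  .block [.assign 36 (.reg 34), .loop (.lt (.reg 36) (.reg 35)) (.block [
    .write 0 (.read 5 (.reg 36)) (.reg 38), .assign 36 (.add (.reg 36) (.const 1))])]

section Separators

variable {n : ℕ} {G : SimpleGraph (Fin n)} {c : Fin n → ℕ} {b : ℕ} {A : List ℕ}

theorem BfsSt.mem_of_getElem {s g : ℕ} {τ : Memory} {l : List (Fin n × ℕ)}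
    (_ : BfsSt G c b A s g τ l) {i : ℕ} {x : Fin n × ℕ} (hi : l[i]? = some x) : x ∈ l :=
  List.mem_iff_getElem?.2 ⟨i, hi⟩

/-- The vertices in `l₀` have been traced, in the given number of steps. -/
structure TraceSt (G : SimpleGraph (Fin n)) (c : Fin n → ℕ) (b : ℕ) (A : List ℕ) (z : ℕ)
    (σ τ : Memory) (steps k : ℕ) (l₀ : List (Fin n)) : Prop where
  seg : Seg (τ.arr 1) (σ.reg 7) (τ.reg 7) l₀
  nodup : l₀.Nodup
  cols : ∀ v : Fin n, τ.arr 0 v = if v ∈ l₀ then z else c v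
  old : ∀ v ∈ l₀, c v = b
  conn : l₀ = [] ∨ Conn G {v | v ∈ l₀}
  hit : ∀ (i f : ℕ), k ≤ i → A[i]? = some f → ∃ v ∈ l₀, Near G c f v
  len : l₀.length ≤ steps
  keep : ∀ i < σ.reg 7, τ.arr 1 i = σ.arr 1 i
  arr5 : τ.arr 5 = σ.arr 5
  arr7 : τ.arr 7 = σ.arr 7
  r20 : τ.reg 20 = b
  r38 : τ.reg 38 = z

/-- The walk leads back from the last copy to copy `0`. Each time it changes copies it stands at a
vertex next to the corresponding tree, so its projection touches all trees. Consecutive nodes have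
equal or adjacent vertices, so the projection is connected. A vertex may be visited in several
copies, and the colour test keeps it from being queued twice. -/
theorem wp_tracePath {qy : ℕ → ℕ → ℕ} {s g : ℕ} {σ : Memory} {t : ℕ}
    {Φ : ℕ → Memory → Prop} {l : List (Fin n × ℕ)} (hst : BfsSt G c b A s g σ l)
    (hl : l ≠ [])
    (hs : 0 < s) (hcols : ∀ v : Fin n, σ.arr 0 v = c v) (h20 : σ.reg 20 = b)
    (hzb : σ.reg 38 ≠ b) (hcm : σ.reg 32 = A.length)
    (hΦ : ∀ t' τ l₀, TraceSt G c b A (σ.reg 38) σ τ (σ.reg 31 + 1) 0 l₀ → l₀ ≠ [] →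
      t' ≤ t + 40 * (σ.reg 31 + 1) + 10 → Frame tracePath σ τ → Φ t' τ) :
    wp qy tracePath Φ t σ := by
  set z := σ.reg 38 with hz
  set tl := σ.reg 31 with htl
  suffices h : wp qy tracePath (fun t' τ => ∃ l₀, TraceSt G c b A z σ τ (tl + 1) 0 l₀ ∧
      l₀ ≠ [] ∧ t' ≤ t + 40 * (tl + 1) + 10) t σ from
    h.mono fun t' τ _ hF ⟨l₀, h1, h2, h3⟩ => hΦ t' τ l₀ h1 h2 h3 hF
  obtain ⟨i₀, v₀, hgoal1, hgoal2, hgoal3⟩ := hst.goal.resolve_left hl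
  simp only [tracePath, Program.block, wp_seq_iff, wp_assign_iff, Expr.ev, Expr.time]
  -- The number of steps plus the layer of the current node is constantly `tl`, since a parent lies
  -- one layer earlier; hence at most `tl + 1` vertices. Trees with index at least `k` have been
  -- touched. The register `36` becomes `0` at a starting node, whose parent entry is `0`.
  refine wp_loop (fun t' τ => ∃ steps k l₀, TraceSt G c b A z σ τ steps k l₀ ∧
      t' ≤ t + 2 + 40 * steps ∧ steps ≤ tl + 1 ∧
      ((∃ (i : ℕ) (x : Fin n × ℕ) (r : ℕ), τ.reg 36 = s + i ∧ l[i]? = some x ∧ x.2 = k ∧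
        x ∈ lay G c b A r ∧ steps + r = tl ∧ (l₀ = [] ∨ ∃ w ∈ l₀, w = x.1 ∨ G.Adj w x.1)) ∨
        (τ.reg 36 = 0 ∧ k = 0 ∧ l₀ ≠ []))) (t + 2 + 40 * (tl + 1)) ?_ ?_ ?_ ?_
  · refine ⟨0, A.length, [], ⟨?_, by simp, by simpa using hcols, by simp, Or.inl rfl, ?_, by simp,
      fun i _ => rfl, rfl, rfl, by simpa using h20, by simp [hz]⟩, by omega, by omega, Or.inl ⟨i₀,
          _, tl,
      by simpa using hgoal1, hgoal2, hcm, hgoal3, by omega, Or.inl rfl⟩⟩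
    · simpa using Seg.nil _ _
    · intro i f hi hf
      have := (List.getElem?_eq_some_iff.1 hf).1
      omega
  · rintro t' τ ⟨steps, k, l₀, -, ht, hsteps, -⟩
    omega
  · rintro t' τ ⟨steps, k, l₀, h, ht, hsteps, hcase⟩ hne
    rcases hcase with ⟨i, x, r, h36, hix, hxk, hxr, hsr, hadj⟩ | ⟨h0, -⟩
    swap
    · exact (hne h0).elim
    have hv : τ.arr 5 (s + i) = x.1 := by rw [h.arr5]; exact hst.vert i x hix
    have hxb : c x.1 = b := hst.col x (hst.mem_of_getElem hix)
    simp only [traceStep, Program.block, wp_seq_iff, wp_assign_iff, Expr.ev, Expr.time, h36, hv]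
    -- the situation after the vertex has been added
    have key : ∀ (τ' : Memory) (t'' : ℕ) (l₁ : List (Fin n)), t'' ≤ t' + 40 →
        TraceSt G c b A z σ τ' (steps + 1) k l₁ → x.1 ∈ l₁ → τ'.reg 36 = σ.arr 7 (s + i) →
        ∃ steps k l₀,
          TraceSt G c b A z σ τ' steps k l₀ ∧ t'' ≤ t + 2 + 40 * steps ∧ steps ≤ tl + 1 ∧
          ((∃ (i : ℕ) (x : Fin n × ℕ) (r : ℕ), τ'.reg 36 = s + i ∧ l[i]? = some x ∧ x.2 = k ∧
            x ∈ lay G c b A r ∧ steps + r = tl ∧ (l₀ = [] ∨ ∃ w ∈ l₀, w = x.1 ∨ G.Adj w x.1)) ∨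
            (τ'.reg 36 = 0 ∧ k = 0 ∧ l₀ ≠ [])) := by
      intro τ' t'' l₁ ht'' h1 hx1 h36'
      have hset : ∀ k' : ℕ, (∀ (i f : ℕ), k' ≤ i → A[i]? = some f → ∃ v ∈ l₁, Near G c f v) →
          TraceSt G c b A z σ τ' (steps + 1) k' l₁ := by
        intro k' hk'
        obtain ⟨g1, g2, g3, g4, g5, g6, g7, g8, g9, g10, g11, g12⟩ := h1
        exact ⟨g1, g2, g3, g4, g5, hk', g7, g8, g9, g10, g11, g12⟩
      rcases hst.par i x hix with ⟨hx0, hp0⟩ | ⟨j, y, hjy, hpj, hyx, hdec⟩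
      · refine ⟨steps + 1, k, l₁, hset k h1.hit, by omega, by omega, Or.inr ⟨by rw [h36', hp0],
          by omega, List.ne_nil_of_mem hx1⟩⟩
      · obtain ⟨r', rfl, hy'⟩ := hdec r hxr
        refine ⟨steps + 1, y.2, l₁, hset y.2 ?_, by omega, by omega, Or.inl ⟨j, y, r',
          by rw [h36', hpj], hjy, rfl, hy', by omega, Or.inr ⟨x.1, hx1, ?_⟩⟩⟩
        -- If the arc from the parent stays within the copy, nothing new is claimed. If it leaves
        -- copy `y.2`, then the vertex just added has a neighbour in the tree of that copy.
        · intro i' f hi' hf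
          rcases hyx with ⟨e1, -⟩ | ⟨e1, e2, f', e3, e4⟩
          · exact h1.hit i' f (by omega) hf
          · rcases Nat.eq_or_lt_of_le hi' with rfl | hlt
            · rw [hf, Option.some_inj] at e3
              exact ⟨x.1, hx1, by rw [e3, e1]; exact e4⟩
            · exact h1.hit i' f (by omega) hf
        · rcases hyx with ⟨-, e1, -⟩ | ⟨e1, -⟩
          exacts [Or.inr e1.symm, Or.inl e1]
    refine wp_cond (fun he => ?_) (fun he => ?_)
    · simp only [Expr.ev, Memory.setReg_reg, Memory.setReg_arr] at he
      norm_num only [if_true, if_false] at he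
      simp [h.cols, h.r20] at he
      have hxl : x.1 ∉ l₀ := by
        intro hm
        rw [if_pos hm] at he
        exact hzb he
      simp only [wp_seq_iff, wp_assign_iff, wp_write_iff, Expr.ev, Expr.time]
      refine key _ _ (l₀ ++ [x.1]) ?_ ⟨?_, ?_, ?_, ?_, ?_, ?_, ?_, ?_, ?_, ?_, ?_, ?_⟩
        (by simp) (by simp [h36, h.arr7])
      · omega
      · simpa using h.seg.push x.1
      · rw [List.nodup_append_comm]
        simpa [hxl] using h.nodup
      · intro v
        simp only [Memory.setReg_arr, Memory.setArr_arr, Memory.setReg_reg, Memory.setArr_reg]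
        norm_num only [if_true, if_false]
        rw [Function.update_apply, h.cols, h.r38]
        simp only [Fin.val_inj, List.mem_append, List.mem_singleton]
        by_cases hv : v = x.1 <;> simp [hv]
      · intro v hv
        rcases List.mem_append.1 hv with hv | hv
        · exact h.old v hv
        · rw [List.mem_singleton.1 hv]; exact hxb
      · right
        have e : {v | v ∈ l₀ ++ [x.1]} = insert x.1 {v | v ∈ l₀} := by
          ext v; simp [or_comm]
        rcases hadj with rfl | ⟨w, hw, rfl | hwx⟩
        · simpa using Conn.singleton x.1
        · exact (hxl hw).elim
        · rw [e]
          exact (h.conn.resolve_left (List.ne_nil_of_mem hw)).insert hw hwx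
      · intro i' f hi' hf
        obtain ⟨v, hv, hn⟩ := h.hit i' f hi' hf
        exact ⟨v, List.mem_append_left _ hv, hn⟩
      · have := h.len
        rw [List.length_append, List.length_singleton]; omega
      · intro i' hi'
        have := h.seg.len
        simp only [Memory.setReg_arr, Memory.setArr_arr, Memory.setReg_reg, Memory.setArr_reg]
        norm_num only [if_true, if_false]
        rw [Function.update_of_ne (by omega)]
        exact h.keep i' hi'
      · simpa using h.arr5
      · simpa using h.arr7
      · simpa using h.r20
      · simpa using h.r38
    · simp only [Expr.ev, Memory.setReg_reg, Memory.setReg_arr] at he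
      norm_num only [if_true, if_false] at he
      simp [h.cols, h.r20] at he
      have hxl : x.1 ∈ l₀ := by
        by_contra hm
        rw [if_neg hm] at he
        exact he hxb
      rw [wp_skip_iff]
      simp only [wp_assign_iff, Expr.ev, Expr.time]
      refine key _ _ l₀ ?_ ?_ hxl (by simp [h36, h.arr7])
      · omega
      obtain ⟨g1, g2, g3, g4, g5, g6, g7, g8, g9, g10, g11, g12⟩ := h
      exact ⟨by simpa using g1, g2, g3, g4, g5, g6, by omega, g8, g9, g10, by simpa using g11,
          by simpa using g12⟩
  · rintro t' τ ⟨steps, k, l₀, h, ht, hsteps, hcase⟩ he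
    rcases hcase with ⟨i, x, r, h36, -⟩ | ⟨-, rfl, hne⟩
    · simp only [Expr.ev, h36] at he
      omega
    · refine ⟨l₀, ?_, hne, by simp only [Expr.time]; omega⟩
      obtain ⟨g1, g2, g3, g4, g5, g6, g7, g8, g9, g10, g11, g12⟩ := h
      exact ⟨g1, g2, g3, g4, g5, g6, by omega, g8, g9, g10, g11, g12⟩

/-- The separator that is found when all active colours can be reached. -/
theorem wp_pathSep (L : IncidenceLists G) {s g : ℕ} {σ : Memory} {t : ℕ}
    {Φ : ℕ → Memory → Prop} {l : List (Fin n × ℕ)} (hst : BfsSt G c b A s g σ l)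
    (hl : l ≠ [])
    (hs : 0 < s) (hcols : ∀ v : Fin n, σ.arr 0 v = c v) (h20 : σ.reg 20 = b)
    (h21 : σ.reg 21 = g) (hzb : σ.reg 38 ≠ b) (hcm : σ.reg 32 = A.length) (hB : Conn G {v | c v = b})
    (hgB : g ≤ {v | c v = b}.ncard)
    (hΦ : ∀ (t' : ℕ) (τ : Memory) (Q : List (Fin n)), Q.Nodup → (∀ v ∈ Q, c v = b) →
      (∀ v : Fin n, τ.arr 0 v = if v ∈ Q then σ.reg 38 else c v) → Conn G {v | v ∈ Q} →
      (∀ f ∈ A, ∃ v ∈ Q, Near G c f v) → (Q.length ≤ σ.reg 31 + 1 ∨ Q.length ≤ g) →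
      g ≤ Q.length → (∀ i < σ.reg 7, τ.arr 1 i = σ.arr 1 i) → σ.reg 7 ≤ τ.reg 7 →
      t' ≤ t + 40 * (σ.reg 31 + 1) + 70 * wsum L Q + 30 → Frame pathSep σ τ → Φ t' τ) :
    wp L.query pathSep Φ t σ := by
  suffices h : wp L.query pathSep (fun t' τ => ∃ Q : List (Fin n), Q.Nodup ∧ (∀ v ∈ Q, c v = b) ∧
      (∀ v : Fin n, τ.arr 0 v = if v ∈ Q then σ.reg 38 else c v) ∧ Conn G {v | v ∈ Q} ∧
      (∀ f ∈ A, ∃ v ∈ Q, Near G c f v) ∧ (Q.length ≤ σ.reg 31 + 1 ∨ Q.length ≤ g) ∧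
      g ≤ Q.length ∧ (∀ i < σ.reg 7, τ.arr 1 i = σ.arr 1 i) ∧ σ.reg 7 ≤ τ.reg 7 ∧
      t' ≤ t + 40 * (σ.reg 31 + 1) + 70 * wsum L Q + 30) t σ from
    h.mono fun t' τ _ hF ⟨Q, h1, h2, h3, h4, h5, h6, h7, h8, h9, h10⟩ =>
      hΦ t' τ Q h1 h2 h3 h4 h5 h6 h7 h8 h9 h10 hF
  simp only [pathSep, Program.block, wp_seq_iff, wp_assign_iff, Expr.ev, Expr.time]
  refine wp_tracePath ((hst.setReg _ (by simp)).setReg _ (by simp)) hl hs (by simpa using hcols)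
    (by simpa using h20) (by simpa using hzb) (by simpa using hcm) ?_
  simp only [Memory.setReg_reg]
  norm_num only [if_true, if_false]
  rintro t' τ l₀ ⟨g1, g2, g3, g4, g5, g6, g7, g8, g9, g10, g11, g12⟩ hne ht' hF
  simp only [Memory.setReg_reg, Memory.setReg_arr] at g1 g8
  norm_num only [if_true, if_false] at g1 g8
  simp only [wp_seq_iff, wp_assign_iff, Expr.ev, Expr.time]
  have e6 : τ.reg 6 = σ.reg 7 := by rw [hF.reg 6 rfl]; simp
  have e19 : τ.reg 19 = σ.reg 7 := by rw [hF.reg 19 rfl]; simp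
  have e21 : τ.reg 21 = g := by rw [hF.reg 21 rfl]; simp [h21]
  refine wp_flood L (fun v => if v ∈ l₀ then σ.reg 38 else c v) l₀ (by simpa using g3) ?_ ?_ g2 ?_ ?_ ?_
  · simpa [e6] using g1
  · simp [e6, e19]
  · intro v hv
    simpa [hv, g11] using hzb
  · simpa [g11, g12] using hzb
  simp only [Memory.setReg_reg]
  norm_num only [if_true, if_false]
  simp only [e6, e21, g11, g12]
  intro t₁ τ₁ l₁ hfl hdone ht₁ hF₁
  have hold : ∀ v ∈ l₀ ++ l₁, c v = b := by
    intro v hv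
    rcases List.mem_append.1 hv with hv | hv
    · exact g4 v hv
    · have := hfl.old v hv
      split_ifs at this
      exacts [(hzb this).elim, this]
  have hcols₁ : ∀ v : Fin n, τ₁.arr 0 v = if v ∈ l₀ ++ l₁ then σ.reg 38 else c v := by
    intro v
    rw [hfl.cols v]
    simp only [List.mem_append]
    by_cases h1 : v ∈ l₀ <;> by_cases h2 : v ∈ l₁ <;> simp [h1, h2]
  have hlen := hfl.seg.len
  refine ⟨l₀ ++ l₁, hfl.nodup, hold, hcols₁, ?_, ?_, ?_, ?_, ?_, by omega, by omega⟩
  · exact (g5.resolve_left hne).of_subset (fun v hv => List.mem_append_left _ hv) hfl.reach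
  · intro f hf
    obtain ⟨i, hi⟩ := List.mem_iff_getElem?.1 hf
    obtain ⟨v, hv, hn⟩ := g6 i f (Nat.zero_le _) hi
    exact ⟨v, List.mem_append_left _ hv, hn⟩
  · rcases hfl.lim with rfl | h
    · left; simpa using g7
    · exact Or.inr h
  -- If the flood ended with fewer than `g` vertices, the limit played no role. Then the flooded set
  -- is closed within the connected class `b` and equals it, although this class has at least `g`
  -- vertices.
  · by_contra hlt
    obtain ⟨r, hr⟩ := List.exists_mem_of_ne_nil l₀ hne
    have hsub : {v | c v = b} ⊆ {v | v ∈ l₀ ++ l₁} := by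
      refine hB.subset_of_closed (g4 r hr) (List.mem_append_left _ hr) fun u v hu hv hul huv => ?_
      rcases hdone u hul v huv with h | h
      · rw [hcols₁] at h
        by_contra hvl
        rw [if_neg (show ¬ v ∈ l₀ ++ l₁ from hvl)] at h
        exact h hv
      · omega
    have h1 := Set.ncard_le_ncard hsub (List.finite_toSet _)
    have h2 : {v | v ∈ l₀ ++ l₁}.ncard ≤ (l₀ ++ l₁).length := by
      classical
      rw [← List.coe_toFinset, Set.ncard_coe_finset]
      exact List.toFinset_card_le _
    omega
  · intro i hi
    rw [hfl.keep i (by omega)]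
    exact g8 i hi

/-- The separator that is found when not all active colours can be reached. -/
theorem wp_layerSep {qy : ℕ → ℕ → ℕ} {s g : ℕ} {σ : Memory} {t : ℕ}
    {Φ : ℕ → Memory → Prop} {l : List (Fin n × ℕ)} (hst : BfsSt G c b A s g σ l)
    (hcols : ∀ v : Fin n, σ.arr 0 v = c v) (h34 : s ≤ σ.reg 34) (h35 : σ.reg 34 ≤ σ.reg 35)
    (hl : σ.reg 35 ≤ s + l.length)
    (hΦ : ∀ (t' : ℕ) (τ : Memory) (Q : List (Fin n)), Q.length = σ.reg 35 - σ.reg 34 →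
      (∀ v, v ∈ Q ↔ ∃ i k, σ.reg 34 ≤ s + i ∧ s + i < σ.reg 35 ∧ l[i]? = some (v, k)) →
      (∀ v : Fin n, τ.arr 0 v = if v ∈ Q then σ.reg 38 else c v) →
      t' ≤ t + 20 * (σ.reg 35 - σ.reg 34) + 10 → Frame layerSep σ τ → Φ t' τ) :
    wp qy layerSep Φ t σ := by
  suffices h : wp qy layerSep (fun t' τ => ∃ Q : List (Fin n), Q.length = σ.reg 35 - σ.reg 34 ∧
      (∀ v, v ∈ Q ↔ ∃ i k, σ.reg 34 ≤ s + i ∧ s + i < σ.reg 35 ∧ l[i]? = some (v, k)) ∧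
      (∀ v : Fin n, τ.arr 0 v = if v ∈ Q then σ.reg 38 else c v) ∧
      t' ≤ t + 20 * (σ.reg 35 - σ.reg 34) + 10) t σ from
    h.mono fun t' τ _ hF ⟨Q, h1, h2, h3, h4⟩ => hΦ t' τ Q h1 h2 h3 h4 hF
  simp only [layerSep, Program.block, wp_seq_iff, wp_assign_iff, Expr.ev, Expr.time]
  refine wp_loop_frame (fun t' τ => ∃ Q : List (Fin n), τ.reg 36 = σ.reg 34 + Q.length ∧
      τ.reg 36 ≤ σ.reg 35 ∧
      (∀ v, v ∈ Q ↔ ∃ i k, σ.reg 34 ≤ s + i ∧ s + i < τ.reg 36 ∧ l[i]? = some (v, k)) ∧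
      (∀ v : Fin n, τ.arr 0 v = if v ∈ Q then σ.reg 38 else c v) ∧
      t' ≤ t + 2 + 20 * Q.length) (t + 2 + 20 * (σ.reg 35 - σ.reg 34)) ?_ ?_ ?_ ?_
  · refine ⟨[], by simp, by simpa using h35, ?_, by simpa using hcols, by omega⟩
    intro v
    simp only [List.not_mem_nil, Memory.setReg_reg, false_iff]
    norm_num only [if_true, if_false]
    rintro ⟨i, k, h1, h2, -⟩
    omega
  · rintro t' τ ⟨Q, h1, h2, -, -, h3⟩
    omega
  · rintro t' τ hF ⟨Q, h1, h2, h3, h4, h5⟩ hne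
    have e35 : τ.reg 35 = σ.reg 35 := by rw [hF.reg 35 rfl]; simp
    have e38 : τ.reg 38 = σ.reg 38 := by rw [hF.reg 38 rfl]; simp
    have e5 : τ.arr 5 = σ.arr 5 := by rw [hF.arr 5 rfl]; simp
    simp only [Expr.ev, e35, ne_eq, ite_eq_right_iff, one_ne_zero, imp_false, not_not] at hne
    have hi : τ.reg 36 - s < l.length := by omega
    obtain ⟨⟨v, k⟩, hv⟩ : ∃ x, l[τ.reg 36 - s]? = some x := ⟨_, List.getElem?_eq_getElem hi⟩
    have hpos : τ.arr 5 (τ.reg 36) = v := by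
      have := hst.vert _ _ hv
      rw [show s + (τ.reg 36 - s) = τ.reg 36 by omega] at this
      rw [e5]; exact this
    simp only [wp_seq_iff, wp_assign_iff, wp_write_iff, Expr.ev, Expr.time, hpos,
      Memory.setArr_reg]
    refine ⟨Q ++ [v], ?_, ?_, ?_, ?_, ?_⟩
    · simp [h1, add_assoc]
    · simpa using hne
    · intro w
      rw [List.mem_append, List.mem_singleton, h3]
      simp only [Memory.setReg_reg, Memory.setArr_reg]
      norm_num only [if_true, if_false]
      constructor
      · rintro (⟨i, k', d1, d2, d3⟩ | rfl)
        · exact ⟨i, k', d1, by omega, d3⟩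
        · exact ⟨τ.reg 36 - s, k, by omega, by omega, hv⟩
      · rintro ⟨i, k', d1, d2, d3⟩
        rcases Nat.lt_or_ge (s + i) (τ.reg 36) with hlt | hge
        · exact Or.inl ⟨i, k', d1, hlt, d3⟩
        · obtain rfl : i = τ.reg 36 - s := by omega
          rw [hv, Option.some_inj, Prod.mk.injEq] at d3
          exact Or.inr d3.1.symm
    · intro w
      simp only [Memory.setReg_arr, Memory.setArr_arr]
      norm_num only [if_true, if_false]
      rw [Function.update_apply, h4, e38]
      simp only [Fin.val_inj, List.mem_append, List.mem_singleton]
      by_cases hw : w = v <;> simp [hw]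
    · rw [List.length_append, List.length_singleton]; omega
  · rintro t' τ hF ⟨Q, h1, h2, h3, h4, h5⟩ he
    have e35 : τ.reg 35 = σ.reg 35 := by rw [hF.reg 35 rfl]; simp
    simp only [Expr.ev, e35, ite_eq_right_iff, one_ne_zero, imp_false] at he
    have e : τ.reg 36 = σ.reg 35 := by omega
    refine ⟨Q, by omega, ?_, h4, ?_⟩
    · rw [← e]; exact h3
    · simp only [Expr.time]; omega

end Separators

end WordRAM


namespace WordRAM

/-! ### Growing a clique of trees -/

section Trees

variable {V : Type*} {G : SimpleGraph V} {c : V → ℕ} {p : Set V} {b c₀ s N : ℕ}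

/-- In the set `p` of `N` vertices, the vertices of the colour `b` form a connected set with more
than half of the vertices, and the active colours are those of pairwise adjacent connected sets;
each of them has at most `s` vertices next to the colour `b`. -/
structure Trees (G : SimpleGraph V) (c : V → ℕ) (p : Set V) (b c₀ s N : ℕ) : Prop where
  conn : Conn G {v | c v = b}
  sub : ∀ v, c v = b → v ∈ p
  inside : ∀ v ∈ p, c v = b ∨ c₀ ≤ c v
  outside : ∀ v, v ∉ p → c v < c₀
  big : N < 2 * {v | c v = b}.ncard
  conn_act : ∀ f, IsActive G c b c₀ f → Conn G {v | c v = f}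
  adj_act : ∀ f f', IsActive G c b c₀ f → IsActive G c b c₀ f' → f ≠ f' →
    ∃ u v, c u = f ∧ c v = f' ∧ G.Adj u v
  few : ∀ f, IsActive G c b c₀ f → {v | c v = f ∧ Near G c b v}.ncard ≤ s

/-- The active trees are connected, pairwise disjoint as colour classes, and pairwise adjacent: they
are the branch sets of a clique minor. This is the only place where the separator search uses the
excluded minor. -/
theorem Trees.length_lt {h : ℕ} (hT : Trees G c p b c₀ s N) (hG : ¬ CliqueMinor h G) {A : List ℕ}
    (hA : A.Nodup) (hact : ∀ f ∈ A, IsActive G c b c₀ f) : A.length < h := by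
  by_contra hlt
  refine hG (CliqueMinor.mono (not_lt.1 hlt) ⟨fun i => {v | c v = A[i]}, fun i => ?_,
      fun i j hij => ?_⟩)
  · exact hT.conn_act _ (hact _ (List.getElem_mem _))
  · have hne : A[i] ≠ A[j] := fun h => hij (Fin.ext ((hA.getElem_inj_iff).1 h))
    obtain ⟨u, v, hu, hv, huv⟩ := hT.adj_act _ _ (hact _ (List.getElem_mem i.2))
      (hact _ (List.getElem_mem j.2)) hne
    refine ⟨Set.disjoint_left.2 fun x hx hx' => hne (hx.symm.trans hx'), u, hu, v, hv, huv⟩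

/-- The separator `Q` meets the neighbourhoods of all trees, and it becomes part of a new tree. -/
theorem Trees.path [Finite V] (hT : Trees G c p b c₀ s N) {Q B' : Set V} (hQ : ∀ v ∈ Q, c v = b)
    (hQc : Conn G Q) (hit : ∀ f, IsActive G c b c₀ f → ∃ v ∈ Q, Near G c f v) (hQs : Q.ncard ≤ s)
    (hB' : ∀ v ∈ B', c v = b ∧ v ∉ Q) (hB'c : Conn G B')
    (hcl : ∀ u ∈ B', ∀ v, G.Adj u v → c v = b → v ∉ Q → v ∈ B') (hbig : N < 2 * B'.ncard)
    {c₂ : V → ℕ} {x y : ℕ} (hin : ∀ v ∈ B', c₂ v = x) (hold : ∀ v, c v = b → v ∉ B' → c₂ v = y)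
    (hoth : ∀ v, c v ≠ b → c₂ v = c v) (hxy : x ≠ y) (hx : ∀ v, c v < x) (hy : ∀ v, c v < y)
    (hc₀ : c₀ ≤ y) :
    Trees G c₂ p x c₀ s N ∧ {v | c₂ v = x}.ncard + Q.ncard ≤ {v | c v = b}.ncard := by
  obtain ⟨r, hr⟩ := hQc.1
  have hby : b ≠ y := by have := hy r; rw [hQ r hr] at this; omega
  have hbx : b ≠ x := by have := hx r; rw [hQ r hr] at this; omega
  have hclass : ∀ v, (v ∈ B' ∧ c v = b ∧ c₂ v = x) ∨ (v ∉ B' ∧ c v = b ∧ c₂ v = y) ∨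
      (v ∉ B' ∧ c v ≠ b ∧ c₂ v = c v ∧ c₂ v ≠ x ∧ c₂ v ≠ y) := by
    intro v
    by_cases h1 : v ∈ B'
    · exact Or.inl ⟨h1, (hB' v h1).1, hin v h1⟩
    · by_cases h2 : c v = b
      · exact Or.inr (Or.inl ⟨h1, h2, hold v h2 h1⟩)
      · have h3 := hx v
        have h4 := hy v
        rw [hoth v h2]
        exact Or.inr (Or.inr ⟨h1, h2, rfl, by omega, by omega⟩)
  have ex : ∀ v, c₂ v = x ↔ v ∈ B' := by
    intro v
    rcases hclass v with ⟨h1, h2, h3⟩ | ⟨h1, h2, h3⟩ | ⟨h1, h2, h3, h4, h5⟩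
    · exact ⟨fun _ => h1, fun _ => h3⟩
    · exact ⟨fun h => (hxy (h.symm.trans h3)).elim, fun h => (h1 h).elim⟩
    · exact ⟨fun h => (h4 h).elim, fun h => (h1 h).elim⟩
  have ey : ∀ v, c₂ v = y ↔ c v = b ∧ v ∉ B' := by
    intro v
    rcases hclass v with ⟨h1, h2, h3⟩ | ⟨h1, h2, h3⟩ | ⟨h1, h2, h3, h4, h5⟩
    · exact ⟨fun h => (hxy (h3.symm.trans h)).elim, fun h => (h.2 h1).elim⟩
    · exact ⟨fun h => ⟨h2, h1⟩, fun _ => h3⟩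
    · exact ⟨fun h => (h5 h).elim, fun h => (h2 h.1).elim⟩
  have ef : ∀ f, f ≠ x → f ≠ y → ∀ v, c₂ v = f ↔ c v = f ∧ f ≠ b := by
    intro f hfx hfy v
    rcases hclass v with ⟨h1, h2, h3⟩ | ⟨h1, h2, h3⟩ | ⟨h1, h2, h3, h4, h5⟩
    · exact ⟨fun h => (hfx (h.symm.trans h3)).elim, fun h => (h.2 (h.1.symm.trans h2)).elim⟩
    · exact ⟨fun h => (hfy (h.symm.trans h3)).elim, fun h => (h.2 (h.1.symm.trans h2)).elim⟩
    · exact ⟨fun h => ⟨h3.symm.trans h, fun h' => h2 (h3.symm.trans (h.trans h'))⟩,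
        fun h => h3.trans h.1⟩
  have hQB : Q ⊆ {v | c v = b ∧ v ∉ B'} := fun v hv => ⟨hQ v hv, fun h => (hB' v h).2 hv⟩
  have hact : ∀ f, f ≠ y → IsActive G c₂ x c₀ f → IsActive G c b c₀ f ∧ f ≠ x := by
    rintro f hfy ⟨h1, h2, v, u, h3, h4, h5⟩
    have h6 := (ef f h2 hfy u).1 h4
    exact ⟨⟨h1, h6.2, v, u, (hB' v ((ex v).1 h3)).1, h6.1, h5⟩, h2⟩
  have hclassf : ∀ f, f ≠ y → IsActive G c₂ x c₀ f → {v | c₂ v = f} = {v | c v = f} := by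
    intro f hfy hf
    have h1 := hact f hfy hf
    ext v
    simp only [Set.mem_setOf_eq, ef f h1.2 hfy v]
    exact ⟨fun h => h.1, fun h => ⟨h, h1.1.2.1⟩⟩
  have hBx : {v | c₂ v = x} = B' := Set.ext ex
  have hBy : {v | c₂ v = y} = {v | c v = b ∧ v ∉ B'} := Set.ext ey
  have hyadj : ∀ f, f ≠ y → IsActive G c₂ x c₀ f →
      ∃ u v, c₂ u = y ∧ c₂ v = f ∧ G.Adj u v := by
    intro f hfy hf
    have h1 := hact f hfy hf
    obtain ⟨v, hv, u, hu, hu'⟩ := hit f h1.1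
    exact ⟨v, u, (ey v).2 (hQB hv), (ef f h1.2 hfy u).2 ⟨hu', h1.1.2.1⟩, hu⟩
  refine ⟨⟨?_, ?_, ?_, ?_, ?_, ?_, ?_, ?_⟩, ?_⟩
  · rw [hBx]; exact hB'c
  · intro v hv
    exact hT.sub v (hB' v ((ex v).1 hv)).1
  · intro v hv
    rcases hclass v with ⟨h1, h2, h3⟩ | ⟨h1, h2, h3⟩ | ⟨h1, h2, h3, h4, h5⟩
    · exact Or.inl h3
    · exact Or.inr (by omega)
    · exact Or.inr (by rw [h3]; exact (hT.inside v hv).resolve_left h2)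
  · intro v hv
    rw [hoth v fun h => hv (hT.sub v h)]
    exact hT.outside v hv
  · rw [hBx]; exact hbig
  · intro f hf
    by_cases hfy : f = y
    · subst hfy
      rw [hBy]
      refine hQc.of_subset hQB fun v hv => ?_
      -- Walk through the connected class `b` starting in `Q`. Every edge that leaves `B'` within
      -- the class ends in `Q`, so each vertex outside `B'` is reachable from `Q` without entering
      -- `B'`. Hence `Q` together with the small components is connected.
      have hsub : {v | c v = b} ⊆ {v | v ∈ B' ∨ ∃ u ∈ Q,
          Relation.ReflTransGen (AdjIn G {v | c v = b ∧ v ∉ B'}) u v} := by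
        refine hT.conn.subset_of_closed (hQ r hr) (Or.inr ⟨r, hr, .refl⟩) fun u v hu hv hU huv => ?_
        by_cases hvB : v ∈ B'
        · exact Or.inl hvB
        by_cases hvQ : v ∈ Q
        · exact Or.inr ⟨v, hvQ, .refl⟩
        have huB : u ∉ B' := fun h => hvB (hcl u h v huv hv hvQ)
        obtain ⟨w, hw, hwu⟩ := hU.resolve_left huB
        exact Or.inr ⟨w, hw, hwu.tail ⟨huv, ⟨hu, huB⟩, hv, hvB⟩⟩
      exact (hsub hv.1).resolve_left hv.2
    · rw [hclassf f hfy hf]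
      exact hT.conn_act f (hact f hfy hf).1
  · intro f f' hf hf' hne
    by_cases hfy : f = y
    · subst hfy
      exact hyadj f' (Ne.symm hne) hf'
    · by_cases hfy' : f' = y
      · subst hfy'
        obtain ⟨u, v, h1, h2, h3⟩ := hyadj f hfy hf
        exact ⟨v, u, h2, h1, h3.symm⟩
      · have h1 := hact f hfy hf
        have h1' := hact f' hfy' hf'
        obtain ⟨u, v, hu, hv, huv⟩ := hT.adj_act f f' h1.1 h1'.1 hne
        exact ⟨u, v, (ef f h1.2 hfy u).2 ⟨hu, h1.1.2.1⟩, (ef f' h1'.2 hfy' v).2 ⟨hv, h1'.1.2.1⟩,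
            huv⟩
  · intro f hf
    by_cases hfy : f = y
    · subst hfy
      -- A vertex of the new tree next to `B'` must lie in `Q`, since `B'` is a full component of
      -- the rest.
      refine le_trans (Set.ncard_le_ncard ?_ (Set.toFinite _)) hQs
      rintro v ⟨hv, u, huv, hu⟩
      rw [ey] at hv
      by_contra hvQ
      exact hv.2 (hcl u ((ex u).1 hu) v huv.symm hv.1 hvQ)
    · refine le_trans (Set.ncard_le_ncard ?_ (Set.toFinite _)) (hT.few f (hact f hfy hf).1)
      rintro v ⟨hv, u, huv, hu⟩
      exact ⟨((ef f (hact f hfy hf).2 hfy v).1 hv).1, u, huv, (hB' u ((ex u).1 hu)).1⟩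
  · rw [hBx, ← Set.ncard_union_eq (Set.disjoint_left.2 fun v hv hv' => (hB' v hv).2 hv')
      (Set.toFinite _) (Set.toFinite _)]
    refine Set.ncard_le_ncard ?_ (Set.toFinite _)
    rintro v (hv | hv)
    exacts [(hB' v hv).1, hQ v hv]

/-- The tree of the colour `m` is extended by the set `D`. -/
theorem Trees.layer [Finite V] (hT : Trees G c p b c₀ s N) {Q B' D : Set V} (hQs : Q.ncard ≤ s)
    (hB' : ∀ v ∈ B', c v = b ∧ v ∉ Q) (hB'c : Conn G B')
    (hcl : ∀ u ∈ B', ∀ v, G.Adj u v → c v = b → v ∉ Q → v ∈ B') (hbig : N < 2 * B'.ncard)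
    {m : ℕ} (hm : IsActive G c b c₀ m) (hBm : ∀ v ∈ B', ¬ Near G c m v)
    (hD : ∀ v ∈ D, c v = b ∧ v ∉ B')
    (hDc : ∀ v ∈ D, ∃ u, c u = m ∧ Relation.ReflTransGen (AdjIn G {v | c v = m ∨ v ∈ D}) u v)
    (hDcl : ∀ u v, c u = m ∨ u ∈ D → G.Adj u v → c v = b → v ∉ B' → v ∈ D)
    {c₂ : V → ℕ} {x : ℕ} (hin : ∀ v ∈ D, c₂ v = m) (hold : ∀ v, c v = b → v ∉ D → c₂ v = x)
    (hoth : ∀ v, c v ≠ b → c₂ v = c v) (hx : ∀ v, c v < x) :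
    Trees G c₂ p x c₀ s N ∧ {v | c₂ v = x}.ncard + D.ncard = {v | c v = b}.ncard := by
  obtain ⟨hm1, hmb, -, um, -, hum, -⟩ := id hm
  have hmx : m ≠ x := by have := hx um; omega
  obtain ⟨r, hr⟩ := hB'c.1
  have hrb := (hB' r hr).1
  have hbx : b ≠ x := by have := hx r; omega
  have hclass : ∀ v, (v ∈ D ∧ c v = b ∧ c₂ v = m) ∨ (v ∉ D ∧ c v = b ∧ c₂ v = x) ∨
      (v ∉ D ∧ c v ≠ b ∧ c₂ v = c v ∧ c₂ v ≠ x) := by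
    intro v
    by_cases h1 : v ∈ D
    · exact Or.inl ⟨h1, (hD v h1).1, hin v h1⟩
    · by_cases h2 : c v = b
      · exact Or.inr (Or.inl ⟨h1, h2, hold v h2 h1⟩)
      · have h3 := hx v
        rw [hoth v h2]
        exact Or.inr (Or.inr ⟨h1, h2, rfl, by omega⟩)
  have ex : ∀ v, c₂ v = x ↔ c v = b ∧ v ∉ D := by
    intro v
    rcases hclass v with ⟨h1, h2, h3⟩ | ⟨h1, h2, h3⟩ | ⟨h1, h2, h3, h4⟩
    · exact ⟨fun h => (hmx (h3.symm.trans h)).elim, fun h => (h.2 h1).elim⟩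
    · exact ⟨fun _ => ⟨h2, h1⟩, fun _ => h3⟩
    · exact ⟨fun h => (h4 h).elim, fun h => (h2 h.1).elim⟩
  have em : ∀ v, c₂ v = m ↔ c v = m ∨ v ∈ D := by
    intro v
    rcases hclass v with ⟨h1, h2, h3⟩ | ⟨h1, h2, h3⟩ | ⟨h1, h2, h3, h4⟩
    · exact ⟨fun _ => Or.inr h1, fun _ => h3⟩
    · exact ⟨fun h => (hmx (h.symm.trans h3)).elim, fun h => h.elim
        (fun h => (hmb (h.symm.trans h2)).elim) fun h => (h1 h).elim⟩
    · rw [h3]; exact ⟨Or.inl, fun h => h.resolve_right h1⟩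
  have ef : ∀ f, f ≠ x → f ≠ m → ∀ v, c₂ v = f ↔ c v = f ∧ f ≠ b := by
    intro f hfx hfm v
    rcases hclass v with ⟨h1, h2, h3⟩ | ⟨h1, h2, h3⟩ | ⟨h1, h2, h3, h4⟩
    · exact ⟨fun h => (hfm (h.symm.trans h3)).elim, fun h => (h.2 (h.1.symm.trans h2)).elim⟩
    · exact ⟨fun h => (hfx (h.symm.trans h3)).elim, fun h => (h.2 (h.1.symm.trans h2)).elim⟩
    · exact ⟨fun h => ⟨h3.symm.trans h, fun h' => h2 (h3.symm.trans (h.trans h'))⟩,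
        fun h => h3.trans h.1⟩
  have hact : ∀ f, IsActive G c₂ x c₀ f → IsActive G c b c₀ f ∧ f ≠ x := by
    rintro f ⟨h1, h2, v, u, h3, h4, h5⟩
    by_cases hfm : f = m
    · subst hfm; exact ⟨hm, h2⟩
    · have h6 := (ef f h2 hfm u).1 h4
      exact ⟨⟨h1, h6.2, v, u, ((ex v).1 h3).1, h6.1, h5⟩, h2⟩
  have hle : ∀ f, IsActive G c₂ x c₀ f → ∀ v, c v = f → c₂ v = f := by
    intro f hf v hv
    have h1 := hact f hf
    rw [hoth v (hv ▸ h1.1.2.1), hv]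
  have hBx : {v | c₂ v = x} = {v | c v = b} \ D := Set.ext ex
  have hBB : B' ⊆ {v | c v = b} \ D := fun v hv => ⟨(hB' v hv).1, fun h => (hD v h).2 hv⟩
  refine ⟨⟨?_, ?_, ?_, ?_, ?_, ?_, ?_, ?_⟩, ?_⟩
  · rw [hBx]
    refine hB'c.of_subset hBB fun v hv => ?_
    -- An edge from `D` to a vertex outside `B'` stays in `D`, so a walk that starts in `B'` can
    -- only come out of `D` into `B'`. Thus everything outside `D` hangs together with `B'`.
    have hsub : {v | c v = b} ⊆ {v | v ∈ D ∨ ∃ u ∈ B',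
        Relation.ReflTransGen (AdjIn G ({v | c v = b} \ D)) u v} := by
      refine hT.conn.subset_of_closed hrb (Or.inr ⟨r, hr, .refl⟩) fun u v hu hv hU huv => ?_
      by_cases hvD : v ∈ D
      · exact Or.inl hvD
      by_cases hvB : v ∈ B'
      · exact Or.inr ⟨v, hvB, .refl⟩
      have huD : u ∉ D := fun h => hvD (hDcl u v (Or.inr h) huv hv hvB)
      obtain ⟨w, hw, hwu⟩ := hU.resolve_left huD
      exact Or.inr ⟨w, hw, hwu.tail ⟨huv, ⟨hu, huD⟩, hv, hvD⟩⟩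
    exact (hsub hv.1).resolve_left hv.2
  · intro v hv
    exact hT.sub v ((ex v).1 hv).1
  · intro v hv
    rcases hclass v with ⟨h1, h2, h3⟩ | ⟨h1, h2, h3⟩ | ⟨h1, h2, h3, h4⟩
    · exact Or.inr (by omega)
    · exact Or.inl h3
    · exact Or.inr (by rw [h3]; exact (hT.inside v hv).resolve_left h2)
  · intro v hv
    rw [hoth v fun h => hv (hT.sub v h)]
    exact hT.outside v hv
  · rw [hBx]
    have := Set.ncard_le_ncard hBB (Set.toFinite _)
    omega
  · intro f hf
    by_cases hfm : f = m
    · subst hfm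
      have e : {v | c₂ v = f} = {v | c v = f ∨ v ∈ D} := Set.ext em
      rw [e]
      refine (hT.conn_act f hm).of_subset (fun v hv => Or.inl hv) fun v hv => ?_
      rcases hv with hv | hv
      · exact ⟨v, hv, .refl⟩
      · exact hDc v hv
    · have h1 := hact f hf
      have e : {v | c₂ v = f} = {v | c v = f} := by
        ext v
        simp only [Set.mem_setOf_eq, ef f h1.2 hfm v]
        exact ⟨fun h => h.1, fun h => ⟨h, h1.1.2.1⟩⟩
      rw [e]
      exact hT.conn_act f h1.1
  · intro f f' hf hf' hne
    obtain ⟨u, v, hu, hv, huv⟩ := hT.adj_act f f' (hact f hf).1 (hact f' hf').1 hne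
    exact ⟨u, v, hle f hf u hu, hle f' hf' v hv, huv⟩
  · intro f hf
    by_cases hfm : f = m
    · subst hfm
      -- A vertex left in the class and adjacent to the extended tree lies in `B'`, or else `D`
      -- would have absorbed it. The old tree does not touch `B'`, so the contact is a vertex of
      -- `D`, and a vertex of `D` next to the component `B'` belongs to `Q`.
      refine le_trans (Set.ncard_le_ncard ?_ (Set.toFinite _)) hQs
      rintro v ⟨hv, u, huv, hu⟩
      rw [ex] at hu
      rw [em] at hv
      have huB : u ∈ B' := by
        by_contra h
        exact hu.2 (hDcl v u hv huv hu.1 h)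
      rcases hv with hv | hv
      · exact (hBm u huB ⟨v, huv.symm, hv⟩).elim
      · by_contra hvQ
        exact (hD v hv).2 (hcl u huB v huv.symm (hD v hv).1 hvQ)
    · have h1 := hact f hf
      refine le_trans (Set.ncard_le_ncard ?_ (Set.toFinite _)) (hT.few f h1.1)
      rintro v ⟨hv, u, huv, hu⟩
      exact ⟨((ef f h1.2 hfm v).1 hv).1, u, huv, ((ex u).1 hu).1⟩
  · rw [hBx]
    exact Set.ncard_sdiff_add_ncard_of_subset (fun v hv => (hD v hv).1) (Set.toFinite _)

end Trees

/-! ### Progress -/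

section Progress

variable {V : Type*} {G : SimpleGraph V} {c : V → ℕ} {b : ℕ} {A : List ℕ}

/-- A connected set is large if it takes many steps to exhaust it. -/
theorem le_ncard_of_steps [Finite V] {K : Set V} (hK : Conn G K) {S : ℕ → Set V} {a g : ℕ}
    (hmono : ∀ i, S i ⊆ S (i + 1))
    (hS : ∀ i, ∀ v ∈ K, v ∈ S i → ∀ w ∈ K, G.Adj v w → w ∈ S (i + 1)) {x y : V}
    (hx : x ∈ K) (hxS : x ∈ S a) (hy : y ∈ K) (hyS : y ∉ S (a + g)) : g ≤ K.ncard := by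
  have hmono' : ∀ i k, S i ⊆ S (i + k) := by
    intro i k
    induction k with
    | zero => exact subset_rfl
    | succ k ih => exact ih.trans (hmono _)
  -- As long as `y` is missing, connectedness gives an edge of `K` leaving the current set, and its
  -- other end is caught one step later: every step gains a vertex of `K`.
  have key : ∀ i, i ≤ g → i + 1 ≤ (K ∩ S (a + i)).ncard := by
    intro i
    induction i with
    | zero =>
      intro _
      exact (Set.ncard_pos (Set.toFinite _)).2 ⟨x, hx, hxS⟩
    | succ i ih =>
      intro hi
      obtain ⟨u, v, hu, hv, huS, hvS, huv⟩ := hK.exists_adj hx (hmono' a i hxS) hy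
        (fun h => hyS (by
          have := hmono' (a + i) (g - i) h
          rwa [show a + i + (g - i) = a + g by omega] at this))
      have h1 : insert v (K ∩ S (a + i)) ⊆ K ∩ S (a + (i + 1)) := by
        rintro w (rfl | hw)
        · exact ⟨hv, hS _ u hu huS w hv huv⟩
        · exact ⟨hw.1, hmono _ hw.2⟩
      have h2 := Set.ncard_le_ncard h1 (Set.toFinite _)
      rw [Set.ncard_insert_of_notMem (fun h => hvS h.2) (Set.toFinite _)] at h2
      have := ih (by omega)
      omega
  have h1 := key g le_rfl
  have h2 := Set.ncard_le_ncard (Set.inter_subset_left : K ∩ S (a + g) ⊆ K) (Set.toFinite _)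
  omega

/-- A walk that gets beyond copy `k` has to pass from copy `k` to copy `k + 1`, and this happens
only at vertices next to the `k`-th tree. -/
theorem exists_near_of_lay {k : ℕ} {f : ℕ} (hf : A[k]? = some f) {t : ℕ} : ∀ {x : V × ℕ},
    x ∈ lay G c b A t → k < x.2 → ∃ a, c a = b ∧ Near G c f a ∧ (a, k + 1) ∈ lay G c b A t := by
  induction t with
  | zero => intro x hx hk; rw [hx.2] at hk; omega
  | succ t ih =>
    rintro x (hx | ⟨y, hy, hyx⟩) hk
    · obtain ⟨a, h1, h2, h3⟩ := ih hx hk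
      exact ⟨a, h1, h2, Or.inl h3⟩
    · by_cases hky : k < y.2
      · obtain ⟨a, h1, h2, h3⟩ := ih hy hky
        exact ⟨a, h1, h2, Or.inl h3⟩
      · rcases hyx with ⟨h1, -⟩ | ⟨h1, h2, f', h3, h4⟩
        · omega
        · obtain rfl : k = y.2 := by omega
          rw [hf, Option.some_inj] at h3
          subst h3
          exact ⟨y.1, lay_col hy, h4, lay_succ_of_adj hy (Or.inr ⟨rfl, rfl, f, hf, h4⟩)⟩

/-- A connected set that avoids the `j`-th layer lies before or behind it in each copy. -/
theorem lay_dichotomy {B' : Set V} (hB'c : Conn G B') (hb : ∀ v ∈ B', c v = b) {j k : ℕ}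
    (hj : 0 < j) (hQ : ∀ v ∈ B', (v, k) ∈ lay G c b A j → (v, k) ∈ lay G c b A (j - 1)) {r : V}
    (hr : r ∈ B') (hrl : (r, k) ∈ lay G c b A j) : ∀ v ∈ B', (v, k) ∈ lay G c b A (j - 1) := by
  intro v hv
  refine hQ v hv (hB'c.subset_of_closed (U := {v | (v, k) ∈ lay G c b A j}) hr hrl ?_ hv)
  intro u w hu hw hul huw
  have := lay_succ_of_adj (hQ u hu hul) (y := (w, k)) (Or.inl ⟨rfl, huw, hb w hw⟩)
  rwa [Nat.sub_add_cancel hj] at this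

/-- If `B'` lies before the layer in the `k`-th copy and behind it in the next copy, then
the set `D` of the vertices that are separated from it is large. -/
theorem le_ncard_of_layer [Finite V] (hB : Conn G {v | c v = b}) {B' D : Set V}
    (hb : ∀ v ∈ B', c v = b) (hne : B'.Nonempty) {j k g tl cm m : ℕ} (hj1 : tl + g < j)
    (hj2 : j ≤ tl + 2 * g) (hm : A[k]? = some m)
    (hbefore : ∀ v ∈ B', (v, k) ∈ lay G c b A (j - 1))
    (hbehind : ∀ v ∈ B', (v, k + 1) ∉ lay G c b A j)
    (hcm : ∀ x ∈ lay G c b A (tl + 3 * g + 1), x.2 ≤ cm) {v₀ : V}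
    (hgoal : (v₀, cm) ∈ lay G c b A tl) (hact : ∃ a, c a = b ∧ Near G c m a)
    (hDcl : ∀ u v, c u = m ∨ u ∈ D → G.Adj u v → c v = b → v ∉ B' → v ∈ D) :
    (∀ v ∈ B', ¬ Near G c m v) ∧ g ≤ D.ncard := by
  have hj : 0 < j := by omega
  have hBm : ∀ v ∈ B', ¬ Near G c m v := by
    intro v hv hn
    have := lay_succ_of_adj (hbefore v hv) (y := (v, k + 1)) (Or.inr ⟨rfl, rfl, m, hm, hn⟩)
    rw [Nat.sub_add_cancel hj] at this
    exact hbehind v hv this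
  refine ⟨hBm, ?_⟩
  obtain ⟨r, hr⟩ := hne
  -- the component of a vertex next to the tree
  have hcomp : ∀ a, c a = b → Near G c m a → ∃ K, Conn G K ∧ a ∈ K ∧ (∀ v ∈ K, c v = b) ∧ K ⊆ D ∧
      ∃ w ∈ K, ∃ u ∈ B', G.Adj w u := by
    intro a ha han
    have haB : a ∉ B' := fun h => hBm a h han
    obtain ⟨f, haf, hf⟩ := han
    set K := {v | Relation.ReflTransGen (AdjIn G {v | c v = b ∧ v ∉ B'}) a v} with hK
    have hKs : ∀ v ∈ K, c v = b ∧ v ∉ B' := by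
      intro v hv
      cases hv with
      | refl => exact ⟨ha, haB⟩
      | tail _ h => exact h.2.2
    have hKD : K ⊆ D := by
      intro v hv
      induction hv with
      | refl => exact hDcl f a (Or.inl hf) haf.symm ha haB
      | tail _ h ih => exact hDcl _ _ (Or.inr ih) h.1 h.2.2.1 h.2.2.2
    refine ⟨K, Conn.of_root (r := a) .refl fun v hv => ?_, .refl, fun v hv => (hKs v hv).1, hKD, ?_⟩
    · have : ∀ v, Relation.ReflTransGen (AdjIn G {v | c v = b ∧ v ∉ B'}) a v →
          Relation.ReflTransGen (AdjIn G K) a v := by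
        intro v hv
        induction hv with
        | refl => exact .refl
        | tail h1 h2 ih => exact ih.tail ⟨h2.1, h1, h1.tail h2⟩
      exact this v hv
    · obtain ⟨u, v, hu, hv, huK, hvK, huv⟩ := hB.exists_adj (U := K) (r := a) ha .refl (hb r hr)
        (fun h => (hKs r h).2 hr)
      refine ⟨u, huK, v, ?_, huv⟩
      by_contra hvB
      exact hvK (Relation.ReflTransGen.tail huK ⟨huv, hKs u huK, hv, hvB⟩)
  have hstep : ∀ (K : Set V) (k' : ℕ), (∀ v ∈ K, c v = b) → ∀ i, ∀ v ∈ K,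
      v ∈ {v | (v, k') ∈ lay G c b A i} → ∀ w ∈ K, G.Adj v w → w ∈ {v | (v,
          k') ∈ lay G c b A (i + 1)} :=
    fun K k' hK i v _ hv w hw hvw => lay_succ_of_adj hv (Or.inl ⟨rfl, hvw, hK w hw⟩)
  rcases Nat.lt_or_ge k cm with hk | hk
  -- In copy `k + 1`, the crossing vertex `a` is reached by step `tl`, but `B'` is not reached even
  -- by step `j > tl + g`. The component of `a` outside `B'` extends to a neighbour of `B'`, so
  -- exhausting it takes more than `g` steps.
  · obtain ⟨a, ha, han, hal⟩ := exists_near_of_lay hm hgoal hk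
    obtain ⟨K, hK, haK, hKb, hKD, w, hw, u, hu, hwu⟩ := hcomp a ha han
    refine le_trans (le_ncard_of_steps hK (S := fun i => {v | (v, k + 1) ∈ lay G c b A i})
      (fun i v hv => Or.inl hv) (hstep K (k + 1) hKb) haK hal hw ?_)
      (Set.ncard_le_ncard hKD (Set.toFinite _))
    intro hwl
    have h1 : (w, k + 1) ∈ lay G c b A (j - 1) := lay_mono (by omega) hwl
    have h2 := lay_succ_of_adj h1 (y := (u, k + 1)) (Or.inl ⟨rfl, hwu, hb u hu⟩)
    rw [Nat.sub_add_cancel hj] at h2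
    exact hbehind u hu h2
  · have hk' : k = cm := by
      have := hcm _ (lay_mono (by omega) (hbefore r hr))
      simp only at this
      omega
    -- Here copy `k + 1` is not reached within `tl + 3 * g + 1` steps, so in copy `k` no vertex next
    -- to the tree is reached by step `tl + 3 * g`. A neighbour of `B'` in the same component,
    -- however, is reached by step `j ≤ tl + 2 * g`. The gap is again `g`.
    obtain ⟨a, ha, han⟩ := hact
    obtain ⟨K, hK, haK, hKb, hKD, w, hw, u, hu, hwu⟩ := hcomp a ha han
    refine le_trans (le_ncard_of_steps hK (S := fun i => {v | (v, k) ∈ lay G c b A i})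
      (a := tl + 2 * g) (fun i v hv => Or.inl hv) (hstep K k hKb) hw ?_ haK ?_)
      (Set.ncard_le_ncard hKD (Set.toFinite _))
    · have h2 := lay_succ_of_adj (hbefore u hu) (y := (w, k)) (Or.inl ⟨rfl, hwu.symm, hKb w hw⟩)
      rw [Nat.sub_add_cancel hj] at h2
      exact lay_mono hj2 h2
    · intro hal
      have h1 : (a, k) ∈ lay G c b A (tl + 3 * g) := lay_mono (by omega) hal
      have := hcm _ (lay_succ_of_adj h1 (y := (a, k + 1)) (Or.inr ⟨rfl, rfl, m, hm, han⟩))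
      simp only at this
      omega

end Progress

end WordRAM


/-! ### Finding a separator of the big class -/

namespace WordRAM

/-- Colour the components that the separator leaves. -/
def sepComps : Program :=
  .block [.assign 40 (.const 0), .assign 39 (.reg 16), .assign 8 (.reg 20), comps,
    .assign 16 (.reg 39)]

/-- Find a separator of the vertices of the colour in the register `20` and colour the components
that it leaves. -/
def findSep (h : ℕ) : Program :=
  .block [active, .assign 38 (.reg 15), .assign 15 (.add (.reg 15) (.const 1)), bfs h,
    .cond (.eq (.reg 32) (.reg 25)) pathSep layerSep, sepComps]

section FindSep

variable {n : ℕ} {G : SimpleGraph (Fin n)}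

/-- The situation while the piece `p` is processed; `σ` is the memory at the beginning, `c₁` and `c`
are the original and the current colouring. -/
structure PieceSt (σ τ : Memory) (p : List (Fin n)) (c₁ c : Fin n → ℕ) (b c₀ g N : ℕ) : Prop where
  cols : ∀ v : Fin n, τ.arr 0 v = c v
  r0 : τ.reg 0 = n
  r20 : τ.reg 20 = b
  r21 : τ.reg 21 = g
  r22 : τ.reg 22 = c₀
  r26 : τ.reg 26 = N
  r4 : τ.reg 4 = σ.reg 4
  r5 : τ.reg 5 = σ.reg 5
  top : τ.reg 16 = σ.reg 16
  queue_le : σ.reg 7 ≤ τ.reg 7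
  keep : ∀ i < σ.reg 7, τ.arr 1 i = σ.arr 1 i
  keep2 : ∀ i < σ.reg 16, τ.arr 2 i = σ.arr 2 i
  keep3 : ∀ i < σ.reg 16, τ.arr 3 i = σ.arr 3 i
  fresh : ∀ v, c v < τ.reg 15
  le_fresh : c₀ ≤ τ.reg 15
  pos : ∀ i, τ.arr 4 i < τ.reg 27
  mark : ∀ i, τ.arr 9 i ≤ τ.reg 24
  outside : ∀ v, v ∉ p → c v = c₁ v

/-- The set `Q` of the vertices of the colour `z` separates the vertices that had the colour `b` in
the colouring `c`; in the new colouring `c'` the components have colours greater than `z`. -/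
structure SepRes (G : SimpleGraph (Fin n)) (c c' : Fin n → ℕ) (b s N z : ℕ) (Q : Set (Fin n))
    (τ : Memory) : Prop where
  lt : ∀ v, c v < z
  old : ∀ v ∈ Q, c v = b
  sep : ∀ v ∈ Q, c' v = z
  other : ∀ v, c v ≠ b → c' v = c v
  rest : ∀ v, c v = b → v ∉ Q → z < c' v
  closed : ∀ u v, c u = b → u ∉ Q → G.Adj u v → c v = b → v ∉ Q → c' v = c' u
  few : Q.ncard ≤ s
  big : (τ.reg 40 = 0 ∧ ∀ f, z < f → 2 * {v | c' v = f}.ncard ≤ N) ∨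
    (z < τ.reg 40 ∧ Conn G {v | c' v = τ.reg 40} ∧ N < 2 * {v | c' v = τ.reg 40}.ncard ∧
      ∃ v : Fin n, c' v = τ.reg 40 ∧ τ.reg 41 = v)

/-- The separator `Q` comes from a layer. -/
structure LayerRes (G : SimpleGraph (Fin n)) (c : Fin n → ℕ) (b g : ℕ) (A : List ℕ)
    (Q : Set (Fin n)) (j tl cm : ℕ) (τ : Memory) : Prop where
  lt_length : cm < A.length
  lt_j : tl + g < j
  j_le : j ≤ tl + 2 * g
  mem : ∀ v, v ∈ Q ↔ ∃ k, (v, k) ∈ lay G c b A j ∧ (v, k) ∉ lay G c b A (j - 1)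
  before : ∀ (v : Fin n) (k : ℕ), (τ.reg 42 ≤ τ.arr 4 (k * n + v) ∧
    τ.arr 4 (k * n + v) < τ.reg 34) ↔ (v, k) ∈ lay G c b A (j - 1)
  le_cm : ∀ x ∈ lay G c b A (tl + 3 * g + 1), x.2 ≤ cm
  goal : ∃ v, (v, cm) ∈ lay G c b A tl

theorem ncard_setOf_mem {α : Type*} {l : List α} (hl : l.Nodup) : {v | v ∈ l}.ncard = l.length := by
  classical
  rw [← List.coe_toFinset, Set.ncard_coe_finset, List.toFinset_card_of_nodup hl]

theorem ncard_setOf_mem_le {α : Type*} (l : List α) : {v | v ∈ l}.ncard ≤ l.length := by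
  classical
  rw [← List.coe_toFinset, Set.ncard_coe_finset]
  exact List.toFinset_card_le _

/-- Fresh colours start above `z`, so comparison with `z` tells separator, components and everything
else apart, and the value `0` of the register `40` cannot be confused with the colour of a big
component. -/
theorem CompsSt.sepRes {σ τ : Memory} {c cQ c' : Fin n → ℕ} {C : List (List (Fin n))}
    (h : CompsSt G σ τ cQ c' C) {b z s N : ℕ} {Q : Set (Fin n)} (h8 : σ.reg 8 = b)
    (hz : z < σ.reg 15) (hN : σ.reg 26 = N) (hb : ∀ v, c' v ≠ b)
    (hlt : ∀ v, c v < z) (hold : ∀ v ∈ Q, c v = b) (hQ : ∀ v ∈ Q, cQ v = z)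
    (hoth : ∀ v, v ∉ Q → cQ v = c v) (hbz : b ≠ z) (hs : Q.ncard ≤ s) :
    SepRes G c c' b s N z Q τ := by
  have hcomp : ∀ v, c v = b → v ∉ Q → ∃ (i : ℕ) (l : List (Fin n)), C[i]? = some l ∧ v ∈ l ∧
      c' v = σ.reg 15 + i := by
    intro v hv hvQ
    have h1 : cQ v = σ.reg 8 := by rw [hoth v hvQ, hv, h8]
    rcases h.todo v h1 with h2 | ⟨i, l, h2, h3⟩
    · exact (hb v (h2.trans h8)).elim
    · exact ⟨i, l, h2, h3, (h.comp_mem i l h2 v).1 h3⟩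
  have hsep : ∀ v ∈ Q, c' v = z := fun v hv => by
    rw [h.other v (by rw [hQ v hv, h8]; exact hbz.symm), hQ v hv]
  have hother : ∀ v, c v ≠ b → c' v = c v := fun v hv => by
    have hvQ : v ∉ Q := fun h => hv (hold v h)
    rw [h.other v (by rw [hoth v hvQ, h8]; exact hv), hoth v hvQ]
  have hrest : ∀ v, c v = b → v ∉ Q → z < c' v := fun v hv hvQ => by
    obtain ⟨i, l, -, -, h3⟩ := hcomp v hv hvQ
    omega
  have hclass : ∀ (i : ℕ) (l : List (Fin n)), C[i]? = some l →
      {v | c' v = σ.reg 15 + i} = {v | v ∈ l} := by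
    intro i l hl
    ext v
    exact (h.comp_mem i l hl v).symm
  refine ⟨hlt, hold, hsep, hother, hrest, ?_, hs, ?_⟩
  · intro u v hu huQ huv hv hvQ
    obtain ⟨i, l, h1, h2, h3⟩ := hcomp u hu huQ
    rw [h3, ← h.comp_mem i l h1]
    exact h.comp_closed i l h1 u h2 v huv (by rw [hoth v hvQ, hv, h8])
  · rcases h.big with ⟨h1, h2⟩ | ⟨i, l, h1, h2, h3, v, h4, h5⟩
    · refine Or.inl ⟨h1, fun f hf => ?_⟩
      rcases Set.eq_empty_or_nonempty {v | c' v = f} with he | ⟨v, rfl⟩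
      · simp [he]
      · have hvb : c v = b := by
          by_contra hne
          rw [hother v hne] at hf
          exact absurd hf (hlt v).le.not_gt
        have hvQ : v ∉ Q := fun hv => by
          rw [hsep v hv] at hf
          exact lt_irrefl _ hf
        obtain ⟨i, l, g1, g2, g3⟩ := hcomp v hvb hvQ
        rw [g3, hclass i l g1, ncard_setOf_mem (h.comp_nodup i l g1), ← hN]
        exact h2 i l g1
    · refine Or.inr ⟨by omega, ?_, ?_, v, ?_, h5⟩
      · rw [h2, hclass i l h1]; exact h.comp_conn i l h1
      · rw [h2, hclass i l h1, ncard_setOf_mem (h.comp_nodup i l h1), ← hN]; exact h3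
      · rw [h2]; exact (h.comp_mem i l h1 v).1 h4

/-- From `1 ≤ g` and `k < h`, the length `(3 * g + 1) * k + 1` is at most `4 * g * k + g`; the
constant `5` leaves room. -/
theorem sep_bound {h g k q : ℕ} (hg : 0 < g) (hk : k < h) (hq : q ≤ (3 * g + 1) * k + 1 ∨ q ≤ g) :
    q ≤ 5 * h * g := by
  obtain ⟨m, rfl⟩ : ∃ m, h = k + 1 + m := ⟨h - k - 1, by omega⟩
  have h1 : k ≤ k * g := Nat.le_mul_of_pos_right _ hg
  have h2 : m ≤ m * g := Nat.le_mul_of_pos_right _ hg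
  rcases hq with hq | hq <;> nlinarith

/-- The choice of `g` gives `N ≤ g ^ 2 + 2 * g ≤ 3 * g ^ 2`, so a layer with at most `h * N / g`
nodes has at most `3 * h * g` of them. -/
theorem layer_bound {h g N q : ℕ} (hg : 0 < g) (hN : N < (g + 1) * (g + 1)) (hq : q * g ≤ h * N) :
    q ≤ 5 * h * g := by
  have h1 : N ≤ 3 * g * g := by nlinarith
  have h2 : q * g ≤ 5 * h * g * g := by
    calc q * g ≤ h * N := hq
      _ ≤ h * (3 * g * g) := Nat.mul_le_mul_left _ h1
      _ ≤ _ := by nlinarith [Nat.zero_le (h * g * g)]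
  exact Nat.le_of_mul_le_mul_right h2 hg

theorem LayerRes.congr {c : Fin n → ℕ} {b g j tl cm : ℕ} {A : List ℕ} {Q : Set (Fin n)}
    {τ τ' : Memory} (h : LayerRes G c b g A Q j tl cm τ) (h42 : τ'.reg 42 = τ.reg 42)
    (h34 : τ'.reg 34 = τ.reg 34) (h4 : τ'.arr 4 = τ.arr 4) : LayerRes G c b g A Q j tl cm τ' := by
  obtain ⟨d1, d2, d3, d4, d5, d6, d7⟩ := h
  refine ⟨d1, d2, d3, d4, ?_, d6, d7⟩
  simpa only [h42, h34, h4] using d5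

/-- The separator `Q` with the list `A` of active colours. -/
structure SepKind (G : SimpleGraph (Fin n)) (c : Fin n → ℕ) (b g : ℕ) (A : List ℕ)
    (Q : Set (Fin n)) (τ : Memory) : Prop where
  act : ∀ (i : ℕ) (f : ℕ), A[i]? = some f → τ.arr 8 i = f
  size : τ.reg 25 = A.length
  kind : (τ.reg 32 = A.length ∧ Conn G Q ∧ (∀ f ∈ A, ∃ v ∈ Q, Near G c f v) ∧ g ≤ Q.ncard) ∨
    (τ.reg 32 < A.length ∧ ∃ j, LayerRes G c b g A Q j (τ.reg 31) (τ.reg 32) τ)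

theorem SepKind.congr {c : Fin n → ℕ} {b g : ℕ} {A : List ℕ} {Q : Set (Fin n)} {τ τ' : Memory}
    (h : SepKind G c b g A Q τ) (hr : ∀ x ∈ [25, 31, 32, 34, 42], τ'.reg x = τ.reg x)
    (h4 : τ'.arr 4 = τ.arr 4) (h8 : τ'.arr 8 = τ.arr 8) : SepKind G c b g A Q τ' := by
  have e25 := hr 25 (by simp)
  have e31 := hr 31 (by simp)
  have e32 := hr 32 (by simp)
  refine ⟨by rw [h8]; exact h.act, by rw [e25]; exact h.size, ?_⟩
  rw [e31, e32]
  refine h.kind.imp id fun ⟨d1, j, d2⟩ => ⟨d1, j, d2.congr (hr 42 (by simp)) (hr 34 (by simp)) h4⟩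

/-- At this point the components are needed only for their colours and for the big one among them.
Their segments, which the search for components puts on the stack, are discarded by restoring the
height saved in the register `39`. -/
theorem wp_sepComps (L : IncidenceLists G) {σ τ₀ : Memory} {t s : ℕ} {Φ : ℕ → Memory → Prop}
    {p : List (Fin n)} {c₁ c cQ : Fin n → ℕ} {b c₀ g N z : ℕ} {A : List ℕ} {Q : Set (Fin n)}
    (hst : PieceSt σ τ₀ p c₁ cQ b c₀ g N) (hseg : Seg (σ.arr 1) (σ.reg 4) (σ.reg 5) p)
    (hle : σ.reg 5 ≤ σ.reg 7) (hbp : ∀ v, c v = b → v ∈ p) (hbz : b < z)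
    (hpos : 0 < τ₀.reg 27) (h38 : τ₀.reg 38 = z) (hz : z < τ₀.reg 15) (hlt : ∀ v, c v < z)
    (hold : ∀ v ∈ Q, c v = b) (hQ : ∀ v ∈ Q, cQ v = z) (hoth : ∀ v, v ∉ Q → cQ v = c v)
    (hs : Q.ncard ≤ s) (hk : SepKind G c b g A Q τ₀)
    (hΦ : ∀ t' τ c', PieceSt σ τ p c₁ c' b c₀ g N → 0 < τ.reg 27 → τ.reg 38 = z →
      z < τ.reg 15 → SepRes G c c' b s N z Q τ → SepKind G c b g A Q τ →
      t' ≤ t + 200 * wsum L p + 40 → Frame sepComps τ₀ τ → Φ t' τ) :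
    wp L.query sepComps Φ t τ₀ := by
  suffices hsuff : wp L.query sepComps (fun t' τ => ∃ c', PieceSt σ τ p c₁ c' b c₀ g N ∧
      0 < τ.reg 27 ∧ τ.reg 38 = z ∧ z < τ.reg 15 ∧ SepRes G c c' b s N z Q τ ∧
      SepKind G c b g A Q τ ∧ t' ≤ t + 200 * wsum L p + 40) t τ₀ from
    hsuff.mono fun t' τ _ hF ⟨c', h1, h2, h3, h4, h5, h6, h7⟩ =>
      hΦ t' τ c' h1 h2 h3 h4 h5 h6 h7 hF
  obtain ⟨p1, p2, p3, p4, p5, p6, p7, p8, p9, p10, p11, p12, p13, p14, p15, p16, p17, p18⟩ := hst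
  have hlen := hseg.len
  rw [sepComps]
  simp only [Program.block, wp_seq_iff, wp_assign_iff, Expr.ev, Expr.time]
  set σ₁ := ((τ₀.setReg 40 0).setReg 39 ((τ₀.setReg 40 0).reg 16)).setReg 8
    (((τ₀.setReg 40 0).setReg 39 ((τ₀.setReg 40 0).reg 16)).reg 20) with hσ₁
  have hr : ∀ x, x ≠ 40 → x ≠ 39 → x ≠ 8 → σ₁.reg x = τ₀.reg x := by
    intro x h1 h2 h3
    simp [hσ₁, h1, h2, h3]
  have ha : σ₁.arr = τ₀.arr := rfl
  have s8 : σ₁.reg 8 = b := by simp [hσ₁, p3]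
  have s39 : σ₁.reg 39 = σ.reg 16 := by simp [hσ₁, p9]
  have s40 : σ₁.reg 40 = 0 := by simp [hσ₁]
  have s0 := hr 0 (by simp) (by simp) (by simp)
  have s4 := hr 4 (by simp) (by simp) (by simp)
  have s5 := hr 5 (by simp) (by simp) (by simp)
  have s7 := hr 7 (by simp) (by simp) (by simp)
  have s15 := hr 15 (by simp) (by simp) (by simp)
  have s16 := hr 16 (by simp) (by simp) (by simp)
  have s26 := hr 26 (by simp) (by simp) (by simp)
  clear_value σ₁
  refine wp_comps L cQ p (by rw [ha]; exact p1) (by rw [s0, p2]) ?_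
    (by rw [s5, s7, p8]; omega) ?_ ?_ s40 ?_ ?_
  · rw [ha, s4, s5, p7, p8]
    exact hseg.congr fun i hi => p11 i (by omega)
  · intro v; rw [s15]; exact p14 v
  · rw [s8, s15]; omega
  · intro v hv
    rw [s8] at hv
    by_cases hvQ : v ∈ Q
    · exact hbp v (hold v hvQ)
    · exact hbp v (by rw [← hoth v hvQ]; exact hv)
  intro t' τ c' C hC hb ht' hF
  have hfr := hC.fresh
  have hql := hC.queue_le
  have hk1 := hC.keep
  have hk2 := hC.keep2
  have hk3 := hC.keep3
  rw [s15] at hfr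
  rw [s7] at hql hk1
  rw [s16] at hk2 hk3
  rw [ha] at hk1 hk2 hk3
  rw [s8] at hb
  have hsep := hC.sepRes (c := c) (b := b) (z := z) (s := s) (N := N) (Q := Q)
    s8 (by rw [s15]; exact hz) (by rw [s26, p6]) hb hlt hold hQ hoth hbz.ne hs
  have hfresh : ∀ v, c' v < τ.reg 15 := by
    intro v
    rw [hfr]
    by_cases hv : c v = b
    · by_cases hvQ : v ∈ Q
      · rw [hsep.sep v hvQ]; omega
      · rcases hC.todo v (by rw [s8, hoth v hvQ, hv]) with h2 | ⟨i, l', h2, h3⟩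
        · rw [s8] at h2
          exact (hb v h2).elim
        · have h4 := (hC.comp_mem i l' h2 v).1 h3
          have := (List.getElem?_eq_some_iff.1 h2).1
          omega
    · rw [hsep.other v hv]
      have := hlt v
      omega
  have hf : ∀ x, comps.setsReg x = false → x ≠ 40 → x ≠ 39 → x ≠ 8 → τ.reg x = τ₀.reg x :=
    fun x h1 h2 h3 h4 => (hF.reg x h1).trans (hr x h2 h3 h4)
  have hfa : ∀ x, comps.setsArr x = false → τ.arr x = τ₀.arr x := fun x h1 => by rw [hF.arr x h1,
      ha]
  simp only [wp_assign_iff, Expr.ev, Expr.time]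
  refine ⟨c', ⟨hC.cols, ?_, ?_, ?_, ?_, ?_, ?_, ?_, ?_, ?_, ?_, ?_, ?_, ?_, ?_, ?_, ?_, ?_⟩,
    ?_, ?_, ?_, ?_, ?_, by omega⟩
  · rw [Memory.setReg_reg, if_neg (by simp), hf 0 rfl (by simp) (by simp) (by simp), p2]
  · rw [Memory.setReg_reg, if_neg (by simp), hf 20 rfl (by simp) (by simp) (by simp), p3]
  · rw [Memory.setReg_reg, if_neg (by simp), hf 21 rfl (by simp) (by simp) (by simp), p4]
  · rw [Memory.setReg_reg, if_neg (by simp), hf 22 rfl (by simp) (by simp) (by simp), p5]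
  · rw [Memory.setReg_reg, if_neg (by simp), hf 26 rfl (by simp) (by simp) (by simp), p6]
  · rw [Memory.setReg_reg, if_neg (by simp), hf 4 rfl (by simp) (by simp) (by simp), p7]
  · rw [Memory.setReg_reg, if_neg (by simp), hf 5 rfl (by simp) (by simp) (by simp), p8]
  · rw [Memory.setReg_reg, if_pos rfl, hF.reg 39 rfl, s39]
  · rw [Memory.setReg_reg, if_neg (by simp)]; omega
  · intro i hi
    rw [Memory.setReg_arr, hk1 i (by omega), p11 i hi]
  · intro i hi
    rw [Memory.setReg_arr, hk2 i (by omega), p12 i hi]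
  · intro i hi
    rw [Memory.setReg_arr, hk3 i (by omega), p13 i hi]
  · intro v
    rw [Memory.setReg_reg, if_neg (by simp)]
    exact hfresh v
  · rw [Memory.setReg_reg, if_neg (by simp)]; omega
  · intro i
    rw [Memory.setReg_reg, if_neg (by simp), Memory.setReg_arr, hfa 4 rfl,
      hf 27 rfl (by simp) (by simp) (by simp)]
    exact p16 i
  · intro i
    rw [Memory.setReg_reg, if_neg (by simp), Memory.setReg_arr, hfa 9 rfl,
      hf 24 rfl (by simp) (by simp) (by simp)]
    exact p17 i
  · intro v hv
    have hvb : c v ≠ b := fun h => hv (hbp v h)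
    have hvQ : v ∉ Q := fun h => hvb (hold v h)
    rw [hsep.other v hvb, ← hoth v hvQ, p18 v hv]
  · rw [Memory.setReg_reg, if_neg (by simp), hf 27 rfl (by simp) (by simp) (by simp)]
    exact hpos
  · rw [Memory.setReg_reg, if_neg (by simp), hf 38 rfl (by simp) (by simp) (by simp), h38]
  · rw [Memory.setReg_reg, if_neg (by simp)]; omega
  · obtain ⟨s1, s2, s3, s4, s5, s6, s7, s8⟩ := hsep
    exact ⟨s1, s2, s3, s4, s5, s6, s7, by simpa using s8⟩
  · refine hk.congr (fun x hx => ?_) (hfa 4 rfl) (hfa 8 rfl)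
    fin_cases hx <;> rw [Memory.setReg_reg, if_neg (by simp)]
    exacts [hf 25 rfl (by simp) (by simp) (by simp), hf 31 rfl (by simp) (by simp) (by simp),
      hf 32 rfl (by simp) (by simp) (by simp), hf 34 rfl (by simp) (by simp) (by simp),
      hf 42 rfl (by simp) (by simp) (by simp)]

/-- The layered graph has at most `h + 1` copies of the piece, so one search takes time linear in
`(h + 1) * wsum L p`; all other phases are linear in the weight of the piece or in the size of the
separator. -/
theorem wp_findSep (L : IncidenceLists G) {σ τ₀ : Memory} {t h : ℕ} {Φ : ℕ → Memory → Prop}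
    {p : List (Fin n)} {c₁ c : Fin n → ℕ} {b c₀ g N : ℕ}
    (hst : PieceSt σ τ₀ p c₁ c b c₀ g N) (hT : Trees G c {v | v ∈ p} b c₀ (5 * h * g) N)
    (hG : ¬ CliqueMinor h G) (hseg : Seg (σ.arr 1) (σ.reg 4) (σ.reg 5) p)
    (hle : σ.reg 5 ≤ σ.reg 7) (hp : p.Nodup) (hN : p.length = N) (hg : 0 < g)
    (hgN : N < (g + 1) * (g + 1)) (hgB : g ≤ {v | c v = b}.ncard)
    (hpos : 0 < τ₀.reg 27)
    (hΦ : ∀ t' τ c' (A : List ℕ) Q, PieceSt σ τ p c₁ c' b c₀ g N → 0 < τ.reg 27 →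
      τ.reg 38 < τ.reg 15 → SepRes G c c' b (5 * h * g) N (τ.reg 38) Q τ →
      c₀ ≤ τ.reg 38 → A.length < h → (∀ f, f ∈ A ↔ IsActive G c b c₀ f) →
      SepKind G c b g A Q τ →
      t' ≤ t + 3000 * ((h + 1) * wsum L p) → Frame (findSep h) τ₀ τ → Φ t' τ) :
    wp L.query (findSep h) Φ t τ₀ := by
  suffices hsuff : wp L.query (findSep h) (fun t' τ => ∃ c' A Q, PieceSt σ τ p c₁ c' b c₀ g N ∧
      0 < τ.reg 27 ∧ τ.reg 38 < τ.reg 15 ∧ SepRes G c c' b (5 * h * g) N (τ.reg 38) Q τ ∧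
      c₀ ≤ τ.reg 38 ∧ A.length < h ∧ (∀ f, f ∈ A ↔ IsActive G c b c₀ f) ∧
      SepKind G c b g A Q τ ∧
      t' ≤ t + 3000 * ((h + 1) * wsum L p)) t τ₀ from
    hsuff.mono fun t' τ _ hF ⟨c', A, Q, h1, h2, h3, h4, h5, h6, h7, h8, h9⟩ =>
      hΦ t' τ c' A Q h1 h2 h3 h4 h5 h6 h7 h8 h9 hF
  obtain ⟨p1, p2, p3, p4, p5, p6, p7, p8, p9, p10, p11, p12, p13, p14, p15, p16, p17, p18⟩ := hst
  have hlen := hseg.len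
  have hseg₀ : Seg (τ₀.arr 1) (τ₀.reg 4) (τ₀.reg 5) p := by
    rw [p7, p8]
    exact hseg.congr fun i hi => p11 i (by omega)
  have hbp : ∀ v, c v = b → v ∈ p := hT.sub
  obtain ⟨vb, hvb⟩ := hT.conn.1
  have hW := length_le_wsum L p
  have hgp : g ≤ p.length := by
    have := Set.ncard_le_ncard (show {v | c v = b} ⊆ {v | v ∈ p} from hbp) (Set.toFinite _)
    rw [ncard_setOf_mem hp] at this
    omega
  rw [findSep]
  simp only [Program.block, wp_seq_iff]
  refine wp_active L c b c₀ p p1 p3 p5 hseg₀ hbp p17 ?_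
  intro t₁ τ₁ A a1 a2 a3 a4 a5 ht₁ hF₁
  simp only [wp_seq_iff, wp_assign_iff, Expr.ev, Expr.time]
  have hAh : A.length < h := hT.length_lt hG a3 fun f hf => (a4 f).1 hf
  have hAb : ∀ f ∈ A, f ≠ b := fun f hf => ((a4 f).1 hf).2.1
  set z := τ₁.reg 15 with hz
  have hz₀ : z = τ₀.reg 15 := hF₁.reg 15 rfl
  have hcz : ∀ v, c v < z := fun v => by rw [hz₀]; exact p14 v
  refine wp_bfs L (h := h) (c := c) (b := b) (A := A) (g := g) (N := N) p ?_ hp ?_ hbp ⟨vb,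
      hvb⟩ hAb hAh.le hN.le hg ?_ ?_
  · intro s
    refine ⟨?_, a2, ?_, ?_, ?_, ?_, ?_, by simp⟩
    · intro v; simpa [hF₁.arr 0 rfl] using p1 v
    · simpa [hF₁.reg 0 rfl] using p2
    · simpa [hF₁.reg 20 rfl] using p3
    · simpa [hF₁.reg 21 rfl] using p4
    · simpa using a1
    · simpa [hF₁.reg 26 rfl] using p6
  · simpa [hF₁.arr 1 rfl, hF₁.reg 4 rfl, hF₁.reg 5 rfl] using hseg₀
  · intro i; simpa [hF₁.arr 4 rfl, hF₁.reg 27 rfl] using p16 i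
  simp only [Memory.setReg_reg]
  norm_num only [if_true, if_false]
  have e27 : τ₁.reg 27 = τ₀.reg 27 := hF₁.reg 27 rfl
  simp only [e27]
  intro t₂ τ₂ l lev b1 b2 b3 b4 ht₂ hF₂
  -- the memory before the separator is coloured
  have f15 : τ₂.reg 15 = z + 1 := by rw [hF₂.reg 15 rfl]; simp [hz]
  have f38 : τ₂.reg 38 = z := by rw [hF₂.reg 38 rfl]; simp
  have f25 : τ₂.reg 25 = A.length := b2.r25
  have f4 : τ₂.reg 4 = σ.reg 4 := by rw [hF₂.reg 4 rfl]; simp [hF₁.reg 4 rfl, p7]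
  have f5 : τ₂.reg 5 = σ.reg 5 := by rw [hF₂.reg 5 rfl]; simp [hF₁.reg 5 rfl, p8]
  have f7 : τ₂.reg 7 = τ₀.reg 7 := by rw [hF₂.reg 7 rfl]; simp [hF₁.reg 7 rfl]
  have f16 : τ₂.reg 16 = σ.reg 16 := by rw [hF₂.reg 16 rfl]; simp [hF₁.reg 16 rfl, p9]
  have f22 : τ₂.reg 22 = c₀ := by rw [hF₂.reg 22 rfl]; simp [hF₁.reg 22 rfl, p5]
  have f24 : τ₂.reg 24 = τ₁.reg 24 := by rw [hF₂.reg 24 rfl]; simp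
  have fa1 : τ₂.arr 1 = τ₀.arr 1 := by rw [hF₂.arr 1 rfl]; simp [hF₁.arr 1 rfl]
  have fa2 : τ₂.arr 2 = τ₀.arr 2 := by rw [hF₂.arr 2 rfl]; simp [hF₁.arr 2 rfl]
  have fa3 : τ₂.arr 3 = τ₀.arr 3 := by rw [hF₂.arr 3 rfl]; simp [hF₁.arr 3 rfl]
  have fa9 : τ₂.arr 9 = τ₁.arr 9 := by rw [hF₂.arr 9 rfl]; simp
  have f27 : 0 < τ₂.reg 27 := by have := b1.size; omega
  have hlne : l ≠ [] := List.ne_nil_of_mem ((b3 (vb, 0)).2 (lay_mono (Nat.zero_le _) ⟨hvb, rfl⟩))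
  have hbz : b ≠ z := by rw [← hvb]; exact (hcz vb).ne
  set X := (h + 1) * wsum L p with hX
  have hX1 : wsum L p ≤ X := Nat.le_mul_of_pos_left _ (by omega)
  have hX2 : (3 * g + 1) * (h + 1) ≤ 4 * X := by
    rw [hX, mul_comm, mul_left_comm]
    exact Nat.mul_le_mul_left _ (by omega)
  have hX3 : 5 * h * g ≤ 5 * X := by
    rw [hX, mul_assoc]
    exact Nat.mul_le_mul_left _ (Nat.mul_le_mul (by omega) (by omega))
  have hb20 : τ₂.reg 20 = b := b2.r20
  -- Both kinds of separator are followed by the same computation of components; only the colouring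
  -- after painting `Q`, the bound on `Q` and the record of its kind matter for it.
  have hend : ∀ (τ₃ : Memory) (t₃ : ℕ) (cQ : Fin n → ℕ) (Q : Set (Fin n)),
      (∀ v : Fin n, τ₃.arr 0 v = cQ v) → (∀ v ∈ Q, cQ v = z) → (∀ v, v ∉ Q → cQ v = c v) →
      (∀ v ∈ Q, c v = b) → Q.ncard ≤ 5 * h * g → τ₂.reg 7 ≤ τ₃.reg 7 →
      (∀ i < τ₂.reg 7, τ₃.arr 1 i = τ₂.arr 1 i) →
      (∀ x ∈ [0, 4, 5, 15, 16, 20, 21, 22, 24, 25, 26, 27, 31, 32, 34, 38, 42],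
        τ₃.reg x = τ₂.reg x) →
      (∀ a ∈ [2, 3, 4, 8, 9], τ₃.arr a = τ₂.arr a) → t₃ ≤ t + 2500 * X →
      SepKind G c b g A Q τ₂ →
      wp L.query sepComps (fun t' τ => ∃ c' A Q, PieceSt σ τ p c₁ c' b c₀ g N ∧
      0 < τ.reg 27 ∧ τ.reg 38 < τ.reg 15 ∧ SepRes G c c' b (5 * h * g) N (τ.reg 38) Q τ ∧
      c₀ ≤ τ.reg 38 ∧ A.length < h ∧ (∀ f, f ∈ A ↔ IsActive G c b c₀ f) ∧
      SepKind G c b g A Q τ ∧ t' ≤ t + 3000 * X) t₃ τ₃ := by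
    intro τ₃ t₃ cQ Q q1 q2 q3 q4 q5 q6 q7 q8 q9 q10 q11
    have hcQ : ∀ v, cQ v ≤ z := by
      intro v
      by_cases hv : v ∈ Q
      · exact (q2 v hv).le
      · rw [q3 v hv]; exact (hcz v).le
    have r15 : τ₃.reg 15 = z + 1 := by rw [q8 15 (by simp), f15]
    refine wp_sepComps L (σ := σ) (p := p) (c₁ := c₁) (c := c) (cQ := cQ) (b := b) (c₀ := c₀)
        (g := g)
      (N := N) (z := z) (A := A) (Q := Q) (s := 5 * h * g)
      ⟨q1, ?_, ?_, ?_, ?_, ?_, ?_, ?_, ?_, ?_, ?_, ?_, ?_, ?_, ?_, ?_, ?_, ?_⟩ hseg hle hbp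
      (by have := hcz vb; rwa [show c vb = b from hvb] at this) ?_ ?_ ?_ hcz q4 q2 q3 q5 ?_ ?_
    · rw [q8 0 (by simp), b2.r0]
    · rw [q8 20 (by simp), hb20]
    · rw [q8 21 (by simp), b2.r21]
    · rw [q8 22 (by simp), f22]
    · rw [q8 26 (by simp), b2.r26]
    · rw [q8 4 (by simp), f4]
    · rw [q8 5 (by simp), f5]
    · rw [q8 16 (by simp), f16]
    · omega
    · intro i hi; rw [q7 i (by omega), fa1, p11 i hi]
    · intro i hi; rw [q9 2 (by simp), fa2, p12 i hi]
    · intro i hi; rw [q9 3 (by simp), fa3, p13 i hi]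
    · intro v; have := hcQ v; omega
    · omega
    · intro i; rw [q9 4 (by simp), q8 27 (by simp)]; exact b1.lt i
    · intro i; rw [q9 9 (by simp), q8 24 (by simp), fa9, f24]; exact a5 i
    · intro v hv
      rw [q3 v fun h => hv (hbp v (q4 v h)), p18 v hv]
    · rw [q8 27 (by simp)]; exact f27
    · rw [q8 38 (by simp), f38]
    · omega
    · refine q11.congr (fun x hx => q8 x ?_) (q9 4 (by simp)) (q9 8 (by simp))
      fin_cases hx <;> simp
    · intro t' τ c' d1 d2 d3 d4 d5 d6 d7 _
      rw [← d3] at d4 d5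
      exact ⟨c', A, Q, d1, d2, d4, d5, by omega, hAh, a4, d6, by omega⟩
  refine wp_seq (wp_cond (fun he => ?_) (fun he => ?_))
  · simp only [Expr.ev, f25, ne_eq, ite_eq_right_iff, one_ne_zero, imp_false, not_not] at he
    refine wp_pathSep L b1 hlne hpos b2.cols b2.r20 b2.r21
      (by rw [f38]; exact hbz.symm) he hT.conn hgB ?_
    rw [f38]
    intro t₃ τ₃ Q q1 q2 q3 q4 q5 q6 q7 q8 q9 ht₃ hF₃
    have hcard := ncard_setOf_mem q1
    have htl := b1.tl_le
    rw [he] at htl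
    have hwQ : wsum L Q ≤ wsum L p := wsum_le_of_subset L q1 fun v hv => hbp v (q2 v hv)
    have htl2 : τ₂.reg 31 + 1 ≤ 5 * h * g := sep_bound hg hAh (Or.inl (by omega))
    refine hend τ₃ t₃ _ {v | v ∈ Q} q3 (fun v hv => if_pos hv)
        (fun v hv => if_neg hv) q2 ?_ q9 q8 ?_ ?_
      ?_ ⟨b2.act, f25, Or.inl ⟨he, q4, q5, by omega⟩⟩
    · rw [hcard]
      rcases q6 with q6 | q6
      · omega
      · exact sep_bound hg hAh (Or.inr q6)
    · intro x hx
      exact hF₃.reg x (by fin_cases hx <;> rfl)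
    · intro x hx
      exact hF₃.arr x (by fin_cases hx <;> rfl)
    · simp only [Expr.time] at ht₃
      omega
  · simp only [Expr.ev, f25, ite_eq_right_iff, one_ne_zero, imp_false] at he
    obtain ⟨hcmlt, hlev, j, j1, j2, j3, j4, j5, j6, j7, j8⟩ := b4.resolve_left he
    refine wp_layerSep b1 b2.cols j6 j7 j8 ?_
    rw [f38]
    intro t₃ τ₃ Q q1 q2 q3 ht₃ hF₃
    have hQlay : ∀ v, v ∈ Q ↔ ∃ k, (v, k) ∈ lay G c b A j ∧ (v, k) ∉ lay G c b A (j - 1) := by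
      intro v
      rw [q2]
      constructor
      · rintro ⟨i, k, d1, d2, d3⟩
        have := j4 i _ d3
        exact ⟨k, this.2.1 d2, fun h => by have := this.1.2 h; omega⟩
      · rintro ⟨k, d1, d2⟩
        obtain ⟨i, hi⟩ := List.mem_iff_getElem?.1 ((b3 (v, k)).2 (lay_mono j3 d1))
        have := j4 i _ hi
        exact ⟨i, k, not_lt.1 fun h => d2 (this.1.1 h), this.2.2 d1, hi⟩
    have hq : Q.length ≤ 5 * h * g := layer_bound hg hgN (by rw [q1]; exact j5)
    -- The layer may contain several copies of one vertex, so the list can have repetitions and only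
    -- an inequality holds.
    have hcard := ncard_setOf_mem_le Q
    refine hend τ₃ t₃ _ {v | v ∈ Q} q3 (fun v hv => if_pos hv)
        (fun v hv => if_neg hv) ?_ (by omega) ?_ ?_
      ?_ ?_ ?_ ⟨b2.act, f25, Or.inr ⟨hcmlt, j, hcmlt, j1, j2, hQlay, ?_, ?_, ?_⟩⟩
    · intro v hv
      obtain ⟨k, hk, -⟩ := (hQlay v).1 hv
      exact lay_col hk
    · rw [hF₃.reg 7 rfl]
    · intro i _; rw [hF₃.arr 1 rfl]
    · intro x hx
      exact hF₃.reg x (by fin_cases hx <;> rfl)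
    · intro x hx
      exact hF₃.arr x (by fin_cases hx <;> rfl)
    · simp only [Expr.time] at ht₃
      omega
    · intro v k
      rw [b2.r42]
      constructor
      · rintro ⟨d1, d2⟩
        obtain ⟨i, hi⟩ := List.mem_iff_getElem?.1 (b1.mem v k d1)
        have h1 := b1.pos i _ hi
        simp only at h1
        exact (j4 i _ hi).1.1 (by omega)
      · intro hv
        obtain ⟨i, hi⟩ := List.mem_iff_getElem?.1 ((b3 (v, k)).2 (lay_mono (by omega) hv))
        have h1 := b1.pos i _ hi
        simp only at h1
        have := (j4 i _ hi).1.2 hv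
        omega
    · intro x hx
      rw [← hlev, ← b3] at hx
      exact b1.le x hx
    · obtain ⟨i, v, -, -, d3⟩ := b1.goal.resolve_left hlne
      exact ⟨v, d3⟩

end FindSep

end WordRAM


namespace WordRAM

/-! ### One round of the search for a separator -/

/-- Give the vertices of the segment that satisfy the condition the colour in the register `f`. -/
def paint (e : Expr) (f : ℕ) : Program := forSeg (.cond e (.write 0 (.reg 18) (.reg f)) .skip)

/-- Put the vertices of the segment that have the colour in the register `9` into the queue. -/
def seeds : Program :=
  forSeg (.cond (.eq (.read 0 (.reg 18)) (.reg 9)) (.block [.write 1 (.reg 7) (.reg 18),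
    .assign 7 (.add (.reg 7) (.const 1))]) .skip)

/-- The position of the node that consists of the vertex in the register `41` and the copy in the
register `37`. -/
def copyPos : Expr := .read 4 (.add (.mul (.reg 37) (.reg 0)) (.reg 41))

/-- Extend a tree by the vertices of the colour in the register `8` that can be reached from it; the
other vertices of this colour get the colour in the register `40`. -/
def extendTree : Program :=
  .block [.assign 37 (.const 1),
    .loop (.mul (.lt copyPos (.reg 34)) (.lt (.reg 42) (.add copyPos (.const 1))))
      (.assign 37 (.add (.reg 37) (.const 1))),
    .assign 9 (.read 8 (.sub (.reg 37) (.const 1))), .assign 6 (.reg 7), .assign 19 (.reg 7), seeds,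
    .assign 10 (.add (.reg 0) (.const 1)), flood, paint (.eq (.read 0 (.reg 18)) (.reg 8)) 40]

/-- Update the trees after a separator with a big component has been found. -/
def updateTrees : Program :=
  .block [.assign 8 (.reg 15), .assign 15 (.add (.reg 15) (.const 1)),
    paint (.mul (.lt (.reg 38) (.add (.read 0 (.reg 18)) (.const 1)))
      (.sub (.const 1) (.eq (.read 0 (.reg 18)) (.reg 40)))) 8,
    .cond (.eq (.reg 32) (.reg 25)) .skip extendTree, .assign 20 (.reg 40)]

/-- Find a separator; put `1` into the register `23` if there is no big component. -/
def sepRound (h : ℕ) : Program :=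
  .block [findSep h, .cond (.eq (.reg 40) (.const 0)) (.assign 23 (.const 1)) updateTrees]

section Round

variable {n : ℕ} {G : SimpleGraph (Fin n)}

theorem wp_paint {qy : ℕ → ℕ → ℕ} {σ : Memory} {t : ℕ} {Φ : ℕ → Memory → Prop} {e : Expr} {f : ℕ}
    (c : Fin n → ℕ) (p : List (Fin n)) (P : Fin n → Prop) [DecidablePred P]
    (hc : ∀ v : Fin n, σ.arr 0 v = c v) (hseg : Seg (σ.arr 1) (σ.reg 4) (σ.reg 5) p)
    (hp : p.Nodup) (hf : f ≠ 17 ∧ f ≠ 18)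
    (he : ∀ τ (v : Fin n), v ∈ p → Frame (paint e f) σ τ → τ.reg 18 = v → τ.arr 0 v = c v →
      (e.ev qy τ ≠ 0 ↔ P v))
    (hΦ : ∀ t' τ, (∀ v : Fin n, τ.arr 0 v = if v ∈ p ∧ P v then σ.reg f else c v) →
      t' ≤ t + (e.time + 5) * p.length + 20 * (p.length + 1) → Frame (paint e f) σ τ → Φ t' τ) :
    wp qy (paint e f) Φ t σ := by
  have hpf : (paint e f).setsReg f = false := by
    simp [paint, forSeg, Program.block, Program.setsReg, hf.1, hf.2]
  refine wp_forSeg p (fun l s τ => s ≤ (e.time + 5) * l.length ∧ (∃ r, p = l ++ r) ∧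
    τ.arr 1 = σ.arr 1 ∧ ∀ v : Fin n, τ.arr 0 v = if v ∈ l ∧ P v then σ.reg f else c v)
    hseg ⟨rfl, rfl, rfl⟩ ((e.time + 5) * p.length) ?_ ?_ ?_ ?_ ?_ ?_
  · rintro l s τ m i - ⟨h1, h2, h3, h4⟩
    exact ⟨h1, h2, h3, h4⟩
  · exact ⟨by simp, ⟨p, rfl⟩, rfl, by simpa using hc⟩
  · rintro l s τ ⟨h1, ⟨r, rfl⟩, -⟩
    exact h1.trans (Nat.mul_le_mul_left _ (by simp))
  · rintro l s τ ⟨-, -, h3, -⟩ i _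
    rw [h3]
  · rintro l v r s t' τ hl hF ⟨h1, -, h3, h4⟩ h18
    have hvl : v ∉ l := by
      intro hm
      rw [hl] at hp
      exact (List.nodup_append.1 hp).2.2 v hm v (by simp) rfl
    have hev := he τ v (by simp [hl]) hF h18 (by rw [h4, if_neg fun h => hvl h.1])
    have hlen : (l ++ [v]).length = l.length + 1 := by simp
    refine wp_cond (fun hne => ?_) (fun hne => ?_)
    · rw [wp_write_iff]
      refine ⟨e.time + 4, by simp only [Expr.time]; omega, ?_, ⟨r, by simp [hl]⟩, by simp [h3], ?_⟩
      · rw [hlen, mul_add]; omega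
      · intro w
        simp only [Expr.ev, Memory.setArr_arr, h18, if_true, Function.update_apply, Fin.val_inj]
        rw [h4, hF.reg f hpf]
        by_cases hw : w = v
        · subst hw; simp [hev.1 hne]
        · simp [hw]
    · rw [wp_skip_iff]
      have hPv : ¬ P v := fun h => hev.2 h hne
      refine ⟨e.time + 2, by omega, ?_, ⟨r, by simp [hl]⟩, h3, ?_⟩
      · rw [hlen, mul_add]; omega
      · intro w
        rw [h4]
        by_cases hw : w = v
        · subst hw; simp [hPv]
        · simp [hw]
  · rintro t' s τ ht' hF ⟨h1, -, -, h4⟩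
    exact hΦ t' τ h4 (by omega) hF

theorem wp_seeds {qy : ℕ → ℕ → ℕ} {σ : Memory} {t : ℕ} {Φ : ℕ → Memory → Prop}
    (c : Fin n → ℕ) (p : List (Fin n)) (hc : ∀ v : Fin n, σ.arr 0 v = c v)
    (hseg : Seg (σ.arr 1) (σ.reg 4) (σ.reg 5) p) (hle : σ.reg 5 ≤ σ.reg 7)
    (hΦ : ∀ t' τ, Seg (τ.arr 1) (σ.reg 7) (τ.reg 7) (p.filter fun v => c v = σ.reg 9) →
      (∀ i < σ.reg 7, τ.arr 1 i = σ.arr 1 i) → t' ≤ t + 40 * p.length + 20 → Frame seeds σ τ →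
      Φ t' τ) :
    wp qy seeds Φ t σ := by
  refine wp_forSeg p (fun l s τ => s ≤ 20 * l.length ∧ (∃ r, p = l ++ r) ∧
    Seg (τ.arr 1) (σ.reg 7) (τ.reg 7) (l.filter fun v => c v = σ.reg 9) ∧
    ∀ i < σ.reg 7, τ.arr 1 i = σ.arr 1 i)
    hseg ⟨rfl, rfl, rfl⟩ (20 * p.length) ?_ ?_ ?_ ?_ ?_ ?_
  · rintro l s τ m i hi ⟨h1, h2, h3, h4⟩
    refine ⟨h1, h2, ?_, h4⟩
    rw [Memory.setReg_reg, if_neg (by rintro rfl; simp at hi)]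
    exact h3
  · exact ⟨by simp, ⟨p, rfl⟩, Seg.nil _ _, fun _ _ => rfl⟩
  · rintro l s τ ⟨h1, ⟨r, rfl⟩, -⟩
    exact h1.trans (Nat.mul_le_mul_left _ (by simp))
  · rintro l s τ ⟨-, -, -, h4⟩ i hi
    exact h4 i (by omega)
  · rintro l v r s t' τ hl hF ⟨h1, -, h3, h4⟩ h18
    have e0 : τ.arr 0 v = c v := by rw [hF.arr 0 rfl, hc]
    have e9 : τ.reg 9 = σ.reg 9 := hF.reg 9 rfl
    have hlen : (l ++ [v]).length = l.length + 1 := by simp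
    refine wp_cond (fun he => ?_) (fun he => ?_)
    · simp only [Expr.ev, h18, e0, e9, ne_eq, ite_eq_right_iff, one_ne_zero, imp_false,
        not_not] at he
      simp only [Program.block, wp_seq_iff, wp_assign_iff, wp_write_iff, Expr.ev, Expr.time, h18,
        Memory.setArr_reg]
      refine ⟨18, by omega, by omega, ⟨r, by simp [hl]⟩, ?_, ?_⟩
      · simpa [List.filter_append, he] using h3.push v
      · intro i hi
        have := h3.len
        simp only [Memory.setReg_arr, Memory.setArr_arr, if_true]
        rw [Function.update_of_ne (by omega)]
        exact h4 i hi
    · simp only [Expr.ev, h18, e0, e9, ite_eq_right_iff, one_ne_zero, imp_false] at he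
      rw [wp_skip_iff]
      refine ⟨10, by simp only [Expr.time]; omega, by omega, ⟨r, by simp [hl]⟩, ?_, h4⟩
      simpa [List.filter_append, he] using h3
  · rintro t' s τ ht' hF ⟨h1, -, h3, h4⟩
    exact hΦ t' τ h3 h4 (by omega) hF

theorem PieceSt.setReg {σ τ : Memory} {p : List (Fin n)} {c₁ c : Fin n → ℕ} {b c₀ g N : ℕ}
    (h : PieceSt σ τ p c₁ c b c₀ g N) {x : ℕ} (m : ℕ)
    (hx : x ∉ [0, 4, 5, 7, 15, 16, 20, 21, 22, 24, 26, 27]) :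
    PieceSt σ (τ.setReg x m) p c₁ c b c₀ g N := by
  have hr : ∀ y ∈ [0, 4, 5, 7, 15, 16, 20, 21, 22, 24, 26, 27], (τ.setReg x m).reg y = τ.reg y := by
    intro y hy
    rw [Memory.setReg_reg, if_neg (by rintro rfl; exact hx hy)]
  obtain ⟨p1, p2, p3, p4, p5, p6, p7, p8, p9, p10, p11, p12, p13, p14, p15, p16, p17, p18⟩ := h
  have e1 := hr 0 (by simp)
  have e2 := hr 4 (by simp)
  have e3 := hr 5 (by simp)
  have e4 := hr 7 (by simp)
  have e5 := hr 15 (by simp)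
  have e6 := hr 16 (by simp)
  have e7 := hr 20 (by simp)
  have e8 := hr 21 (by simp)
  have e9 := hr 22 (by simp)
  have e10 := hr 24 (by simp)
  have e11 := hr 26 (by simp)
  have e12 := hr 27 (by simp)
  constructor <;> (try simp only [e1, e2, e3, e4, e5, e6, e7, e8, e9, e10, e11, e12,
    Memory.setReg_arr]) <;> assumption

/-- The piece after steps that change only colours, the queue, and some registers. -/
theorem PieceSt.change {σ τ τ' : Memory} {p : List (Fin n)} {c₁ c c' : Fin n → ℕ} {b c₀ g N : ℕ}
    (h : PieceSt σ τ p c₁ c b c₀ g N)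
    (hr : ∀ y ∈ [0, 4, 5, 15, 16, 20, 21, 22, 24, 26, 27], τ'.reg y = τ.reg y)
    (ha : ∀ a ∈ [2, 3, 4, 9], τ'.arr a = τ.arr a) (h7 : τ.reg 7 ≤ τ'.reg 7)
    (hk : ∀ i < τ.reg 7, τ'.arr 1 i = τ.arr 1 i) (hc : ∀ v : Fin n, τ'.arr 0 v = c' v)
    (hlt : ∀ v, c' v < τ.reg 15) (hout : ∀ v, v ∉ p → c' v = c v) :
    PieceSt σ τ' p c₁ c' b c₀ g N := by
  obtain ⟨p1, p2, p3, p4, p5, p6, p7, p8, p9, p10, p11, p12, p13, p14, p15, p16, p17, p18⟩ := h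
  have e1 := hr 0 (by simp)
  have e2 := hr 4 (by simp)
  have e3 := hr 5 (by simp)
  have e5 := hr 15 (by simp)
  have e6 := hr 16 (by simp)
  have e7 := hr 20 (by simp)
  have e8 := hr 21 (by simp)
  have e9 := hr 22 (by simp)
  have e10 := hr 24 (by simp)
  have e11 := hr 26 (by simp)
  have e12 := hr 27 (by simp)
  have a2 := ha 2 (by simp)
  have a3 := ha 3 (by simp)
  have a4 := ha 4 (by simp)
  have a9 := ha 9 (by simp)
  constructor
  any_goals simp only [e1, e2, e3, e5, e6, e7, e8, e9, e10, e11, e12, a2, a3, a4, a9]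
  any_goals assumption
  · omega
  · intro i hi; rw [hk i (by omega), p11 i hi]
  · intro v hv; rw [hout v hv, p18 v hv]

/-- To find a tree that `B'` does not touch, it suffices to follow one vertex `r` of `B'` through
the copies: being before or behind the layer is the same for all of `B'`. The flood from that tree
over the colour `y` of `B \ B'` then computes `D`. -/
theorem wp_extendTree (L : IncidenceLists G) {σ τ₀ : Memory} {t h : ℕ} {Φ : ℕ → Memory → Prop}
    {p : List (Fin n)} {c₁ c cy c' : Fin n → ℕ} {b c₀ g N x y s j : ℕ} {A : List ℕ}
    {Q : Set (Fin n)} (hst : PieceSt σ τ₀ p c₁ cy b c₀ g N)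
    (hT : Trees G c {v | v ∈ p} b c₀ s N) (hseg : Seg (σ.arr 1) (σ.reg 4) (σ.reg 5) p)
    (hle : σ.reg 5 ≤ σ.reg 7) (hp : p.Nodup) (hpos : 0 < τ₀.reg 27)
    (hsep : ∀ v, c' v = x → c v = b ∧ v ∉ Q) (hcl : ∀ u v, c' u = x → G.Adj u v → c v = b →
      v ∉ Q → c' v = x) (hQs : Q.ncard ≤ s) (hx : Conn G {v | c' v = x})
    (hbig : N < 2 * {v | c' v = x}.ncard) (hlay : LayerRes G c b g A Q j (τ₀.reg 31) (τ₀.reg 32) τ₀)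
    (hA : ∀ f ∈ A, IsActive G c b c₀ f) (hAh : A.length < h)
    (hact : ∀ (i : ℕ) (f : ℕ), A[i]? = some f → τ₀.arr 8 i = f)
    (hlx : ∀ v, c v < x) (hly : ∀ v, c v < y) (hxy : x ≠ y) (h8 : τ₀.reg 8 = y)
    (h40 : τ₀.reg 40 = x) (hxf : x < τ₀.reg 15) {r : Fin n} (h41 : τ₀.reg 41 = r) (hr : c' r = x)
    (hcy1 : ∀ v, c' v = x → cy v = x) (hcy2 : ∀ v, c v = b → c' v ≠ x → cy v = y)
    (hcy3 : ∀ v, c v ≠ b → cy v = c v)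
    (hΦ : ∀ t' τ c₂, PieceSt σ τ p c₁ c₂ b c₀ g N → 0 < τ.reg 27 →
      Trees G c₂ {v | v ∈ p} x c₀ s N →
      {v | c₂ v = x}.ncard + g ≤ {v | c v = b}.ncard →
      t' ≤ t + 300 * ((h + 1) * wsum L p) → Frame extendTree τ₀ τ → Φ t' τ) :
    wp L.query extendTree Φ t τ₀ := by
  suffices hsuff : wp L.query extendTree (fun t' τ => ∃ c₂, PieceSt σ τ p c₁ c₂ b c₀ g N ∧
      0 < τ.reg 27 ∧ Trees G c₂ {v | v ∈ p} x c₀ s N ∧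
      {v | c₂ v = x}.ncard + g ≤ {v | c v = b}.ncard ∧
      t' ≤ t + 300 * ((h + 1) * wsum L p)) t τ₀ from
    hsuff.mono fun t' τ _ hF ⟨c₂, h1, h2, h3, h4, h5⟩ => hΦ t' τ c₂ h1 h2 h3 h4 h5 hF
  obtain ⟨l1, l2, l3, l4, l5, l6, v₀, l7⟩ := hlay
  have hlen := hseg.len
  have hrb := (hsep r hr).1
  have hrp : r ∈ p := hT.sub r hrb
  have hcyr : cy r = x := hcy1 r hr
  have hbx : b ≠ x := by have := hlx r; omega
  have hby : b ≠ y := by have := hly r; omega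
  have hj : 0 < j := by omega
  have hb' : ∀ v ∈ {v | c' v = x}, c v = b := fun v hv => (hsep v hv).1
  have hQlay : ∀ k, ∀ v ∈ {v | c' v = x}, (v, k) ∈ lay G c b A j → (v,
      k) ∈ lay G c b A (j - 1) := by
    intro k v hv hvl
    by_contra hcon
    exact (hsep v hv).2 ((l4 v).2 ⟨k, hvl, hcon⟩)
  -- The last copy was never reached, so the loop over the copies stops in time.
  have hlast : (r, A.length) ∉ lay G c b A (j - 1) := by
    intro hm
    have := l6 _ (lay_mono (by omega) hm)
    simp only at this
    omega
  have hpl : 1 ≤ p.length := List.length_pos_of_mem hrp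
  have hW := length_le_wsum L p
  set X := (h + 1) * wsum L p with hX
  have hX1 : wsum L p ≤ X := Nat.le_mul_of_pos_left _ (by omega)
  have hX2 : h + 1 ≤ X := Nat.le_mul_of_pos_right _ (by omega)
  rw [extendTree]
  simp only [Program.block, wp_seq_iff, wp_assign_iff, Expr.ev, Expr.time]
  -- Copy `0` contains the starting nodes, so the loop may begin at copy `1`. It stops at the first
  -- copy in which `r` is not reached before the layer; the guard compares positions in the list of
  -- nodes, the lower comparison excluding entries of earlier searches.
  refine wp_loop (fun t' τ => ∃ k, 0 < k ∧ k ≤ A.length ∧ τ = τ₀.setReg 37 k ∧ t' ≤ t + 2 + 40 * k ∧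
    (r, k - 1) ∈ lay G c b A (j - 1)) (t + 2 + 40 * A.length) ?_ ?_ ?_ ?_
  · refine ⟨1, one_pos, ?_, rfl, by omega, lay_mono (Nat.zero_le _) ⟨hrb, rfl⟩⟩
    omega
  · rintro t' τ ⟨k, -, h2, -, h3, -⟩
    omega
  · rintro t' τ ⟨k, k1, k2, rfl, k3, k4⟩ hne
    simp only [copyPos, Expr.ev, Memory.setReg_reg, Memory.setReg_arr] at hne
    norm_num only [if_true, if_false] at hne
    rw [hst.r0, h41] at hne
    simp only [ne_eq, mul_eq_zero, ite_eq_right_iff, one_ne_zero, imp_false, not_or, not_not] at hne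
    have hkl : (r, k) ∈ lay G c b A (j - 1) := (l5 r k).1 ⟨by omega, hne.1⟩
    have hkne : k ≠ A.length := by rintro rfl; exact hlast hkl
    simp only [wp_assign_iff, copyPos, Expr.ev, Expr.time]
    refine ⟨k + 1, by omega, by omega, ?_, by omega, by simpa using hkl⟩
    rw [Memory.setReg_reg, if_pos rfl]
    simp [Memory.setReg]
  rintro t₁ τ ⟨k, k1, k2, rfl, k3, k4⟩ he
  simp only [copyPos, Expr.ev, Memory.setReg_reg, Memory.setReg_arr] at he
  norm_num only [if_true, if_false] at he
  rw [hst.r0, h41] at he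
  simp only [mul_eq_zero, ite_eq_right_iff, one_ne_zero, imp_false] at he
  have hkl : (r, k) ∉ lay G c b A (j - 1) := by
    intro hm
    have := (l5 r k).2 hm
    omega
  clear he
  obtain ⟨k, rfl⟩ : ∃ k', k = k' + 1 := ⟨k - 1, by omega⟩
  rw [Nat.add_sub_cancel] at k4
  obtain ⟨m, hm⟩ : ∃ m, A[k]? = some m := ⟨_, List.getElem?_eq_getElem k2⟩
  have hma := hA m (List.mem_of_getElem? hm)
  -- `B'` avoids the layer and is connected. So in copy `k`, where `r` is before the layer, all of
  -- `B'` is; and if any vertex of `B'` were reached in copy `k + 1`, then `r` would be before the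
  -- layer there as well.
  have hbefore : ∀ v ∈ {v | c' v = x}, (v, k) ∈ lay G c b A (j - 1) :=
    lay_dichotomy hx hb' hj (hQlay k) hr (lay_mono (by omega) k4)
  have hbehind : ∀ v ∈ {v | c' v = x}, (v, k + 1) ∉ lay G c b A j := by
    intro v hv hvl
    exact hkl (lay_dichotomy hx hb' hj (hQlay (k + 1)) hv hvl r hr)
  have hm8 : τ₀.arr 8 k = m := hact k m hm
  obtain ⟨hm1, hmb, va, um, hva, hum, hvu⟩ := id hma
  have hmx : m < x := by rw [← hum]; exact hlx um
  have hmy : m < y := by rw [← hum]; exact hly um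
  simp only [wp_seq_iff, wp_assign_iff, Expr.ev, Expr.time, Memory.setReg_reg, Memory.setReg_arr]
  norm_num only [if_true, if_false]
  rw [Nat.add_sub_cancel, hm8]
  set τ₁ := (((τ₀.setReg 37 (k + 1)).setReg 9 m).setReg 6 (τ₀.reg 7)).setReg 19 (τ₀.reg 7) with hτ₁
  have hP₁ : PieceSt σ τ₁ p c₁ cy b c₀ g N :=
    (((hst.setReg _ (by simp)).setReg _ (by simp)).setReg _ (by simp)).setReg _ (by simp)
  have g9 : τ₁.reg 9 = m := by simp [hτ₁]
  have g6 : τ₁.reg 6 = τ₀.reg 7 := by simp [hτ₁]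
  have g7 : τ₁.reg 7 = τ₀.reg 7 := by simp [hτ₁]
  have g19 : τ₁.reg 19 = τ₀.reg 7 := by simp [hτ₁]
  have g8 : τ₁.reg 8 = y := by simp [hτ₁, h8]
  have g40 : τ₁.reg 40 = x := by simp [hτ₁, h40]
  have g27 : τ₁.reg 27 = τ₀.reg 27 := by simp [hτ₁]
  clear_value τ₁
  have hq := hst.queue_le
  have hseg₁ : Seg (τ₁.arr 1) (τ₁.reg 4) (τ₁.reg 5) p := by
    rw [hP₁.r4, hP₁.r5]
    exact hseg.congr fun i hi => hP₁.keep i (by omega)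
  refine wp_seeds cy p hP₁.cols hseg₁ (by rw [hP₁.r5, g7]; omega) ?_
  rw [g9, g7]
  intro t₂ τ₂ d1 d2 ht₂ hF₂
  set l₀ := p.filter fun v => cy v = m with hl₀
  have hmem₀ : ∀ v, v ∈ l₀ ↔ c v = m := by
    intro v
    simp only [hl₀, List.mem_filter, decide_eq_true_eq]
    constructor
    · rintro ⟨-, h2⟩
      by_cases hv : c v = b
      · by_cases hv' : c' v = x
        · rw [hcy1 v hv'] at h2; omega
        · rw [hcy2 v hv hv'] at h2; omega
      · rwa [hcy3 v hv] at h2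
    · rintro rfl
      refine ⟨?_, hcy3 v hmb⟩
      by_contra hv
      have := hT.outside v hv
      omega
  simp only [wp_seq_iff, wp_assign_iff, Expr.ev, Expr.time]
  have f0 : τ₂.reg 0 = n := by rw [hF₂.reg 0 rfl, hP₁.r0]
  have f6 : τ₂.reg 6 = τ₀.reg 7 := by rw [hF₂.reg 6 rfl, g6]
  have f19 : τ₂.reg 19 = τ₀.reg 7 := by rw [hF₂.reg 19 rfl, g19]
  have f8 : τ₂.reg 8 = y := by rw [hF₂.reg 8 rfl, g8]
  have f9 : τ₂.reg 9 = m := by rw [hF₂.reg 9 rfl, g9]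
  have fc : ∀ v : Fin n, τ₂.arr 0 v = cy v := fun v => by rw [hF₂.arr 0 rfl, hP₁.cols]
  refine wp_flood L cy l₀ fc (by simpa [f6] using d1) (by simp [f6, f19]) (hp.filter _) ?_ ?_ ?_
  · intro v hv
    rw [hmem₀] at hv
    simp only [Memory.setReg_reg]
    norm_num only [if_true, if_false]
    rw [f8, hcy3 v (by omega)]
    omega
  · simp only [Memory.setReg_reg]
    norm_num only [if_true, if_false]
    rw [f8, f9]
    omega
  simp only [Memory.setReg_reg]
  norm_num only [if_true, if_false]
  rw [f0, f6, f8, f9]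
  intro t₃ τ₃ l e1 e2 ht₃ hF₃
  -- As above, the limit `n + 1` is never attained, so the flood reaches everything it can.
  have hcard : (l₀ ++ l).length ≤ n := by simpa using e1.nodup.length_le_card
  have hslen := e1.seg.len
  have hlD : ∀ v ∈ l, c v = b ∧ c' v ≠ x := by
    intro v hv
    have h1 := e1.old v hv
    by_cases hvb : c v = b
    · refine ⟨hvb, fun h => ?_⟩
      rw [hcy1 v h] at h1
      exact hxy h1
    · rw [hcy3 v hvb] at h1
      have := hly v
      omega
  have hlp : ∀ v ∈ l₀ ++ l, v ∈ p := by
    intro v hv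
    rcases List.mem_append.1 hv with hv | hv
    · exact (List.mem_filter.1 hv).1
    · exact hT.sub v (hlD v hv).1
  have hDcl : ∀ u v, c u = m ∨ u ∈ {v | v ∈ l} → G.Adj u v → c v = b → v ∉ {v | c' v = x} →
      v ∈ {v | v ∈ l} := by
    intro u v hu huv hv hv'
    have hul : u ∈ l₀ ++ l := by
      rcases hu with hu | hu
      · exact List.mem_append_left _ ((hmem₀ u).2 hu)
      · exact List.mem_append_right _ hu
    rcases e2 u hul v huv with h1 | h1
    · rw [e1.cols] at h1
      by_contra hvl
      rw [if_neg (show ¬ v ∈ l from hvl), hcy2 v hv hv'] at h1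
      exact h1 rfl
    · omega
  obtain ⟨hBm, hgD⟩ := le_ncard_of_layer (G := G) (c := c) (b := b) (A := A) hT.conn
    (B' := {v | c' v = x}) (D := {v | v ∈ l}) hb' ⟨r, hr⟩ l2 l3 hm hbefore hbehind l6 l7
    ⟨va, hva, um, hvu, hum⟩ hDcl
  have hDc : ∀ v ∈ {v | v ∈ l}, ∃ u, c u = m ∧
      Relation.ReflTransGen (AdjIn G {v | c v = m ∨ v ∈ {v | v ∈ l}}) u v := by
    intro v hv
    obtain ⟨u, hu, huv⟩ := e1.reach v (List.mem_append_right _ hv)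
    refine ⟨u, (hmem₀ u).1 hu, reach_mono ?_ huv⟩
    intro w hw
    exact (List.mem_append.1 hw).imp (hmem₀ w).1 id
  -- the last recolouring
  set cD : Fin n → ℕ := fun v => if v ∈ l then m else cy v with hcD
  have hlenD := d1.len
  have hkeep₃ : ∀ i < τ₀.reg 7, τ₃.arr 1 i = τ₁.arr 1 i := by
    intro i hi
    have := e1.keep i (by omega)
    rw [this]
    simpa using d2 i hi
  have hP₃ : PieceSt σ τ₃ p c₁ cD b c₀ g N := by
    refine hP₁.change (fun a ha => ?_) (fun a ha => ?_) ?_ (by rw [g7]; exact hkeep₃) e1.cols ?_ ?_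
    · fin_cases ha
      all_goals (refine (hF₃.reg _ rfl).trans ?_; rw [Memory.setReg_reg,
          if_neg (by simp)]; exact hF₂.reg _ rfl)
    · fin_cases ha
      all_goals (refine (hF₃.arr _ rfl).trans ?_; exact hF₂.arr _ rfl)
    · rw [g7]; omega
    · intro v
      simp only [hcD]
      split_ifs
      · have := hP₁.fresh um
        rw [hcy3 um (by omega)] at this
        omega
      · exact hP₁.fresh v
    · intro v hv
      simp only [hcD]
      rw [if_neg fun h => hv (hlp v (List.mem_append_right _ h))]
  have hseg₃ : Seg (τ₃.arr 1) (τ₃.reg 4) (τ₃.reg 5) p := by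
    rw [hP₃.r4, hP₃.r5]
    exact hseg.congr fun i hi => hP₃.keep i (by omega)
  have m8 : τ₃.reg 8 = y := by rw [hF₃.reg 8 rfl]; simp [f8]
  have m40 : τ₃.reg 40 = x := by rw [hF₃.reg 40 rfl]; simp [hF₂.reg 40 rfl, g40]
  have m27 : τ₃.reg 27 = τ₀.reg 27 := by rw [hF₃.reg 27 rfl]; simp [hF₂.reg 27 rfl, g27]
  have m15 : τ₃.reg 15 = τ₁.reg 15 := by rw [hF₃.reg 15 rfl]; simp [hF₂.reg 15 rfl]
  refine wp_paint cD p (fun v => cD v = y) e1.cols hseg₃ hp (by simp) ?_ ?_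
  · intro τ v hv hF h18 hcv
    simp only [Expr.ev, h18, hcv, hF.reg 8 rfl, m8]
    simp
  rw [m40]
  intro t₄ τ₄ n1 ht₄ hF₄
  -- What the flood has not reached rejoins the big class: the new class is `B \ D`, possibly larger
  -- than `B'`.
  set c₂ : Fin n → ℕ := fun v => if v ∈ p ∧ cD v = y then x else cD v with hc₂
  have hin : ∀ v ∈ {v | v ∈ l}, c₂ v = m := by
    intro v hv
    have h1 : cD v = m := if_pos hv
    simp only [hc₂, h1]
    rw [if_neg (by omega)]
  have hold : ∀ v, c v = b → v ∉ {v | v ∈ l} → c₂ v = x := by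
    intro v hv hvl
    have h1 : cD v = cy v := if_neg hvl
    simp only [hc₂, h1]
    by_cases hv' : c' v = x
    · rw [hcy1 v hv', if_neg (by omega)]
    · rw [hcy2 v hv hv', if_pos ⟨hT.sub v hv, rfl⟩]
  have hoth : ∀ v, c v ≠ b → c₂ v = c v := by
    intro v hv
    have h1 : cD v = cy v := if_neg fun h => hv (hlD v h).1
    have := hly v
    simp only [hc₂, h1, hcy3 v hv]
    rw [if_neg (by omega)]
  obtain ⟨hT₂, hcount⟩ := hT.layer (Q := Q) (B' := {v | c' v = x}) (D := {v | v ∈ l}) (m := m)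
    (c₂ := c₂) (x := x) hQs hsep hx (fun u hu v huv hv hvQ => hcl u v hu huv hv hvQ) hbig hma hBm
    hlD hDc hDcl hin hold hoth hlx
  have hwl : wsum L (l₀ ++ l) ≤ wsum L p := wsum_le_of_subset L e1.nodup hlp
  have hxf₁ : x < τ₁.reg 15 := by rw [hτ₁]; simpa using hxf
  refine ⟨c₂, hP₃.change (fun a ha => ?_) (fun a ha => ?_) ?_ ?_ n1 ?_ ?_, ?_, hT₂, by omega, ?_⟩
  · fin_cases ha <;> exact hF₄.reg _ rfl
  · fin_cases ha <;> exact hF₄.arr _ rfl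
  · rw [hF₄.reg 7 rfl]
  · intro i _; rw [hF₄.arr 1 rfl]
  · intro v
    simp only [hc₂]
    split_ifs
    · rw [m15]; exact hxf₁
    · exact hP₃.fresh v
  · intro v hv
    simp only [hc₂]
    rw [if_neg fun h => hv h.1]
  · rw [hF₄.reg 27 rfl, m27]; exact hpos
  · simp only [Expr.time, copyPos] at ht₄ ht₂ ht₃
    omega

end Round

end WordRAM


/-! ### Repeating rounds until a balanced separator appears -/

namespace WordRAM

/-- Search for a separator. -/
def search (h : ℕ) : Program :=
  .block [.assign 23 (.const 0), .loop (.eq (.reg 23) (.const 0)) (sepRound h)]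

section Search

variable {n : ℕ} {G : SimpleGraph (Fin n)}

/-- All of `B \ B'` is first given one fresh colour `y`. After a path separator this class is the
new tree already; after a layer separator it is divided between an old tree and the big class. The
class shrinks by `g` since the path has at least `g` vertices, respectively since `D` has. -/
theorem wp_updateTrees (L : IncidenceLists G) {σ τ₀ : Memory} {t h : ℕ} {Φ : ℕ → Memory → Prop}
    {p : List (Fin n)} {c₁ c c' : Fin n → ℕ} {b c₀ g N s : ℕ} {A : List ℕ} {Q : Set (Fin n)}
    (hst : PieceSt σ τ₀ p c₁ c' b c₀ g N) (hT : Trees G c {v | v ∈ p} b c₀ s N)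
    (hseg : Seg (σ.arr 1) (σ.reg 4) (σ.reg 5) p) (hle : σ.reg 5 ≤ σ.reg 7) (hp : p.Nodup)
    (hpos : 0 < τ₀.reg 27) (hz : τ₀.reg 38 < τ₀.reg 15) (hc₀ : c₀ ≤ τ₀.reg 38)
    (hsep : SepRes G c c' b s N (τ₀.reg 38) Q τ₀) (hAh : A.length < h)
    (hA : ∀ f, f ∈ A ↔ IsActive G c b c₀ f) (hk : SepKind G c b g A Q τ₀) (h40 : τ₀.reg 40 ≠ 0)
    (hΦ : ∀ t' τ x c₂, PieceSt σ τ p c₁ c₂ x c₀ g N → 0 < τ.reg 27 →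
      Trees G c₂ {v | v ∈ p} x c₀ s N →
      {v | c₂ v = x}.ncard + g ≤ {v | c v = b}.ncard →
      t' ≤ t + 500 * ((h + 1) * wsum L p) → Frame updateTrees τ₀ τ → Φ t' τ) :
    wp L.query updateTrees Φ t τ₀ := by
  suffices hsuff : wp L.query updateTrees (fun t' τ => ∃ x c₂, PieceSt σ τ p c₁ c₂ x c₀ g N ∧
      0 < τ.reg 27 ∧ Trees G c₂ {v | v ∈ p} x c₀ s N ∧
      {v | c₂ v = x}.ncard + g ≤ {v | c v = b}.ncard ∧
      t' ≤ t + 500 * ((h + 1) * wsum L p)) t τ₀ from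
    hsuff.mono fun t' τ _ hF ⟨x, c₂, h1, h2, h3, h4, h5⟩ => hΦ t' τ x c₂ h1 h2 h3 h4 h5 hF
  obtain ⟨hzx, hxc, hbig, r, hr, h41⟩ := hsep.big.resolve_left fun h => h40 h.1
  set z := τ₀.reg 38 with hz'
  set x := τ₀.reg 40 with hx'
  set y := τ₀.reg 15 with hy'
  have hlt := hsep.lt
  have hB : ∀ v, c' v = x → c v = b ∧ v ∉ Q := by
    intro v hv
    have h1 : c v = b := by
      by_contra hne
      have := hlt v
      rw [hsep.other v hne] at hv
      omega
    refine ⟨h1, fun hvQ => ?_⟩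
    rw [hsep.sep v hvQ] at hv
    omega
  have hcl : ∀ u v, c' u = x → G.Adj u v → c v = b → v ∉ Q → c' v = x := by
    intro u v hu huv hv hvQ
    rw [hsep.closed u v (hB u hu).1 (hB u hu).2 huv hv hvQ, hu]
  have hxy : x < y := by rw [← hr]; exact hst.fresh r
  have hrp : r ∈ p := hT.sub r (hB r hr).1
  have hpl : 1 ≤ p.length := List.length_pos_of_mem hrp
  have hW := length_le_wsum L p
  set X := (h + 1) * wsum L p with hX
  have hX1 : wsum L p ≤ X := Nat.le_mul_of_pos_left _ (by omega)
  rw [updateTrees]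
  simp only [Program.block, wp_seq_iff, wp_assign_iff, Expr.ev, Expr.time]
  have hq := hst.queue_le
  set τ₁ := (τ₀.setReg 8 (τ₀.reg 15)).setReg 15 ((τ₀.setReg 8 (τ₀.reg 15)).reg 15 + 1) with hτ₁
  have hr₁ : ∀ i, i ≠ 8 → i ≠ 15 → τ₁.reg i = τ₀.reg i := by
    intro i h1 h2
    simp [hτ₁, h1, h2]
  have g8 : τ₁.reg 8 = y := by simp [hτ₁, hy']
  have g15 : τ₁.reg 15 = y + 1 := by simp [hτ₁, hy']
  have ga : τ₁.arr = τ₀.arr := rfl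
  clear_value τ₁
  have hP₁ : PieceSt σ τ₁ p c₁ c' b c₀ g N := by
    obtain ⟨p1, p2, p3, p4, p5, p6, p7, p8, p9, p10, p11, p12, p13, p14, p15, p16, p17, p18⟩ := hst
    have e0 := hr₁ 0 (by simp) (by simp)
    have e4 := hr₁ 4 (by simp) (by simp)
    have e5 := hr₁ 5 (by simp) (by simp)
    have e7 := hr₁ 7 (by simp) (by simp)
    have e16 := hr₁ 16 (by simp) (by simp)
    have e20 := hr₁ 20 (by simp) (by simp)
    have e21 := hr₁ 21 (by simp) (by simp)
    have e22 := hr₁ 22 (by simp) (by simp)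
    have e24 := hr₁ 24 (by simp) (by simp)
    have e26 := hr₁ 26 (by simp) (by simp)
    have e27 := hr₁ 27 (by simp) (by simp)
    constructor
    any_goals simp only [e0, e4, e5, e7, e16, e20, e21, e22, e24, e26, e27, ga]
    any_goals assumption
    · intro v; rw [g15]; exact (p14 v).trans (Nat.lt_succ_self _)
    · omega
  have hseg₁ : Seg (τ₁.arr 1) (τ₁.reg 4) (τ₁.reg 5) p := by
    rw [hP₁.r4, hP₁.r5]
    have := hseg.len
    exact hseg.congr fun i hi => hP₁.keep i (by omega)
  refine wp_paint c' p (fun v => z ≤ c' v ∧ c' v ≠ x) hP₁.cols hseg₁ hp (by simp) ?_ ?_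
  · intro τ v hv hF h18 hcv
    simp only [Expr.ev, h18, hcv, hF.reg 38 rfl, hF.reg 40 rfl, hr₁ 38 (by simp) (by simp),
      hr₁ 40 (by simp) (by simp)]
    rw [← hz', ← hx']
    by_cases h1 : z ≤ c' v <;> by_cases h2 : c' v = x <;> simp [h1, h2] <;> omega
  rw [g8]
  intro t₂ τ₂ d1 ht₂ hF₂
  set cy : Fin n → ℕ := fun v => if v ∈ p ∧ z ≤ c' v ∧ c' v ≠ x then y else c' v with hcy
  have hcy1 : ∀ v, c' v = x → cy v = x := by
    intro v hv
    simp only [hcy]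
    rw [if_neg fun h => h.2.2 hv, hv]
  have hcy2 : ∀ v, c v = b → c' v ≠ x → cy v = y := by
    intro v hv hv'
    simp only [hcy]
    rw [if_pos]
    refine ⟨hT.sub v hv, ?_, hv'⟩
    by_cases hvQ : v ∈ Q
    · exact (hsep.sep v hvQ).ge
    · exact (hsep.rest v hv hvQ).le
  have hcy3 : ∀ v, c v ≠ b → cy v = c v := by
    intro v hv
    have := hlt v
    simp only [hcy]
    rw [hsep.other v hv, if_neg (by omega)]
  have hP₂ : PieceSt σ τ₂ p c₁ cy b c₀ g N := by
    refine hP₁.change (fun a ha => ?_) (fun a ha => ?_) ?_ ?_ d1 ?_ ?_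
    · fin_cases ha <;> exact hF₂.reg _ rfl
    · fin_cases ha <;> exact hF₂.arr _ rfl
    · rw [hF₂.reg 7 rfl]
    · intro i _; rw [hF₂.arr 1 rfl]
    · intro v
      simp only [hcy]
      split_ifs
      · omega
      · exact hP₁.fresh v
    · intro v hv
      simp only [hcy]
      rw [if_neg fun h => hv h.1]
  have f32 : τ₂.reg 32 = τ₀.reg 32 := by rw [hF₂.reg 32 rfl, hr₁ 32 (by simp) (by simp)]
  have f31 : τ₂.reg 31 = τ₀.reg 31 := by rw [hF₂.reg 31 rfl, hr₁ 31 (by simp) (by simp)]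
  have f25 : τ₂.reg 25 = τ₀.reg 25 := by rw [hF₂.reg 25 rfl, hr₁ 25 (by simp) (by simp)]
  have f27 : τ₂.reg 27 = τ₀.reg 27 := by rw [hF₂.reg 27 rfl, hr₁ 27 (by simp) (by simp)]
  have f40 : τ₂.reg 40 = x := by rw [hF₂.reg 40 rfl, hr₁ 40 (by simp) (by simp)]
  have f41 : τ₂.reg 41 = r := by rw [hF₂.reg 41 rfl, hr₁ 41 (by simp) (by simp), h41]
  have f8 : τ₂.reg 8 = y := by rw [hF₂.reg 8 rfl, g8]
  have f15 : τ₂.reg 15 = y + 1 := by rw [hF₂.reg 15 rfl, g15]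
  have hfin : ∀ (t' : ℕ) (τ : Memory) (c₂ : Fin n → ℕ), PieceSt σ τ p c₁ c₂ b c₀ g N →
      0 < τ.reg 27 → Trees G c₂ {v | v ∈ p} x c₀ s N →
      {v | c₂ v = x}.ncard + g ≤ {v | c v = b}.ncard → t' ≤ t₂ + 400 * X → τ.reg 40 = x →
      wp L.query (.assign 20 (.reg 40)) (fun t' τ => ∃ x c₂, PieceSt σ τ p c₁ c₂ x c₀ g N ∧
        0 < τ.reg 27 ∧ Trees G c₂ {v | v ∈ p} x c₀ s N ∧
        {v | c₂ v = x}.ncard + g ≤ {v | c v = b}.ncard ∧ t' ≤ t + 500 * X) t' τ := by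
    intro t' τ c₂ h1 h2 h3 h4 h5 h6
    rw [wp_assign_iff]
    refine ⟨x, c₂, ?_, by simpa using h2, h3, h4, ?_⟩
    · obtain ⟨p1, p2, p3, p4, p5, p6, p7, p8, p9, p10, p11, p12, p13, p14, p15, p16, p17, p18⟩ := h1
      constructor
      any_goals simp only [Memory.setReg_reg, Memory.setReg_arr, Expr.ev]
      any_goals norm_num only [if_true, if_false]
      any_goals assumption
    · simp only [Expr.time] at ht₂ ⊢
      omega
  refine wp_seq (wp_cond (fun he => ?_) (fun he => ?_))
  · simp only [Expr.ev, f32, f25, hk.size, ne_eq, ite_eq_right_iff, one_ne_zero, imp_false,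
      not_not] at he
    obtain ⟨-, k1, k2, k3⟩ := hk.kind.resolve_right fun h => by omega
    obtain ⟨hT₂, hcount⟩ := hT.path (Q := Q) (B' := {v | c' v = x}) (c₂ := cy) (x := x) (y := y)
      hsep.old k1 (fun f hf => k2 f ((hA f).2 hf)) hsep.few hB hxc
      (fun u hu v => hcl u v hu) hbig hcy1 hcy2 hcy3 hxy.ne
      (fun v => (hlt v).trans hzx) (fun v => (hlt v).trans hz) (hc₀.trans hz.le)
    rw [wp_skip_iff]
    refine hfin _ _ cy hP₂ (by omega) hT₂ (by omega) ?_ f40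
    simp only [Expr.time]
    omega
  · simp only [Expr.ev, f32, f25, hk.size, ite_eq_right_iff, one_ne_zero, imp_false] at he
    obtain ⟨-, j, hlay⟩ := hk.kind.resolve_left fun h => he h.1
    have hlay₂ : LayerRes G c b g A Q j (τ₂.reg 31) (τ₂.reg 32) τ₂ := by
      rw [f31, f32]
      refine hlay.congr ?_ ?_ ?_
      · rw [hF₂.reg 42 rfl, hr₁ 42 (by simp) (by simp)]
      · rw [hF₂.reg 34 rfl, hr₁ 34 (by simp) (by simp)]
      · rw [hF₂.arr 4 rfl, ga]
    refine wp_extendTree L hP₂ hT hseg hle hp (by omega) hB hcl hsep.few hxc hbig hlay₂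
      (fun f hf => (hA f).1 hf) hAh ?_ (fun v => (hlt v).trans hzx)
          (fun v => (hlt v).trans hz) hxy.ne
      f8 f40 (by omega) f41 hr hcy1 hcy2 hcy3 ?_
    · rw [hF₂.arr 8 rfl, ga]; exact hk.act
    · intro t₃ τ₃ c₂ e1 e2 e3 e4 ht₃ hF₃
      refine hfin _ _ c₂ e1 e2 e3 e4 ?_ (by rw [hF₃.reg 40 rfl, f40])
      simp only [Expr.time] at ht₃
      omega

/-- In the piece `p` the vertices of the colour `z` and the vertices of smaller colours next to a
greater colour form a small balanced separator. -/
structure SplitSt (G : SimpleGraph (Fin n)) (p : List (Fin n)) (c : Fin n → ℕ) (z q N : ℕ) :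
    Prop where
  count : {v | v ∈ p ∧ (c v = z ∨ c v < z ∧ ∃ u, G.Adj v u ∧ z < c u)}.ncard ≤ q
  mem : ∀ v, z ≤ c v → v ∈ p
  closed : ∀ u v, z < c u → z < c v → G.Adj u v → c v = c u
  small : ∀ f, z < f → 2 * {v | c v = f}.ncard ≤ N
  rest : 2 * {v | v ∈ p ∧ c v < z}.ncard ≤ N

/-- The only vertices outside `B` next to a component of `B - Q` lie in active trees, at most `s` in
each. With `Q` these are at most `A.length + 1 ≤ h` sets of at most `s` vertices. The part of the
piece outside `B` is small because `B` has more than half of the vertices. -/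
theorem SepRes.split {c c' : Fin n → ℕ} {b s c₀ N z h : ℕ} {A : List ℕ} {Q : Set (Fin n)}
    {τ : Memory} {p : List (Fin n)} (hsep : SepRes G c c' b s N z Q τ)
    (hT : Trees G c {v | v ∈ p} b c₀ s N) (hAh : A.length < h)
    (hA : ∀ f, f ∈ A ↔ IsActive G c b c₀ f) (h40 : τ.reg 40 = 0) (hp : p.Nodup)
    (hN : p.length = N) : SplitSt G p c' z (h * s) N := by
  have hlt := hsep.lt
  have hcases : ∀ v, (v ∈ Q ∧ c v = b ∧ c' v = z) ∨ (v ∉ Q ∧ c v = b ∧ z < c' v) ∨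
      (v ∉ Q ∧ c v ≠ b ∧ c' v = c v ∧ c' v < z) := by
    intro v
    by_cases h1 : c v = b
    · by_cases h2 : v ∈ Q
      · exact Or.inl ⟨h2, h1, hsep.sep v h2⟩
      · exact Or.inr (Or.inl ⟨h2, h1, hsep.rest v h1 h2⟩)
    · refine Or.inr (Or.inr ⟨fun h => h1 (hsep.old v h), h1, hsep.other v h1, ?_⟩)
      rw [hsep.other v h1]; exact hlt v
  have hgt : ∀ v, z < c' v → c v = b ∧ v ∉ Q := by
    intro v hv
    rcases hcases v with ⟨h1, h2, h3⟩ | ⟨h1, h2, h3⟩ | ⟨h1, h2, h3, h4⟩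
    · omega
    · exact ⟨h2, h1⟩
    · omega
  refine ⟨?_, ?_, ?_, ?_, ?_⟩
  · have hsub : {v | v ∈ p ∧ (c' v = z ∨ c' v < z ∧ ∃ u, G.Adj v u ∧ z < c' u)} ⊆
        Q ∪ ⋃ f ∈ A.toFinset, {v | c v = f ∧ Near G c b v} := by
      rintro v ⟨hvp, hv⟩
      rcases hcases v with ⟨h1, h2, h3⟩ | ⟨h1, h2, h3⟩ | ⟨h1, h2, h3, h4⟩
      · exact Or.inl h1
      · omega
      · obtain ⟨-, u, huv, hu⟩ := hv.resolve_left (by omega)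
        right
        have hub := (hgt u hu).1
        simp only [Set.mem_iUnion, List.mem_toFinset]
        refine ⟨c v, (hA _).2 ⟨(hT.inside v hvp).resolve_left h2, h2, u, v, hub, rfl, huv.symm⟩,
          rfl, u, huv, hub⟩
    refine (Set.ncard_le_ncard hsub (Set.toFinite _)).trans ((Set.ncard_union_le _ _).trans ?_)
    have h1 : (⋃ f ∈ A.toFinset, {v | c v = f ∧ Near G c b v}).ncard ≤ A.toFinset.card * s := by
      refine (Finset.set_ncard_biUnion_le _ _).trans ?_
      rw [← smul_eq_mul]
      exact Finset.sum_le_card_nsmul _ _ _ fun f hf => hT.few f ((hA f).1 (List.mem_toFinset.1 hf))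
    have h2 : A.toFinset.card * s ≤ A.length * s := Nat.mul_le_mul_right _ (List.toFinset_card_le _)
    have h3 := hsep.few
    have h4 : (A.length + 1) * s ≤ h * s := Nat.mul_le_mul_right _ hAh
    rw [add_mul, one_mul] at h4
    omega
  · intro v hv
    rcases hcases v with ⟨h1, h2, h3⟩ | ⟨h1, h2, h3⟩ | ⟨h1, h2, h3, h4⟩
    · exact hT.sub v h2
    · exact hT.sub v h2
    · omega
  · intro u v hu hv huv
    exact hsep.closed u v (hgt u hu).1 (hgt u hu).2 huv (hgt v hv).1 (hgt v hv).2
  · rcases hsep.big with h | h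
    · exact h.2
    · omega
  · have hdisj : Disjoint {v | v ∈ p ∧ c' v < z} {v | c v = b} := by
      refine Set.disjoint_left.2 fun v hv hv' => ?_
      have h5 : c v = b := hv'
      have h6 := hv.2
      rcases hcases v with ⟨h1, h2, h3⟩ | ⟨h1, h2, h3⟩ | ⟨h1, h2, h3, h4⟩
      · omega
      · omega
      · exact h2 h5
    have h1 := Set.ncard_union_eq hdisj (Set.toFinite _) (Set.toFinite _)
    have h2 := Set.ncard_le_ncard (show {v | v ∈ p ∧ c' v < z} ∪ {v | c v = b} ⊆ {v | v ∈ p} from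
      fun v hv => hv.elim (fun h => h.1) (hT.sub v)) (Set.toFinite _)
    rw [ncard_setOf_mem hp, hN] at h2
    have := hT.big
    omega

theorem wp_sepRound (L : IncidenceLists G) {σ τ₀ : Memory} {t h : ℕ} {Φ : ℕ → Memory → Prop}
    {p : List (Fin n)} {c₁ c : Fin n → ℕ} {b c₀ g N : ℕ}
    (hst : PieceSt σ τ₀ p c₁ c b c₀ g N) (hT : Trees G c {v | v ∈ p} b c₀ (5 * h * g) N)
    (hG : ¬ CliqueMinor h G) (hseg : Seg (σ.arr 1) (σ.reg 4) (σ.reg 5) p)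
    (hle : σ.reg 5 ≤ σ.reg 7) (hp : p.Nodup) (hN : p.length = N) (hg : 0 < g)
    (hgN : N < (g + 1) * (g + 1)) (hgB : g ≤ {v | c v = b}.ncard)
    (hpos : 0 < τ₀.reg 27)
    (hΦ : ∀ t' τ, (τ.reg 23 = 1 ∧ (∃ c', PieceSt σ τ p c₁ c' b c₀ g N ∧
        SplitSt G p c' (τ.reg 38) (h * (5 * h * g)) N) ∧ τ.reg 38 < τ.reg 15) ∨
      (τ.reg 23 = τ₀.reg 23 ∧ ∃ x c₂, PieceSt σ τ p c₁ c₂ x c₀ g N ∧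
        Trees G c₂ {v | v ∈ p} x c₀ (5 * h * g) N ∧
        {v | c₂ v = x}.ncard + g ≤ {v | c v = b}.ncard) → 0 < τ.reg 27 →
      t' ≤ t + 4000 * ((h + 1) * wsum L p) → Frame (sepRound h) τ₀ τ → Φ t' τ) :
    wp L.query (sepRound h) Φ t τ₀ := by
  suffices hsuff : wp L.query (sepRound h) (fun t' τ =>
      ((τ.reg 23 = 1 ∧ (∃ c', PieceSt σ τ p c₁ c' b c₀ g N ∧
        SplitSt G p c' (τ.reg 38) (h * (5 * h * g)) N) ∧ τ.reg 38 < τ.reg 15) ∨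
      (τ.reg 23 = τ₀.reg 23 ∧ ∃ x c₂, PieceSt σ τ p c₁ c₂ x c₀ g N ∧
        Trees G c₂ {v | v ∈ p} x c₀ (5 * h * g) N ∧
        {v | c₂ v = x}.ncard + g ≤ {v | c v = b}.ncard)) ∧ 0 < τ.reg 27 ∧
      t' ≤ t + 4000 * ((h + 1) * wsum L p)) t τ₀ from
    hsuff.mono fun t' τ _ hF ⟨h1, h2, h3⟩ => hΦ t' τ h1 h2 h3 hF
  obtain ⟨r, hr⟩ := hT.conn.1
  have hpl : 1 ≤ p.length := List.length_pos_of_mem (hT.sub r hr)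
  have hW := length_le_wsum L p
  have hX1 : wsum L p ≤ (h + 1) * wsum L p := Nat.le_mul_of_pos_left _ (by omega)
  set X := (h + 1) * wsum L p with hX
  rw [sepRound]
  simp only [Program.block, wp_seq_iff]
  refine wp_findSep L hst hT hG hseg hle hp hN hg hgN hgB hpos ?_
  intro t₁ τ₁ c' A Q d1 d2 d3 d4 d5 d6 d7 d8 ht₁ hF₁
  refine wp_cond (fun he => ?_) (fun he => ?_)
  · have he : τ₁.reg 40 = 0 := by_contra fun h => he (if_neg h)
    rw [wp_assign_iff]
    refine ⟨Or.inl ⟨by simp [Expr.ev], ⟨c', d1.setReg _ (by simp), ?_⟩, by simpa using d3⟩,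
      by simpa using d2, by simp only [Expr.time]; omega⟩
    simpa using d4.split hT d6 d7 he hp hN
  · have he : τ₁.reg 40 ≠ 0 := fun h => one_ne_zero ((if_pos h).symm.trans he)
    refine wp_updateTrees L d1 hT hseg hle hp d2 d3 d5 d4 d6 d7 d8 he ?_
    intro t₂ τ₂ x c₂ e1 e2 e3 e4 ht₂ hF₂
    refine ⟨Or.inr ⟨?_, x, c₂, e1, e3, e4⟩, e2, by simp only [Expr.time] at ht₂; omega⟩
    rw [hF₂.reg 23 rfl, hF₁.reg 23 rfl]

theorem half_bound {g N m : ℕ} (hN : g * g ≤ N) (hm : N < 2 * m) : g ≤ m := by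
  nlinarith

/-- Every round that ends with a big component removes at least `g` vertices from the big class, so
the number of rounds is at most `N / g = O(g)`. The number of vertices removed so far is kept in the
invariant as `i * g`. -/
theorem wp_search (L : IncidenceLists G) {σ τ₀ : Memory} {t h : ℕ} {Φ : ℕ → Memory → Prop}
    {p : List (Fin n)} {c₁ c : Fin n → ℕ} {b c₀ g N : ℕ}
    (hst : PieceSt σ τ₀ p c₁ c b c₀ g N) (hT : Trees G c {v | v ∈ p} b c₀ (5 * h * g) N)
    (hG : ¬ CliqueMinor h G) (hseg : Seg (σ.arr 1) (σ.reg 4) (σ.reg 5) p)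
    (hle : σ.reg 5 ≤ σ.reg 7) (hp : p.Nodup) (hN : p.length = N) (hg : 0 < g)
    (hgN : N < (g + 1) * (g + 1)) (hgN' : g * g ≤ N) (hpos : 0 < τ₀.reg 27)
    (hΦ : ∀ t' τ b' c', PieceSt σ τ p c₁ c' b' c₀ g N →
        SplitSt G p c' (τ.reg 38) (h * (5 * h * g)) N → τ.reg 38 < τ.reg 15 → 0 < τ.reg 27 →
      t' ≤ t + 30000 * ((h + 1) * wsum L p) * g → Frame (search h) τ₀ τ → Φ t' τ) :
    wp L.query (search h) Φ t τ₀ := by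
  suffices hsuff : wp L.query (search h) (fun t' τ => ∃ b' c', PieceSt σ τ p c₁ c' b' c₀ g N ∧
      SplitSt G p c' (τ.reg 38) (h * (5 * h * g)) N ∧ τ.reg 38 < τ.reg 15 ∧ 0 < τ.reg 27 ∧
      t' ≤ t + 30000 * ((h + 1) * wsum L p) * g) t τ₀ from
    hsuff.mono fun t' τ _ hF ⟨b', c', h1, h2, h3, h4, h5⟩ => hΦ t' τ b' c' h1 h2 h3 h4 h5 hF
  obtain ⟨r, hr⟩ := hT.conn.1
  have hpl : 1 ≤ p.length := List.length_pos_of_mem (hT.sub r hr)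
  have hW := length_le_wsum L p
  have hX1 : wsum L p ≤ (h + 1) * wsum L p := Nat.le_mul_of_pos_left _ (by omega)
  set X := (h + 1) * wsum L p with hX
  have hBN : ∀ (c : Fin n → ℕ) (b : ℕ), Trees G c {v | v ∈ p} b c₀ (5 * h * g) N →
      {v | c v = b}.ncard ≤ N := by
    intro c b hT
    have := Set.ncard_le_ncard (show {v | c v = b} ⊆ {v | v ∈ p} from hT.sub) (Set.toFinite _)
    rwa [ncard_setOf_mem hp, hN] at this
  -- From `N < (g + 1) ^ 2` one gets `i * g ≤ N ≤ 3 * g * g`.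
  have hrounds : ∀ i m, i * g + m ≤ N → i ≤ 3 * g := by
    intro i m him
    have h1 : i * g ≤ 3 * g * g := by nlinarith
    exact Nat.le_of_mul_le_mul_right h1 hg
  have hfin : ∀ i, i ≤ 3 * g → 4100 * X * (i + 1) + 10 ≤ 30000 * X * g := by
    intro i hi
    have h1 : 4100 * X * (i + 1) ≤ 4100 * X * (4 * g) := Nat.mul_le_mul_left _ (by omega)
    have h2 : 1 ≤ X * g := Nat.mul_pos (by omega) hg
    nlinarith
  rw [search]
  simp only [Program.block, wp_seq_iff, wp_assign_iff, Expr.ev, Expr.time]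
  refine wp_loop (fun t' τ => 0 < τ.reg 27 ∧ ∃ i, i ≤ 3 * g ∧
    ((τ.reg 23 = 1 ∧ t' ≤ t + 2 + 4100 * X * (i + 1) ∧ (∃ b' c', PieceSt σ τ p c₁ c' b' c₀ g N ∧
        SplitSt G p c' (τ.reg 38) (h * (5 * h * g)) N) ∧ τ.reg 38 < τ.reg 15) ∨
      (τ.reg 23 = 0 ∧ t' ≤ t + 2 + 4100 * X * i ∧ ∃ x c₂, PieceSt σ τ p c₁ c₂ x c₀ g N ∧
        Trees G c₂ {v | v ∈ p} x c₀ (5 * h * g) N ∧ i * g + {v | c₂ v = x}.ncard ≤ N)))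
    (t + 30000 * X * g) ?_ ?_ ?_ ?_
  · refine ⟨by simpa using hpos, 0, by omega, Or.inr ⟨by simp, by omega, b, c,
      hst.setReg _ (by simp),
      hT, ?_⟩⟩
    have := hBN c b hT
    omega
  · rintro t' τ ⟨-, i, hi, ⟨-, h1, -⟩ | ⟨-, h1, -⟩⟩
    · have := hfin i hi
      omega
    · have := hfin i hi
      have : 4100 * X * i ≤ 4100 * X * (i + 1) := Nat.mul_le_mul_left _ (by omega)
      omega
  · rintro t' τ ⟨h27, i, hi, ⟨h1, -⟩ | ⟨h1, ht', x, c₂, h2, h3, h4⟩⟩ he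
    · simp [Expr.ev, h1] at he
    · refine wp_sepRound L h2 h3 hG hseg hle hp hN hg hgN (half_bound hgN' h3.big) h27 ?_
      intro t₁ τ₁ hcase e1 ht₁ hF₁
      refine ⟨e1, ?_⟩
      rcases hcase with ⟨d1, ⟨c', d2⟩, d3⟩ | ⟨d1, x', c₃, d2, d3, d4⟩
      · refine ⟨i, hi, Or.inl ⟨d1, ?_, ⟨x, c', d2⟩, d3⟩⟩
        simp only [Expr.time] at ht₁
        rw [mul_add]
        omega
      · have hb : (i + 1) * g + {v | c₃ v = x'}.ncard ≤ N := by
          rw [add_mul, one_mul]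
          omega
        refine ⟨i + 1, hrounds _ _ hb, Or.inr ⟨d1.trans h1, ?_, x', c₃, d2, d3, hb⟩⟩
        simp only [Expr.time] at ht₁
        rw [mul_add]
        omega
  · rintro t' τ ⟨h27, i, hi, ⟨h1, ht', ⟨b', c', h2, h3⟩, h4⟩ | ⟨h1, -⟩⟩ he
    · refine ⟨b', c', h2, h3, h4, h27, ?_⟩
      have := hfin i hi
      simp only [Expr.time]
      omega
    · simp [Expr.ev, h1] at he

end Search

end WordRAM


namespace WordRAM

/-! ### Splitting a piece -/

/-- Mark in the array `10` the vertices of the segment that have the colour in the register `38` or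
a smaller colour and a neighbour of a greater colour. -/
def markCut : Program :=
  forSeg (.block [.write 10 (.reg 18) (.eq (.read 0 (.reg 18)) (.reg 38)),
    .cond (.lt (.read 0 (.reg 18)) (.reg 38))
      (forNbrs 18 (.cond (.lt (.reg 38) (.read 0 (.reg 14))) (.write 10 (.reg 18)
          (.const 1)) .skip))
      .skip])

/-- Every marked vertex of the segment gets its own fresh colour, the others get the colour in the
register `8`. -/
def colorCut : Program :=
  forSeg (.cond (.read 10 (.reg 18))
    (.block [.write 0 (.reg 18) (.reg 15), .assign 15 (.add (.reg 15) (.const 1))])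
    (.write 0 (.reg 18) (.reg 8)))

section Cut

variable {n : ℕ} {G : SimpleGraph (Fin n)}

/-- The vertices marked by `markCut` for the colour `z`. -/
def IsCut (G : SimpleGraph (Fin n)) (c : Fin n → ℕ) (z : ℕ) (v : Fin n) : Prop :=
  c v = z ∨ c v < z ∧ ∃ u, G.Adj v u ∧ z < c u

/-- Each vertex of the segment first gets a definite value in array `10`, so marks from earlier
pieces do no harm. -/
theorem wp_markCut (L : IncidenceLists G) {σ : Memory} {t : ℕ} {Φ : ℕ → Memory → Prop}
    (c : Fin n → ℕ) (p : List (Fin n)) (hc : ∀ v : Fin n, σ.arr 0 v = c v)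
    (hseg : Seg (σ.arr 1) (σ.reg 4) (σ.reg 5) p) (hp : p.Nodup)
    (hΦ : ∀ t' τ, (∀ v ∈ p, τ.arr 10 v ≠ 0 ↔ IsCut G c (σ.reg 38) v) →
      t' ≤ t + 60 * wsum L p + 20 * (p.length + 1) → Frame markCut σ τ → Φ t' τ) :
    wp L.query markCut Φ t σ := by
  refine wp_forSeg p (fun l s τ => s ≤ 60 * wsum L l ∧ (∃ r, p = l ++ r) ∧
    τ.arr 1 = σ.arr 1 ∧ ∀ v ∈ l, τ.arr 10 v ≠ 0 ↔ IsCut G c (σ.reg 38) v)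
    hseg ⟨rfl, rfl, rfl⟩ (60 * wsum L p) ?_ ?_ ?_ ?_ ?_ ?_
  · rintro l s τ m i - h
    exact h
  · exact ⟨by simp [wsum], ⟨p, rfl⟩, rfl, by simp⟩
  · rintro l s τ ⟨h1, ⟨r, rfl⟩, -⟩
    rw [wsum_append]
    omega
  · rintro l s τ ⟨-, -, h2, -⟩ i _
    rw [h2]
  · rintro l v r s t' τ hl hF ⟨h1, -, h2, h3⟩ h18
    have hvl : v ∉ l := by
      intro hm
      rw [hl] at hp
      exact (List.nodup_append.1 hp).2.2 v hm v (by simp) rfl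
    have e0 : ∀ w : Fin n, τ.arr 0 w = c w := fun w => by rw [hF.arr 0 rfl, hc]
    have e38 : τ.reg 38 = σ.reg 38 := hF.reg 38 rfl
    have hwt := one_le_wt L v
    have hother : ∀ (τ' : Memory), (∀ w : Fin n, w ≠ v → τ'.arr 10 w = τ.arr 10 w) →
        (τ'.arr 10 v ≠ 0 ↔ IsCut G c (σ.reg 38) v) →
        ∀ w ∈ l ++ [v], τ'.arr 10 w ≠ 0 ↔ IsCut G c (σ.reg 38) w := by
      intro τ' h4 h5 w hw
      rcases List.mem_append.1 hw with hw | hw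
      · rw [h4 w (ne_of_mem_of_not_mem hw hvl)]
        exact h3 w hw
      · rw [List.mem_singleton.1 hw]
        exact h5
    have hs : wsum L (l ++ [v]) = wsum L l + L.wt v := by simp [wsum]
    simp only [Program.block, wp_seq_iff, wp_write_iff, Expr.ev, Expr.time, h18, e0, e38]
    refine wp_cond (fun he => ?_) (fun he => ?_)
    · simp only [Expr.ev, Memory.setArr_reg, Memory.setArr_arr, h18, e38] at he
      norm_num only [if_false] at he
      rw [e0] at he
      have hlt : c v < σ.reg 38 := by
        by_contra h
        exact he (if_neg h)
      refine wp_forNbrs L v 15 (fun l' τ' => (∀ w : Fin n, w ≠ v → τ'.arr 10 w = τ.arr 10 w) ∧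
        (τ'.arr 10 v ≠ 0 ↔ ∃ u ∈ l', σ.reg 38 < c u)) (by simpa using h18) rfl rfl ?_ ?_ ?_ ?_
      · rintro l' τ' m i - h
        exact h
      · refine ⟨fun w hw => ?_, ?_⟩
        · simp [Function.update_apply, Fin.val_inj, hw]
        · simp [hlt.ne]
      · rintro l' u r' t₁ τ₁ - hF₁ ⟨g1, g2⟩ h14 hadj
        have f0 : τ₁.arr 0 u = c u := by rw [hF₁.arr 0 rfl]; simpa using e0 u
        have f38 : τ₁.reg 38 = σ.reg 38 := by rw [hF₁.reg 38 rfl]; simpa using e38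
        have f18 : τ₁.reg 18 = v := by rw [hF₁.reg 18 rfl]; simpa using h18
        refine wp_cond (fun he => ?_) (fun he => ?_)
        · simp only [Expr.ev, h14, f0, f38] at he
          have hlt : σ.reg 38 < c u := by
            by_contra h
            exact he (if_neg h)
          rw [wp_write_iff]
          refine ⟨by simp only [Expr.time]; omega, fun w hw => ?_, ?_⟩
          · simp [Expr.ev, f18, Function.update_apply, Fin.val_inj, hw, g1 w hw]
          · simp only [Expr.ev, Memory.setArr_arr, f18, if_true, Function.update_self]
            exact ⟨fun _ => ⟨u, by simp, hlt⟩, fun _ => one_ne_zero⟩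
        · simp only [Expr.ev, h14, f0, f38, ite_eq_right_iff, one_ne_zero, imp_false] at he
          rw [wp_skip_iff]
          refine ⟨by simp only [Expr.time]; omega, g1, ?_⟩
          rw [g2]
          simp [he, or_and_right, exists_or]
      · rintro t₁ τ₁ ht₁ hF₁ ⟨g1, g2⟩
        refine ⟨60 * L.wt v, ?_, by rw [hs]; omega, ⟨r, by simp [hl]⟩, ?_, hother _ g1 ?_⟩
        · simp only [Expr.time] at ht₁
          omega
        · rw [hF₁.arr 1 rfl]
          simpa using h2
        · rw [g2, IsCut]
          simp only [L.mem_iff, hlt.ne, false_or, hlt, true_and]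
    · simp only [Expr.ev, Memory.setArr_reg, Memory.setArr_arr, h18, e38] at he
      norm_num only [if_false] at he
      rw [e0] at he
      have hlt : ¬ c v < σ.reg 38 := by
        intro h
        rw [if_pos h] at he
        exact one_ne_zero he
      rw [wp_skip_iff]
      refine ⟨60 * L.wt v, by simp only [Expr.time]; omega, by rw [hs]; omega, ⟨r, by simp [hl]⟩,
        by simpa using h2, hother _ (fun w hw => ?_) ?_⟩
      · simp [Function.update_apply, Fin.val_inj, hw]
      · simp [IsCut, hlt]
  · rintro t' s τ ht' hF ⟨h1, -, -, h4⟩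
    exact hΦ t' τ h4 (by omega) hF

theorem wp_colorCut {qy : ℕ → ℕ → ℕ} {σ : Memory} {t : ℕ} {Φ : ℕ → Memory → Prop}
    (c : Fin n → ℕ) (p : List (Fin n)) (P : Fin n → Prop) [DecidablePred P]
    (hc : ∀ v : Fin n, σ.arr 0 v = c v)
    (hseg : Seg (σ.arr 1) (σ.reg 4) (σ.reg 5) p) (hp : p.Nodup)
    (hP : ∀ v ∈ p, σ.arr 10 v ≠ 0 ↔ P v)
    (hΦ : ∀ t' τ (c' : Fin n → ℕ), (∀ v : Fin n, τ.arr 0 v = c' v) → (∀ v, v ∉ p → c' v = c v) →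
      (∀ v ∈ p, ¬ P v → c' v = σ.reg 8) →
      (∀ v ∈ p, P v → σ.reg 15 ≤ c' v ∧ c' v < τ.reg 15 ∧ ∀ u ∈ p, P u → c' u = c' v → u = v) →
      σ.reg 15 ≤ τ.reg 15 →
      t' ≤ t + 20 * p.length + 20 * (p.length + 1) → Frame colorCut σ τ → Φ t' τ) :
    wp qy colorCut Φ t σ := by
  refine wp_forSeg p (fun l s τ => s ≤ 20 * l.length ∧ (∃ r, p = l ++ r) ∧ σ.reg 15 ≤ τ.reg 15 ∧
    τ.arr 1 = σ.arr 1 ∧ ∃ c' : Fin n → ℕ, (∀ v : Fin n, τ.arr 0 v = c' v) ∧ (∀ v, v ∉ l →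
        c' v = c v) ∧
      (∀ v ∈ l, ¬ P v → c' v = σ.reg 8) ∧
      (∀ v ∈ l, P v → σ.reg 15 ≤ c' v ∧ c' v < τ.reg 15 ∧ ∀ u ∈ l, P u → c' u = c' v → u = v))
    hseg ⟨rfl, rfl, rfl⟩ (20 * p.length) ?_ ?_ ?_ ?_ ?_ ?_
  · rintro l s τ m i hi ⟨h1, h2, h3, h4, h5⟩
    have h15 : (τ.setReg i m).reg 15 = τ.reg 15 := by
      rw [Memory.setReg_reg, if_neg (by rintro rfl; simp at hi)]
    refine ⟨h1, h2, ?_, h4, ?_⟩ <;> rw [h15] <;> assumption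
  · exact ⟨by simp, ⟨p, rfl⟩, le_rfl, rfl, c, hc, fun _ _ => rfl, by simp, by simp⟩
  · rintro l s τ ⟨h1, ⟨r, rfl⟩, -⟩
    exact h1.trans (Nat.mul_le_mul_left _ (by simp))
  · rintro l s τ ⟨-, -, -, h2, -⟩ i _
    rw [h2]
  · rintro l v r s t' τ hl hF ⟨h1, -, h3, h2, c', g1, g2, g3, g4⟩ h18
    have hvl : v ∉ l := by
      intro hm
      rw [hl] at hp
      exact (List.nodup_append.1 hp).2.2 v hm v (by simp) rfl
    have e10 : τ.arr 10 v ≠ 0 ↔ P v := by rw [hF.arr 10 rfl]; exact hP v (by simp [hl])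
    have e8 : τ.reg 8 = σ.reg 8 := hF.reg 8 rfl
    have hlen : (l ++ [v]).length = l.length + 1 := by simp
    refine wp_cond (fun he => ?_) (fun he => ?_)
    · have hv : P v := by rwa [← e10, ← h18]
      simp only [Program.block, wp_seq_iff, wp_write_iff, wp_assign_iff, Expr.ev, Expr.time, h18]
      refine ⟨20, by omega, by omega, ⟨r, by simp [hl]⟩, by simp; omega, by simp [h2],
        Function.update c' v (τ.reg 15), fun w => ?_, fun w hw => ?_, fun w hw hPw => ?_,
        fun w hw hPw => ?_⟩
      · simp [Function.update_apply, Fin.val_inj, g1]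
      · simp only [List.mem_append, List.mem_singleton, not_or] at hw
        rw [Function.update_of_ne hw.2, g2 w hw.1]
      · rcases List.mem_append.1 hw with hw | hw
        · rw [Function.update_of_ne (ne_of_mem_of_not_mem hw hvl), g3 w hw hPw]
        · rw [List.mem_singleton.1 hw] at hPw
          exact absurd hv hPw
      · simp only [Memory.setReg_reg, if_true, Memory.setArr_reg]
        rcases List.mem_append.1 hw with hw | hw
        · obtain ⟨k1, k2, k3⟩ := g4 w hw hPw
          rw [Function.update_of_ne (ne_of_mem_of_not_mem hw hvl)]
          refine ⟨k1, by omega, fun u hu hPu huw => ?_⟩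
          rcases List.mem_append.1 hu with hu | hu
          · rw [Function.update_of_ne (ne_of_mem_of_not_mem hu hvl)] at huw
            exact k3 u hu hPu huw
          · rw [List.mem_singleton.1 hu, Function.update_self] at huw
            omega
        · obtain rfl := List.mem_singleton.1 hw
          rw [Function.update_self]
          refine ⟨h3, by omega, fun u hu hPu huw => ?_⟩
          rcases List.mem_append.1 hu with hu | hu
          · rw [Function.update_of_ne (ne_of_mem_of_not_mem hu hvl)] at huw
            have := (g4 u hu hPu).2.1
            omega
          · exact List.mem_singleton.1 hu
    · have hv : ¬ P v := by
        rw [← e10, ← h18]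
        exact fun h => h he
      rw [wp_write_iff]
      refine ⟨20, by simp only [Expr.time]; omega, by omega, ⟨r, by simp [hl]⟩, h3, by simp [h2],
        Function.update c' v (σ.reg 8), fun w => ?_, fun w hw => ?_, fun w hw hPw => ?_,
        fun w hw hPw => ?_⟩
      · simp [Expr.ev, h18, e8, Function.update_apply, Fin.val_inj, g1]
      · simp only [List.mem_append, List.mem_singleton, not_or] at hw
        rw [Function.update_of_ne hw.2, g2 w hw.1]
      · rcases List.mem_append.1 hw with hw | hw
        · rw [Function.update_of_ne (ne_of_mem_of_not_mem hw hvl), g3 w hw hPw]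
        · rw [List.mem_singleton.1 hw, Function.update_self]
      · have hmem : ∀ u ∈ l ++ [v], P u → u ∈ l ∧ u ≠ v := by
          intro u hu hPu
          rcases List.mem_append.1 hu with hu | hu
          · exact ⟨hu, ne_of_mem_of_not_mem hu hvl⟩
          · rw [List.mem_singleton.1 hu] at hPu
            exact absurd hPu hv
        obtain ⟨hw1, hw2⟩ := hmem w hw hPw
        obtain ⟨k1, k2, k3⟩ := g4 w hw1 hPw
        rw [Function.update_of_ne hw2]
        refine ⟨k1, k2, fun u hu hPu huw => ?_⟩
        obtain ⟨hu1, hu2⟩ := hmem u hu hPu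
        rw [Function.update_of_ne hu2] at huw
        exact k3 u hu1 hPu huw
  · rintro t' s τ ht' hF ⟨h1, -, h3, h2, c', g1, g2, g3, g4⟩
    exact hΦ t' τ c' g1 g2 g3 g4 h3 (by omega) hF

end Cut

end WordRAM


/-! ### Splitting a piece into components of at most half its size -/

namespace WordRAM

/-- Split the colour class in the segment given by the registers `4` and `5`, and put the new pieces
on the stack. -/
def process (h : ℕ) : Program :=
  .block [.assign 26 (.sub (.reg 5) (.reg 4)), .assign 20 (.read 0 (.read 1 (.reg 4))),
    .assign 22 (.reg 15), .assign 21 (.const 0),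
    .loop (.lt (.mul (.add (.reg 21) (.const 1)) (.add (.reg 21) (.const 1)))
      (.add (.reg 26) (.const 1))) (.assign 21 (.add (.reg 21) (.const 1))),
    search h, markCut, .assign 8 (.reg 15), .assign 15 (.add (.reg 15) (.const 1)), colorCut,
    .assign 40 (.const 0), comps]

section Splitting

variable {n : ℕ} {G : SimpleGraph (Fin n)}

/-- The colouring `c'` arises from `c` by splitting the class `p` into the vertices of the set `X`
and the pieces `C`. -/
structure Split (G : SimpleGraph (Fin n)) (p : List (Fin n)) (c c' : Fin n → ℕ) (X : Set (Fin n))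
    (C : List (List (Fin n))) : Prop where
  cover : ∀ v ∈ p, v ∈ X ∨ ∃ l ∈ C, v ∈ l
  single : ∀ v ∈ X, ∀ u, c' u = c' v → u = v
  cls : ∀ l ∈ C, ∃ f, ∀ v, v ∈ l ↔ c' v = f
  sub_piece : ∀ l ∈ C, ∀ v ∈ l, v ∈ p
  nodup : C.flatten.Nodup
  conn : ∀ l ∈ C, Conn G {x | x ∈ l}
  small : ∀ l ∈ C, 2 * l.length ≤ p.length
  edge : ∀ u v, u ∈ p → v ∈ p → G.Adj u v → c' u ≠ c' v → u ∈ X ∨ v ∈ X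
  outside : ∀ v, v ∉ p → c' v = c v
  new : ∀ v ∈ p, ∀ u, u ∉ p → c' u ≠ c' v

/-- The state of the memory between splits of pieces. -/
structure IdleSt (c : Fin n → ℕ) (τ : Memory) : Prop where
  cols : ∀ v : Fin n, τ.arr 0 v = c v
  r0 : τ.reg 0 = n
  fresh : ∀ v, c v < τ.reg 15
  pos : ∀ i, τ.arr 4 i < τ.reg 27
  mark : ∀ i, τ.arr 9 i ≤ τ.reg 24

theorem CompsSt.lt_fresh {σ τ : Memory} {c c' : Fin n → ℕ} {C : List (List (Fin n))}
    (hC : CompsSt G σ τ c c' C) (hne : ∀ v, c' v ≠ σ.reg 8) (hc : ∀ v, c v < σ.reg 15) (v : Fin n) :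
    c' v < τ.reg 15 := by
  have h1 := hC.fresh
  have h2 := hc v
  by_cases hv : c v = σ.reg 8
  · obtain ⟨i, l, hl, hvl⟩ := (hC.todo v hv).resolve_left (hne v)
    have h3 := (hC.comp_mem i l hl v).1 hvl
    obtain ⟨h4, -⟩ := List.getElem?_eq_some_iff.1 hl
    omega
  · rw [hC.other v hv]
    omega

/-- Removing the cut vertices removes all edges between the colours below `z` and those above `z`,
and two adjacent vertices with colours above `z` have the same colour. So a component of the rest
lies on one side: in the part below `z`, or in a single class above `z`. Both have at most `N / 2`
vertices. -/
theorem SplitSt.split {c c' c₂ c₃ : Fin n → ℕ} {z q N y : ℕ} {p : List (Fin n)}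
    {C : List (List (Fin n))} {σ τ : Memory} (h : SplitSt G p c' z q N)
    (hN : p.length = N) (hC : CompsSt G σ τ c₂ c₃ C) (h8 : σ.reg 8 = y) (hne : ∀ v, c₃ v ≠ y)
    (hout : ∀ v, v ∉ p → c' v = c v) (hlt : ∀ v, c' v < y) (h15 : ∀ v, c₂ v < σ.reg 15)
    (hy : y < σ.reg 15)
    (h1 : ∀ v, v ∉ p → c₂ v = c' v) (h2 : ∀ v ∈ p, ¬ IsCut G c' z v → c₂ v = y)
    (h3 : ∀ v ∈ p, IsCut G c' z v → y < c₂ v ∧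
      ∀ u ∈ p, IsCut G c' z u → c₂ u = c₂ v → u = v) :
    Split G p c c₃ {v | v ∈ p ∧ IsCut G c' z v} C := by
  have hold := hC.comp_old
  have hother := hC.other
  have htodo := hC.todo
  rw [h8] at hold hother htodo
  have e1 : ∀ v, v ∉ p → c₃ v = c' v := fun v hv => by
    have := hlt v
    rw [hother v (by rw [h1 v hv]; omega), h1 v hv]
  have e2 : ∀ v ∈ p, IsCut G c' z v → c₃ v = c₂ v := fun v hv hcut =>
    hother v (h3 v hv hcut).1.ne'
  have e3 : ∀ v ∈ p, ¬ IsCut G c' z v → ∃ (i : ℕ) (l : List (Fin n)), C[i]? = some l ∧ v ∈ l :=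
    fun v hv hcut => (htodo v (h2 v hv hcut)).resolve_left (hne v)
  have e4 : ∀ v, c₂ v = y → v ∈ p ∧ ¬ IsCut G c' z v := by
    intro v hv
    have hvp : v ∈ p := by
      by_contra hvp
      have := hlt v
      rw [h1 v hvp] at hv
      omega
    exact ⟨hvp, fun hcut => (h3 v hvp hcut).1.ne' hv⟩
  have e5 : ∀ v ∈ p, y < c₃ v := by
    intro v hv
    by_cases hcut : IsCut G c' z v
    · rw [e2 v hv hcut]; exact (h3 v hv hcut).1
    · obtain ⟨i, l, hl, hvl⟩ := e3 v hv hcut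
      have := (hC.comp_mem i l hl v).1 hvl
      omega
  refine ⟨fun v hv => ?_, ?_, fun l hl => ?_, fun l hl v hv => ?_, hC.nodup,
    fun l hl => ?_, fun l hl => ?_, fun u v hu hv huv hc => ?_, fun v hv => ?_, fun v hv u hu => ?_⟩
  · by_cases hcut : IsCut G c' z v
    · exact Or.inl ⟨hv, hcut⟩
    · obtain ⟨i, l, hl, hvl⟩ := e3 v hv hcut
      exact Or.inr ⟨l, List.mem_of_getElem? hl, hvl⟩
  · rintro v ⟨hv, hcut⟩ u huv
    have hvy := e5 v hv
    have hup : u ∈ p := by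
      by_contra hu
      have := hlt u
      rw [e1 u hu] at huv
      omega
    rw [e2 v hv hcut] at huv
    by_cases hcut' : IsCut G c' z u
    · rw [e2 u hup hcut'] at huv
      exact (h3 v hv hcut).2 u hup hcut' huv
    · obtain ⟨i, l, hl, hul⟩ := e3 u hup hcut'
      have h4 := (hC.comp_mem i l hl u).1 hul
      have h5 := h15 v
      omega
  · obtain ⟨i, hi⟩ := List.mem_iff_getElem?.1 hl
    exact ⟨_, hC.comp_mem i l hi⟩
  · obtain ⟨i, hi⟩ := List.mem_iff_getElem?.1 hl
    exact (e4 v (hold i l hi v hv)).1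
  · obtain ⟨i, hi⟩ := List.mem_iff_getElem?.1 hl
    exact hC.comp_conn i l hi
  · obtain ⟨i, hi⟩ := List.mem_iff_getElem?.1 hl
    have hconn := hC.comp_conn i l hi
    have hin : ∀ v ∈ l, v ∈ p ∧ ¬ IsCut G c' z v := fun v hv => e4 v (hold i l hi v hv)
    obtain ⟨r, hr⟩ := hconn.1
    rw [hN, ← ncard_setOf_mem (hC.comp_nodup i l hi)]
    have hrz : c' r ≠ z := fun h => (hin r hr).2 (Or.inl h)
    -- The side of one vertex decides for the whole component, since an edge that changes sides has
    -- a cut vertex as an end.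
    rcases Nat.lt_or_gt_of_ne hrz with hrz | hrz
    · have hsub : {x | x ∈ l} ⊆ {v | c' v < z} := by
        refine hconn.subset_of_closed hr hrz fun u v hu hv hu' huv => ?_
        rcases Nat.lt_trichotomy (c' v) z with hv' | hv' | hv'
        · exact hv'
        · exact absurd (Or.inl hv') (hin v hv).2
        · exact absurd (Or.inr ⟨hu', v, huv, hv'⟩) (hin u hu).2
      have := Set.ncard_le_ncard (show {x | x ∈ l} ⊆ {v | v ∈ p ∧ c' v < z} from
        fun v hv => ⟨(hin v hv).1, hsub hv⟩) (Set.toFinite _)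
      have := h.rest
      omega
    · have hsub : {x | x ∈ l} ⊆ {v | c' v = c' r} := by
        refine hconn.subset_of_closed hr rfl fun u v hu hv hu' huv => ?_
        have hu' : c' u = c' r := hu'
        rcases Nat.lt_trichotomy (c' v) z with hv' | hv' | hv'
        · exact absurd (Or.inr ⟨hv', u, huv.symm, hu' ▸ hrz⟩) (hin v hv).2
        · exact absurd (Or.inl hv') (hin v hv).2
        · exact (h.closed u v (by omega) hv' huv).trans hu'
      have := Set.ncard_le_ncard hsub (Set.toFinite _)
      have := h.small _ hrz
      omega
  · by_contra hcon
    push Not at hcon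
    have hu' : ¬ IsCut G c' z u := fun h => hcon.1 ⟨hu, h⟩
    have hv' : ¬ IsCut G c' z v := fun h => hcon.2 ⟨hv, h⟩
    obtain ⟨i, l, hl, hul⟩ := e3 u hu hu'
    have hvl := hC.comp_closed i l hl u hul v huv (by rw [h8]; exact h2 v hv hv')
    rw [(hC.comp_mem i l hl u).1 hul, (hC.comp_mem i l hl v).1 hvl] at hc
    exact hc rfl
  · rw [e1 v hv, hout v hv]
  · have h4 := e5 v hv
    have h5 := hlt u
    rw [e1 u hu]
    omega

/-- The `O(g)` rounds of the search dominate the time. All new segments are written behind the old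
end of the queue and all new stack entries above the old top, so the pieces waiting on the stack are
not disturbed. -/
theorem wp_process (L : IncidenceLists G) {σ : Memory} {t h : ℕ} {Φ : ℕ → Memory → Prop}
    {p : List (Fin n)} {c : Fin n → ℕ} {b : ℕ} (hst : IdleSt c σ)
    (hG : ¬ CliqueMinor h G) (hseg : Seg (σ.arr 1) (σ.reg 4) (σ.reg 5) p)
    (hle : σ.reg 5 ≤ σ.reg 7) (hp : p.Nodup) (hb : ∀ v, v ∈ p ↔ c v = b)
    (hconn : Conn G {v | v ∈ p})
    (hΦ : ∀ t' τ c' C X g, IdleSt c' τ → Split G p c c' X C → X.ncard ≤ 5 * h * h * g →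
      g * g ≤ p.length → τ.reg 16 = σ.reg 16 + C.length →
      (∀ (i : ℕ) (l : List (Fin n)), C[i]? = some l →
        Seg (τ.arr 1) (τ.arr 2 (σ.reg 16 + i)) (τ.arr 3 (σ.reg 16 + i)) l ∧
        τ.arr 3 (σ.reg 16 + i) ≤ τ.reg 7) →
      σ.reg 7 ≤ τ.reg 7 → (∀ i < σ.reg 7, τ.arr 1 i = σ.arr 1 i) →
      (∀ i < σ.reg 16, τ.arr 2 i = σ.arr 2 i) → (∀ i < σ.reg 16, τ.arr 3 i = σ.arr 3 i) →
      t' ≤ t + 31000 * ((h + 1) * wsum L p) * g → Frame (process h) σ τ → Φ t' τ) :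
    wp L.query (process h) Φ t σ := by
  classical
  suffices hsuff : wp L.query (process h) (fun t' τ => ∃ c' C X g, IdleSt c' τ ∧
      Split G p c c' X C ∧ X.ncard ≤ 5 * h * h * g ∧
      g * g ≤ p.length ∧ τ.reg 16 = σ.reg 16 + C.length ∧
      (∀ (i : ℕ) (l : List (Fin n)), C[i]? = some l →
        Seg (τ.arr 1) (τ.arr 2 (σ.reg 16 + i)) (τ.arr 3 (σ.reg 16 + i)) l ∧
        τ.arr 3 (σ.reg 16 + i) ≤ τ.reg 7) ∧
      σ.reg 7 ≤ τ.reg 7 ∧ (∀ i < σ.reg 7, τ.arr 1 i = σ.arr 1 i) ∧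
      (∀ i < σ.reg 16, τ.arr 2 i = σ.arr 2 i) ∧ (∀ i < σ.reg 16, τ.arr 3 i = σ.arr 3 i) ∧
      t' ≤ t + 31000 * ((h + 1) * wsum L p) * g) t σ from
    hsuff.mono fun t' τ _ hF ⟨c', C, X, g, h1, h2, h3, h4, h5, h6, h7, h8, h9, h10, h11⟩ =>
      hΦ t' τ c' C X g h1 h2 h3 h4 h5 h6 h7 h8 h9 h10 h11 hF
  obtain ⟨r, hr⟩ := hconn.1
  have hpl : 1 ≤ p.length := List.length_pos_of_mem hr
  have hW := length_le_wsum L p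
  have hX1 : wsum L p ≤ (h + 1) * wsum L p := Nat.le_mul_of_pos_left _ (by omega)
  set W := (h + 1) * wsum L p with hWdef
  have hlen := hseg.len
  have hfirst : c p[0] = b := (hb _).1 (List.getElem_mem _)
  have hget : σ.arr 1 (σ.reg 4) = (p[0] : ℕ) := hseg.get 0 hpl
  rw [process]
  simp only [Program.block, wp_seq_iff, wp_assign_iff, Expr.ev, Expr.time, Memory.setReg_reg,
    Memory.setReg_arr]
  norm_num only [if_true, if_false]
  rw [hget, hst.cols, hfirst, hlen, Nat.add_sub_cancel_left]
  set τ₁ := (((σ.setReg 26 p.length).setReg 20 b).setReg 22 (σ.reg 15)).setReg 21 0 with hτ₁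
  have hr₁ : ∀ i, i ≠ 20 → i ≠ 21 → i ≠ 22 → i ≠ 26 → τ₁.reg i = σ.reg i := by
    intro i h1 h2 h3 h4
    simp [hτ₁, h1, h2, h3, h4]
  have g20 : τ₁.reg 20 = b := by simp [hτ₁]
  have g21 : τ₁.reg 21 = 0 := by simp [hτ₁]
  have g22 : τ₁.reg 22 = σ.reg 15 := by simp [hτ₁]
  have g26 : τ₁.reg 26 = p.length := by simp [hτ₁]
  have ga : τ₁.arr = σ.arr := rfl
  clear_value τ₁
  -- The integer square root `g` is found by counting upwards, in keeping with the rule that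
  -- assigned values grow by at most one; the `g` iterations are cheap in comparison with the
  -- search.
  refine wp_loop_frame (fun t' τ => τ.reg 21 * τ.reg 21 ≤ p.length ∧ t' ≤ t + 20 + 20 * τ.reg 21)
    (t + 20 + 20 * p.length) ⟨by simp [g21], by rw [g21]; omega⟩ ?_ ?_ ?_
  · rintro t' τ ⟨h1, h2⟩
    have := (Nat.le_mul_self (τ.reg 21)).trans h1
    omega
  · rintro t' τ hF ⟨h1, h2⟩ he
    have e26 : τ.reg 26 = p.length := by rw [hF.reg 26 rfl, g26]
    have he' : (τ.reg 21 + 1) * (τ.reg 21 + 1) < p.length + 1 := by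
      by_contra hlt
      simp only [Expr.ev, e26] at he
      exact he (if_neg hlt)
    rw [wp_assign_iff]
    simp only [Expr.ev, Memory.setReg_reg, if_true, Expr.time]
    exact ⟨by omega, by omega⟩
  rintro t₂ τ₂ hF₂ ⟨hgN', ht₂⟩ he
  have e26 : τ₂.reg 26 = p.length := by rw [hF₂.reg 26 rfl, g26]
  have hgN : p.length < (τ₂.reg 21 + 1) * (τ₂.reg 21 + 1) := by
    by_contra hlt
    simp only [Expr.ev, e26] at he
    rw [if_pos (by omega)] at he
    exact one_ne_zero he
  obtain ⟨g, hg⟩ : ∃ g, τ₂.reg 21 = g := ⟨_, rfl⟩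
  rw [hg] at hgN hgN' ht₂
  have hg0 : 0 < g := by
    rcases Nat.eq_zero_or_pos g with rfl | h
    · omega
    · exact h
  have hr₂ : ∀ i, i ≠ 20 → i ≠ 21 → i ≠ 22 → i ≠ 26 → τ₂.reg i = σ.reg i := by
    intro i h1 h2 h3 h4
    rw [hF₂.reg i (by simp [Program.setsReg, h2]), hr₁ i h1 h2 h3 h4]
  have ga₂ : ∀ a, τ₂.arr a = σ.arr a := fun a => by rw [hF₂.arr a rfl, ga]
  have hP₂ : PieceSt σ τ₂ p c c b (σ.reg 15) g p.length := by
    constructor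
    · intro v; rw [ga₂, hst.cols]
    · rw [hr₂ 0 (by simp) (by simp) (by simp) (by simp), hst.r0]
    · rw [hF₂.reg 20 rfl, g20]
    · exact hg
    · rw [hF₂.reg 22 rfl, g22]
    · exact e26
    · rw [hr₂ 4 (by simp) (by simp) (by simp) (by simp)]
    · rw [hr₂ 5 (by simp) (by simp) (by simp) (by simp)]
    · rw [hr₂ 16 (by simp) (by simp) (by simp) (by simp)]
    · rw [hr₂ 7 (by simp) (by simp) (by simp) (by simp)]
    · intro i _; rw [ga₂]
    · intro i _; rw [ga₂]
    · intro i _; rw [ga₂]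
    · intro v; rw [hr₂ 15 (by simp) (by simp) (by simp) (by simp)]; exact hst.fresh v
    · rw [hr₂ 15 (by simp) (by simp) (by simp) (by simp)]
    · intro i; rw [ga₂, hr₂ 27 (by simp) (by simp) (by simp) (by simp)]; exact hst.pos i
    · intro i; rw [ga₂, hr₂ 24 (by simp) (by simp) (by simp) (by simp)]; exact hst.mark i
    · intro v _; rfl
  have hclass : {v | c v = b} = {v | v ∈ p} := by
    ext v
    exact (hb v).symm
  -- Colours count as trees only from the first unused colour `σ.reg 15` on, so the search begins
  -- without trees and with the whole piece as the big class.
  have hnoact : ∀ f, ¬ IsActive G c b (σ.reg 15) f := by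
    rintro f ⟨h1, -, v, u, -, h2, -⟩
    have := hst.fresh u
    omega
  have hT : Trees G c {v | v ∈ p} b (σ.reg 15) (5 * h * g) p.length := by
    refine ⟨hclass ▸ hconn, fun v hv => (hb v).2 hv, fun v hv => Or.inl ((hb v).1 hv),
      fun v _ => hst.fresh v, ?_, fun f hf => absurd hf (hnoact f),
      fun f _ hf => absurd hf (hnoact f), fun f hf => absurd hf (hnoact f)⟩
    rw [hclass, ncard_setOf_mem hp]
    omega
  rw [wp_seq_iff]
  refine wp_search L hP₂ hT hG hseg hle hp rfl hg0 hgN hgN' ?_ ?_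
  · rw [hr₂ 27 (by simp) (by simp) (by simp) (by simp)]
    exact (Nat.zero_le _).trans_lt (hst.pos 0)
  intro t₃ τ₃ b' c' hP₃ hS hz hpos₃ ht₃ hF₃
  have hseg₃ : Seg (τ₃.arr 1) (τ₃.reg 4) (τ₃.reg 5) p := by
    rw [hP₃.r4, hP₃.r5]
    exact hseg.congr fun i hi => hP₃.keep i (by omega)
  rw [wp_seq_iff]
  refine wp_markCut L c' p hP₃.cols hseg₃ hp ?_
  intro t₄ τ₄ hcut₄ ht₄ hF₄
  simp only [wp_seq_iff, wp_assign_iff, Expr.ev, Expr.time]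
  obtain ⟨y, hy⟩ : ∃ y, τ₃.reg 15 = y := ⟨_, rfl⟩
  have hy₄ : τ₄.reg 15 = y := by rw [hF₄.reg 15 rfl, hy]
  simp only [Memory.setReg_reg]
  norm_num only [if_true, if_false]
  rw [hy₄]
  set τ₅ := (τ₄.setReg 8 y).setReg 15 (y + 1) with hτ₅
  have hr₅ : ∀ i, i ≠ 8 → i ≠ 15 → τ₅.reg i = τ₄.reg i := by
    intro i h1 h2
    simp [hτ₅, h1, h2]
  have g8 : τ₅.reg 8 = y := by simp [hτ₅]
  have g15 : τ₅.reg 15 = y + 1 := by simp [hτ₅]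
  have ga₅ : τ₅.arr = τ₄.arr := rfl
  clear_value τ₅
  have hseg₅ : Seg (τ₅.arr 1) (τ₅.reg 4) (τ₅.reg 5) p := by
    rw [hr₅ 4 (by simp) (by simp), hr₅ 5 (by simp) (by simp), ga₅, hF₄.reg 4 rfl, hF₄.reg 5 rfl,
      hF₄.arr 1 rfl]
    exact hseg₃
  refine wp_colorCut c' p (IsCut G c' (τ₃.reg 38)) (fun v => by rw [ga₅, hF₄.arr 0 rfl, hP₃.cols])
    hseg₅ hp (fun v hv => by rw [ga₅]; exact hcut₄ v hv) ?_
  intro t₆ τ₆ c₂ k1 k2 k3 k4 k5 ht₆ hF₆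
  rw [g8] at k3
  rw [g15] at k4 k5
  simp only [wp_seq_iff, wp_assign_iff, Expr.ev, Expr.time]
  have hr₇ : ∀ i, i ≠ 40 → (τ₆.setReg 40 0).reg i = τ₆.reg i := by
    intro i h1
    simp [h1]
  have ha₇ : (τ₆.setReg 40 0).arr = τ₆.arr := rfl
  have h40 : (τ₆.setReg 40 0).reg 40 = 0 := by simp
  generalize τ₆.setReg 40 0 = τ₇ at hr₇ ha₇ h40 ⊢
  have f8 : τ₇.reg 8 = y := by rw [hr₇ 8 (by simp), hF₆.reg 8 rfl, g8]
  have f7 : τ₇.reg 7 = τ₃.reg 7 := by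
    rw [hr₇ 7 (by simp), hF₆.reg 7 rfl, hr₅ 7 (by simp) (by simp), hF₄.reg 7 rfl]
  have f16 : τ₇.reg 16 = σ.reg 16 := by
    rw [hr₇ 16 (by simp), hF₆.reg 16 rfl, hr₅ 16 (by simp) (by simp), hF₄.reg 16 rfl, hP₃.top]
  have f15 : τ₇.reg 15 = τ₆.reg 15 := hr₇ 15 (by simp)
  have fa : ∀ a, colorCut.setsArr a = false → markCut.setsArr a = false →
      τ₇.arr a = τ₃.arr a := by
    intro a h1 h2
    rw [ha₇, hF₆.arr a h1, ga₅, hF₄.arr a h2]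
  have hq := hP₃.queue_le
  have hlt : ∀ v, c' v < y := fun v => hy ▸ hP₃.fresh v
  have h15 : ∀ v, c₂ v < τ₇.reg 15 := by
    intro v
    have := hlt v
    by_cases hv : v ∈ p
    · by_cases hv' : IsCut G c' (τ₃.reg 38) v
      · rw [f15]; exact (k4 v hv hv').2.1
      · rw [k3 v hv hv']; omega
    · rw [k2 v hv]; omega
  refine wp_comps L c₂ p (fun v => by rw [ha₇, k1]) ?_ ?_ ?_ h15 (by omega) h40 ?_ ?_
  · rw [hr₇ 0 (by simp), hF₆.reg 0 rfl, hr₅ 0 (by simp) (by simp), hF₄.reg 0 rfl, hP₃.r0]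
  · rw [hr₇ 4 (by simp), hF₆.reg 4 rfl, hr₇ 5 (by simp), hF₆.reg 5 rfl, ha₇, hF₆.arr 1 rfl]
    exact hseg₅
  · rw [f7, hr₇ 5 (by simp), hF₆.reg 5 rfl, hr₅ 5 (by simp) (by simp), hF₄.reg 5 rfl, hP₃.r5]
    omega
  · intro v hv
    by_contra hvp
    have := hlt v
    rw [k2 v hvp, f8] at hv
    omega
  intro t₈ τ₈ c₃ C hC hne ht₈ hF₈
  rw [f8] at hne
  refine ⟨c₃, C, {v | v ∈ p ∧ IsCut G c' (τ₃.reg 38) v}, g, ?_,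
    hS.split rfl hC f8 hne hP₃.outside hlt h15 (by omega) k2 k3
      (fun v hv hcut => ⟨(k4 v hv hcut).1, (k4 v hv hcut).2.2⟩), ?_, hgN', ?_, ?_, ?_, ?_, ?_, ?_,
          ?_⟩
  · refine ⟨hC.cols, ?_, ?_, ?_, ?_⟩
    · rw [hF₈.reg 0 rfl, hr₇ 0 (by simp), hF₆.reg 0 rfl, hr₅ 0 (by simp) (by simp), hF₄.reg 0 rfl,
        hP₃.r0]
    · exact hC.lt_fresh (by rw [f8]; exact hne) h15
    · intro i
      rw [hF₈.arr 4 rfl, fa 4 rfl rfl, hF₈.reg 27 rfl, hr₇ 27 (by simp), hF₆.reg 27 rfl,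
        hr₅ 27 (by simp) (by simp), hF₄.reg 27 rfl]
      exact hP₃.pos i
    · intro i
      rw [hF₈.arr 9 rfl, fa 9 rfl rfl, hF₈.reg 24 rfl, hr₇ 24 (by simp), hF₆.reg 24 rfl,
        hr₅ 24 (by simp) (by simp), hF₄.reg 24 rfl]
      exact hP₃.mark i
  · refine hS.count.trans (le_of_eq (by ring))
  · rw [hC.top, f16]
  · intro i l hl
    rw [← f16]
    exact ⟨hC.comp_seg i l hl, hC.comp_le i l hl⟩
  · have := hC.queue_le
    omega
  · intro i hi
    rw [hC.keep i (by omega), fa 1 rfl rfl, hP₃.keep i hi]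
  · intro i hi
    rw [hC.keep2 i (by omega), fa 2 rfl rfl, hP₃.keep2 i hi]
  · intro i hi
    rw [hC.keep3 i (by omega), fa 3 rfl rfl, hP₃.keep3 i hi]
  · simp only [Expr.time, ← hWdef] at ht₃
    have h1 : W ≤ W * g := Nat.le_mul_of_pos_right _ hg0
    have h2 : g ≤ W * g := Nat.le_mul_of_pos_left _ (by omega)
    have h3 : 31000 * W * g = 31000 * (W * g) := by ring
    have h4 : 30000 * W * g = 30000 * (W * g) := by ring
    omega

end Splitting

end WordRAM


namespace WordRAM

/-! ### The bounds for the recursion -/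

/-- The potential of a piece with `m` vertices. -/
noncomputable def potential (κ A B : ℝ) (m : ℕ) : ℝ :=
  if κ < m then A * m / √κ - B * √m else 0

theorem potential_le {κ A B : ℝ} (hA : 0 ≤ A) (hB : 0 ≤ B) (m : ℕ) :
    potential κ A B m ≤ A * m / √κ := by
  rw [potential]
  split_ifs
  · have : 0 ≤ B * √m := by positivity
    linarith
  · positivity

/-- For `m > κ` one has `m / √κ ≥ √m`, so `B ≤ A` suffices. Nonnegativity is needed when a small
piece is dropped from the stack. -/
theorem potential_nonneg {κ A B : ℝ} (hκ : 0 < κ) (hA : 0 ≤ A) (hAB : B ≤ A) (m : ℕ) :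
    0 ≤ potential κ A B m := by
  rw [potential]
  split_ifs with hm
  · have hs : 0 < √κ := Real.sqrt_pos.2 hκ
    have hr : √κ ≤ √m := Real.sqrt_le_sqrt hm.le
    have h1 : A * √m ≤ A * m / √κ := by
      rw [le_div_iff₀ hs, mul_assoc]
      refine mul_le_mul_of_nonneg_left ?_ hA
      calc √(m : ℝ) * √κ ≤ √m * √m := mul_le_mul_of_nonneg_left hr (Real.sqrt_nonneg _)
        _ = m := Real.mul_self_sqrt (Nat.cast_nonneg _)
    have h2 : B * √m ≤ A * √m := mul_le_mul_of_nonneg_right hAB (Real.sqrt_nonneg _)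
    linarith
  · exact le_rfl

/-- For `m ≤ N / 2` the square root satisfies `√m ≥ √2 * m / √N`, and `7 / 5 < √2`. The bound is
linear in `m`, so it can be summed over the parts of a piece; it also covers parts of size at most
`κ`, whose potential is `0`, because `7 * B ≤ 5 * A` makes the factor nonnegative. -/
theorem potential_half {κ A B : ℝ} (hκ : 0 < κ) (hB : 0 ≤ B) (hAB : 7 * B ≤ 5 * A) {m N : ℕ}
    (hN : κ < N) (hm : 2 * m ≤ N) : potential κ A B m ≤ m * (A / √κ - 7 / 5 * B / √N) := by
  have hs : 0 < √κ := Real.sqrt_pos.2 hκ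
  have hr : √κ ≤ √N := Real.sqrt_le_sqrt hN.le
  have hr0 : 0 < √(N : ℝ) := hs.trans_le hr
  rw [potential]
  split_ifs
  · have h1 : 7 / 5 * (m : ℝ) ≤ √m * √N := by
      rw [← Real.sqrt_mul (by positivity)]
      refine Real.le_sqrt_of_sq_le ?_
      have h2 : (2 : ℝ) * m ≤ N := by exact_mod_cast hm
      nlinarith [mul_le_mul_of_nonneg_left h2 (Nat.cast_nonneg (α := ℝ) m),
        sq_nonneg (m : ℝ)]
    have h3 : (m : ℝ) * (7 / 5 * B / √N) ≤ B * √m := by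
      rw [mul_div_assoc', div_le_iff₀ hr0]
      nlinarith [mul_le_mul_of_nonneg_left h1 hB]
    have h4 : (m : ℝ) * (A / √κ) = A * m / √κ := by ring
    rw [mul_sub]
    linarith
  · refine mul_nonneg (Nat.cast_nonneg _) (sub_nonneg.2 ?_)
    exact div_le_div₀ (by linarith) (by linarith) hs hr

theorem sum_potential_le {κ A B : ℝ} (hκ : 0 < κ) (hB : 0 ≤ B) (hAB : 7 * B ≤ 5 * A)
    {α : Type*} {N : ℕ} (hN : κ < N) (C : List (List α)) (hC : ∀ l ∈ C, 2 * l.length ≤ N)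
    (hsum : C.flatten.length ≤ N) :
    (C.map fun l => potential κ A B l.length).sum ≤ A * N / √κ - 7 / 5 * B * √N := by
  have hs : 0 < √κ := Real.sqrt_pos.2 hκ
  have hr : √κ ≤ √N := Real.sqrt_le_sqrt hN.le
  have hr0 : 0 < √(N : ℝ) := hs.trans_le hr
  have h1 : (C.map fun l => potential κ A B l.length).sum ≤
      C.flatten.length * (A / √κ - 7 / 5 * B / √N) := by
    clear hsum
    induction C with
    | nil => simp
    | cons l C ih =>
      simp only [List.map_cons, List.sum_cons, List.flatten_cons, List.length_append, Nat.cast_add,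
        add_mul]
      exact add_le_add (potential_half hκ hB hAB hN (hC l (by simp)))
        (ih fun l' hl' => hC l' (by simp [hl']))
  have h2 : 0 ≤ A / √κ - 7 / 5 * B / √N :=
    sub_nonneg.2 (div_le_div₀ (by linarith) (by linarith) hs hr)
  have h3 : (C.flatten.length : ℝ) ≤ N := by exact_mod_cast hsum
  have h4 : (N : ℝ) * (A / √κ - 7 / 5 * B / √N) = A * N / √κ - 7 / 5 * B * √N := by
    have h5 : (N : ℝ) / √N = √N := Real.div_sqrt
    calc (N : ℝ) * (A / √κ - 7 / 5 * B / √N) = A * N / √κ - 7 / 5 * B * (N / √N) := by ring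
      _ = _ := by rw [h5]
  have h5 := mul_le_mul_of_nonneg_right h3 h2
  linarith

section Budget

variable {n : ℕ} {G : SimpleGraph (Fin n)}

/-- The time reserved for a piece. -/
noncomputable def budget (L : IncidenceLists G) (a b : ℝ) (l : List (Fin n)) : ℝ :=
  wsum L l * (a * √l.length + b)

theorem budget_nonneg (L : IncidenceLists G) {a b : ℝ} (ha : 0 ≤ a) (hb : 0 ≤ b)
    (l : List (Fin n)) : 0 ≤ budget L a b l := by
  rw [budget]
  positivity

/-- The parts are disjoint, so their weights add up to at most the weight of the piece, while each
square root is bounded by the common `r`. -/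
theorem sum_budget_le (L : IncidenceLists G) {a b r : ℝ} (ha : 0 ≤ a) (hb : 0 ≤ b)
    (C : List (List (Fin n))) (hC : ∀ l ∈ C, √(l.length : ℝ) ≤ r) (p : List (Fin n))
    (hnd : C.flatten.Nodup) (hp : ∀ v ∈ C.flatten, v ∈ p) (hr : 0 ≤ r) :
    (C.map (budget L a b)).sum ≤ wsum L p * (a * r + b) := by
  have h1 : (C.map (budget L a b)).sum ≤ wsum L C.flatten * (a * r + b) := by
    clear hnd hp
    induction C with
    | nil => simp [wsum]
    | cons l C ih =>
      simp only [List.map_cons, List.sum_cons, List.flatten_cons, wsum_append, Nat.cast_add,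
          add_mul]
      refine add_le_add ?_ (ih fun l' hl' => hC l' (by simp [hl']))
      rw [budget]
      have := mul_le_mul_of_nonneg_left (hC l (by simp)) ha
      exact mul_le_mul_of_nonneg_left (by linarith) (Nat.cast_nonneg _)
  have h2 : (wsum L C.flatten : ℝ) ≤ wsum L p := by exact_mod_cast wsum_le_of_subset L hnd hp
  exact h1.trans (mul_le_mul_of_nonneg_right h2 (by positivity))

theorem sqrt_half_le {m N : ℕ} (h : 2 * m ≤ N) : √(m : ℝ) ≤ 5 / 7 * √N := by
  refine Real.sqrt_le_iff.2 ⟨by positivity, ?_⟩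
  rw [mul_pow, Real.sq_sqrt (by positivity)]
  have h2 : (2 : ℝ) * m ≤ N := by exact_mod_cast h
  have h3 : (0 : ℝ) ≤ N := Nat.cast_nonneg _
  nlinarith

end Budget

/-! ### Divisions into pieces -/

section Division

variable {n : ℕ} {G : SimpleGraph (Fin n)}

/-- The colour classes are connected, those with more than `κ` vertices are in the list `S`, and the
set `X` covers all edges between different classes. -/
structure Division (G : SimpleGraph (Fin n)) (c : Fin n → ℕ) (S : List (List (Fin n)))
    (X : Set (Fin n)) (κ : ℝ) : Prop where
  nodup : S.flatten.Nodup
  conn : ∀ v, Conn G {u | c u = c v}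
  cls : ∀ l ∈ S, ∃ f, ∀ v, v ∈ l ↔ c v = f
  conn_piece : ∀ l ∈ S, Conn G {v | v ∈ l}
  small : ∀ v, (∃ l ∈ S, v ∈ l) ∨ ({u | c u = c v}.ncard : ℝ) ≤ κ
  edge : ∀ u v, G.Adj u v → c u ≠ c v → u ∈ X ∨ v ∈ X

theorem Division.drop {c : Fin n → ℕ} {S : List (List (Fin n))} {X : Set (Fin n)} {κ : ℝ}
    {p : List (Fin n)} (h : Division G c (S ++ [p]) X κ) (hp : (p.length : ℝ) ≤ κ) :
    Division G c S X κ := by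
  refine ⟨?_, h.conn, fun l hl => h.cls l (by simp [hl]), fun l hl => h.conn_piece l (by simp [hl]),
    fun v => ?_, h.edge⟩
  · have := h.nodup
    rw [List.flatten_append] at this
    exact (List.nodup_append.1 this).1
  · rcases h.small v with ⟨l, hl, hv⟩ | hv
    · rcases List.mem_append.1 hl with hl | hl
      · exact Or.inl ⟨l, hl, hv⟩
      · obtain rfl := List.mem_singleton.1 hl
        obtain ⟨f, hf⟩ := h.cls l (by simp)
        right
        have : {u | c u = c v} = {u | u ∈ l} := by
          ext u
          simp [hf, (hf v).1 hv]
        rw [this]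
        exact le_trans (by exact_mod_cast ncard_setOf_mem_le l) hp
    · exact Or.inr hv

/-- Cut vertices become singleton classes, which are small because `κ ≥ 1`. Classes outside the
split piece keep their vertices: the colours inside it are unused elsewhere. -/
theorem Division.split {c c' : Fin n → ℕ} {S C : List (List (Fin n))} {X Y : Set (Fin n)} {κ : ℝ}
    {p : List (Fin n)} (h : Division G c (S ++ [p]) X κ) (hs : Split G p c c' Y C) (hκ : 1 ≤ κ) :
    Division G c' (S ++ C) (X ∪ Y) κ := by
  obtain ⟨b, hb⟩ := h.cls p (by simp)
  have hnd := h.nodup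
  rw [List.flatten_append, List.flatten_singleton, List.nodup_append] at hnd
  have hSp : ∀ l ∈ S, ∀ v ∈ l, v ∉ p := fun l hl v hv hvp =>
    hnd.2.2 v (List.mem_flatten.2 ⟨l, hl, hv⟩) v hvp rfl
  have hX : ∀ v ∈ Y, {u | c' u = c' v} = {v} := by
    intro v hv
    ext u
    exact ⟨fun hu => hs.single v hv u hu, fun hu => by rw [Set.mem_singleton_iff.1 hu]; rfl⟩
  have hC : ∀ l ∈ C, ∀ v ∈ l, {u | c' u = c' v} = {u | u ∈ l} := by
    intro l hl v hv
    obtain ⟨f, hf⟩ := hs.cls l hl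
    ext u
    simp [hf, (hf v).1 hv]
  have hout : ∀ v, v ∉ p → {u | c' u = c' v} = {u | c u = c v} := by
    intro v hv
    ext u
    simp only [Set.mem_setOf_eq]
    by_cases hu : u ∈ p
    · refine ⟨fun h' => absurd h'.symm (hs.new u hu v hv), fun h' => absurd ((hb v).2 ?_) hv⟩
      rw [← h', (hb u).1 hu]
    · rw [hs.outside u hu, hs.outside v hv]
  refine ⟨?_, fun v => ?_, fun l hl => ?_, fun l hl => ?_, fun v => ?_, fun u v huv hne => ?_⟩
  · rw [List.flatten_append, List.nodup_append]
    refine ⟨hnd.1, hs.nodup, fun a ha b hb hab => ?_⟩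
    obtain ⟨l, hl, hbl⟩ := List.mem_flatten.1 hb
    exact hnd.2.2 a ha b (hs.sub_piece l hl b hbl) hab
  · by_cases hv : v ∈ p
    · rcases hs.cover v hv with hv' | ⟨l, hl, hvl⟩
      · rw [hX v hv']; exact Conn.singleton v
      · rw [hC l hl v hvl]; exact hs.conn l hl
    · rw [hout v hv]; exact h.conn v
  · rcases List.mem_append.1 hl with hl | hl
    · obtain ⟨f, hf⟩ := h.cls l (by simp [hl])
      obtain ⟨w, hw⟩ := (h.conn_piece l (by simp [hl])).1
      have hwp := hSp l hl w hw
      refine ⟨f, fun v => ⟨fun hv => ?_, fun hv => ?_⟩⟩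
      · rw [hs.outside v (hSp l hl v hv), (hf v).1 hv]
      · have hcw : c' w = f := by rw [hs.outside w hwp, (hf w).1 hw]
        have hvp : v ∉ p := fun hvp => hs.new v hvp w hwp (hcw.trans hv.symm)
        rw [hf, ← hs.outside v hvp, hv]
    · exact hs.cls l hl
  · rcases List.mem_append.1 hl with hl | hl
    · exact h.conn_piece l (by simp [hl])
    · exact hs.conn l hl
  · by_cases hv : v ∈ p
    · rcases hs.cover v hv with hv' | ⟨l, hl, hvl⟩
      · right
        rw [hX v hv', Set.ncard_singleton]
        simpa using hκ
      · exact Or.inl ⟨l, by simp [hl], hvl⟩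
    · rcases h.small v with ⟨l, hl, hvl⟩ | h'
      · rcases List.mem_append.1 hl with hl | hl
        · exact Or.inl ⟨l, by simp [hl], hvl⟩
        · rw [List.mem_singleton.1 hl] at hvl
          exact absurd hvl hv
      · rw [hout v hv]
        exact Or.inr h'
  · by_cases hu : u ∈ p <;> by_cases hv : v ∈ p
    · exact (hs.edge u v hu hv huv hne).imp Or.inr Or.inr
    · refine (h.edge u v huv fun h' => hv ?_).imp Or.inl Or.inl
      rw [hb, ← h', (hb u).1 hu]
    · refine (h.edge u v huv fun h' => hu ?_).imp Or.inl Or.inl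
      rw [hb, h', (hb v).1 hv]
    · rw [hs.outside u hu, hs.outside v hv] at hne
      exact (h.edge u v huv hne).imp Or.inl Or.inl

theorem CompsSt.division {σ τ : Memory} {c c' : Fin n → ℕ} {C : List (List (Fin n))}
    (h : CompsSt G σ τ c c' C) (hc : ∀ v, c v = σ.reg 8) (hne : ∀ v, c' v ≠ σ.reg 8) (κ : ℝ) :
    Division G c' C ∅ κ := by
  have hC : ∀ v, ∃ (i : ℕ) (l : List (Fin n)), C[i]? = some l ∧ v ∈ l := fun v =>
    (h.todo v (hc v)).resolve_left (hne v)
  refine ⟨h.nodup, fun v => ?_, fun l hl => ?_, fun l hl => ?_, fun v => ?_, fun u v huv hc' => ?_⟩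
  · obtain ⟨i, l, hl, hv⟩ := hC v
    have : {u | c' u = c' v} = {u | u ∈ l} := by
      ext u
      simp [h.comp_mem i l hl, (h.comp_mem i l hl v).1 hv]
    rw [this]
    exact h.comp_conn i l hl
  · obtain ⟨i, hi⟩ := List.mem_iff_getElem?.1 hl
    exact ⟨_, h.comp_mem i l hi⟩
  · obtain ⟨i, hi⟩ := List.mem_iff_getElem?.1 hl
    exact h.comp_conn i l hi
  · obtain ⟨i, l, hl, hv⟩ := hC v
    exact Or.inl ⟨l, List.mem_of_getElem? hl, hv⟩
  · obtain ⟨i, l, hl, hu⟩ := hC u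
    have hv := h.comp_closed i l hl u hu v huv (hc v)
    rw [(h.comp_mem i l hl u).1 hu, (h.comp_mem i l hl v).1 hv] at hc'
    exact absurd rfl hc'

end Division

end WordRAM


/-! ### The main loop over the stack of pieces -/

namespace WordRAM

/-- The segment given by the registers `4` and `5` has too many vertices. -/
def isLarge (h : ℕ) : Expr :=
  .lt (.mul (.const (400 * h ^ 4)) (.mul (.mul (.reg 1) (.reg 1)) (.mul (.reg 3) (.reg 3))))
    (.mul (.sub (.reg 5) (.reg 4)) (.mul (.reg 2) (.reg 2)))

/-- Take a piece from the stack and split it if it is too large. -/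
def pieceStep (h : ℕ) : Program :=
  .block [.assign 16 (.sub (.reg 16) (.const 1)), .assign 4 (.read 2 (.reg 16)),
    .assign 5 (.read 3 (.reg 16)), .cond (isLarge h) (process h) .skip]

/-- Put the components of the graph on the stack. -/
def start : Program :=
  .block [.assign 27 (.const 1), .assign 15 (.const 1),
    .loop (.lt (.reg 7) (.reg 0)) (.block [.write 1 (.reg 7) (.reg 7),
      .assign 7 (.add (.reg 7) (.const 1))]),
    .assign 5 (.reg 7), comps]

/-- The whole program. -/
def partitionProgram (h : ℕ) : Program := .seq start (.loop (.reg 16) (pieceStep h))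

section Main

variable {n : ℕ} {G : SimpleGraph (Fin n)}

/-- The segments of the lists in `S` are on the stack. -/
structure StackSt (τ : Memory) (S : List (List (Fin n))) : Prop where
  top : τ.reg 16 = S.length
  seg : ∀ (i : ℕ) (l : List (Fin n)), S[i]? = some l →
    Seg (τ.arr 1) (τ.arr 2 i) (τ.arr 3 i) l ∧ τ.arr 3 i ≤ τ.reg 7

/-- A piece of at most `κ` vertices is final and just leaves the stack. A larger one is replaced by
its components, while the segments further down the stack stay intact because the queue is only
extended at its end. -/
theorem wp_pieceStep (L : IncidenceLists G) {τ : Memory} {t h : ℕ} {c : Fin n → ℕ}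
    {S : List (List (Fin n))} {p : List (Fin n)} {X : Set (Fin n)} {κ : ℝ} {Φ : ℕ → Memory → Prop}
    (hst : IdleSt c τ) (hS : StackSt τ (S ++ [p])) (hD : Division G c (S ++ [p]) X κ)
    (hG : ¬ CliqueMinor h G) (hκ : 1 ≤ κ)
    (hlarge : ∀ m : ℕ, κ < m ↔
      400 * h ^ 4 * (τ.reg 1 * τ.reg 1 * (τ.reg 3 * τ.reg 3)) < m * (τ.reg 2 * τ.reg 2))
    (hsmall : ∀ t' τ', IdleSt c τ' → StackSt τ' S → Division G c S X κ → t' ≤ t + 60 →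
      Frame (pieceStep h) τ τ' → Φ t' τ')
    (hsplit : ∀ t' τ' c' C Y g, IdleSt c' τ' → StackSt τ' (S ++ C) → Division G c' (S ++ C)
    (X ∪ Y) κ →
      Split G p c c' Y C → κ < p.length → Y.ncard ≤ 5 * h * h * g → g * g ≤ p.length →
      t' ≤ t + 60 + 31000 * ((h + 1) * wsum L p) * g → Frame (pieceStep h) τ τ' → Φ t' τ') :
    wp L.query (pieceStep h) Φ t τ := by
  suffices hsuff : wp L.query (pieceStep h) (fun t' τ' =>
      (IdleSt c τ' ∧ StackSt τ' S ∧ Division G c S X κ ∧ t' ≤ t + 60) ∨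
      ∃ c' C Y g, IdleSt c' τ' ∧ StackSt τ' (S ++ C) ∧ Division G c' (S ++ C) (X ∪ Y) κ ∧
        Split G p c c' Y C ∧ κ < p.length ∧ Y.ncard ≤ 5 * h * h * g ∧ g * g ≤ p.length ∧
        t' ≤ t + 60 + 31000 * ((h + 1) * wsum L p) * g) t τ by
    refine hsuff.mono fun t' τ' _ hF h' => ?_
    rcases h' with ⟨h1, h2, h3, h4⟩ | ⟨c', C, Y, g, h1, h2, h3, h4, h5, h6, h7, h8⟩
    · exact hsmall t' τ' h1 h2 h3 h4 hF
    · exact hsplit t' τ' c' C Y g h1 h2 h3 h4 h5 h6 h7 h8 hF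
  have htop : τ.reg 16 = S.length + 1 := by rw [hS.top]; simp
  obtain ⟨hseg, hle⟩ := hS.seg S.length p (by simp)
  have hSseg : ∀ (i : ℕ) (l : List (Fin n)), S[i]? = some l → i < S.length ∧
      Seg (τ.arr 1) (τ.arr 2 i) (τ.arr 3 i) l ∧ τ.arr 3 i ≤ τ.reg 7 := by
    intro i l hl
    have hi : i < S.length := (List.getElem?_eq_some_iff.1 hl).1
    exact ⟨hi, hS.seg i l (by rw [List.getElem?_append_left hi]; exact hl)⟩
  have hnd : p.Nodup := by
    have := hD.nodup
    rw [List.flatten_append, List.flatten_singleton, List.nodup_append] at this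
    exact this.2.1
  obtain ⟨b, hb⟩ := hD.cls p (by simp)
  rw [pieceStep]
  simp only [Program.block, wp_seq_iff, wp_assign_iff, Expr.ev, Expr.time, Memory.setReg_reg,
    Memory.setReg_arr]
  norm_num only [if_true, if_false]
  rw [htop, Nat.add_sub_cancel]
  set τ₁ := ((τ.setReg 16 S.length).setReg 4 (τ.arr 2 S.length)).setReg 5 (τ.arr 3 S.length)
    with hτ₁
  have hr₁ : ∀ i, i ≠ 4 → i ≠ 5 → i ≠ 16 → τ₁.reg i = τ.reg i := by
    intro i h1 h2 h3
    simp [hτ₁, h1, h2, h3]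
  have g4 : τ₁.reg 4 = τ.arr 2 S.length := by simp [hτ₁]
  have g5 : τ₁.reg 5 = τ.arr 3 S.length := by simp [hτ₁]
  have g16 : τ₁.reg 16 = S.length := by simp [hτ₁]
  have ga : τ₁.arr = τ.arr := rfl
  clear_value τ₁
  have hst₁ : IdleSt c τ₁ := by
    refine ⟨fun v => by rw [ga, hst.cols], ?_, fun v => ?_, fun i => ?_, fun i => ?_⟩
    · rw [hr₁ 0 (by simp) (by simp) (by simp), hst.r0]
    · rw [hr₁ 15 (by simp) (by simp) (by simp)]; exact hst.fresh v
    · rw [ga, hr₁ 27 (by simp) (by simp) (by simp)]; exact hst.pos i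
    · rw [ga, hr₁ 24 (by simp) (by simp) (by simp)]; exact hst.mark i
  have h7 : τ₁.reg 7 = τ.reg 7 := hr₁ 7 (by simp) (by simp) (by simp)
  have hlen : τ₁.reg 5 - τ₁.reg 4 = p.length := by
    rw [g4, g5, hseg.len, Nat.add_sub_cancel_left]
  have hcond : (isLarge h).ev L.query τ₁ ≠ 0 ↔ κ < p.length := by
    rw [hlarge]
    simp only [isLarge, Expr.ev, hlen, hr₁ 1 (by simp) (by simp) (by simp),
      hr₁ 2 (by simp) (by simp) (by simp), hr₁ 3 (by simp) (by simp) (by simp)]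
    simp
  have htime : (isLarge h).time = 17 := rfl
  refine wp_cond (fun he => ?_) (fun he => ?_)
  · have hbig := hcond.1 he
    have hseg₁ : Seg (τ₁.arr 1) (τ₁.reg 4) (τ₁.reg 5) p := by rw [ga, g4, g5]; exact hseg
    refine wp_process L hst₁ hG hseg₁ (by rw [g5, h7]; exact hle) hnd hb
      (hD.conn_piece p (by simp)) ?_
    intro t' τ' c' C Y g e1 e2 e3 e4 e5 e6 e7 e8 e9 e10 ht' _
    rw [g16] at e5 e6 e9 e10
    rw [h7] at e7 e8
    rw [ga] at e8 e9 e10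
    refine Or.inr ⟨c', C, Y, g, e1, ⟨by rw [e5]; simp, fun i l hl => ?_⟩, hD.split e2 hκ, e2, hbig,
      e3, e4, by omega⟩
    rcases Nat.lt_or_ge i S.length with hi | hi
    · rw [List.getElem?_append_left hi] at hl
      obtain ⟨-, h1, h2⟩ := hSseg i l hl
      rw [e9 i hi, e10 i hi]
      exact ⟨h1.congr fun j hj => e8 j (by omega), by omega⟩
    · rw [List.getElem?_append_right hi] at hl
      have := e6 _ l hl
      rwa [Nat.add_sub_cancel' hi] at this
  · have hsm : ¬ κ < p.length := fun h' => hcond.2 h' he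
    rw [wp_skip_iff]
    refine Or.inl ⟨hst₁, ⟨g16, fun i l hl => ?_⟩, hD.drop (not_lt.1 hsm), by omega⟩
    rw [ga, h7]
    exact (hSseg i l hl).2

theorem wp_start (L : IncidenceLists G) {d p q : ℕ} {Φ : ℕ → Memory → Prop} (κ : ℝ)
    (hΦ : ∀ t' τ c C, IdleSt c τ → StackSt τ C → Division G c C ∅ κ →
      t' ≤ 300 * wsum L (List.finRange n) + 100 → Frame start (input n d p q) τ → Φ t' τ) :
    wp L.query start Φ 0 (input n d p q) := by
  suffices hsuff : wp L.query start (fun t' τ => ∃ c C, IdleSt c τ ∧ StackSt τ C ∧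
      Division G c C ∅ κ ∧ t' ≤ 300 * wsum L (List.finRange n) + 100) 0 (input n d p q) from
    hsuff.mono fun t' τ _ hF ⟨c, C, h1, h2, h3, h4⟩ => hΦ t' τ c C h1 h2 h3 h4 hF
  have hW : n ≤ wsum L (List.finRange n) := by
    simpa using length_le_wsum L (List.finRange n)
  rw [start]
  simp only [Program.block, wp_seq_iff, wp_assign_iff, Expr.ev, Expr.time]
  have hr₁ : ∀ i, i ≠ 15 → i ≠ 27 → (((input n d p q).setReg 27 1).setReg 15 1).reg i =
      (input n d p q).reg i := by
    intro i h1 h2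
    simp [h1, h2]
  -- Colours used after the start and positions of nodes begin with `1`. So `0` is free to mean "no
  -- big component" and "no parent", and the initial zeros of array `4` count as unvisited.
  have g15 : (((input n d p q).setReg 27 1).setReg 15 1).reg 15 = 1 := by simp
  have g27 : (((input n d p q).setReg 27 1).setReg 15 1).reg 27 = 1 := by simp
  have ga : ∀ a i, (((input n d p q).setReg 27 1).setReg 15 1).arr a i = 0 := fun a i => rfl
  generalize ((input n d p q).setReg 27 1).setReg 15 1 = τ₁ at hr₁ g15 g27 ga ⊢
  have g0 : τ₁.reg 0 = n := hr₁ 0 (by simp) (by simp)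
  refine wp_loop_frame (fun t' τ => τ.reg 7 ≤ n ∧ t' ≤ 4 + 20 * τ.reg 7 ∧
    ∀ i < τ.reg 7, τ.arr 1 i = i) (4 + 20 * n) ?_ ?_ ?_ ?_
  · rw [hr₁ 7 (by simp) (by simp)]
    exact ⟨by simp [input], by omega, by simp [input]⟩
  · rintro t' τ ⟨h1, h2, -⟩
    omega
  · rintro t' τ hF ⟨h1, h2, h3⟩ he
    have h0 : τ.reg 0 = n := by rw [hF.reg 0 rfl, g0]
    have hlt : τ.reg 7 < n := by
      by_contra hlt
      simp only [Expr.ev, h0] at he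
      exact he (if_neg hlt)
    simp only [wp_seq_iff, wp_assign_iff, wp_write_iff, Expr.ev, Expr.time, Memory.setReg_reg,
      Memory.setArr_reg, Memory.setReg_arr, Memory.setArr_arr, if_true]
    refine ⟨by omega, by omega, fun i hi => ?_⟩
    rw [Function.update_apply]
    split_ifs with h
    · exact h.symm
    · exact h3 i (by omega)
  rintro t₂ τ₂ hF₂ ⟨h1, h2, h3⟩ he
  have h0 : τ₂.reg 0 = n := by rw [hF₂.reg 0 rfl, g0]
  have h7 : τ₂.reg 7 = n := by
    by_contra hne
    simp only [Expr.ev, h0] at he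
    rw [if_pos (by omega)] at he
    exact one_ne_zero he
  simp only [wp_seq_iff, wp_assign_iff, Expr.ev, Expr.time]
  have hr₃ : ∀ i, i ≠ 5 → (τ₂.setReg 5 (τ₂.reg 7)).reg i = τ₂.reg i := by
    intro i h1
    simp [h1]
  have g5 : (τ₂.setReg 5 (τ₂.reg 7)).reg 5 = n := by simp [h7]
  have ga₃ : (τ₂.setReg 5 (τ₂.reg 7)).arr = τ₂.arr := rfl
  generalize τ₂.setReg 5 (τ₂.reg 7) = τ₃ at hr₃ g5 ga₃ ⊢
  have hz : ∀ i, i ≠ 5 → i ≠ 7 → i ≠ 15 → i ≠ 27 → τ₃.reg i = (input n d p q).reg i := by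
    intro i h1 h2 h3 h4
    rw [hr₃ i h1, hF₂.reg i (by simp [Program.setsReg, h2]), hr₁ i h3 h4]
  have f15 : τ₃.reg 15 = 1 := by rw [hr₃ 15 (by simp), hF₂.reg 15 rfl, g15]
  have f8 : τ₃.reg 8 = 0 := hz 8 (by simp) (by simp) (by simp) (by simp)
  have f4 : τ₃.reg 4 = 0 := hz 4 (by simp) (by simp) (by simp) (by simp)
  have f16 : τ₃.reg 16 = 0 := hz 16 (by simp) (by simp) (by simp) (by simp)
  have f0 : τ₃.reg 0 = n := hz 0 (by simp) (by simp) (by simp) (by simp)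
  refine wp_comps L (fun _ => 0) (List.finRange n) (fun v => ?_) f0 ?_ ?_ (fun v => ?_) ?_
    (hz 40 (by simp) (by simp) (by simp) (by simp)) (fun v _ => List.mem_finRange v) ?_
  · rw [ga₃, hF₂.arr 0 rfl, ga]
  · rw [f4, g5, ga₃]
    refine ⟨by simp, fun i hi => ?_⟩
    simp only [List.length_finRange] at hi
    simp [h3 i (by omega)]
  · rw [g5, hr₃ 7 (by simp), h7]
  · rw [f15]; exact one_pos
  · rw [f8, f15]; exact one_pos
  intro t₄ τ₄ c C hC hne ht₄ hF₄
  refine ⟨c, C, ⟨hC.cols, ?_, ?_, ?_, ?_⟩, ⟨?_, fun i l hl => ?_⟩,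
    hC.division (fun v => f8.symm) hne κ, ?_⟩
  · rw [hF₄.reg 0 rfl, f0]
  · exact hC.lt_fresh hne fun v => by rw [f15]; exact one_pos
  · intro i
    rw [hF₄.arr 4 rfl, ga₃, hF₂.arr 4 rfl, ga, hF₄.reg 27 rfl, hr₃ 27 (by simp), hF₂.reg 27 rfl,
        g27]
    exact one_pos
  · intro i
    rw [hF₄.arr 9 rfl, ga₃, hF₂.arr 9 rfl, ga]
    exact Nat.zero_le _
  · rw [hC.top, f16, zero_add]
  · have h4 := hC.comp_seg i l hl
    have h5 := hC.comp_le i l hl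
    rw [f16, zero_add] at h4 h5
    exact ⟨h4, h5⟩
  · omega

end Main

end WordRAM


/-! ### The total number of separator vertices and the total time -/

namespace WordRAM

section Total

variable {n : ℕ} {G : SimpleGraph (Fin n)}

/-- Passing from a piece to its parts releases at least `(2 / 5) * B * √N = 5.2 * h ^ 2 * √N` of
potential, which pays for the at most `5 * h ^ 2 * g` separator vertices since `g ≤ √N`. -/
theorem split_count {h g N : ℕ} {A B κ : ℝ} {x : ℕ} (hN : κ < N)
    (hB : B = 13 * h ^ 2) (hx : x ≤ 5 * h * h * g) (hg : g * g ≤ N) {s : ℝ}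
    (hs : s ≤ A * N / √κ - 7 / 5 * B * √N) : x + s ≤ potential κ A B N := by
  rw [potential, if_pos hN]
  have h1 : (g : ℝ) ≤ √N := Real.le_sqrt_of_sq_le (by rw [sq]; exact_mod_cast hg)
  have h2 : (x : ℝ) ≤ 5 * h * h * g := by exact_mod_cast hx
  have h3 : (5 : ℝ) * h * h * g ≤ 5 * h * h * √N := mul_le_mul_of_nonneg_left h1 (by positivity)
  have h4 : 0 ≤ (h : ℝ) * h * √N := by positivity
  subst hB
  nlinarith

/-- Two conserved quantities control the loop: separator vertices plus potentials of the waiting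
pieces stay below `A * n / √κ`, and elapsed time plus budgets of the waiting pieces stay below `T`.
When the stack is empty, they bound the number of separator vertices and the time. -/
theorem wp_partitionProgram (L : IncidenceLists G) {d p q h : ℕ} {κ : ℝ}
    {Φ : ℕ → Memory → Prop} (hG : ¬ CliqueMinor h G) (hn : 1 ≤ n) (hκ : 1 ≤ κ)
    (hlarge : ∀ m : ℕ, κ < m ↔ 400 * h ^ 4 * (d * d * (q * q)) < m * (p * p))
    (hΦ : ∀ (t' : ℕ) τ c X, (∀ v : Fin n, τ.arr 0 v = c v) → Division G c [] X κ →
      (X.ncard : ℝ) ≤ 20 * h ^ 2 * n / √κ →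
      (t' : ℝ) ≤ 120000 * (h + 1) * (wsum L (List.finRange n) * √n) → Φ t' τ) :
    wp L.query (partitionProgram h) Φ 0 (input n d p q) := by
  rw [partitionProgram, wp_seq_iff]
  refine wp_start L κ ?_
  intro t₁ τ₁ c₁ C hst₁ hS₁ hD₁ ht₁ hF₁
  set W := wsum L (List.finRange n) with hW
  have hWn : n ≤ W := by
    simpa using length_le_wsum L (List.finRange n)
  set A : ℝ := 20 * h ^ 2 with hA
  set B : ℝ := 13 * h ^ 2 with hB
  set a : ℝ := 110000 * (h + 1) with ha
  have hA0 : 0 ≤ A := by positivity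
  have hB0 : 0 ≤ B := by positivity
  have hAB : 7 * B ≤ 5 * A := by
    rw [hA, hB]
    nlinarith [sq_nonneg (h : ℝ)]
  have ha0 : 0 ≤ a := by positivity
  have hκ0 : 0 < κ := by linarith
  -- The start-up time plus the budget of all components, each bounded as if it had `n` vertices.
  set T : ℝ := 300 * W + 100 + W * (a * √n + 100) with hT
  have hsqrt : 1 ≤ √(n : ℝ) := Real.one_le_sqrt.2 (by exact_mod_cast hn)
  have hTW : T + 2 ≤ 120000 * (h + 1) * (W * √n) := by
    have h1 : (1 : ℝ) ≤ W := by exact_mod_cast hn.trans hWn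
    have h2 : (W : ℝ) ≤ W * √n := le_mul_of_one_le_right (by linarith) hsqrt
    have h3 : (W : ℝ) * √n ≤ (h + 1) * (W * √n) :=
      le_mul_of_one_le_left (by positivity) (by linarith [Nat.cast_nonneg (α := ℝ) h])
    have h4 : T = 400 * W + 100 + 110000 * ((h + 1) * (W * √n)) := by
      rw [hT, ha]
      ring
    linarith
  refine wp_loop_frame (fun t' τ => ∃ c S X, IdleSt c τ ∧ StackSt τ S ∧ Division G c S X κ ∧
    (X.ncard : ℝ) + (S.map fun l => potential κ A B l.length).sum ≤ A * n / √κ ∧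
    (t' : ℝ) + (S.map (budget L a 100)).sum ≤ T) ⌈T⌉₊ ?_ ?_ ?_ ?_
  · refine ⟨c₁, C, ∅, hst₁, hS₁, hD₁, ?_, ?_⟩
    · have hlen : (C.flatten.length : ℝ) ≤ n := by
        exact_mod_cast hD₁.nodup.length_le_card.trans_eq (Fintype.card_fin n)
      have h1 : ∀ C : List (List (Fin n)), (C.map fun l => potential κ A B l.length).sum ≤
          A * C.flatten.length / √κ := by
        intro C
        induction C with
        | nil => simp
        | cons l C ih =>
          simp only [List.map_cons, List.sum_cons, List.flatten_cons, List.length_append,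
            Nat.cast_add, mul_add, add_div]
          exact add_le_add (potential_le hA0 hB0 _) ih
      refine (add_le_add_right (h1 C) _).trans ?_
      simp only [Set.ncard_empty, Nat.cast_zero, zero_add]
      gcongr
    · have h1 := sum_budget_le L ha0 (b := 100) (by norm_num) C (r := √n) (fun l hl => ?_)
        (List.finRange n) hD₁.nodup (fun v _ => List.mem_finRange v) (Real.sqrt_nonneg _)
      · have h2 : (t₁ : ℝ) ≤ 300 * W + 100 := by exact_mod_cast ht₁
        rw [hT]
        linarith
      · refine Real.sqrt_le_sqrt ?_
        have : l.Nodup := (List.nodup_flatten.1 hD₁.nodup).1 l hl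
        exact_mod_cast this.length_le_card.trans_eq (Fintype.card_fin n)
  · rintro t' τ ⟨c, S, X, -, -, -, -, ht⟩
    have h1 : 0 ≤ (S.map (budget L a 100)).sum := List.sum_nonneg fun x hx => by
      obtain ⟨l, -, rfl⟩ := List.mem_map.1 hx
      exact budget_nonneg L ha0 (by norm_num) l
    exact Nat.cast_le.1 ((by linarith : (t' : ℝ) ≤ T).trans (Nat.le_ceil _))
  · rintro t' τ hF ⟨c, S, X, hst, hS, hD, hX, ht⟩ he
    have hne : S ≠ [] := by
      rintro rfl
      exact he hS.top
    obtain ⟨S, P, rfl⟩ := (List.eq_nil_or_concat' S).resolve_left hne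
    have hreg : ∀ x, (pieceStep h).setsReg x = false → start.setsReg x = false →
        τ.reg x = (input n d p q).reg x := fun x h1 h2 => by rw [hF.reg x h1, hF₁.reg x h2]
    obtain ⟨r, hr⟩ := (hD.conn_piece P (by simp)).1
    have hPl : 1 ≤ P.length := List.length_pos_of_mem hr
    have hPW : (1 : ℝ) ≤ wsum L P := by exact_mod_cast hPl.trans (length_le_wsum L P)
    simp only [List.map_append, List.map_cons, List.map_nil, List.sum_append, List.sum_cons,
      List.sum_nil, add_zero] at hX ht
    refine wp_pieceStep L hst hS hD hG hκ ?_ ?_ ?_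
    · intro m
      rw [hreg 1 rfl rfl, hreg 2 rfl rfl, hreg 3 rfl rfl]
      exact hlarge m
    · intro t₂ τ₂ e1 e2 e3 ht₂ _
      refine ⟨c, S, X, e1, e2, e3, ?_, ?_⟩
      · have := potential_nonneg hκ0 hA0 (by linarith : B ≤ A) P.length
        linarith
      · have h1 : (t₂ : ℝ) ≤ t' + 62 := by exact_mod_cast ht₂
        have h2 : 100 ≤ budget L a 100 P := by
          rw [budget]
          have : 0 ≤ (wsum L P : ℝ) * (a * √P.length) := by positivity
          rw [mul_add]
          linarith
        linarith
    · intro t₂ τ₂ c' C Y g e1 e2 e3 e4 hbig hY hg ht₂ _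
      have hsub : ∀ v ∈ C.flatten, v ∈ P := fun v hv => by
        obtain ⟨l, hl, hvl⟩ := List.mem_flatten.1 hv
        exact e4.sub_piece l hl v hvl
      refine ⟨c', S ++ C, X ∪ Y, e1, e2, e3, ?_, ?_⟩
      · have h1 : ((X ∪ Y).ncard : ℝ) ≤ X.ncard + Y.ncard := by
          exact_mod_cast Set.ncard_union_le X Y
        have h2 : C.flatten.length ≤ P.length := (e4.nodup.subperm hsub).length_le
        have h3 := split_count hbig hB hY hg (sum_potential_le hκ0 hB0 hAB hbig C e4.small h2)
        rw [List.map_append, List.sum_append]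
        linarith
      -- The parts have at most half of the vertices, so their square roots are at most `5 / 7` of
      -- that of the piece. The remaining `2 / 7` of `110000` exceeds `31000` by more than the
      -- constant overhead `62`.
      · have h1 := sum_budget_le L ha0 (b := 100) (by norm_num) C (r := 5 / 7 * √P.length)
          (fun l hl => sqrt_half_le (e4.small l hl)) P e4.nodup hsub (by positivity)
        have h2 : (t₂ : ℝ) ≤ t' + 62 + 31000 * ((h + 1) * wsum L P) * g := by exact_mod_cast ht₂
        have h3 : (g : ℝ) ≤ √P.length := Real.le_sqrt_of_sq_le (by rw [sq]; exact_mod_cast hg)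
        have h4 : (1 : ℝ) ≤ √P.length := Real.one_le_sqrt.2 (by exact_mod_cast hPl)
        have h5 : 31000 * ((h + 1) * (wsum L P : ℝ)) * g ≤
            31000 * ((h + 1) * wsum L P) * √P.length := mul_le_mul_of_nonneg_left h3 (by positivity)
        have h6 : 1 ≤ (h + 1) * (wsum L P : ℝ) * √P.length :=
          one_le_mul_of_one_le_of_one_le (one_le_mul_of_one_le_of_one_le
            (by linarith [Nat.cast_nonneg (α := ℝ) h]) hPW) h4
        rw [List.map_append, List.sum_append]
        have h7 : budget L a 100 P = 110000 * ((h + 1) * wsum L P * √P.length) + 100 * wsum L P := by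
          rw [budget, ha]
          ring
        have h8 : (wsum L P : ℝ) * (a * (5 / 7 * √P.length) + 100) =
            5 / 7 * 110000 * ((h + 1) * wsum L P * √P.length) + 100 * wsum L P := by
          rw [ha]
          ring
        linarith
  · rintro t' τ hF ⟨c, S, X, hst, hS, hD, hX, ht⟩ he
    have hnil : S = [] := List.length_eq_zero_iff.1 (hS.top.symm.trans he)
    subst hnil
    refine hΦ _ τ c X hst.cols hD (by simpa using hX) ?_
    simp only [List.map_nil, List.sum_nil, add_zero] at ht
    simp only [Expr.time]
    push_cast
    linarith

end Total

end WordRAM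


/-! ### Word size and the resulting partition -/

namespace WordRAM

/-- Products and sums appear only in conditions and indices, apart from increments by one; the only
constants that depend on `h` are those in the tests for small layers and for large pieces. -/
theorem partitionProgram_tame (h : ℕ) : (partitionProgram h).Tame 10 (400 * h ^ 4 + h + 100) := by
  have h4 : 400 * h ^ 4 ≤ 400 * h ^ 4 + h + 100 := by omega
  simp only [partitionProgram, start, pieceStep, isLarge, process, colorCut, markCut, search,
      sepRound,
    updateTrees, extendTree, copyPos, seeds, paint, findSep, sepComps, layerSep, pathSep, tracePath,
    traceStep, active, actVertex, actStep, bfs, bfsInitStep, bfsGuard, bfsRound, smallLayer,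
        bfsLayer,
    bfsNode, bfsStep, pushNode, nodeIdx, comps, compsStep, flood, floodStep, forSeg, forNbrs,
    Program.block, Program.Tame, Expr.Slow, Expr.Flat, Expr.deg, Expr.constLe, h4, true_and,
        and_true]
  norm_num
  omega

section Output

variable {n : ℕ} {G : SimpleGraph (Fin n)}

/-- The weights are the degrees plus one, so they add up to the number of arcs plus `n`, and the
number of arcs is linear for want of a clique minor. -/
theorem wsum_finRange_le (L : IncidenceLists G) {h : ℕ} (hn : 1 ≤ n) (hG : ¬ CliqueMinor h G) :
    wsum L (List.finRange n) ≤ (2 ^ (h + 1) + 1) * n := by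
  have : Nonempty (Fin n) := ⟨⟨0, hn⟩⟩
  have h1 := ncard_arcs_lt h n G (Nat.card_fin n) hG
  have h2 : wsum L (List.finRange n) = (arcs G).ncard + n := by
    have h3 : ∀ v, L.wt v = (G.neighborSet v).ncard + 1 := by
      intro v
      have : G.neighborSet v = {u | u ∈ L.nbrs v} := by
        ext u
        simp [L.mem_iff]
      rw [this, ncard_setOf_mem (L.nodup v)]
      rfl
    rw [ncard_arcs_eq_sum, wsum, ← List.ofFn_eq_map, List.sum_ofFn]
    simp [h3, Finset.sum_add_distrib]
  rw [h2, add_mul, one_mul]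
  rw [Nat.card_fin] at h1
  omega

/-- A set that covers the edges of a graph of bounded degree is not much smaller than the number of
edges. -/
theorem ncard_edges_le {V : Type*} [Finite V] {G : SimpleGraph V} {d : ℕ} (hd : DegreeBoundedBy G d)
    {X : Set V} {E : Set (Sym2 V)}
    (hE : ∀ e ∈ E, ∃ u v, e = s(u, v) ∧ G.Adj u v ∧ (u ∈ X ∨ v ∈ X)) : E.ncard ≤ X.ncard * d := by
  classical
  have := Fintype.ofFinite V
  have hsub : E ⊆ ⋃ x ∈ X.toFinset, (fun w => s(x, w)) '' G.neighborSet x := by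
    intro e he
    obtain ⟨u, v, rfl, huv, h⟩ := hE e he
    simp only [Set.mem_toFinset, Set.mem_iUnion]
    rcases h with h | h
    · exact ⟨u, h, v, huv, rfl⟩
    · exact ⟨v, h, u, huv.symm, Sym2.eq_swap⟩
  refine (Set.ncard_le_ncard hsub (Set.toFinite _)).trans
    ((Finset.set_ncard_biUnion_le _ _).trans ?_)
  rw [Set.ncard_eq_toFinset_card', ← smul_eq_mul]
  exact Finset.sum_le_card_nsmul _ _ _ fun x _ =>
    (Set.ncard_image_le (Set.toFinite _)).trans (hd x)

/-- With an empty stack every class has at most `κ` vertices. An edge between two classes has an end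
in `X`, and a vertex has at most `d` edges. -/
theorem Division.isEpsPartition {c : Fin n → ℕ} {X : Set (Fin n)} {κ k ε : ℝ} {d : ℕ}
    (hD : Division G c [] X κ) (hd : DegreeBoundedBy G d) (hk : κ ≤ k)
    (hX : (X.ncard : ℝ) * d ≤ ε * n) : IsEpsPartition G ε k (Setoid.ker c) := by
  refine ⟨?_, ?_, ?_⟩
  · rintro _ ⟨v, rfl⟩
    exact ((hD.small v).resolve_left (by simp)).trans hk
  · rintro _ ⟨v, rfl⟩
    exact (hD.conn v).induce_connected
  · rw [Nat.card_fin]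
    refine le_trans ?_ hX
    have : {e ∈ G.edgeSet | ∃ u v, e = s(u, v) ∧ ¬ Setoid.ker c u v}.ncard ≤ X.ncard * d := by
      refine ncard_edges_le hd ?_
      rintro _ ⟨he, u, v, rfl, huv⟩
      exact ⟨u, v, rfl, he, hD.edge u v he huv⟩
    exact_mod_cast this

/-- Words of length logarithmic in `s` suffice. -/
theorem words_suffice {K C s t D : ℕ} (hs : 2 ≤ s) (ht : t ≤ C * (s * s)) :
    (K + s + t) ^ D < s ^ ((K + C + 3) * D + 1) := by
  have h1 : K + s + t ≤ (K + C + 1) * (s * s) := by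
    have h2 : s ≤ s * s := Nat.le_mul_self s
    have h3 : K ≤ K * (s * s) := Nat.le_mul_of_pos_right _ (by positivity)
    calc K + s + t ≤ K * (s * s) + s * s + C * (s * s) := by omega
      _ = _ := by ring
  have h2 : K + C + 1 ≤ s ^ (K + C + 1) :=
    (Nat.lt_two_pow_self.le).trans (Nat.pow_le_pow_left hs _)
  have h3 : K + s + t ≤ s ^ (K + C + 3) := by
    calc K + s + t ≤ (K + C + 1) * (s * s) := h1
      _ ≤ s ^ (K + C + 1) * (s * s) := Nat.mul_le_mul_right _ h2
      _ = _ := by ring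
  calc (K + s + t) ^ D ≤ (s ^ (K + C + 3)) ^ D := Nat.pow_le_pow_left h3 D
    _ = s ^ ((K + C + 3) * D) := (pow_mul _ _ _).symm
    _ < _ := Nat.pow_lt_pow_right (by omega) (Nat.lt_succ_self _)

/-- Clearing denominators turns the comparison with the real threshold into one between natural
numbers that the machine can evaluate. -/
theorem large_iff {h d p q : ℕ} (hp : 0 < p) (m : ℕ) :
    400 * (h : ℝ) ^ 4 * d ^ 2 * q ^ 2 / p ^ 2 < m ↔
      400 * h ^ 4 * (d * d * (q * q)) < m * (p * p) := by
  have hp' : (0 : ℝ) < (p : ℝ) ^ 2 := by positivity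
  rw [div_lt_iff₀ hp', ← Nat.cast_lt (α := ℝ)]
  push_cast
  have h1 : 400 * (h : ℝ) ^ 4 * d ^ 2 * q ^ 2 = 400 * h ^ 4 * (d * d * (q * q)) := by ring
  have h2 : (m : ℝ) * p ^ 2 = m * (p * p) := by ring
  rw [h1, h2]

/-- The program finds a partition if there is no large clique minor. -/
theorem exists_runs (h : ℕ) (hh : 1 ≤ h) : ∃ (C : ℝ) (a : ℕ), ∀ (n d p q : ℕ) (γ : ℝ)
    (G : SimpleGraph (Fin n)) (L : IncidenceLists G), 1 ≤ n → 1 ≤ d → 0 < γ → γ ≤ 1 → 1 ≤ q →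
    γ / 2 ≤ (p : ℝ) / (q : ℝ) → (p : ℝ) / (q : ℝ) ≤ γ → ¬ CliqueMinor h G → DegreeBoundedBy G d →
    ∃ (t : ℕ) (τ : Memory), Runs L.query ((n + d + q) ^ a) (partitionProgram h)
        (input n d p q) t τ ∧
      (t : ℝ) ≤ C * (n : ℝ) ^ (3 / 2 : ℝ) ∧
      IsEpsPartition G γ (1600 * h ^ 4 * (d : ℝ) ^ 2 / γ ^ 2) (outputPartition n τ) := by
  set C : ℕ := 120000 * (h + 1) * (2 ^ (h + 1) + 1) with hC
  set K : ℕ := 400 * h ^ 4 + h + 100 with hK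
  have htame : (partitionProgram h).Tame 10 K := partitionProgram_tame h
  clear_value K
  refine ⟨C, (K + C + 3) * 10 + 1, ?_⟩
  intro n d p q γ G L hn hd hγ hγ1 hq hpq hpq' hG hdeg
  have hq0 : (0 : ℝ) < q := by exact_mod_cast hq
  have hp0 : (0 : ℝ) < p := by
    have : 0 < (p : ℝ) / q := lt_of_lt_of_le (by linarith) hpq
    by_contra hcon
    exact absurd this (not_lt.2 (div_nonpos_of_nonpos_of_nonneg (not_lt.1 hcon) hq0.le))
  have hp : 0 < p := by exact_mod_cast hp0
  have hpq1 : (p : ℝ) ≤ q := by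
    have := hpq'.trans hγ1
    rwa [div_le_one hq0] at this
  have hpq2 : p ≤ q := by exact_mod_cast hpq1
  have hh' : (1 : ℝ) ≤ h := by exact_mod_cast hh
  have hd' : (1 : ℝ) ≤ d := by exact_mod_cast hd
  have hn' : (1 : ℝ) ≤ n := by exact_mod_cast hn
  -- The threshold is chosen so that `√κ = 20 * h ^ 2 * d * (q / p)`, which cancels the factors `20
  -- * h ^ 2` and `d` in the number of cut edges; and `q / p ≤ 2 / γ` leads to the constant `1600 =
  -- 4 * 400`.
  set κ : ℝ := 400 * (h : ℝ) ^ 4 * d ^ 2 * q ^ 2 / p ^ 2 with hκ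
  have hκr : κ = (20 * h ^ 2 * d * (q / p)) ^ 2 := by
    rw [hκ]
    field_simp
    ring
  have hr1 : 1 ≤ (q : ℝ) / p := (one_le_div hp0).2 hpq1
  have hroot : 1 ≤ 20 * (h : ℝ) ^ 2 * d * (q / p) := by
    have h1 : 1 ≤ (h : ℝ) ^ 2 := one_le_pow₀ hh'
    have h2 : 1 ≤ (h : ℝ) ^ 2 * d := one_le_mul_of_one_le_of_one_le h1 hd'
    have h3 : 1 ≤ (h : ℝ) ^ 2 * d * (q / p) := one_le_mul_of_one_le_of_one_le h2 hr1
    calc (1 : ℝ) ≤ 20 * ((h : ℝ) ^ 2 * d * (q / p)) := by linarith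
      _ = _ := by ring
  have hsκ : √κ = 20 * h ^ 2 * d * (q / p) := by
    rw [hκr, Real.sqrt_sq (by linarith)]
  have hκ1 : 1 ≤ κ := by
    rw [hκr]
    exact one_le_pow₀ hroot
  have hqp : (q : ℝ) / p ≤ 2 / γ := by
    rw [div_le_div_iff₀ hp0 hγ]
    rw [div_le_div_iff₀ (by norm_num) hq0] at hpq
    linarith
  have hκk : κ ≤ 1600 * h ^ 4 * (d : ℝ) ^ 2 / γ ^ 2 := by
    have h1 : ((q : ℝ) / p) ^ 2 ≤ (2 / γ) ^ 2 := pow_le_pow_left₀ (by positivity) hqp 2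
    calc κ = 400 * h ^ 4 * d ^ 2 * ((q : ℝ) / p) ^ 2 := by rw [hκr]; ring
      _ ≤ 400 * h ^ 4 * d ^ 2 * (2 / γ) ^ 2 := mul_le_mul_of_nonneg_left h1 (by positivity)
      _ = _ := by ring
  obtain ⟨t, τ, hex, c, X, hcol, hD, hX, ht⟩ : wp L.query (partitionProgram h) (fun t τ =>
      ∃ (c : Fin n → ℕ) (X : Set (Fin n)), (∀ v : Fin n, τ.arr 0 v = c v) ∧ Division G c [] X κ ∧
      (X.ncard : ℝ) ≤ 20 * h ^ 2 * n / √κ ∧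
      (t : ℝ) ≤ 120000 * (h + 1) * (wsum L (List.finRange n) * √n)) 0 (input n d p q) :=
    wp_partitionProgram L hG hn hκ1 (large_iff hp) fun t τ c X h1 h2 h3 h4 => ⟨c, X, h1, h2, h3, h4⟩
  rw [zero_add] at ht
  have ht' : (t : ℝ) ≤ C * (n * √n) := by
    have h1 : (wsum L (List.finRange n) : ℝ) ≤ (2 ^ (h + 1) + 1) * n := by
      exact_mod_cast wsum_finRange_le L hn hG
    have h2 : (wsum L (List.finRange n) : ℝ) * √n ≤ (2 ^ (h + 1) + 1) * n * √n :=
      mul_le_mul_of_nonneg_right h1 (Real.sqrt_nonneg _)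
    have h3 : (120000 : ℝ) * (h + 1) * (wsum L (List.finRange n) * √n) ≤
        120000 * (h + 1) * ((2 ^ (h + 1) + 1) * n * √n) :=
      mul_le_mul_of_nonneg_left h2 (by positivity)
    refine ht.trans (h3.trans (le_of_eq ?_))
    rw [hC]
    push_cast
    ring
  have hpow : (n : ℝ) ^ (3 / 2 : ℝ) = n * √n := by
    rw [show (3 / 2 : ℝ) = 1 + 1 / 2 by norm_num, Real.rpow_add (by linarith), Real.rpow_one,
      Real.sqrt_eq_rpow]
  clear_value C
  set s := n + d + q with hs
  have htn : t ≤ C * (s * s) := by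
    have h1 : √(n : ℝ) ≤ n := Real.sqrt_le_iff.2 ⟨by linarith, by nlinarith⟩
    have h2 : (t : ℝ) ≤ C * (n * n) := ht'.trans
      (mul_le_mul_of_nonneg_left (mul_le_mul_of_nonneg_left h1 (by linarith)) (Nat.cast_nonneg _))
    have h3 : t ≤ C * (n * n) := by exact_mod_cast h2
    exact h3.trans (Nat.mul_le_mul_left _ (Nat.mul_le_mul (by omega) (by omega)))
  -- The number `K + s` bounds the input, all answers to queries and all constants of the program,
  -- so no number in memory ever exceeds `K + s + t`.
  refine ⟨t, τ, (hex.runs htame (M := K + s) ?_ ?_ (by omega) (by omega)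
    (words_suffice (by omega) htn)).1, by rwa [hpow], ?_⟩
  · refine ⟨fun x => ?_, fun a i => Nat.zero_le _⟩
    simp only [input]
    split_ifs <;> omega
  · intro v i
    rw [IncidenceLists.query]
    split_ifs with hv
    · split
      · rename_i u _
        have := u.2
        omega
      · exact Nat.zero_le _
    · exact Nat.zero_le _
  · have hout : outputPartition n τ = Setoid.ker c := by
      rw [outputPartition]
      congr 1
      funext v
      exact hcol v
    rw [hout]
    refine hD.isEpsPartition hdeg hκk ?_
    -- The number of cut edges is thus at most `(p / q) * n`, so only the upper bound `p / q ≤ γ` is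
    -- needed here; the lower bound on `p / q` serves the size of the parts.
    have h1 : 20 * (h : ℝ) ^ 2 * n / √κ * d = n * (p / q) := by
      rw [hsκ]
      have : (h : ℝ) ≠ 0 := by linarith
      have : (d : ℝ) ≠ 0 := by linarith
      field_simp
    calc (X.ncard : ℝ) * d ≤ 20 * h ^ 2 * n / √κ * d :=
          mul_le_mul_of_nonneg_right hX (Nat.cast_nonneg _)
      _ = n * (p / q) := h1
      _ ≤ n * γ := mul_le_mul_of_nonneg_left hpq' (by linarith)
      _ = γ * n := mul_comm _ _

end Output

end WordRAM

/-! ### Hyperfiniteness -/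

section Hyperfinite

/-- Without the edges between parts, a walk cannot leave the part in which it starts, so every
component is contained in a part. -/
theorem IsEpsPartition.isHyperfinite {V : Type*} [Finite V] {G : SimpleGraph V} {ε k : ℝ}
    {P : Setoid V} (h : IsEpsPartition G ε k P) : IsHyperfinite G ε k := by
  refine ⟨_, Set.sep_subset _ _, h.2.2, fun c => ?_⟩
  obtain ⟨v, rfl⟩ := c.exists_rep
  refine le_trans (Nat.cast_le.2 (Set.ncard_le_ncard ?_ (Set.toFinite _))) (h.1 {u | P u v} ⟨v,
      rfl⟩)
  intro u hu
  have hr := SimpleGraph.ConnectedComponent.exact hu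
  rw [SimpleGraph.reachable_iff_reflTransGen] at hr
  have hstep : ∀ w, Relation.ReflTransGen (G.deleteEdges
      {e ∈ G.edgeSet | ∃ u v, e = s(u, v) ∧ ¬ P u v}).Adj u w → P u w := by
    intro w hw
    induction hw with
    | refl => exact P.refl _
    | tail _ h2 ih =>
      refine P.trans ih ?_
      rw [SimpleGraph.deleteEdges_adj] at h2
      by_contra hP
      exact h2.2 ⟨h2.1, _, _, rfl, hP⟩
  exact hstep v hr

theorem IsHyperfinite.of_iso {V V' : Type*} [Finite V] {G : SimpleGraph V} {G' : SimpleGraph V'}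
    (e : G ≃g G') {ε k : ℝ} (h : IsHyperfinite G' ε k) : IsHyperfinite G ε k := by
  have : Finite V' := Finite.of_equiv V e.toEquiv
  obtain ⟨F, hF, hcard, hcomp⟩ := h
  have hinj : Function.Injective (Sym2.map e) := Sym2.map.injective e.injective
  refine ⟨Sym2.map e ⁻¹' F, ?_, ?_, fun c => ?_⟩
  · intro x hx
    induction x with
    | _ u v => exact e.map_adj_iff.1 (hF hx)
  · have h1 : (Sym2.map e ⁻¹' F).ncard ≤ F.ncard := by
      rw [← Set.ncard_image_of_injective _ hinj]
      exact Set.ncard_le_ncard (Set.image_preimage_subset _ _) (Set.toFinite _)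
    rw [Nat.card_congr e.toEquiv]
    exact le_trans (by exact_mod_cast h1) hcard
  · let f : G.deleteEdges (Sym2.map e ⁻¹' F) →g G'.deleteEdges F :=
      ⟨e, fun {u v} huv => by
        rw [SimpleGraph.deleteEdges_adj] at huv ⊢
        exact ⟨e.map_adj_iff.2 huv.1, huv.2⟩⟩
    refine le_trans ?_ (hcomp (c.map f))
    have h1 : c.supp.ncard ≤ (c.map f).supp.ncard := by
      rw [← Set.ncard_image_of_injective _ e.injective]
      refine Set.ncard_le_ncard ?_ (Set.toFinite _)
      rintro _ ⟨v, hv, rfl⟩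
      rw [SimpleGraph.ConnectedComponent.mem_supp_iff] at hv ⊢
      rw [← hv]
      rfl
    exact_mod_cast h1

theorem CliqueMinor.of_iso {V V' : Type*} {G : SimpleGraph V} {G' : SimpleGraph V'} (e : G ≃g G')
    {t : ℕ} (h : CliqueMinor t G') : CliqueMinor t G := by
  obtain ⟨B, hB, hBB⟩ := h
  refine ⟨fun i => e ⁻¹' B i, fun i => ?_, fun i j hij => ?_⟩
  · obtain ⟨r, hr⟩ := (hB i).1
    refine ⟨⟨e.symm r, by simpa using hr⟩, fun u hu v hv => ?_⟩
    have h1 := ((hB i).2 _ hu _ hv).lift e.symm (p := AdjIn G (e ⁻¹' B i)) fun a b hab =>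
      ⟨e.symm.map_adj_iff.2 hab.1, by simpa using hab.2.1, by simpa using hab.2.2⟩
    simpa [Function.onFun] using h1
  · obtain ⟨h1, u, hu, v, hv, huv⟩ := hBB i j hij
    exact ⟨h1.preimage e, e.symm u, by simpa using hu, e.symm v, by simpa using hv,
      e.symm.map_adj_iff.2 huv⟩

theorem DegreeBoundedBy.of_iso {V V' : Type*} [Finite V] {G : SimpleGraph V} {G' : SimpleGraph V'}
    (e : G ≃g G') {d : ℕ} (h : DegreeBoundedBy G d) : DegreeBoundedBy G' d := by
  intro v
  refine le_trans ?_ (h (e.symm v))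
  rw [← Set.ncard_image_of_injective _ e.symm.injective]
  refine Set.ncard_le_ncard ?_ (Set.toFinite _)
  rintro _ ⟨u, hu, rfl⟩
  exact e.symm.map_adj_iff.2 hu

/-- The fraction `1 / ⌈1 / γ⌉` works, since `1 / γ ≤ ⌈1 / γ⌉ ≤ 1 / γ + 1 ≤ 2 / γ`. -/
theorem exists_fraction {γ : ℝ} (h0 : 0 < γ) (h1 : γ ≤ 1) :
    ∃ q : ℕ, 1 ≤ q ∧ γ / 2 ≤ ((1 : ℕ) : ℝ) / q ∧ ((1 : ℕ) : ℝ) / q ≤ γ := by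
  have h2 : 1 ≤ 1 / γ := (one_le_div h0).2 h1
  have h3 := Nat.le_ceil (1 / γ)
  have h4 := (Nat.ceil_lt_add_one (zero_le_one.trans h2)).le
  have h5 : (1 : ℝ) ≤ ⌈1 / γ⌉₊ := h2.trans h3
  have h6 : γ * (1 / γ) = 1 := mul_one_div_cancel h0.ne'
  refine ⟨⌈1 / γ⌉₊, by exact_mod_cast h5, ?_, ?_⟩
  · rw [Nat.cast_one, le_div_iff₀ (by linarith)]
    have := mul_le_mul_of_nonneg_left h4 h0.le
    nlinarith
  · rw [Nat.cast_one, div_le_iff₀ (by linarith)]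
    have := mul_le_mul_of_nonneg_left h3 h0.le
    linarith

/-- Number the vertices, list the neighbours in any order, and run the program: its output witnesses
the purely combinatorial claim. The empty graph is separate because the program expects at least one
vertex. -/
theorem isHyperfinite_of_not_cliqueMinor {V : Type*} [Finite V] {G : SimpleGraph V} {h d : ℕ}
    {γ : ℝ} (hh : 1 ≤ h) (hd : 1 ≤ d) (h0 : 0 < γ) (h1 : γ ≤ 1) (hG : ¬ CliqueMinor h G)
    (hdeg : DegreeBoundedBy G d) : IsHyperfinite G γ (1600 * h ^ 4 * (d : ℝ) ^ 2 / γ ^ 2) := by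
  classical
  rcases isEmpty_or_nonempty V with hV | hV
  · exact ⟨∅, Set.empty_subset _, by simp, fun c => (hV.false c.nonempty_supp.some).elim⟩
  · let φ := Finite.equivFin V
    let e : G ≃g G.comap φ.symm := (SimpleGraph.Iso.comap φ.symm G).symm
    refine IsHyperfinite.of_iso e ?_
    obtain ⟨C, a, hrun⟩ := WordRAM.exists_runs h hh
    obtain ⟨q, hq, hq1, hq2⟩ := exists_fraction h0 h1
    let L : IncidenceLists (G.comap φ.symm) :=
      ⟨fun v => ((G.comap φ.symm).neighborFinset v).toList, fun v => Finset.nodup_toList _,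
        fun v u => by simp⟩
    obtain ⟨t, τ, -, -, hP⟩ := hrun _ d 1 q γ _ L Nat.card_pos hd h0 h1 hq hq1 hq2
      (fun hm => hG (hm.of_iso e)) (hdeg.of_iso e)
    exact hP.isHyperfinite

end Hyperfinite

theorem corollary1 {W : Type*} [Finite W] (H : SimpleGraph W) :
    ∃ c₂ : ℝ, 1 < c₂ ∧
      (∀ (V : Type*) [Finite V] (G : SimpleGraph V) (d : ℕ) (γ : ℝ), 1 ≤ d → 0 < γ → γ ≤ 1 →
        IsMinorFree H G → DegreeBoundedBy G d →
        IsHyperfinite G γ (c₂ * (d : ℝ) ^ 2 / γ ^ 2)) ∧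
      ∃ (P : WordRAM.Program) (C : ℝ) (a : ℕ), FindsPartition H P c₂ C a := by
  -- The summand `1` ensures `h ≥ 1` even if `H` has no vertices, so that `1600 * h ^ 4` exceeds
  -- `1`. A clique minor of order `h` contains one of order `Nat.card W`, hence `H`.
  set h := Nat.card W + 1 with hh
  have hle : 1 ≤ h := by omega
  have hle' : (1 : ℝ) ≤ h := by exact_mod_cast hle
  have hpow : (1 : ℝ) ≤ (h : ℝ) ^ 4 := one_le_pow₀ hle'
  refine ⟨1600 * h ^ 4, by linarith, fun V _ G d γ hd h0 h1 hG hdeg =>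
    isHyperfinite_of_not_cliqueMinor hle hd h0 h1
      (fun hm => hG ((hm.mono (by omega)).isMinor H)) hdeg, ?_⟩
  obtain ⟨C, a, hrun⟩ := WordRAM.exists_runs h hle
  exact ⟨WordRAM.partitionProgram h, C, a, fun n d p q γ G L hn hd h0 h1 hq hq1 hq2 hG hdeg =>
    hrun n d p q γ G L hn hd h0 h1 hq hq1 hq2 (fun hm => hG ((hm.mono (by omega)).isMinor H)) hdeg⟩
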